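/- **Theorem.** Let $\mathfrak g$ be of type $A_n$ ($n\ge 1$) or $C_n$ ($n\ge 3$), let $\lambda=\omega_{i_1}+\cdots+\omega_{i_t}$ with $1\le i_1\le\cdots\le i_t\le n$ be a dominant integral weight ($\omega_i$ the $i$-th fundamental weight), let $Y(\lambda)$ be the set of Young walls and $T(\lambda)$ the set of tableaux of reverse shape defined below. Then $Y(\lambda)$ and $T(\lambda)$ are stable under the Kashiwara operators $\tilde e_i,\tilde f_i$ ($1\le i\le n$) and are crystals for $U_q(\mathfrak g)$, $Y(\lambda)$ being generated by the $\tilde f_i$ from its highest weight element $H_\lambda$ of weight $\lambda$, and the map $\varphi\colon Y(\lambda)\to T(\lambda)$, $Y\mapsto T_Y$, is an isomorphism of crystals: it is a bijection that preserves $\mathrm{wt}$, $\varepsilon_i$, $\varphi_i$ and commutes with $\tilde e_i$ and $\tilde f_i$ for $1\le i\le n$. **Young walls.** Put $N=i_1+\cdots+i_t$, and number the columns of a wall from right to left. For $A_n$ the walls follow the pattern of $A_n^{(1)}$: unit cubes, the block in column $k\ge 0$ and row $r\ge 0$ having colour $N+r-k$ modulo $n+1$, on the empty ground-state wall of weight $\Lambda_{N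 \bmod (n+1)}$. For $C_n$ they follow the pattern of $A_{2n-1}^{(2)}$: in every column the rows are, periodically from the bottom, a row consisting of a $0$-block and a $1$-block of half-unit thickness (one in front of the other; the two colours alternate from column to column in the front and in the back), then unit cubes of colours $2,\dots,n-1,n,n-1,\dots,2$; the ground-state wall consists of the back half-blocks of the bottom row, with $0$ in back in column $k$ iff $N+k$ is odd, and has weight $\Lambda_0$ ($N$ even) or $\Lambda_1$ ($N$ odd). A Young wall is obtained by adding finitely many blocks, each resting on a completely filled row of its column, with no free space to the right of a block (except in the right-most column). For $C_n$ it is proper if no two full columns (top row completely filled) have the same height; for $A_n$ every Young wall is proper. A $\delta$-column is a top part of a column with one block of each colour (for $C_n$: one block of each colour $0,1,n$ and two of each colour $2,\dots,n-1$); a proper wall is reduced if no $\delta$-column can be removed so that the wall stays proper. The operators $\tilde e_i,\tilde f_i$ remove or add an $i$-block by the signature rule: write, for the columns from left to right, a $-$ for a removable $i$-block followed by a $+$ for an admissible $i$-slot, cancel $(+,-)$-pairs; $\tilde e_i$ acts at the right-most remaining $-$, $\tilde f_i$ at the left-most remaining $+$ (and gives $0$ if there is none), $\varepsilon_i,\varphi_i$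 are the numbers of remaining $-$ and $+$, and $\mathrm{wt}(Y)=\Lambda-\sum_i k_i\alpha_i$ restricted to $h_1,\dots,h_n$, where $k_i$ is the number of added $i$-blocks. **The map.** The first $i_1$ columns from the right are assigned to $\omega_{i_1}$, the next $i_2$ to $\omega_{i_2}$, and so on; $T_Y$ has bottom-justified columns of lengths $i_1,\dots,i_t$ from left to right, and the $a$-th column from the right of the part of $\omega_{i_k}$ gives the entry in the $a$-th row from the bottom of the $k$-th column of $T_Y$, according to its top: for $A_n$, top colour $j$ gives $j+1$ ($0\le j\le n$; an empty column is read by continuing the pattern downwards); for $C_n$, a single $0$-block gives $1$, $0$ and $1$ together give $2$, a block $j-1$ on a block $j-2$ (for $j=3$: a block $2$ on the blocks $0,1$) gives $j$ ($3\le j\le n$), a block $n$ gives $\bar n$, a block $j$ on a block $j+1$ gives $\bar j$ ($2\le j\le n-1$), a single $1$-block on a block $2$ gives $\bar 1$ (in a column consisting of a single half-block of the ground-state wall, $0$ is read as $1$ and $1$ as $\bar 1$). **The set $Y(\lambda)$.** $H_\lambda$ (resp. $L_\lambda$) is the wall whose columns in the part of $\omega_{i_k}$ represent, from right to left, $i_k,\dots,2,1$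 (resp. $n+1,n,\dots$ for $A_n$ and $\bar1,\bar2,\dots,\overline{i_k}$ for $C_n$), each part being placed at the lowest possible level: for $A_n$ the columns of the part of $\omega_{i_k}$ in $H_\lambda$ all have height $\sum_{l>k}(n+1-i_l)$; for $C_n$ the part of $\omega_{i_k}$ is lifted by $t-k$ periods. $Y(\lambda)$ consists of the reduced proper Young walls $Y$ with $H_\lambda\subseteq Y\subseteq L_\lambda$ such that * (Y2) for $1\le k<t$: $Y^{\omega_{i_k}}\subseteq Y^{\omega_{i_{k+1}}}$, where the blocks of the two parts are compared column by column ($a$-th column from the right with $a$-th column, for $a\le i_k$) in the region above both highest weight walls; and, for $C_n$, moreover, where "above/below" refers to the row of the $n$-blocks in the part considered, $|Z|$ is obtained from a set $Z$ of blocks below the $n$-row by reflecting in the $n$-row and shifting the blocks to the right as far as possible, and all columns are counted from the right in each part: * (Y1) $Y_{\omega_{i_k}}^+\subseteq |Y_{\omega_{i_k}}^-|$, with $Y_{\omega_{i_k}}^{\pm}$ the blocks of the part of $\omega_{i_k}$ over $H_\lambda$ lying above/below the $n$-row; * (Y3) for $1\le k<t$: $|Y\cap L^-|\subseteq Y\cap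 L^+$, where $L^-$ is the triangle of the blocks of colours $n-a+1,\dots,n-1$ below the $n$-row in the columns $a\le i_k$ of the part of $\omega_{i_k}$, and $L^+$ the triangle of the blocks of colours $n-1,\dots,n-i_k+a$ above the $n$-row in the columns $a\le i_k$ of the part of $\omega_{i_{k+1}}$; * (Y4) for $1\le k<t$, whenever for some $p>q$ and $1\le a\le n$ the $p$-th column of the part of $\omega_{i_k}$ represents $a$ and the $q$-th column of the part of $\omega_{i_{k+1}}$ represents $\bar a$: $Y\cap L^+_\omega\subseteq |Y\cap L^-_\omega|$ for $\omega=\omega_{i_k}$ and $\omega=\omega_{i_{k+1}}$, where $L^+_\omega$ consists of the blocks above the $n$-row of colours $a+(c-q),\dots,a+p-q-1$ in the columns $q\le c<p$ of the part of $\omega$, $L^-_\omega$ of the blocks below the $n$-row of colours $a+(p-c),\dots,a+p-q-1$ in the columns $q<c\le p$, and the shift in $|\cdot|$ goes up to column $q$. **The set $T(\lambda)$.** It consists of the tableaux of bottom-justified columns of lengths $i_1\le\dots\le i_t$ (from left to right), with entries in $1<\cdots<n+1$ for $A_n$ and in $1\prec\cdots\prec n\prec\bar n\prec\cdots\prec\bar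 1$ for $C_n$, weakly increasing along the rows and strictly increasing down the columns; for $C_n$ moreover, with rows counted from the bottom: * (1CC) if $a$ and $\bar a$ lie in rows $p>q$ of a column of length $N$, then $p-q-1\ge N-a$; * (2CC-1) if $a$ lies in row $p$ of a column and $\bar a$ in row $q<p$ of the next column to the right, then $p-q\le n-a$; * (2CC-2) if, in the situation of (2CC-1), $b$ and $\bar b$ lie in rows $r>s$ of one of the two columns, with $q\le s<r\le p$, then $(p-r)+(s-q)<b-a$. The crystal structure of $T(\lambda)$ comes from identifying $T$ with the tensor product, in the crystal of the vector representation, of its entries read column by column from right to left and from top to bottom in each column (same signature rule). -/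

import Mathlib

namespace WallTableau

/-! ## Crystals -/

/-- The data of a crystal with index set `Fin n` (the index `i` stands for the simple root
`α_{i+1}` of a Lie algebra of rank `n`): weights, recorded by their values
`⟨h_1, wt b⟩, …, ⟨h_n, wt b⟩` on the simple coroots (that is, by the coefficients of the fundamental
weights), the functions `ε_i`, `φ_i`, and the Kashiwara operators, with `none` in the role of `0`. -/
structure CrystalData (n : ℕ) (B : Type) where
  wt : B → Fin n → ℤ
  eps : Fin n → B → ℕ
  phi : Fin n → B → ℕ
  e : Fin n → B → Option B
  f : Fin n → B → Option B

/-- The subset `S` is stable under the Kashiwara operators and is a (seminormal) crystal for the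
Cartan matrix `A`, `A i j = ⟨h_i, α_j⟩`. -/
structure IsCrystal {n : ℕ} {B : Type} (A : Fin n → Fin n → ℤ) (C : CrystalData n B)
    (S : Set B) : Prop where
  e_mem : ∀ b ∈ S, ∀ i, ∀ b', C.e i b = some b' → b' ∈ S
  f_mem : ∀ b ∈ S, ∀ i, ∀ b', C.f i b = some b' → b' ∈ S
  e_eq_none : ∀ b ∈ S, ∀ i, C.e i b = none ↔ C.eps i b = 0
  f_eq_none : ∀ b ∈ S, ∀ i, C.f i b = none ↔ C.phi i b = 0
  phi_sub_eps : ∀ b ∈ S, ∀ i, (C.phi i b : ℤ) - C.eps i b = C.wt b i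
  f_iff_e : ∀ b ∈ S, ∀ b' ∈ S, ∀ i, C.f i b = some b' ↔ C.e i b' = some b
  wt_f : ∀ b ∈ S, ∀ i, ∀ b', C.f i b = some b' → ∀ j, C.wt b' j = C.wt b j - A j i
  eps_f : ∀ b ∈ S, ∀ i, ∀ b', C.f i b = some b' → C.eps i b' = C.eps i b + 1
  phi_f : ∀ b ∈ S, ∀ i, ∀ b', C.f i b = some b' → C.phi i b = C.phi i b' + 1

/-- The crystal `S` consists of all elements that are obtained from `u` by the operators `f_i`, and
`u` has weight `w`. -/
def IsGeneratedBy {n : ℕ} {B : Type} (C : CrystalData n B) (S : Set B) (u : B)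
    (w : Fin n → ℕ) : Prop :=
  (∀ j, C.wt u j = w j) ∧
    ∀ b, b ∈ S ↔ Relation.ReflTransGen (fun x y => ∃ i, C.f i x = some y) u b

/-- `g` restricts to an isomorphism of crystals from `S` onto `S'`. -/
structure IsCrystalIso {n : ℕ} {B B' : Type} (C : CrystalData n B) (S : Set B)
    (C' : CrystalData n B') (S' : Set B') (g : B → B') : Prop where
  bijOn : Set.BijOn g S S'
  wt_eq : ∀ b ∈ S, C'.wt (g b) = C.wt b
  eps_eq : ∀ b ∈ S, ∀ i, C'.eps i (g b) = C.eps i b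
  phi_eq : ∀ b ∈ S, ∀ i, C'.phi i (g b) = C.phi i b
  e_eq : ∀ b ∈ S, ∀ i, C'.e i (g b) = (C.e i b).map g
  f_eq : ∀ b ∈ S, ∀ i, C'.f i (g b) = (C.f i b).map g

/-! ## The signature rule -/

inductive Sgn
  | plus
  | minus
  deriving DecidableEq

/-- Cancel all `(+,-)`-pairs in a word of labelled signs; what is left is a sequence of `-`'s
followed by `+`'s. -/
def cancelSigns {α : Type} : List (Sgn × α) → List (Sgn × α)
  | [] => []
  | (Sgn.minus, a) :: w => (Sgn.minus, a) :: cancelSigns w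
  | (Sgn.plus, a) :: w =>
    match cancelSigns w with
    | (Sgn.minus, _) :: r => r
    | r => (Sgn.plus, a) :: r

/-- The labels of the `-`'s (of the `+`'s) that survive the cancellation, from left to right. -/
def survivors {α : Type} (s : Sgn) (w : List (Sgn × α)) : List α :=
  ((cancelSigns w).filter (fun x => x.1 = s)).map Prod.snd

/-- The crystal data defined by the signature rule: `e_i` acts at the right-most surviving `-`,
`f_i` acts at the left-most surviving `+`. -/
def signatureCrystal {n : ℕ} {B α : Type} (wt : B → Fin n → ℤ)
    (word : Fin n → B → List (Sgn × α)) (raise lower : Fin n → α → B → B) : CrystalData n B where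
  wt := wt
  eps := fun i b => (survivors Sgn.minus (word i b)).length
  phi := fun i b => (survivors Sgn.plus (word i b)).length
  e := fun i b => ((survivors Sgn.minus (word i b)).getLast?).map fun a => raise i a b
  f := fun i b => ((survivors Sgn.plus (word i b)).head?).map fun a => lower i a b

/-! ## Young walls -/

/-- The place `(k, r, σ)` of a block: column `k` (counted from the right, starting with `0`),
row `r` (from the bottom, starting with `0`, all rows have unit height), slot `σ`. In a row of blocks
of unit thickness the only slot is `false`; in a row of blocks of half-unit thickness `false` is the
back slot and `true` is the front slot. -/
abbrev Block : Type := ℕ × ℕ × Bool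

/-- The pattern of coloured blocks and the ground-state wall `Y_Λ` for an affine Cartan datum and
a fundamental weight `Λ = Λ_s` of level `1`. The affine colours are `0, 1, 2, …`. -/
structure WallPattern where
  /-- `a_{ij} = ⟨h_i, α_j⟩` for the affine algebra -/
  cartan : ℕ → ℕ → ℤ
  /-- the index `s` of `Λ = Λ_s` -/
  top : ℕ
  /-- the slots of a row -/
  slots : ℕ → Finset Bool
  color : Block → ℕ
  /-- the blocks of the ground-state wall -/
  ground : Block → Bool
  /-- whether properness forbids two full columns of the same height -/
  strict : Bool
  /-- the number of blocks of each colour in a `δ`-column -/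
  delta : ℕ → ℕ

namespace WallPattern

variable (P : WallPattern)

/-- A wall is given by the finite set `Y` of the blocks added to the ground-state wall. The place
`b` is filled if it belongs to the ground-state wall or to `Y`. -/
def Filled (Y : Finset Block) (b : Block) : Prop := P.ground b = true ∨ b ∈ Y

instance (Y : Finset Block) (b : Block) : Decidable (P.Filled Y b) := by
  unfold Filled; infer_instance

/-- Building rules: the blocks follow the pattern, every block rests on a completely filled row of
its column, and, except in the right-most column, there is no free space to the right of a block.
(The blocks of the ground-state wall satisfy these rules by themselves.) -/
def IsYoungWall (Y : Finset Block) : Prop :=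
  ∀ b ∈ Y, P.ground b = false ∧ b.2.2 ∈ P.slots b.2.1 ∧
    (b.2.1 ≠ 0 → ∀ σ ∈ P.slots (b.2.1 - 1), P.Filled Y (b.1, b.2.1 - 1, σ)) ∧
    (b.1 ≠ 0 → P.Filled Y (b.1 - 1, b.2.1, b.2.2))

instance (Y : Finset Block) : Decidable (P.IsYoungWall Y) := by
  unfold IsYoungWall; infer_instance

/-- Row `r` is the top row of column `k`, and it is completely filled: column `k` is a full column
of height `r + 1`. -/
def IsFullColumn (Y : Finset Block) (k r : ℕ) : Prop :=
  (∀ σ ∈ P.slots r, P.Filled Y (k, r, σ)) ∧ ∀ σ ∈ P.slots (r + 1), ¬ P.Filled Y (k, r + 1, σ)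

instance (Y : Finset Block) (k r : ℕ) : Decidable (P.IsFullColumn Y k r) := by
  unfold IsFullColumn; infer_instance

/-- Proper Young walls. (For the patterns with `strict = true` below, the top row of a full column
always contains an added block.) -/
def IsProper (Y : Finset Block) : Prop :=
  P.IsYoungWall Y ∧
    (P.strict = true → ∀ b ∈ Y, ∀ c ∈ Y, P.IsFullColumn Y b.1 b.2.1 →
      P.IsFullColumn Y c.1 c.2.1 → b.2.1 = c.2.1 → b.1 = c.1)

instance (Y : Finset Block) : Decidable (P.IsProper Y) := by
  unfold IsProper; infer_instance

/-- No column contains a removable `δ`. -/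
def IsReduced (Y : Finset Block) : Prop :=
  ∀ D ⊆ Y, ∀ k, (∀ b ∈ D, b.1 = k) → (∀ c, (D.filter fun b => P.color b = c).card = P.delta c) →
    ¬ P.IsProper (Y \ D)

def IsRemovable (c : ℕ) (Y : Finset Block) (b : Block) : Prop :=
  b ∈ Y ∧ P.color b = c ∧ P.IsProper (Y.erase b)

instance (c : ℕ) (Y : Finset Block) (b : Block) : Decidable (P.IsRemovable c Y b) := by
  unfold IsRemovable; infer_instance

def IsAdmissible (c : ℕ) (Y : Finset Block) (b : Block) : Prop :=
  b ∉ Y ∧ P.color b = c ∧ P.IsProper (insert b Y)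

instance (c : ℕ) (Y : Finset Block) (b : Block) : Decidable (P.IsAdmissible c Y b) := by
  unfold IsAdmissible; infer_instance

/-- Every removable block and every admissible slot of `Y` lies in a column and in a row of number
less than `bound Y`. -/
def bound (Y : Finset Block) : ℕ := (Y.sup fun b => max b.1 b.2.1) + 2

/-- The places of column `k` below row `bound Y`. -/
def places (Y : Finset Block) (k : ℕ) : List Block :=
  (List.range (bound Y)).flatMap fun r => [(k, r, false), (k, r, true)]

/-- The signs of colour `c` of column `k`: a `-` for every removable block, followed by a `+` for
every admissible slot. (In the patterns below two blocks of the same colour are never adjacent in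
a column, so that a column is never twice removable or twice admissible.) -/
def columnSigns (c : ℕ) (Y : Finset Block) (k : ℕ) : List (Sgn × Block) :=
  ((places Y k).filter fun b => P.IsRemovable c Y b).map (fun b => (Sgn.minus, b)) ++
    ((places Y k).filter fun b => P.IsAdmissible c Y b).map (fun b => (Sgn.plus, b))

/-- The word of signs of colour `c` of the wall, the columns being read from left to right. -/
def word (c : ℕ) (Y : Finset Block) : List (Sgn × Block) :=
  (List.range (bound Y)).reverse.flatMap (P.columnSigns c Y)

/-- The Cartan matrix of the finite-dimensional Lie algebra obtained by removing the node `0`. -/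
def classicalCartan (n : ℕ) (i j : Fin n) : ℤ := P.cartan (i + 1) (j + 1)

/-- The values on `h_1, …, h_n` of `Λ - ∑ k_i α_i`, where `k_i` is the number of added
`i`-blocks. -/
def weight (n : ℕ) (Y : Finset Block) (j : Fin n) : ℤ :=
  (if P.top = j + 1 then 1 else 0) - ∑ b ∈ Y, P.cartan (j + 1) (P.color b)

/-- The crystal of Young walls with the `0`-arrows removed. -/
def crystal (n : ℕ) : CrystalData n (Finset Block) :=
  signatureCrystal (P.weight n) (fun i Y => P.word (i + 1) Y)
    (fun _ b Y => Y.erase b) (fun _ b Y => insert b Y)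

end WallPattern

/-! ## The two affine patterns -/

/-- The Cartan matrix of type `A_n^{(1)}`, `n ≥ 1`. -/
def cartanA (n i j : ℕ) : ℤ :=
  if i = j then 2
  else if n = 1 then -2
  else if i + 1 = j ∨ j + 1 = i ∨ (i = 0 ∧ j = n) ∨ (i = n ∧ j = 0) then -1
  else 0

/-- The pattern of type `A_n^{(1)}` for `Λ = Λ_{N mod (n+1)}`: all blocks are unit cubes, the block
in column `k` and row `r` has colour `N + r - k` modulo `n + 1`, the ground-state wall is empty. -/
def patternA (n N : ℕ) : WallPattern where
  cartan := cartanA n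
  top := N % (n + 1)
  slots := fun _ => {false}
  color := fun b => (N + b.2.1 + n * b.1) % (n + 1)
  ground := fun _ => false
  strict := false
  delta := fun c => if c ≤ n then 1 else 0

/-- The Cartan matrix of type `A_{2n-1}^{(2)}`, `n ≥ 3`; removing the node `0` leaves the Cartan
matrix of type `C_n` with long root `α_n`. -/
def cartanC (n i j : ℕ) : ℤ :=
  if i = j then 2
  else if (i = 0 ∧ j = 2) ∨ (i = 2 ∧ j = 0) then -1
  else if i = 0 ∨ j = 0 then 0
  else if i + 1 = n ∧ j = n then -2
  else if i + 1 = j ∨ j + 1 = i then -1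
  else 0

/-- The pattern of type `A_{2n-1}^{(2)}` for `Λ = Λ_0` (`N` even) or `Λ = Λ_1` (`N` odd). The rows
repeat with period `2n - 2`, from the bottom: a row of blocks `0` and `1` of half-unit thickness,
then the unit cubes `2, …, n - 1, n, n - 1, …, 2`. In the rows of half-unit thickness the colours `0`
and `1` alternate along the back slots and along the front slots. The ground-state wall consists of
the blocks in the back slots of the bottom row. -/
def patternC (n N : ℕ) : WallPattern where
  cartan := cartanC n
  top := N % 2
  slots := fun r => if r % (2 * n - 2) = 0 then {false, true} else {false}
  color := fun b =>
    if b.2.1 % (2 * n - 2) = 0 then (N + b.1 + 1 + (if b.2.2 then 1 else 0)) % 2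
    else if b.2.1 % (2 * n - 2) < n then b.2.1 % (2 * n - 2) + 1
    else 2 * n - 1 - b.2.1 % (2 * n - 2)
  ground := fun b => b.2.1 = 0 ∧ b.2.2 = false
  strict := true
  delta := fun c => if c ≤ 1 ∨ c = n then 1 else if c < n then 2 else 0

/-! ## Dominant integral weights -/

/-- For the dominant integral weight `w 0 • λ_1 + … + w (n-1) • λ_n` the sequence
`i_1 ≤ … ≤ i_t` with `λ = ω_{i_1} + … + ω_{i_t}`. -/
def omegas {n : ℕ} (w : Fin n → ℕ) : List ℕ :=
  (List.finRange n).flatMap fun j => List.replicate (w j) (j + 1 : ℕ)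

/-- The `k`-th member of the sequence, `k = 0, …, t - 1`. -/
def len (s : List ℕ) (k : ℕ) : ℕ := s.getD k 0

/-- The columns of a wall that belong to `ω_{i_{k+1}}` are the columns
`start s k + a`, `0 ≤ a < len s k`, to the left of those of `ω_{i_1}, …, ω_{i_k}`. -/
def start (s : List ℕ) (k : ℕ) : ℕ := (s.take k).sum

/-! ## Tableaux of reverse shape -/

/-- A filling of boxes by positive integers: `T k a` is the entry in the `k`-th column from the left
and in the `a`-th row from the bottom (both starting with `0`), and `0` where there is no box. -/
abbrev Tableau : Type := ℕ → ℕ → ℕ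

/-- The tableaux of the generalized reverse Young diagram of `ω_{i_1} + … + ω_{i_t}`
(bottom-justified columns of lengths `i_1 ≤ … ≤ i_t` from left to right) with entries in `1, …, m`,
weakly increasing along the rows and strictly increasing down the columns. -/
structure IsReverseTableau (m : ℕ) (s : List ℕ) (T : Tableau) : Prop where
  off_shape : ∀ k a, ¬ (k < s.length ∧ a < len s k) → T k a = 0
  entries : ∀ k a, k < s.length → a < len s k → 1 ≤ T k a ∧ T k a ≤ m
  rows : ∀ k a, k + 1 < s.length → a < len s k → T k a ≤ T (k + 1) a
  columns : ∀ k a, k < s.length → a + 1 < len s k → T k (a + 1) < T k a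

/-- The boxes of the shape, columns from right to left and each column from top to bottom. -/
def boxes (s : List ℕ) : List (ℕ × ℕ) :=
  (List.range s.length).reverse.flatMap fun k =>
    (List.range (len s k)).reverse.map fun a => (k, a)

/-- The crystal structure on tableaux: the tableau is identified with the tensor product of its
entries (in the order of `boxes`) in the crystal of the vector representation. The latter is given by
its operators `ve`, `vf` (so that `ε_i, φ_i ≤ 1`) and its weight `vwt`. -/
def tableauCrystal (n : ℕ) (ve vf : Fin n → ℕ → Option ℕ) (vwt : ℕ → Fin n → ℤ) (s : List ℕ) :
    CrystalData n Tableau :=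
  signatureCrystal (fun T j => ((boxes s).map fun x => vwt (T x.1 x.2) j).sum)
    (fun i T => (boxes s).flatMap fun x =>
      (if (ve i (T x.1 x.2)).isSome then [(Sgn.minus, x)] else []) ++
        (if (vf i (T x.1 x.2)).isSome then [(Sgn.plus, x)] else []))
    (fun i x T => Function.update T x.1
      (Function.update (T x.1) x.2 ((ve i (T x.1 x.2)).getD 0)))
    (fun i x T => Function.update T x.1
      (Function.update (T x.1) x.2 ((vf i (T x.1 x.2)).getD 0)))

/-! ### Type `A_n` -/

namespace TypeA

/-- The vector representation `1 → 2 → … → n + 1`. -/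
def ve {n : ℕ} (i : Fin n) (x : ℕ) : Option ℕ := if x = i + 2 then some (i + 1 : ℕ) else none

def vf {n : ℕ} (i : Fin n) (x : ℕ) : Option ℕ := if x = i + 1 then some (i + 2 : ℕ) else none

def vwt {n : ℕ} (x : ℕ) (j : Fin n) : ℤ :=
  (if x = j + 1 then 1 else 0) - (if x = j + 2 then 1 else 0)

def tabCrystal (n : ℕ) (s : List ℕ) : CrystalData n Tableau := tableauCrystal n ve vf vwt s

/-- `T(λ)` -/
def tableaux (n : ℕ) (s : List ℕ) : Set Tableau := {T | IsReverseTableau (n + 1) s T}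

/-- The common height of the columns of `ω_{i_{k+1}}` in the highest weight wall. -/
def base (n : ℕ) (s : List ℕ) (k : ℕ) : ℕ := ((s.drop (k + 1)).map fun i => n + 1 - i).sum

/-- The blocks of column `a` of the part of `ω_{i_{k+1}}` when that column is to represent the
entry `x`. -/
def stack (n : ℕ) (s : List ℕ) (k a x : ℕ) : Finset Block :=
  (Finset.range (base n s k + x - (len s k - a))).image fun r => (start s k + a, r, false)

/-- The highest weight wall `H_λ`. -/
def highest (n : ℕ) (s : List ℕ) : Finset Block :=
  (Finset.range s.length).biUnion fun k => (Finset.range (len s k)).biUnion fun a =>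
    stack n s k a (len s k - a)

/-- The lowest weight wall `L_λ`. -/
def lowest (n : ℕ) (s : List ℕ) : Finset Block :=
  (Finset.range s.length).biUnion fun k => (Finset.range (len s k)).biUnion fun a =>
    stack n s k a (n + 1 - a)

/-- In column `a` of the part of `ω_{i_{k+1}}` the blocks between `H_λ` and `L_λ` have the colours
`u = i_{k+1} - a, …, n - a`; this is the place of the block of colour `u`. -/
def place (n : ℕ) (s : List ℕ) (k a u : ℕ) : Block :=
  (start s k + a, base n s k + u - (len s k - a), false)

/-- The blocks `(a, u)` (column, colour) of `Y` in the part of `ω_{i_{k+1}}` that lie above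
`H_λ`. -/
def part (n : ℕ) (s : List ℕ) (Y : Finset Block) (k : ℕ) : Finset (ℕ × ℕ) :=
  (Finset.range (len s k) ×ˢ Finset.range (n + 1)).filter fun x =>
    len s k ≤ x.1 + x.2 ∧ x.1 + x.2 ≤ n ∧ place n s k x.1 x.2 ∈ Y

/-- `Y(λ)`: the reduced proper Young walls between `H_λ` and `L_λ` such that
`Y^{ω_{i_k}} ⊆ Y^{ω_{i_{k+1}}}` for all `k`, where `Y^{ω_{i_k}}` and `Y^{ω_{i_{k+1}}}` are the parts
of `ω_{i_k}` and `ω_{i_{k+1}}` restricted to the region that lies in the first `i_k` columns and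
above both highest weight walls. -/
def walls (n : ℕ) (s : List ℕ) : Set (Finset Block) :=
  {Y | (patternA n s.sum).IsProper Y ∧ (patternA n s.sum).IsReduced Y ∧
    highest n s ⊆ Y ∧ Y ⊆ lowest n s ∧
    ∀ k, k + 1 < s.length → ∀ x : ℕ × ℕ, x.1 < len s k → len s (k + 1) ≤ x.1 + x.2 →
      x ∈ part n s Y k → x ∈ part n s Y (k + 1)}

/-- A column `c` with top block of colour `j` goes to the entry `j + 1`. The colour of the top block
of a column of height `h` is `N + (h - 1) - c` modulo `n + 1`; for an empty column this is the colour
of the place just below the wall. -/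
def entry (n N : ℕ) (Y : Finset Block) (c : ℕ) : ℕ :=
  (N + ((Y.filter fun b => b.1 = c).card + n) + n * c) % (n + 1) + 1

/-- The tableau `T_Y`. -/
def toTableau (n : ℕ) (s : List ℕ) (Y : Finset Block) : Tableau := fun k a =>
  if k < s.length ∧ a < len s k then entry n s.sum Y (start s k + a) else 0

end TypeA

/-! ### Type `C_n`

The alphabet `1 ≺ … ≺ n ≺ n̄ ≺ … ≺ 1̄` is encoded by `1, …, 2n`, with `ī` encoded as
`bar n i = 2n + 1 - i`. -/

namespace TypeC

def bar (n i : ℕ) : ℕ := 2 * n + 1 - i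

/-- The vector representation `1 → 2 → … → n → n̄ → … → 1̄`, with arrows `1, …, n, …, 1`. -/
def vf {n : ℕ} (i : Fin n) (x : ℕ) : Option ℕ :=
  if (i : ℕ) + 1 = n then (if x = n then some (bar n n) else none)
  else if x = i + 1 then some (i + 2 : ℕ)
  else if x = bar n (i + 2) then some (bar n (i + 1))
  else none

def ve {n : ℕ} (i : Fin n) (x : ℕ) : Option ℕ :=
  if (i : ℕ) + 1 = n then (if x = bar n n then some n else none)
  else if x = i + 2 then some (i + 1 : ℕ)
  else if x = bar n (i + 1) then some (bar n (i + 2))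
  else none

/-- The `ε_i`-coordinate of the weight of a letter: `i` has weight `ε_i`, `ī` has weight `-ε_i`. -/
def coord (n x i : ℕ) : ℤ := (if x = i then 1 else 0) - (if x = bar n i then 1 else 0)

def vwt {n : ℕ} (x : ℕ) (j : Fin n) : ℤ :=
  if (j : ℕ) + 1 = n then coord n x n else coord n x (j + 1) - coord n x (j + 2)

def tabCrystal (n : ℕ) (s : List ℕ) : CrystalData n Tableau := tableauCrystal n ve vf vwt s

/-- The one column condition (1CC) for a column of length `N` with entry `C p` in row `p` from the
bottom: if `a` and `ā` lie in rows `p > q`, then `p - q - 1 ≥ N - a`. -/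
def OneColumn (n N : ℕ) (C : ℕ → ℕ) : Prop :=
  ∀ p q a, q < p → p < N → 1 ≤ a → a ≤ n → C p = a → C q = bar n a →
    (N : ℤ) - a ≤ (p : ℤ) - q - 1

/-- The first two column condition (2CC-1) for adjacent columns `C` (left, of length `N`), `C'`:
if `a` lies in row `p` of `C`, `ā` in row `q` of `C'` and `p > q`, then `p - q ≤ n - a`. -/
def TwoColumnFirst (n N : ℕ) (C C' : ℕ → ℕ) : Prop :=
  ∀ p q a, q < p → p < N → 1 ≤ a → a ≤ n → C p = a → C' q = bar n a →
    (p : ℤ) - q ≤ (n : ℤ) - a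

/-- The second two column condition (2CC-2): if `a` lies in row `p` of `C`, `ā` in row `q` of `C'`,
`p > q`, and if moreover `b` and `b̄` lie in rows `r > s` of one of the two columns, both between
the rows `q` and `p`, then `(p - r) + (s - q) < b - a`. -/
def TwoColumnSecond (n N : ℕ) (C C' : ℕ → ℕ) : Prop :=
  ∀ p q a, q < p → p < N → 1 ≤ a → a ≤ n → C p = a → C' q = bar n a →
    ∀ r s b, q ≤ s → s < r → r ≤ p → 1 ≤ b → b ≤ n →
      ((C r = b ∧ C s = bar n b) ∨ (C' r = b ∧ C' s = bar n b)) →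
      ((p : ℤ) - r) + ((s : ℤ) - q) < (b : ℤ) - a

/-- `T(λ)` -/
def tableaux (n : ℕ) (s : List ℕ) : Set Tableau :=
  {T | IsReverseTableau (2 * n) s T ∧
    (∀ k, k < s.length → OneColumn n (len s k) (T k)) ∧
    (∀ k, k + 1 < s.length → TwoColumnFirst n (len s k) (T k) (T (k + 1))) ∧
    (∀ k, k + 1 < s.length → TwoColumnSecond n (len s k) (T k) (T (k + 1)))}

/-- The number of rows, a multiple of the period, by which the part of `ω_{i_{k+1}}` is lifted. -/
def base (n : ℕ) (s : List ℕ) (k : ℕ) : ℕ := (s.length - 1 - k) * (2 * n - 2)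

/-- The blocks of column `a` of the part of `ω_{i_{k+1}}` when that column is to represent the letter
`x`: the rows below the top one are completely filled; for `x = 1` (for `x = 1̄`) the top row contains
only a `0`-block (only a `1`-block). -/
def stack (n : ℕ) (s : List ℕ) (k a x : ℕ) : Finset Block :=
  ((Finset.range (base n s k + 2 * n) ×ˢ (Finset.univ : Finset Bool)).image
      fun y => ((start s k + a, y.1, y.2) : Block)).filter fun b =>
    b.2.2 ∈ (patternC n s.sum).slots b.2.1 ∧ (patternC n s.sum).ground b = false ∧
    if x = 1 then
      b.2.1 < base n s k ∨ (b.2.1 = base n s k ∧ (patternC n s.sum).color b = 0)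
    else if x = bar n 1 then
      b.2.1 < base n s k + (2 * n - 2) ∨
        (b.2.1 = base n s k + (2 * n - 2) ∧ (patternC n s.sum).color b = 1)
    else b.2.1 < base n s k + x - 1

/-- The highest weight wall `H_λ`: the columns of the part of `ω_{i_k}` represent
`i_k, …, 2, 1` from right to left. -/
def highest (n : ℕ) (s : List ℕ) : Finset Block :=
  (Finset.range s.length).biUnion fun k => (Finset.range (len s k)).biUnion fun a =>
    stack n s k a (len s k - a)

/-- The lowest weight wall `L_λ`: the columns of the part of `ω_{i_k}` represent
`1̄, 2̄, …` from right to left. -/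
def lowest (n : ℕ) (s : List ℕ) : Finset Block :=
  (Finset.range s.length).biUnion fun k => (Finset.range (len s k)).biUnion fun a =>
    stack n s k a (bar n (a + 1))

/-- A column of the part of `ω_{i_{k+1}}` is built, on top of the column representing `1`, by blocks
of colours `1, 2, …, n, …, 2, 1`, which are numbered `u = 1, 2, …, n, …, 2n - 1`. This is the place of
block `u` of column `a`. Block `n` forms the `n`-row, and the reflection with respect to the `n`-row
exchanges `u` and `2n - u`. -/
def place (n : ℕ) (s : List ℕ) (k a u : ℕ) : Block :=
  (start s k + a, base n s k + u - 1,
    if u = 1 ∨ u = 2 * n - 1 then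
      decide ((patternC n s.sum).color (start s k + a, base n s k + u - 1, true) = 1)
    else false)

/-- The blocks `(a, u)` of `Y` in the part of `ω_{i_{k+1}}`. -/
def part (n : ℕ) (s : List ℕ) (Y : Finset Block) (k : ℕ) : Finset (ℕ × ℕ) :=
  (Finset.range (len s k) ×ˢ Finset.Ico 1 (2 * n)).filter fun x =>
    (patternC n s.sum).Filled Y (place n s k x.1 x.2)

/-- The block `(a, u)` lies above `H_λ` in the part of `ω_{i_{k+1}}`. -/
def Above (s : List ℕ) (k : ℕ) (x : ℕ × ℕ) : Prop := len s k ≤ x.1 + x.2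

/-- `|Z|`: the set of blocks obtained by reflecting `Z` with respect to the `n`-row and shifting the
blocks to the right as much as possible, up to column `q`. -/
def reflectShift (n q : ℕ) (Z : Finset (ℕ × ℕ)) : Set (ℕ × ℕ) :=
  {x | q ≤ x.1 ∧ x.1 < q + (Z.filter fun y => y.2 + x.2 = 2 * n).card}

/-- The letter of column `c`, read off from the top of the column (`m` is the position of the top row
in the period): a `0`-block alone gives `1`, a `1`-block alone gives `1̄`, both together give `2`; a
block `j - 1` on top of a block `j - 2` (for `j = 3`: on top of the blocks `0` and `1`) gives `j`; the
block `n` gives `n̄`, and a block `j` on top of a block `j + 1` gives `j̄`. -/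
def entry (n N : ℕ) (Y : Finset Block) (c : ℕ) : ℕ :=
  let h := (Y.filter fun b => b.1 = c).sup fun b => b.2.1
  let m := h % (2 * n - 2)
  let blocks := (Finset.univ : Finset Bool).filter fun σ => (patternC n N).Filled Y (c, h, σ)
  let colors := blocks.image fun σ => (patternC n N).color (c, h, σ)
  if m = 0 then (if colors = {0} then 1 else if colors = {1} then bar n 1 else 2)
  else if m + 1 < n then (patternC n N).color (c, h, false) + 1
  else bar n ((patternC n N).color (c, h, false))

/-- (Y1): `Y_{ω_{i_k}}^+ ⊆ |Y_{ω_{i_k}}^-|`, where `Y_{ω_{i_k}}^±` consists of the blocks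
above `H_λ` that lie above (below) the `n`-row. -/
def Y1 (n : ℕ) (s : List ℕ) (Y : Finset Block) : Prop :=
  ∀ k, k < s.length → ∀ x ∈ part n s Y k, Above s k x → n < x.2 →
    x ∈ reflectShift n 0 ((part n s Y k).filter fun y => len s k ≤ y.1 + y.2 ∧ y.2 < n)

/-- (Y2): `Y^{ω_{i_k}} ⊆ Y^{ω_{i_{k+1}}}`, the two parts being restricted to the region that lies
in the first `i_k` columns and above both highest weight walls. -/
def Y2 (n : ℕ) (s : List ℕ) (Y : Finset Block) : Prop :=
  ∀ k, k + 1 < s.length → ∀ x ∈ part n s Y k, Above s k x → Above s (k + 1) x →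
    x ∈ part n s Y (k + 1)

/-- (Y3): `|Y_{(ω_{i_k}, ω_{i_{k+1}})}^-| ⊆ Y_{(ω_{i_k}, ω_{i_{k+1}})}^+`, where the left hand side is
formed from the triangle `L^-` of the blocks of the colours `n - a, …, n - 1` below the `n`-row in the
columns `0 ≤ a < i_k` of the part of `ω_{i_k}`, and the right hand side from the triangle `L^+` of
the blocks of the colours `n - 1, …, n - i_k + a + 1` above the `n`-row in the columns `0 ≤ a < i_k`
of the part of `ω_{i_{k+1}}`. -/
def Y3 (n : ℕ) (s : List ℕ) (Y : Finset Block) : Prop :=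
  ∀ k, k + 1 < s.length →
    reflectShift n 0 ((part n s Y k).filter fun y => n ≤ y.1 + y.2 ∧ y.2 < n) ⊆
      {x | x ∈ part n s Y (k + 1) ∧ n < x.2 ∧ x.1 + x.2 < n + len s k}

/-- The triangle `L^+(a; p, q)`: above the `n`-row, in the columns `q ≤ c < p`, the blocks of the
colours `a + (c - q), …, a + (p - q) - 1`. -/
def InUpper (n a p q : ℕ) (x : ℕ × ℕ) : Prop :=
  n < x.2 ∧ q ≤ x.1 ∧ x.1 < p ∧ a + x.1 + x.2 ≤ 2 * n + q ∧ 2 * n + q < a + p + x.2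

/-- The triangle `L^-(a; p, q)`: below the `n`-row, in the columns `q < c ≤ p`, the blocks of the
colours `a + (p - c), …, a + (p - q) - 1`. -/
def InLower (n a p q : ℕ) (x : ℕ × ℕ) : Prop :=
  x.2 < n ∧ q < x.1 ∧ x.1 ≤ p ∧ a + p ≤ x.1 + x.2 ∧ x.2 + q < a + p

instance (n a p q : ℕ) (x : ℕ × ℕ) : Decidable (InLower n a p q x) := by
  unfold InLower; infer_instance

/-- (Y4): whenever, for some `p > q`, the top of column `p` of the part of `ω_{i_k}` is that of the
letter `a` and the top of column `q` of the part of `ω_{i_{k+1}}` is that of the letter `ā`, then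
`Y_ω^+(a; p, q) ⊆ |Y_ω^-(a; p, q)|` for `ω = ω_{i_k}` and for `ω = ω_{i_{k+1}}`. -/
def Y4 (n : ℕ) (s : List ℕ) (Y : Finset Block) : Prop :=
  ∀ k, k + 1 < s.length → ∀ p q a, q < p → p < len s k → 1 ≤ a → a ≤ n →
    entry n s.sum Y (start s k + p) = a → entry n s.sum Y (start s (k + 1) + q) = bar n a →
    ∀ g, g = k ∨ g = k + 1 → ∀ x ∈ part n s Y g, InUpper n a p q x →
      x ∈ reflectShift n q ((part n s Y g).filter fun y => InLower n a p q y)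

/-- `Y(λ)`: the reduced proper Young walls between `H_λ` and `L_λ` with the properties
(Y1) – (Y4). -/
def walls (n : ℕ) (s : List ℕ) : Set (Finset Block) :=
  {Y | (patternC n s.sum).IsProper Y ∧ (patternC n s.sum).IsReduced Y ∧
    highest n s ⊆ Y ∧ Y ⊆ lowest n s ∧ Y1 n s Y ∧ Y2 n s Y ∧ Y3 n s Y ∧ Y4 n s Y}

/-- The tableau `T_Y`. -/
def toTableau (n : ℕ) (s : List ℕ) (Y : Finset Block) : Tableau := fun k a =>
  if k < s.length ∧ a < len s k then entry n s.sum Y (start s k + a) else 0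

end TypeC

end WallTableau

namespace WallTableau

/-! ## The signature rule -/

section Signature

variable {α β : Type}

/-! Walls and tableaux carry the same signature rule, so the theorem rests on three facts: the
tableaux form a stable set with a single element killed by all $\tilde e_i$; the walls of
$Y(\lambda)$ and the tableaux of $T(\lambda)$ encode the same data; and the sign word of a wall has
the same surviving signs as that of its tableau.

Stability. A strict column is determined by its counting function $z\mapsto\#\{\text{entries}>z\}$,
and the row of a letter is a value of that function. For $C_n$, write $c(a)$ for the number of
entries $\succ a$ and $d(a)$ for the number of entries $\succeq\bar a$. Then (1CC) becomes the
inequalities `SingleCond`, and the row condition together with (2CC-1) and (2CC-2) becomes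
`PairCond`, now required for all indices and not only where letters are present (`oneColumn_iff`,
`two_columns_iff`). An operator changes $c$ or $d$ of one column by one at a single index (both of
them, at $n$, for the long root). The signature rule tells which letters of the relevant colour may
occur in that column and in its two neighbours (`ActsAt`), and with this knowledge the inequalities
at the adjacent indices imply the one that has become sharper. Type $A_n$ is the same argument with
the row condition alone.

Generation. Every $\tilde e_i$ lowers the sum of the entries, so a stable set is generated by its
elements killed by all $\tilde e_i$. In such a tableau every initial segment of the reading word has
dominant weight; at the first box that differs from the tableau with columns $1,2,\dots,i_k$ this
contradicts the row condition or (1CC) (`first_difference`).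

Walls. The blocks of a column over the highest weight wall correspond to the arrows of the vector
representation, so the top of the column is a letter, and properness of the wall is strictness of
the columns of letters. `WallModel` axiomatises this. If $y$ and $y+1$ stand in adjacent rows of a
column, the tableau shows a $+$ and a $-$ that the wall does not show; they are adjacent in the word
and cancel. Hence the survivors agree (`survivors_word`), and `crystal_walls` transports the whole
crystal structure.

It remains to match the conditions. Row $u$ of a part of the wall is the interval of the columns
$a<\#\{\text{entries}>u\}$, so (Y2) is the row condition, and reflection in the $n$-row compares $c$
with $d$: (Y1) is `SingleCond`, (Y3) the case $b=n$ of `PairCond`, and (Y4) the instances that give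
(2CC-2). Reducedness follows from the conditions on the tableau. -/

theorem cancelSigns_eq (w : List (Sgn × α)) :
    cancelSigns w = (survivors Sgn.minus w).map (Prod.mk Sgn.minus) ++
      (survivors Sgn.plus w).map (Prod.mk Sgn.plus) := by
  have key : ∀ M P : List α, ∀ l : List (Sgn × α),
      l = M.map (Prod.mk Sgn.minus) ++ P.map (Prod.mk Sgn.plus) →
      l = ((l.filter (fun x => x.1 = Sgn.minus)).map Prod.snd).map (Prod.mk Sgn.minus) ++
        ((l.filter (fun x => x.1 = Sgn.plus)).map Prod.snd).map (Prod.mk Sgn.plus) := by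
    rintro M P l rfl
    simp [List.filter_append, List.filter_map, Function.comp_def]
  suffices h : ∃ M P : List α,
      cancelSigns w = M.map (Prod.mk Sgn.minus) ++ P.map (Prod.mk Sgn.plus) by
    obtain ⟨M, P, h⟩ := h
    exact key M P _ h
  induction w with
  | nil => exact ⟨[], [], rfl⟩
  | cons x w ih =>
    obtain ⟨M, P, h⟩ := ih
    obtain ⟨s, a⟩ := x
    cases s with
    | minus => exact ⟨a :: M, P, by simp [cancelSigns, h]⟩
    | plus =>
      cases M with
      | nil =>
        refine ⟨[], a :: P, ?_⟩
        cases P with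
        | nil => simp [cancelSigns, h]
        | cons b P => simp [cancelSigns, h]
      | cons b M => exact ⟨M, P, by simp [cancelSigns, h]⟩

@[simp] theorem survivors_nil (s : Sgn) : survivors s ([] : List (Sgn × α)) = [] := rfl

theorem survivors_minus_minus_cons (a : α) (w : List (Sgn × α)) :
    survivors Sgn.minus ((Sgn.minus, a) :: w) = a :: survivors Sgn.minus w := by
  simp [survivors, cancelSigns]

theorem survivors_plus_minus_cons (a : α) (w : List (Sgn × α)) :
    survivors Sgn.plus ((Sgn.minus, a) :: w) = survivors Sgn.plus w := by
  simp [survivors, cancelSigns]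

theorem survivors_plus_cons (a : α) (w : List (Sgn × α)) :
    survivors Sgn.minus ((Sgn.plus, a) :: w) = (survivors Sgn.minus w).tail ∧
    survivors Sgn.plus ((Sgn.plus, a) :: w) =
      if survivors Sgn.minus w = [] then a :: survivors Sgn.plus w else survivors Sgn.plus w := by
  have h := cancelSigns_eq w
  generalize hM : survivors Sgn.minus w = M at *
  generalize hP : survivors Sgn.plus w = P at *
  cases M with
  | nil =>
    cases P with
    | nil => simp_all [survivors, cancelSigns]
    | cons b P => simp_all [survivors, cancelSigns, List.filter_map, Function.comp_def]
  | cons b M => simp_all [survivors, cancelSigns, List.filter_map, Function.comp_def]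

/-- After both factors have been reduced to the form $-\cdots-+\cdots+$, only the $+$ of the first
and the $-$ of the second face each other. The last $+$ of `u` cancel against the first $-$ of `v`,
whence `take` on one side and `drop` on the other. -/
theorem survivors_append (u v : List (Sgn × α)) :
    survivors Sgn.minus (u ++ v) = survivors Sgn.minus u ++
      (survivors Sgn.minus v).drop (survivors Sgn.plus u).length ∧
    survivors Sgn.plus (u ++ v) = (survivors Sgn.plus u).take
      ((survivors Sgn.plus u).length - (survivors Sgn.minus v).length) ++ survivors Sgn.plus v := by
  induction u with
  | nil => simp
  | cons x u ih =>
    obtain ⟨s, a⟩ := x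
    obtain ⟨ih1, ih2⟩ := ih
    cases s with
    | minus =>
      simp only [List.cons_append, survivors_minus_minus_cons, survivors_plus_minus_cons, ih1, ih2,
        and_self]
    | plus =>
      obtain ⟨h1, h2⟩ := survivors_plus_cons a (u ++ v)
      obtain ⟨h3, h4⟩ := survivors_plus_cons a u
      simp only [List.cons_append, h1, h2, h3, h4, ih1, ih2]
      generalize survivors Sgn.minus u = Mu
      generalize survivors Sgn.plus u = Pu
      generalize survivors Sgn.minus v = Mv
      generalize survivors Sgn.plus v = Pv
      cases Mu with
      | cons b Mu => simp
      | nil =>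
        by_cases hlt : Mv.length ≤ Pu.length
        · have : Mv.drop Pu.length = [] := List.drop_eq_nil_of_le hlt
          have e : Pu.length + 1 - Mv.length = (Pu.length - Mv.length) + 1 := by omega
          have h5 : Mv.drop (Pu.length + 1) = [] := List.drop_eq_nil_of_le (by omega)
          simp [this, e, h5]
        · have h5 : Mv.drop Pu.length ≠ [] := by
            simp [List.drop_eq_nil_iff]; omega
          have e : Pu.length + 1 - Mv.length = 0 := by omega
          have e' : Pu.length - Mv.length = 0 := by omega
          simp [h5, e, e', List.tail_drop]

/-- Cancellation never looks at labels. The new label may depend on the sign, as is needed when a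
box is replaced by the block to be removed or by the slot to be filled. -/
theorem survivors_map (s : Sgn) (f : Sgn → α → β) (w : List (Sgn × α)) :
    survivors s (w.map fun x => (x.1, f x.1 x.2)) = (survivors s w).map (f s) := by
  suffices h : survivors Sgn.minus (w.map fun x => (x.1, f x.1 x.2)) =
        (survivors Sgn.minus w).map (f Sgn.minus) ∧
      survivors Sgn.plus (w.map fun x => (x.1, f x.1 x.2)) =
        (survivors Sgn.plus w).map (f Sgn.plus) by
    cases s
    exacts [h.2, h.1]
  induction w with
  | nil => simp
  | cons x w ih =>
    obtain ⟨t, a⟩ := x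
    cases t with
    | minus =>
      simp only [List.map_cons, survivors_minus_minus_cons, survivors_plus_minus_cons, ih,
        and_self]
    | plus =>
      simp only [List.map_cons, survivors_plus_cons, ih, List.map_eq_nil_iff, List.map_tail,
        true_and]
      split_ifs <;> simp

theorem mem_of_mem_survivors {s : Sgn} {w : List (Sgn × α)} {a : α} (h : a ∈ survivors s w) :
    (s, a) ∈ w := by
  suffices key : (∀ a ∈ survivors Sgn.minus w, (Sgn.minus, a) ∈ w) ∧
      ∀ a ∈ survivors Sgn.plus w, (Sgn.plus, a) ∈ w by
    cases s
    exacts [key.2 a h, key.1 a h]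
  clear h
  induction w with
  | nil => simp
  | cons x w ih =>
    obtain ⟨t, b⟩ := x
    cases t with
    | minus =>
      simp only [survivors_minus_minus_cons, survivors_plus_minus_cons]
      refine ⟨fun a ha => ?_, fun a ha => List.mem_cons_of_mem _ (ih.2 a ha)⟩
      rcases List.mem_cons.1 ha with rfl | ha
      · simp
      · exact List.mem_cons_of_mem _ (ih.1 a ha)
    | plus =>
      simp only [survivors_plus_cons]
      refine ⟨fun a ha => List.mem_cons_of_mem _ (ih.1 a (List.mem_of_mem_tail ha)),
        fun a ha => ?_⟩
      split_ifs at ha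
      · rcases List.mem_cons.1 ha with rfl | ha
        · simp
        · exact List.mem_cons_of_mem _ (ih.2 a ha)
      · exact List.mem_cons_of_mem _ (ih.2 a ha)

/-- The numbers of surviving signs differ as the numbers of all signs do. -/
def net (w : List (Sgn × α)) : ℤ :=
  (w.map fun x => if x.1 = Sgn.plus then (1 : ℤ) else -1).sum

theorem net_append (u v : List (Sgn × α)) : net (u ++ v) = net u + net v := by
  simp [net]

theorem length_survivors_sub (w : List (Sgn × α)) :
    ((survivors Sgn.plus w).length : ℤ) - (survivors Sgn.minus w).length = net w := by
  induction w with
  | nil => simp [net]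
  | cons x w ih =>
    obtain ⟨t, b⟩ := x
    cases t with
    | minus =>
      simp only [survivors_minus_minus_cons, survivors_plus_minus_cons]
      simp only [net, List.map_cons, List.sum_cons, List.length_cons] at ih ⊢
      rw [← ih]; simp; ring
    | plus =>
      simp only [survivors_plus_cons]
      simp only [net, List.map_cons, List.sum_cons] at ih ⊢
      rw [← ih]
      split_ifs with h
      · simp [h]; ring
      · have := List.length_pos_of_ne_nil h
        simp; omega

/-- Two words are equivalent if the same signs survive. -/
def SameSurvivors (u v : List (Sgn × α)) : Prop := ∀ s, survivors s u = survivors s v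

theorem SameSurvivors.append {u u' v v' : List (Sgn × α)} (h : SameSurvivors u u')
    (h' : SameSurvivors v v') : SameSurvivors (u ++ v) (u' ++ v') := by
  intro s
  cases s
  · rw [(survivors_append u v).2, (survivors_append u' v').2, h, h', h']
  · rw [(survivors_append u v).1, (survivors_append u' v').1, h, h', h]

theorem SameSurvivors.flatMap {ι : Type} {l : List ι} {f g : ι → List (Sgn × α)}
    (h : ∀ x ∈ l, SameSurvivors (f x) (g x)) : SameSurvivors (l.flatMap f) (l.flatMap g) := by
  induction l with
  | nil => intro s; rfl
  | cons x l ih =>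
    simp only [List.flatMap_cons]
    exact (h x (by simp)).append (ih fun y hy => h y (by simp [hy]))

theorem sameSurvivors_cancel (a b : α) (w : List (Sgn × α)) :
    SameSurvivors ((Sgn.plus, a) :: (Sgn.minus, b) :: w) w := by
  intro s
  cases s
  · rw [(survivors_plus_cons _ _).2, survivors_minus_minus_cons, survivors_plus_minus_cons]; simp
  · rw [(survivors_plus_cons _ _).1, survivors_minus_minus_cons]; simp

/-! ### The sign at which an operator acts -/

/-- A $-$ surviving in `v` would cancel the $+$ labelled `a`, and a $+$ surviving in `u` would then
stand further to the left. That `a` labels no other sign is what identifies the head of the list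
with this occurrence. -/
theorem plus_head_split {u v : List (Sgn × α)} {a : α}
    (h : (survivors Sgn.plus (u ++ (Sgn.plus, a) :: v)).head? = some a)
    (hu : ∀ s, (s, a) ∉ u) (hv : ∀ s, (s, a) ∉ v) :
    survivors Sgn.plus u = [] ∧ survivors Sgn.minus v = [] := by
  rw [(survivors_append _ _).2, (survivors_plus_cons _ _).1, (survivors_plus_cons _ _).2] at h
  have hv' : a ∉ survivors Sgn.plus v := fun h => hv _ (mem_of_mem_survivors h)
  have hu' : a ∉ survivors Sgn.plus u := fun h => hu _ (mem_of_mem_survivors h)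
  have hhead : ∀ l : List α, a ∉ l → l.head? ≠ some a := fun l hl e =>
    hl (List.mem_of_mem_head? (by simp [e]))
  by_cases hM : survivors Sgn.minus v = []
  · refine ⟨?_, hM⟩
    simp only [hM, List.tail_nil, List.length_nil, Nat.sub_zero, List.take_length, if_true] at h
    by_contra hne
    obtain ⟨b, l, e⟩ := List.exists_cons_of_ne_nil hne
    rw [e] at h hu'
    simp at h
    simp [h] at hu'
  · exfalso
    rw [if_neg hM] at h
    refine hhead _ ?_ h
    simp only [List.mem_append, not_or]
    exact ⟨fun h => hu' (List.mem_of_mem_take h), hv'⟩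

theorem minus_last_split {u v : List (Sgn × α)} {a : α}
    (h : (survivors Sgn.minus (u ++ (Sgn.minus, a) :: v)).getLast? = some a)
    (hu : ∀ s, (s, a) ∉ u) (hv : ∀ s, (s, a) ∉ v) :
    survivors Sgn.plus u = [] ∧ survivors Sgn.minus v = [] := by
  rw [(survivors_append _ _).1, survivors_minus_minus_cons] at h
  have hv' : a ∉ survivors Sgn.minus v := fun h => hv _ (mem_of_mem_survivors h)
  have hu' : a ∉ survivors Sgn.minus u := fun h => hu _ (mem_of_mem_survivors h)
  have hlast : ∀ l : List α, a ∉ l → l.getLast? ≠ some a := fun l hl e =>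
    hl (List.mem_of_getLast? e)
  by_cases hP : survivors Sgn.plus u = []
  · refine ⟨hP, ?_⟩
    simp only [hP, List.length_nil, List.drop_zero] at h
    by_contra hne
    rcases List.eq_nil_or_concat (survivors Sgn.minus v) with e | ⟨l, b, e⟩
    · exact hne e
    · rw [e] at h hv'
      have h2 : b = a := by
        have : survivors Sgn.minus u ++ a :: (l ++ [b]) = (survivors Sgn.minus u ++ a :: l) ++ [b] := by
          simp
        rw [List.concat_eq_append, this, List.getLast?_append] at h
        simpa using h
      simp [h2] at hv'
  · exfalso
    refine hlast _ ?_ h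
    obtain ⟨b, l, e⟩ := List.exists_cons_of_ne_nil hP
    simp only [e, List.length_cons, List.drop_succ_cons, List.mem_append, not_or]
    exact ⟨hu', fun h => hv' (List.mem_of_mem_drop h)⟩

/-- At a place with no surviving $+$ before it and no surviving $-$ after it, either sign survives
and affects nothing else. Reversing that sign is therefore an operation whose inverse acts at the
same place. -/
theorem survivors_of_split {u v : List (Sgn × α)} (a : α)
    (hu : survivors Sgn.plus u = []) (hv : survivors Sgn.minus v = []) :
    survivors Sgn.minus (u ++ (Sgn.plus, a) :: v) = survivors Sgn.minus u ∧
    survivors Sgn.plus (u ++ (Sgn.plus, a) :: v) = a :: survivors Sgn.plus v ∧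
    survivors Sgn.minus (u ++ (Sgn.minus, a) :: v) = survivors Sgn.minus u ++ [a] ∧
    survivors Sgn.plus (u ++ (Sgn.minus, a) :: v) = survivors Sgn.plus v := by
  simp [survivors_append, survivors_plus_cons, survivors_minus_minus_cons,
    survivors_plus_minus_cons, hu, hv]

theorem survivors_plus_suffix {u v : List (Sgn × α)} (h : survivors Sgn.plus (u ++ v) = []) :
    survivors Sgn.plus v = [] := by
  rw [(survivors_append u v).2] at h
  exact (List.append_eq_nil_iff.1 h).2

theorem survivors_minus_prefix {u v : List (Sgn × α)} (h : survivors Sgn.minus (u ++ v) = []) :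
    survivors Sgn.minus u = [] := by
  rw [(survivors_append u v).1] at h
  exact (List.append_eq_nil_iff.1 h).1

end Signature

/-! ## Crystals of tableaux -/

/-- A vector representation `1 → 2 → ⋯ → m` in which the arrow from `x` to `x + 1` has the colour
`col x`, consecutive arrows having different colours; `A` is the Cartan matrix. -/
structure IsLetterChain (n m : ℕ) (A : Fin n → Fin n → ℤ) (col : ℕ → ℕ)
    (ve vf : Fin n → ℕ → Option ℕ) (vwt : ℕ → Fin n → ℤ) : Prop where
  ve_iff : ∀ i x y, ve i x = some y ↔ 1 ≤ y ∧ x = y + 1 ∧ x ≤ m ∧ col y = i + 1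
  vf_iff : ∀ i x y, vf i x = some y ↔ 1 ≤ x ∧ y = x + 1 ∧ y ≤ m ∧ col x = i + 1
  col_ne : ∀ x, 1 ≤ x → x + 1 < m → col x ≠ col (x + 1)
  col_mem : ∀ x, 1 ≤ x → x < m → 1 ≤ col x ∧ col x ≤ n
  vwt_eq : ∀ x j, 1 ≤ x → x ≤ m → vwt x j =
    (if x < m ∧ col x = j + 1 then 1 else 0) - (if 2 ≤ x ∧ col (x - 1) = j + 1 then 1 else 0)
  vwt_succ : ∀ x (i j : Fin n), 1 ≤ x → x < m → col x = i + 1 → vwt (x + 1) j = vwt x j - A j i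

/-- Change of one entry of a tableau. -/
def Tableau.upd (T : Tableau) (x : ℕ × ℕ) (y : ℕ) : Tableau :=
  Function.update T x.1 (Function.update (T x.1) x.2 y)

theorem Tableau.upd_apply (T : Tableau) (x : ℕ × ℕ) (y k a : ℕ) :
    T.upd x y k a = if (k, a) = x then y else T k a := by
  obtain ⟨k', a'⟩ := x
  unfold Tableau.upd
  by_cases hk : k = k'
  · subst hk
    by_cases ha : a = a' <;> simp [Function.update, ha]
  · simp [Function.update, hk]

theorem Tableau.upd_self (T : Tableau) (x : ℕ × ℕ) (y : ℕ) : T.upd x y x.1 x.2 = y := by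
  simp [Tableau.upd_apply]

theorem Tableau.upd_upd (T : Tableau) (x : ℕ × ℕ) (y z : ℕ) (h : T x.1 x.2 = z) :
    (T.upd x y).upd x z = T := by
  funext k a
  rw [Tableau.upd_apply, Tableau.upd_apply]
  split_ifs with h1
  · rw [← h, ← h1]
  · rfl

theorem mem_boxes {s : List ℕ} {k a : ℕ} :
    (k, a) ∈ boxes s ↔ k < s.length ∧ a < len s k := by
  simp [boxes]

theorem nodup_boxes (s : List ℕ) : (boxes s).Nodup := by
  unfold boxes
  rw [List.nodup_flatMap]
  refine ⟨fun k _ => ?_, ?_⟩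
  · exact (List.nodup_reverse.2 List.nodup_range).map fun a b h => by simpa using h
  · refine (List.nodup_reverse.2 List.nodup_range).imp ?_
    intro k k' hkk x hx hx'
    simp only [List.mem_map] at hx hx'
    obtain ⟨_, _, rfl⟩ := hx
    obtain ⟨_, _, h⟩ := hx'
    simp at h
    exact hkk h.1.symm

section Word

variable {n : ℕ} {α : Type} (ve vf : Fin n → ℕ → Option ℕ)

/-- The signs of a letter. -/
def letterSigns (i : Fin n) (y : ℕ) (b : α) : List (Sgn × α) :=
  (if (ve i y).isSome then [(Sgn.minus, b)] else []) ++
    (if (vf i y).isSome then [(Sgn.plus, b)] else [])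

/-- The word of signs of a list of boxes. -/
def boxWord (i : Fin n) (T : Tableau) (l : List (ℕ × ℕ)) : List (Sgn × (ℕ × ℕ)) :=
  l.flatMap fun x => letterSigns ve vf i (T x.1 x.2) x

theorem boxWord_append (i : Fin n) (T : Tableau) (l l' : List (ℕ × ℕ)) :
    boxWord ve vf i T (l ++ l') = boxWord ve vf i T l ++ boxWord ve vf i T l' := by
  simp [boxWord]

theorem boxWord_cons (i : Fin n) (T : Tableau) (x : ℕ × ℕ) (l : List (ℕ × ℕ)) :
    boxWord ve vf i T (x :: l) = letterSigns ve vf i (T x.1 x.2) x ++ boxWord ve vf i T l := by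
  simp [boxWord]

theorem boxWord_congr {i : Fin n} {T T' : Tableau} {l : List (ℕ × ℕ)}
    (h : ∀ x ∈ l, T x.1 x.2 = T' x.1 x.2) : boxWord ve vf i T l = boxWord ve vf i T' l := by
  unfold boxWord
  rw [List.flatMap_def, List.flatMap_def]
  congr 1
  exact List.map_congr_left fun x hx => by rw [h x hx]

theorem mem_boxWord {i : Fin n} {T : Tableau} {l : List (ℕ × ℕ)} {s : Sgn} {x : ℕ × ℕ}
    (h : (s, x) ∈ boxWord ve vf i T l) : x ∈ l ∧
      (s = Sgn.minus → (ve i (T x.1 x.2)).isSome) ∧ (s = Sgn.plus → (vf i (T x.1 x.2)).isSome) := by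
  simp only [boxWord, letterSigns, List.mem_flatMap, List.mem_append] at h
  obtain ⟨y, hy, h⟩ := h
  rcases h with h | h <;> split_ifs at h with h' <;> simp at h <;> obtain ⟨rfl, rfl⟩ := h <;>
    simp [hy, h']

end Word

section TableauCrystal

/-! ### Kashiwara operators on fillings by a chain of letters -/

variable {n m : ℕ} {A : Fin n → Fin n → ℤ} {col : ℕ → ℕ} {ve vf : Fin n → ℕ → Option ℕ}
  {vwt : ℕ → Fin n → ℤ} (h : IsLetterChain n m A col ve vf vwt) {s : List ℕ}
include h

/-- The arrow entering a letter and the arrow leaving it have different colours, so a letter carries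
at most one sign of a given colour. -/
theorem IsLetterChain.letterSigns_of_vf {α : Type} {i : Fin n} {x y : ℕ} (b : α)
    (hx : vf i x = some y) : letterSigns ve vf i x b = [(Sgn.plus, b)] := by
  have h1 : ve i x = none := by
    rw [Option.eq_none_iff_forall_ne_some]
    intro z hz
    rw [h.ve_iff] at hz
    rw [h.vf_iff] at hx
    obtain ⟨hz1, rfl, hz2, hz3⟩ := hz
    exact h.col_ne z hz1 (by omega) (by omega)
  simp [letterSigns, h1, hx]

theorem IsLetterChain.letterSigns_of_ve {α : Type} {i : Fin n} {x y : ℕ} (b : α)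
    (hx : ve i x = some y) : letterSigns ve vf i x b = [(Sgn.minus, b)] := by
  have h1 : vf i x = none := by
    rw [Option.eq_none_iff_forall_ne_some]
    intro z hz
    rw [h.vf_iff] at hz
    rw [h.ve_iff] at hx
    obtain ⟨hz1, rfl, hz2, hz3⟩ := hx
    exact h.col_ne y hz1 (by omega) (by omega)
  simp [letterSigns, h1, hx]

theorem IsLetterChain.vf_iff_ve {i : Fin n} {x y : ℕ} : vf i x = some y ↔ ve i y = some x := by
  rw [h.vf_iff, h.ve_iff]

omit h in
theorem boxes_split {x : ℕ × ℕ} (hx : x ∈ boxes s) :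
    ∃ l₁ l₂, boxes s = l₁ ++ x :: l₂ ∧ x ∉ l₁ ∧ x ∉ l₂ := by
  obtain ⟨l₁, l₂, e⟩ := List.append_of_mem hx
  have := nodup_boxes s
  rw [e, List.nodup_append] at this
  refine ⟨l₁, l₂, e, fun hx => ?_, ?_⟩
  · exact this.2.2 x hx x (by simp) rfl
  · exact (List.nodup_cons.1 this.2.1).1

/-- Since each box labels at most one sign, acting at a box means that no $+$ survives before it and
no $-$ after it. The description of $\tilde e_i$ has the same shape, which makes the two operators
mutually inverse. -/
theorem IsLetterChain.f_eq_some_iff {i : Fin n} {T T' : Tableau} :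
    (tableauCrystal n ve vf vwt s).f i T = some T' ↔
      ∃ l₁ x l₂ y, boxes s = l₁ ++ x :: l₂ ∧ x ∉ l₁ ∧ x ∉ l₂ ∧ vf i (T x.1 x.2) = some y ∧
        T' = T.upd x y ∧ survivors Sgn.plus (boxWord ve vf i T l₁) = [] ∧
        survivors Sgn.minus (boxWord ve vf i T l₂) = [] := by
  change Option.map (fun x => T.upd x ((vf i (T x.1 x.2)).getD 0))
    (survivors Sgn.plus (boxWord ve vf i T (boxes s))).head? = some T' ↔ _
  rw [Option.map_eq_some_iff]
  constructor
  · rintro ⟨x, hx, rfl⟩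
    have hm := mem_boxWord ve vf (mem_of_mem_survivors (List.mem_of_mem_head? hx))
    obtain ⟨l₁, l₂, e, h1, h2⟩ := boxes_split hm.1
    obtain ⟨y, hy⟩ := Option.isSome_iff_exists.1 (hm.2.2 rfl)
    rw [e, boxWord_append, boxWord_cons, h.letterSigns_of_vf x hy] at hx
    have := plus_head_split hx (fun s hs => h1 (mem_boxWord ve vf hs).1)
      (fun s hs => h2 (mem_boxWord ve vf hs).1)
    exact ⟨l₁, x, l₂, y, e, h1, h2, hy, by simp [hy], this⟩
  · rintro ⟨l₁, x, l₂, y, e, h1, h2, hy, rfl, h3, h4⟩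
    refine ⟨x, ?_, by simp [hy]⟩
    rw [e, boxWord_append, boxWord_cons, h.letterSigns_of_vf x hy, List.singleton_append,
      (survivors_of_split x h3 h4).2.1]
    rfl

theorem IsLetterChain.e_eq_some_iff {i : Fin n} {T T' : Tableau} :
    (tableauCrystal n ve vf vwt s).e i T = some T' ↔
      ∃ l₁ x l₂ y, boxes s = l₁ ++ x :: l₂ ∧ x ∉ l₁ ∧ x ∉ l₂ ∧ ve i (T x.1 x.2) = some y ∧
        T' = T.upd x y ∧ survivors Sgn.plus (boxWord ve vf i T l₁) = [] ∧
        survivors Sgn.minus (boxWord ve vf i T l₂) = [] := by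
  change Option.map (fun x => T.upd x ((ve i (T x.1 x.2)).getD 0))
    (survivors Sgn.minus (boxWord ve vf i T (boxes s))).getLast? = some T' ↔ _
  rw [Option.map_eq_some_iff]
  constructor
  · rintro ⟨x, hx, rfl⟩
    have hm := mem_boxWord ve vf (mem_of_mem_survivors (List.mem_of_getLast? hx))
    obtain ⟨l₁, l₂, e, h1, h2⟩ := boxes_split hm.1
    obtain ⟨y, hy⟩ := Option.isSome_iff_exists.1 (hm.2.1 rfl)
    rw [e, boxWord_append, boxWord_cons, h.letterSigns_of_ve x hy] at hx
    have := minus_last_split hx (fun s hs => h1 (mem_boxWord ve vf hs).1)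
      (fun s hs => h2 (mem_boxWord ve vf hs).1)
    exact ⟨l₁, x, l₂, y, e, h1, h2, hy, by simp [hy], this⟩
  · rintro ⟨l₁, x, l₂, y, e, h1, h2, hy, rfl, h3, h4⟩
    refine ⟨x, ?_, by simp [hy]⟩
    rw [e, boxWord_append, boxWord_cons, h.letterSigns_of_ve x hy, List.singleton_append,
      (survivors_of_split x h3 h4).2.2.1]
    simp

theorem IsLetterChain.f_iff_e {i : Fin n} {T T' : Tableau} :
    (tableauCrystal n ve vf vwt s).f i T = some T' ↔
      (tableauCrystal n ve vf vwt s).e i T' = some T := by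
  rw [h.f_eq_some_iff, h.e_eq_some_iff]
  constructor
  · rintro ⟨l₁, x, l₂, y, e, h1, h2, hy, rfl, h3, h4⟩
    have c1 : ∀ l, x ∉ l → boxWord ve vf i (T.upd x y) l = boxWord ve vf i T l := fun l hl =>
      boxWord_congr ve vf fun z hz => by
        rw [Tableau.upd_apply, if_neg]; rintro rfl; exact hl hz
    refine ⟨l₁, x, l₂, T x.1 x.2, e, h1, h2, ?_, ?_, ?_, ?_⟩
    · rw [Tableau.upd_self, ← h.vf_iff_ve, hy]
    · rw [Tableau.upd_upd _ _ _ _ rfl]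
    · rw [c1 _ h1, h3]
    · rw [c1 _ h2, h4]
  · rintro ⟨l₁, x, l₂, y, e, h1, h2, hy, rfl, h3, h4⟩
    have c1 : ∀ l, x ∉ l → boxWord ve vf i (T'.upd x y) l = boxWord ve vf i T' l := fun l hl =>
      boxWord_congr ve vf fun z hz => by
        rw [Tableau.upd_apply, if_neg]; rintro rfl; exact hl hz
    refine ⟨l₁, x, l₂, T' x.1 x.2, e, h1, h2, ?_, ?_, ?_, ?_⟩
    · rw [Tableau.upd_self, h.vf_iff_ve, hy]
    · rw [Tableau.upd_upd _ _ _ _ rfl]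
    · rw [c1 _ h1, h3]
    · rw [c1 _ h2, h4]

theorem IsLetterChain.length_survivors_of_f {i : Fin n} {T T' : Tableau}
    (hf : (tableauCrystal n ve vf vwt s).f i T = some T') :
    (tableauCrystal n ve vf vwt s).eps i T' = (tableauCrystal n ve vf vwt s).eps i T + 1 ∧
    (tableauCrystal n ve vf vwt s).phi i T = (tableauCrystal n ve vf vwt s).phi i T' + 1 := by
  rw [h.f_eq_some_iff] at hf
  obtain ⟨l₁, x, l₂, y, e, h1, h2, hy, rfl, h3, h4⟩ := hf
  change (survivors Sgn.minus (boxWord ve vf i (T.upd x y) (boxes s))).length =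
      (survivors Sgn.minus (boxWord ve vf i T (boxes s))).length + 1 ∧
    (survivors Sgn.plus (boxWord ve vf i T (boxes s))).length =
      (survivors Sgn.plus (boxWord ve vf i (T.upd x y) (boxes s))).length + 1
  have c1 : ∀ l, x ∉ l → boxWord ve vf i (T.upd x y) l = boxWord ve vf i T l := fun l hl =>
    boxWord_congr ve vf fun z hz => by
      rw [Tableau.upd_apply, if_neg]; rintro rfl; exact hl hz
  have hy' : ve i (T.upd x y x.1 x.2) = some (T x.1 x.2) := by
    rw [Tableau.upd_self, ← h.vf_iff_ve, hy]
  simp only [e, boxWord_append, boxWord_cons, h.letterSigns_of_vf x hy,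
    h.letterSigns_of_ve x hy', List.singleton_append, c1 _ h1, c1 _ h2]
  obtain ⟨e1, e2, e3, e4⟩ := survivors_of_split x h3 h4
  simp [e1, e2, e3, e4]

/-- The weight of a letter on $h_i$ is $\varphi_i-\varepsilon_i$; by additivity this gives the same
relation for whole tableaux. -/
theorem IsLetterChain.net_letterSigns {α : Type} {x : ℕ} (i : Fin n) (b : α) (h1 : 1 ≤ x)
    (h2 : x ≤ m) : net (letterSigns ve vf i x b) = vwt x i := by
  have hf : (vf i x).isSome ↔ x < m ∧ col x = i + 1 := by
    rw [Option.isSome_iff_exists]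
    simp only [h.vf_iff]
    constructor
    · rintro ⟨y, _, rfl, hy, hc⟩; exact ⟨by omega, hc⟩
    · rintro ⟨hy, hc⟩; exact ⟨x + 1, h1, rfl, hy, hc⟩
  have he : (ve i x).isSome ↔ 2 ≤ x ∧ col (x - 1) = i + 1 := by
    rw [Option.isSome_iff_exists]
    simp only [h.ve_iff]
    constructor
    · rintro ⟨y, hy, rfl, _, hc⟩; exact ⟨by omega, hc⟩
    · rintro ⟨hy, hc⟩; exact ⟨x - 1, by omega, by omega, h2, hc⟩
  rw [h.vwt_eq x i h1 h2, letterSigns, net_append]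
  simp only [hf, he]
  split_ifs <;> simp [net]

theorem IsLetterChain.net_boxWord {T : Tableau} {l : List (ℕ × ℕ)} (i : Fin n)
    (hl : ∀ x ∈ l, 1 ≤ T x.1 x.2 ∧ T x.1 x.2 ≤ m) :
    net (boxWord ve vf i T l) = (l.map fun x => vwt (T x.1 x.2) i).sum := by
  induction l with
  | nil => rfl
  | cons x l ih =>
    rw [boxWord_cons, net_append, ih fun y hy => hl y (by simp [hy]),
      h.net_letterSigns i x (hl x (by simp)).1 (hl x (by simp)).2]
    simp

/-- A set of tableaux of a given shape that is stable under the Kashiwara operators is a crystal. -/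
theorem IsLetterChain.isCrystal {S : Set Tableau}
    (hS : ∀ T ∈ S, ∀ x ∈ boxes s, 1 ≤ T x.1 x.2 ∧ T x.1 x.2 ≤ m)
    (he : ∀ T ∈ S, ∀ i, ∀ T', (tableauCrystal n ve vf vwt s).e i T = some T' → T' ∈ S)
    (hf : ∀ T ∈ S, ∀ i, ∀ T', (tableauCrystal n ve vf vwt s).f i T = some T' → T' ∈ S) :
    IsCrystal A (tableauCrystal n ve vf vwt s) S where
  e_mem := he
  f_mem := hf
  e_eq_none T _ i := by
    change Option.map _ (List.getLast? _) = none ↔ List.length _ = 0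
    simp
  f_eq_none T _ i := by
    change Option.map _ (List.head? _) = none ↔ List.length _ = 0
    simp
  phi_sub_eps T hT i := by
    change ((survivors Sgn.plus (boxWord ve vf i T (boxes s))).length : ℤ) -
      (survivors Sgn.minus (boxWord ve vf i T (boxes s))).length =
        ((boxes s).map fun x => vwt (T x.1 x.2) i).sum
    rw [length_survivors_sub, h.net_boxWord i (hS T hT)]
  f_iff_e T _ T' _ i := h.f_iff_e
  wt_f T hT i T' hf j := by
    rw [h.f_eq_some_iff] at hf
    obtain ⟨l₁, x, l₂, y, e, h1, h2, hy, rfl, -, -⟩ := hf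
    change ((boxes s).map fun z => vwt (T.upd x y z.1 z.2) j).sum =
      ((boxes s).map fun z => vwt (T z.1 z.2) j).sum - A j i
    have c1 : ∀ l : List (ℕ × ℕ), x ∉ l → (l.map fun z => vwt (T.upd x y z.1 z.2) j) =
        l.map fun z => vwt (T z.1 z.2) j := fun l hl =>
      List.map_congr_left fun z hz => by
        rw [Tableau.upd_apply, if_neg]; rintro rfl; exact hl hz
    rw [h.vf_iff] at hy
    obtain ⟨hx, rfl, hxm, hc⟩ := hy
    rw [e, List.map_append, List.map_append, List.map_cons, List.map_cons, c1 _ h1, c1 _ h2,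
      Tableau.upd_self, h.vwt_succ _ i j hx (by omega) hc]
    simp only [List.sum_append, List.sum_cons]
    ring
  eps_f T _ i T' hf := (h.length_survivors_of_f hf).1
  phi_f T _ i T' hf := (h.length_survivors_of_f hf).2

end TableauCrystal

/-! ### The vector representations of types $A_n$ and $C_n$ -/

theorem TypeA.isLetterChain {n N : ℕ} : IsLetterChain n (n + 1)
    ((patternA n N).classicalCartan n) (fun x => x) TypeA.ve TypeA.vf TypeA.vwt where
  ve_iff i x y := by
    unfold TypeA.ve
    have := i.2
    split_ifs <;> simp <;> omega
  vf_iff i x y := by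
    unfold TypeA.vf
    have := i.2
    split_ifs <;> simp <;> omega
  col_ne x _ _ := by omega
  col_mem x _ _ := by omega
  vwt_eq x j hx hm := by
    unfold TypeA.vwt
    have := j.2
    split_ifs <;> omega
  vwt_succ x i j hx hm hc := by
    change x = i + 1 at hc
    subst hc
    change _ = _ - cartanA n (j + 1) (i + 1)
    unfold TypeA.vwt cartanA
    have := j.2
    have := i.2
    grind

theorem classicalCartan_patternC {n N : ℕ} (i j : Fin n) :
    (patternC n N).classicalCartan n j i = if (j : ℕ) = i then 2
      else if (j : ℕ) + 2 = n ∧ (i : ℕ) + 1 = n then -2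
      else if (j : ℕ) + 1 = i ∨ (i : ℕ) + 1 = j then -1 else 0 := by
  change cartanC n (j + 1) (i + 1) = _
  unfold cartanC
  have := j.2
  have := i.2
  grind

/-- Coordinates and bars are flattened into indicators of four explicit letters, so that weights can
be compared by linear arithmetic. The last two indicators vanish for the long root. -/
theorem TypeC.vwt_eq_ite {n : ℕ} {x : ℕ} (j : Fin n) (hx : 1 ≤ x) (hm : x ≤ 2 * n) :
    TypeC.vwt x j = (if x = j + 1 then 1 else 0) - (if x = 2 * n - j then 1 else 0) -
      (if x = j + 2 ∧ (j : ℕ) + 1 ≠ n then 1 else 0) +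
      (if x = 2 * n - 1 - j ∧ (j : ℕ) + 1 ≠ n then 1 else 0) := by
  unfold TypeC.vwt TypeC.coord TypeC.bar
  have := j.2
  by_cases h1 : (j : ℕ) + 1 = n
  · simp only [h1, if_true, ne_eq, not_true_eq_false, and_false, if_false]
    split_ifs <;> omega
  · simp only [h1, if_false, ne_eq, not_false_eq_true, and_true]
    split_ifs <;> omega

theorem TypeC.vwt_succ {n N : ℕ} (x : ℕ) (i j : Fin n)
    (hc : x = i + 1 ∨ x = 2 * n - (i + 1)) :
    (TypeC.vwt (x + 1) j : ℤ) = TypeC.vwt x j - (patternC n N).classicalCartan n j i := by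
  have hj := j.2
  have hi := i.2
  rw [classicalCartan_patternC, TypeC.vwt_eq_ite j (by omega) (by omega),
    TypeC.vwt_eq_ite j (by omega) (by omega)]
  generalize (j : ℕ) = b at *
  generalize (i : ℕ) = a at *
  have e0 : (x + 1 = b + 1 ↔ x = b) := by omega
  have e1 : (x + 1 = b + 2 ↔ x = b + 1) := by omega
  have e2 : (x + 1 = 2 * n - b ↔ x = 2 * n - 1 - b) := by omega
  have e3 : (x + 1 = 2 * n - 1 - b ↔ x = 2 * n - 2 - b) := by omega
  simp only [e0, e1, e2, e3]
  clear e0 e1 e2 e3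
  by_cases h0 : a + 1 = n
  · have hx : x = n := by omega
    subst hx
    omega
  · by_cases h4 : b + 1 = n
    · simp only [h4, ne_eq, not_true_eq_false, and_false, if_false]
      rcases hc with rfl | rfl
      · omega
      · omega
    · simp only [h0, h4, ne_eq, not_false_eq_true, and_false, and_true, if_false]
      rcases hc with rfl | rfl
      · omega
      · omega

theorem TypeC.vwt_eq_of_col {n x : ℕ} (j : Fin n) (hx : 1 ≤ x) (hm : x ≤ 2 * n) :
    TypeC.vwt x j =
      (if x < 2 * n ∧ (if x ≤ n then x else 2 * n - x) = (j : ℕ) + 1 then 1 else 0) -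
      (if 2 ≤ x ∧ (if x - 1 ≤ n then x - 1 else 2 * n - (x - 1)) = (j : ℕ) + 1 then 1 else 0) := by
  rw [TypeC.vwt_eq_ite j hx hm]
  have := j.2
  have e1 : (x < 2 * n ∧ (if x ≤ n then x else 2 * n - x) = (j : ℕ) + 1) ↔
      x = j + 1 ∨ (x = 2 * n - 1 - j ∧ (j : ℕ) + 1 ≠ n) := by split_ifs <;> omega
  have e2 : (2 ≤ x ∧ (if x - 1 ≤ n then x - 1 else 2 * n - (x - 1)) = (j : ℕ) + 1) ↔
      x = 2 * n - j ∨ (x = j + 2 ∧ (j : ℕ) + 1 ≠ n) := by split_ifs <;> omega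
  simp only [e1, e2]
  repeat' split
  all_goals omega

theorem TypeC.isLetterChain {n N : ℕ} (hn : 3 ≤ n) : IsLetterChain n (2 * n)
    ((patternC n N).classicalCartan n) (fun x => if x ≤ n then x else 2 * n - x)
    TypeC.ve TypeC.vf TypeC.vwt where
  ve_iff i x y := by
    unfold TypeC.ve TypeC.bar
    have := i.2
    split_ifs <;> simp <;> omega
  vf_iff i x y := by
    unfold TypeC.vf TypeC.bar
    have := i.2
    split_ifs <;> simp <;> omega
  col_ne x _ _ := by split_ifs <;> omega
  col_mem x _ _ := by split_ifs <;> omega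
  vwt_eq x j hx hm := TypeC.vwt_eq_of_col j hx hm
  vwt_succ x i j hx hm hc := TypeC.vwt_succ x i j (by
    have := i.2
    split_ifs at hc <;> omega)

/-! ## Columns -/

/-- The number of entries greater than `z` of a column of length `N`. -/
def cnt (C : ℕ → ℕ) (N z : ℕ) : ℕ := ((Finset.range N).filter fun a => z < C a).card

/-- Strict decrease from bottom to top. -/
def StrictColumn (C : ℕ → ℕ) (N : ℕ) : Prop := ∀ a, a + 1 < N → C (a + 1) < C a

theorem StrictColumn.lt {C : ℕ → ℕ} {N : ℕ} (h : StrictColumn C N) {a b : ℕ} (hab : a < b)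
    (hb : b < N) : C b < C a := by
  induction b, hab using Nat.le_induction with
  | base => exact h a hb
  | succ b hab ih => exact (h b hb).trans (ih (by omega))

theorem StrictColumn.inj {C : ℕ → ℕ} {N : ℕ} (h : StrictColumn C N) {a b : ℕ} (ha : a < N)
    (hb : b < N) (e : C a = C b) : a = b := by
  rcases Nat.lt_trichotomy a b with hab | hab | hab
  · have := h.lt hab hb; omega
  · exact hab
  · have := h.lt hab ha; omega

theorem StrictColumn.lower {C : ℕ → ℕ} {N : ℕ} (h : StrictColumn C N)
    (h1 : ∀ a < N, 1 ≤ C a) {a : ℕ} (ha : a < N) : N - a ≤ C a := by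
  induction k : N - a generalizing a with
  | zero => omega
  | succ d ih =>
    by_cases hd : a + 1 < N
    · have := ih hd (by omega)
      have := h a hd
      omega
    · have := h1 a ha
      omega

theorem StrictColumn.upper {C : ℕ → ℕ} {N m : ℕ} (h : StrictColumn C N)
    (h1 : ∀ a < N, C a ≤ m) {a : ℕ} (ha : a < N) : C a + a ≤ m := by
  induction a with
  | zero => exact h1 0 ha
  | succ d ih =>
    have := ih (by omega)
    have := h d ha
    omega

/-- In a column that decreases from bottom to top, the entries greater than `z` occupy an initial
segment of the rows, and the counting function is the length of that segment. -/
theorem StrictColumn.lt_cnt_iff {C : ℕ → ℕ} {N : ℕ} (h : StrictColumn C N) {a : ℕ} (ha : a < N)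
    (z : ℕ) : a < cnt C N z ↔ z < C a := by
  have key : ∀ M ≤ N, ∃ K ≤ M, ∀ a < M, a < K ↔ z < C a := by
    intro M hM
    induction M with
    | zero => exact ⟨0, le_rfl, by simp⟩
    | succ M ih =>
      by_cases hz : z < C M
      · refine ⟨M + 1, le_rfl, fun a ha => ⟨fun _ => ?_, fun _ => ha⟩⟩
        rcases Nat.lt_or_ge a M with hlt | hge
        · exact hz.trans (h.lt hlt (by omega))
        · rwa [show a = M by omega]
      · obtain ⟨K, hK, hK'⟩ := ih (by omega)
        refine ⟨K, by omega, fun a ha => ?_⟩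
        rcases Nat.lt_or_ge a M with hlt | hge
        · exact hK' a hlt
        · rw [show a = M by omega]
          exact ⟨fun h => by omega, fun h => absurd h hz⟩
  obtain ⟨K, hK, hK'⟩ := key N le_rfl
  have : cnt C N z = K := by
    unfold cnt
    rw [← Finset.card_range K]
    congr 1
    ext b
    simp only [Finset.mem_filter, Finset.mem_range]
    constructor
    · rintro ⟨hb, hz⟩; exact (hK' b hb).2 hz
    · intro hb; exact ⟨by omega, (hK' b (by omega)).1 hb⟩
  rw [this]
  exact hK' a ha

theorem cnt_le (C : ℕ → ℕ) (N z : ℕ) : cnt C N z ≤ N := by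
  unfold cnt
  exact (Finset.card_filter_le _ _).trans (by simp)

theorem cnt_anti (C : ℕ → ℕ) (N : ℕ) {y z : ℕ} (h : y ≤ z) : cnt C N z ≤ cnt C N y := by
  unfold cnt
  refine Finset.card_le_card fun a ha => ?_
  simp only [Finset.mem_filter] at ha ⊢
  exact ⟨ha.1, by omega⟩

theorem cnt_zero {C : ℕ → ℕ} {N : ℕ} (h1 : ∀ a < N, 1 ≤ C a) : cnt C N 0 = N := by
  unfold cnt
  rw [Finset.filter_true_of_mem, Finset.card_range]
  intro a ha
  have := h1 a (Finset.mem_range.1 ha)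
  omega

theorem cnt_eq_zero {C : ℕ → ℕ} {N m : ℕ} (h1 : ∀ a < N, C a ≤ m) : cnt C N m = 0 := by
  unfold cnt
  rw [Finset.card_eq_zero, Finset.filter_eq_empty_iff]
  intro a ha
  have := h1 a (Finset.mem_range.1 ha)
  omega

/-- `1` if the letter `y` occurs in the column, and `0` otherwise. -/
def occ (C : ℕ → ℕ) (N y : ℕ) : ℕ := if ∃ a < N, C a = y then 1 else 0

/-- A letter occurs at most once in a strict column, so the counting function descends in steps of
at most one, and the steps mark the letters that occur. -/
theorem StrictColumn.cnt_eq {C : ℕ → ℕ} {N : ℕ} (h : StrictColumn C N) (z : ℕ) :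
    cnt C N z = cnt C N (z + 1) + occ C N (z + 1) := by
  have : (Finset.range N).filter (fun a => z < C a) =
      (Finset.range N).filter (fun a => z + 1 < C a) ∪
        (Finset.range N).filter (fun a => C a = z + 1) := by
    ext a
    simp only [Finset.mem_filter, Finset.mem_union, Finset.mem_range]
    constructor
    · rintro ⟨ha, hz⟩
      rcases Nat.lt_or_ge (z + 1) (C a) with h1 | h1
      · exact Or.inl ⟨ha, h1⟩
      · exact Or.inr ⟨ha, by omega⟩
    · rintro (⟨ha, hz⟩ | ⟨ha, hz⟩) <;> exact ⟨ha, by omega⟩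
  unfold cnt
  rw [this, Finset.card_union_of_disjoint]
  · congr 1
    unfold occ
    split_ifs with hex
    · obtain ⟨a, ha, e⟩ := hex
      rw [Finset.card_eq_one]
      refine ⟨a, ?_⟩
      ext b
      simp only [Finset.mem_filter, Finset.mem_range, Finset.mem_singleton]
      constructor
      · rintro ⟨hb, e'⟩; exact h.inj hb ha (by omega)
      · rintro rfl; exact ⟨ha, e⟩
    · rw [Finset.card_eq_zero, Finset.filter_eq_empty_iff]
      intro a ha e
      exact hex ⟨a, Finset.mem_range.1 ha, e⟩
  · rw [Finset.disjoint_filter]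
    intro a _ h1 h2
    omega

theorem occ_le_one (C : ℕ → ℕ) (N y : ℕ) : occ C N y ≤ 1 := by
  unfold occ; split_ifs <;> omega

theorem occ_eq_one_iff {C : ℕ → ℕ} {N y : ℕ} : occ C N y = 1 ↔ ∃ a < N, C a = y := by
  unfold occ
  split_ifs with h
  · simpa using h
  · simpa using h

/-- Exactly the entries in lower rows are greater. Row numbers, and with them the distances in the
column conditions, thus become values of the counting function. -/
theorem StrictColumn.cnt_at {C : ℕ → ℕ} {N : ℕ} (h : StrictColumn C N) {a : ℕ} (ha : a < N) :
    cnt C N (C a) = a := by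
  have h1 := (h.lt_cnt_iff ha (C a)).1.mt (lt_irrefl _)
  by_contra hne
  have h2 : cnt C N (C a) < a := by omega
  have := (h.lt_cnt_iff (a := cnt C N (C a)) (by omega) (C a)).2 (h.lt h2 ha)
  omega

/-- Raising an entry `y` to `y + 1` changes the counting function at `y` only. -/
theorem cnt_raise {C D : ℕ → ℕ} {N a : ℕ} (ha : a < N) (hD : D a = C a + 1)
    (h : ∀ b, b ≠ a → D b = C b) (z : ℕ) :
    cnt D N z = cnt C N z + if z = C a then 1 else 0 := by
  unfold cnt
  split_ifs with hz
  · have : (Finset.range N).filter (fun b => z < D b) =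
        insert a ((Finset.range N).filter fun b => z < C b) := by
      ext b
      simp only [Finset.mem_filter, Finset.mem_insert, Finset.mem_range]
      by_cases hb : b = a
      · subst hb; simp [ha, hD, hz]
      · simp [hb, h b hb]
    rw [this, Finset.card_insert_of_notMem]
    simp [hz]
  · rw [add_zero]
    congr 1
    ext b
    simp only [Finset.mem_filter, Finset.mem_range]
    by_cases hb : b = a
    · subst hb; rw [hD]; constructor <;> rintro ⟨h1, h2⟩ <;> exact ⟨h1, by omega⟩
    · rw [h b hb]

/-- If some $C_a>D_a$, then at $z=D_a$ the initial segment of `C` contains row `a` and that of `D`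
does not, so the counting functions are not in order. The comparison by counts can be used one value
of `z` at a time. -/
theorem rows_iff_cnt {C D : ℕ → ℕ} {N N' : ℕ} (hC : StrictColumn C N) (hD : StrictColumn D N')
    (hN : N ≤ N') : (∀ a < N, C a ≤ D a) ↔ ∀ z, cnt C N z ≤ cnt D N' z := by
  constructor
  · intro h z
    unfold cnt
    refine Finset.card_le_card fun a ha => ?_
    simp only [Finset.mem_filter, Finset.mem_range] at ha ⊢
    have := h a ha.1
    exact ⟨by omega, by omega⟩
  · intro h a ha
    by_contra hlt
    have h1 := (hC.lt_cnt_iff ha (D a)).2 (by omega)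
    have h2 := (hD.lt_cnt_iff (a := a) (by omega) (D a)).1 (h1.trans_le (h _))
    omega

/-! ## Words of signs of sorted lists of letters -/

/-- Only the letters of `sp` contribute signs, and both lists are increasing, so the word depends
only on which letters of `sp` occur. -/
theorem flatMap_eq_of_sorted {β : Type} {L sp : List ℕ} (hL : L.Pairwise (· < ·))
    (hsp : sp.Pairwise (· < ·)) (g : ℕ → List β) (hg : ∀ y ∈ L, y ∉ sp → g y = []) :
    L.flatMap g = sp.flatMap fun y => if y ∈ L then g y else [] := by
  have h1 : ∀ L : List ℕ, (∀ y ∈ L, y ∉ sp → g y = []) →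
      L.flatMap g = (L.filter (· ∈ sp)).flatMap g := by
    intro L hg
    induction L with
    | nil => rfl
    | cons y L ih =>
      rw [List.flatMap_cons, ih fun z hz => hg z (by simp [hz])]
      by_cases hy : y ∈ sp
      · simp [hy]
      · simp [hy, hg y (by simp) hy]
  have h2 : ∀ l : List ℕ, l.flatMap (fun y => if y ∈ L then g y else []) =
      (l.filter (· ∈ L)).flatMap g := by
    intro l
    induction l with
    | nil => rfl
    | cons y l ih =>
      rw [List.flatMap_cons, ih]
      by_cases hy : y ∈ L <;> simp [hy]
  rw [h1 L hg, h2]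
  congr 1
  refine List.Perm.eq_of_pairwise (le := (· < ·)) ?_ (hL.filter _) (hsp.filter _) ?_
  · intro a b _ _ h1 h2; omega
  · refine (List.perm_ext_iff_of_nodup ?_ ?_).2 ?_
    · exact (hL.filter _).imp fun h => h.ne
    · exact (hsp.filter _).imp fun h => h.ne
    · intro a; simp [and_comm]

section LetterWord

variable {n : ℕ} (ve vf : Fin n → ℕ → Option ℕ)

/-- The word of signs of a list of letters. -/
def letterWord (i : Fin n) (L : List ℕ) : List (Sgn × Unit) :=
  L.flatMap fun y => letterSigns ve vf i y ()

theorem letterWord_append (i : Fin n) (L L' : List ℕ) :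
    letterWord ve vf i (L ++ L') = letterWord ve vf i L ++ letterWord ve vf i L' := by
  simp [letterWord]

/-- The numbers of survivors do not see the boxes, so the geometry can be forgotten and the word
read off the list of letters. -/
theorem length_survivors_boxWord (s : Sgn) (i : Fin n) (T : Tableau) (l : List (ℕ × ℕ)) :
    (survivors s (boxWord ve vf i T l)).length =
      (survivors s (letterWord ve vf i (l.map fun x => T x.1 x.2))).length := by
  have : letterWord ve vf i (l.map fun x => T x.1 x.2) =
      (boxWord ve vf i T l).map fun x => (x.1, (fun _ _ => ()) x.1 x.2) := by
    induction l with
    | nil => rfl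
    | cons x l ih =>
      rw [boxWord_cons, List.map_append, ← ih, List.map_cons]
      simp only [letterWord, List.flatMap_cons]
      congr 1
      simp only [letterSigns]
      split_ifs <;> simp
  rw [this, survivors_map s (fun _ _ => ()), List.length_map]

theorem length_survivors_append {α : Type} (u v : List (Sgn × α)) :
    (survivors Sgn.minus (u ++ v)).length = (survivors Sgn.minus u).length +
      ((survivors Sgn.minus v).length - (survivors Sgn.plus u).length) ∧
    (survivors Sgn.plus (u ++ v)).length = ((survivors Sgn.plus u).length -
      (survivors Sgn.minus v).length) + (survivors Sgn.plus v).length := by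
  rw [(survivors_append u v).1, (survivors_append u v).2]
  simp

end LetterWord

/-- `1` if the letter `y` occurs in the list, and `0` otherwise. -/
def mult (L : List ℕ) (y : ℕ) : ℕ := if y ∈ L then 1 else 0

section

variable {n m : ℕ} {A : Fin n → Fin n → ℤ} {col : ℕ → ℕ} {ve vf : Fin n → ℕ → Option ℕ}
  {vwt : ℕ → Fin n → ℤ} (h : IsLetterChain n m A col ve vf vwt)
include h

theorem IsLetterChain.letterSigns_eq {α : Type} {i : Fin n} {y : ℕ} (b : α) (h1 : 1 ≤ y)
    (h2 : y ≤ m) : letterSigns ve vf i y b =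
      if y < m ∧ col y = i + 1 then [(Sgn.plus, b)]
      else if 2 ≤ y ∧ col (y - 1) = i + 1 then [(Sgn.minus, b)] else [] := by
  split_ifs with c1 c2
  · exact h.letterSigns_of_vf b ((h.vf_iff i y (y + 1)).2 ⟨h1, rfl, c1.1, c1.2⟩)
  · exact h.letterSigns_of_ve b ((h.ve_iff i y (y - 1)).2 ⟨by omega, by omega, h2, c2.2⟩)
  · have e1 : vf i y = none := by
      rw [Option.eq_none_iff_forall_ne_some]
      intro z hz
      rw [h.vf_iff] at hz
      exact c1 ⟨by omega, hz.2.2.2⟩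
    have e2 : ve i y = none := by
      rw [Option.eq_none_iff_forall_ne_some]
      intro z hz
      rw [h.ve_iff] at hz
      exact c2 ⟨by omega, by rw [← hz.2.2.2]; congr 1; omega⟩
    simp [letterSigns, e1, e2]

/-- Only one arrow of colour `i`. -/
theorem IsLetterChain.survivors_two {i : Fin n} {p : ℕ} (hp : 1 ≤ p) (hpm : p < m)
    (hcol : ∀ y, 1 ≤ y → y < m → (col y = i + 1 ↔ y = p)) {L : List ℕ}
    (hL : L.Pairwise (· < ·)) (hLm : ∀ y ∈ L, 1 ≤ y ∧ y ≤ m) :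
    (survivors Sgn.plus (letterWord ve vf i L)).length = mult L p - mult L (p + 1) ∧
    (survivors Sgn.minus (letterWord ve vf i L)).length = mult L (p + 1) - mult L p := by
  have e : letterWord ve vf i L = (if p ∈ L then [(Sgn.plus, ())] else []) ++
      if p + 1 ∈ L then [(Sgn.minus, ())] else [] := by
    unfold letterWord
    rw [flatMap_eq_of_sorted hL (sp := [p, p + 1]) (by simp) _ ?_]
    · simp only [List.flatMap_cons, List.flatMap_nil, List.append_nil]
      rw [h.letterSigns_of_vf () ((h.vf_iff i p (p + 1)).2 ⟨hp, rfl, hpm, (hcol p hp hpm).2 rfl⟩),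
        h.letterSigns_of_ve () ((h.ve_iff i (p + 1) p).2 ⟨hp, rfl, hpm, (hcol p hp hpm).2 rfl⟩)]
    · intro y hy hne
      obtain ⟨h1, h2⟩ := hLm y hy
      simp only [List.mem_cons, List.not_mem_nil, or_false, not_or] at hne
      rw [h.letterSigns_eq () h1 h2, if_neg, if_neg]
      · rintro ⟨c1, c2⟩
        have := (hcol _ (by omega) (by omega)).1 c2; omega
      · rintro ⟨c1, c2⟩
        have := (hcol _ (by omega) (by omega)).1 c2; omega
  rw [e]
  unfold mult
  by_cases h1 : p ∈ L <;> by_cases h2 : p + 1 ∈ L <;> simp [h1, h2, survivors, cancelSigns]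

/-- Two arrows of colour `i`. -/
theorem IsLetterChain.survivors_four {i : Fin n} {p q : ℕ} (hp : 1 ≤ p) (hpq : p + 1 < q)
    (hqm : q < m) (hcol : ∀ y, 1 ≤ y → y < m → (col y = i + 1 ↔ y = p ∨ y = q)) {L : List ℕ}
    (hL : L.Pairwise (· < ·)) (hLm : ∀ y ∈ L, 1 ≤ y ∧ y ≤ m) :
    (survivors Sgn.plus (letterWord ve vf i L)).length =
      mult L p - mult L (p + 1) + mult L q - mult L (q + 1) ∧
    (survivors Sgn.minus (letterWord ve vf i L)).length =
      mult L (p + 1) - mult L p +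
        (mult L (q + 1) - (mult L p - mult L (p + 1) + mult L q)) := by
  have e : letterWord ve vf i L = (if p ∈ L then [(Sgn.plus, ())] else []) ++
      ((if p + 1 ∈ L then [(Sgn.minus, ())] else []) ++
      ((if q ∈ L then [(Sgn.plus, ())] else []) ++
      if q + 1 ∈ L then [(Sgn.minus, ())] else [])) := by
    unfold letterWord
    -- The four letters carry the signs $+,-,+,-$ in this order. They are distinct because $p+1<q$;
    -- the truncated differences in the statement record the cancellations in the sixteen cases of
    -- presence or absence.
    rw [flatMap_eq_of_sorted hL (sp := [p, p + 1, q, q + 1]) (by simp; omega) _ ?_]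
    · simp only [List.flatMap_cons, List.flatMap_nil, List.append_nil]
      have hs : ∀ r, 1 ≤ r → r < m → (r = p ∨ r = q) →
          letterSigns ve vf i r () = [(Sgn.plus, ())] ∧
          letterSigns ve vf i (r + 1) () = [(Sgn.minus, ())] := by
        intro r h1 h2 h3
        exact ⟨h.letterSigns_of_vf () ((h.vf_iff i r (r + 1)).2 ⟨h1, rfl, h2, (hcol r h1 h2).2 h3⟩),
          h.letterSigns_of_ve () ((h.ve_iff i (r + 1) r).2 ⟨h1, rfl, h2, (hcol r h1 h2).2 h3⟩)⟩
      rw [(hs p hp (by omega) (Or.inl rfl)).1, (hs p hp (by omega) (Or.inl rfl)).2,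
        (hs q (by omega) hqm (Or.inr rfl)).1, (hs q (by omega) hqm (Or.inr rfl)).2]
    · intro y hy hne
      obtain ⟨h1, h2⟩ := hLm y hy
      simp only [List.mem_cons, List.not_mem_nil, or_false, not_or] at hne
      rw [h.letterSigns_eq () h1 h2, if_neg, if_neg]
      · rintro ⟨c1, c2⟩
        have := (hcol _ (by omega) (by omega)).1 c2; omega
      · rintro ⟨c1, c2⟩
        have := (hcol _ (by omega) (by omega)).1 c2; omega
  rw [e]
  unfold mult
  by_cases h1 : p ∈ L <;> by_cases h2 : p + 1 ∈ L <;> by_cases h3 : q ∈ L <;>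
    by_cases h4 : q + 1 ∈ L <;> simp [h1, h2, h3, h4, survivors, cancelSigns]

end

/-! ## The column conditions in terms of counting functions -/

namespace TypeC

/-- The column conditions for a pair of adjacent columns: `c a` (`d a`) is the number of entries
`≻ a` (`⪰ ā`) of the left column, `c'` and `d'` are the same numbers for the right column. -/
def PairCond (n : ℕ) (c d c' d' : ℕ → ℕ) : Prop :=
  ∀ a b, a ≤ b → b ≤ n →
    c a + a + d b ≤ c b + b + d' a ∧ c a + a + d' b ≤ c' b + b + d' a

/-- The one column condition. -/
def SingleCond (n : ℕ) (c d : ℕ → ℕ) : Prop := ∀ b ≤ n, c 0 + d b ≤ c b + b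

/-- `o a` (`ō a`) is the number of entries `a` (`ā`). -/
structure Counts (n : ℕ) (c d o ō : ℕ → ℕ) : Prop where
  left : ∀ a < n, c a = c (a + 1) + o (a + 1)
  right : ∀ a < n, d (a + 1) = d a + ō (a + 1)
  mid : c n = d n
  o_le : ∀ a, o a ≤ 1
  ō_le : ∀ a, ō a ≤ 1

theorem PairCond.congr {n : ℕ} {c d c' d' c₁ d₁ c₁' d₁' : ℕ → ℕ} (H : PairCond n c d c' d')
    (h1 : ∀ z ≤ n, c₁ z = c z) (h2 : ∀ z ≤ n, d₁ z = d z) (h3 : ∀ z ≤ n, c₁' z = c' z)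
    (h4 : ∀ z ≤ n, d₁' z = d' z) : PairCond n c₁ d₁ c₁' d₁' := by
  intro a b hab hb
  rw [h1 a (by omega), h1 b hb, h2 b hb, h3 b hb, h4 a (by omega), h4 b hb]
  exact H a b hab hb

theorem SingleCond.congr {n : ℕ} {c d c₁ d₁ : ℕ → ℕ} (H : SingleCond n c d)
    (h1 : ∀ z ≤ n, c₁ z = c z) (h2 : ∀ z ≤ n, d₁ z = d z) : SingleCond n c₁ d₁ := by
  intro b hb
  rw [h1 0 (by omega), h1 b hb, h2 b hb]
  exact H b hb

/-! ### Preservation of the inequalities when one counting function changes at one index -/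

variable {n r : ℕ} {c d o ō c' d' o' ō' e : ℕ → ℕ}

theorem Counts.step (h : Counts n c d o ō) (hr : r < n) :
    c r = c (r + 1) + o (r + 1) ∧ d (r + 1) = d r + ō (r + 1) ∧ o (r + 1) ≤ 1 ∧ ō (r + 1) ≤ 1 :=
  ⟨h.left r hr, h.right r hr, h.o_le _, h.ō_le _⟩

/-- Instances around $r+1$ for the case in which both indices equal $r+1$. -/
theorem PairCond.near (H : PairCond n c d c' d') (hr : r + 1 < n) :
    (c r + r + d r ≤ c r + r + d' r ∧ c r + r + d' r ≤ c' r + r + d' r) ∧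
    (c (r + 2) + (r + 2) + d (r + 2) ≤ c (r + 2) + (r + 2) + d' (r + 2) ∧
      c (r + 2) + (r + 2) + d' (r + 2) ≤ c' (r + 2) + (r + 2) + d' (r + 2)) ∧
    (c r + r + d (r + 1) ≤ c (r + 1) + (r + 1) + d' r ∧
      c r + r + d' (r + 1) ≤ c' (r + 1) + (r + 1) + d' r) ∧
    (c r + r + d (r + 2) ≤ c (r + 2) + (r + 2) + d' r ∧
      c r + r + d' (r + 2) ≤ c' (r + 2) + (r + 2) + d' r) ∧
    (c (r + 1) + (r + 1) + d (r + 2) ≤ c (r + 2) + (r + 2) + d' (r + 1) ∧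
      c (r + 1) + (r + 1) + d' (r + 2) ≤ c' (r + 2) + (r + 2) + d' (r + 1)) :=
  ⟨H r r (by omega) (by omega), H (r + 2) (r + 2) (by omega) (by omega),
    H r (r + 1) (by omega) (by omega), H r (r + 2) (by omega) (by omega),
    H (r + 1) (r + 2) (by omega) (by omega)⟩

/-- The pattern of the lemmas that follow. Only inequalities with an index equal to $r+1$ change.
Such an inequality is compared with those at $r$ and at $r+2$: $c$ and $d$ move by $0$ or $1$
between neighbouring indices, and the presence or absence of the letters $r+1$, $r+2$ and their bars
leaves the unit of slack that is needed. Here `h1` says that the right column has no surviving $+$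
of colour $r+1$. -/
theorem PairCond.raise_left (H : PairCond n c d c' d') (h : Counts n c d o ō)
    (h' : Counts n c' d' o' ō') (hr : r + 1 < n)
    (h0 : o (r + 1) = 1)
    (h1 : o' (r + 1) - o' (r + 2) + ō' (r + 2) - ō' (r + 1) = 0)
    (h2 : o (r + 2) = 0)
    (he : ∀ z ≤ n, e z = c z + if z = r + 1 then 1 else 0) :
    PairCond n e d c' d' := by
  intro a b hab hbn
  have s1 := h.step (r := r) (by omega)
  have s2 := h.step (r := r + 1) (by omega)
  have s3 := h'.step (r := r) (by omega)
  have s4 := h'.step (r := r + 1) (by omega)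
  rw [show r + 1 + 1 = r + 2 from rfl] at s2 s4
  have H0 := H a b hab hbn
  have e1 := he a (by omega)
  have e2 := he b (by omega)
  by_cases ha : a = r + 1 <;> by_cases hb : b = r + 1
  · subst ha hb
    have H1 := H.near hr
    rw [if_pos rfl] at e1
    omega
  · subst ha
    have H1 := H r b (by omega) (by omega)
    have H2 := H (r + 2) b (by omega) (by omega)
    rw [if_pos rfl] at e1
    rw [if_neg hb] at e2
    omega
  · subst hb
    have H1 := H a r (by omega) (by omega)
    have H2 := H a (r + 2) (by omega) (by omega)
    rw [if_neg ha] at e1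
    rw [if_pos rfl] at e2
    omega
  · rw [if_neg ha] at e1
    rw [if_neg hb] at e2
    omega

/-- The letter $\overline{r+2}$ of the left column becomes $\overline{r+1}$. In `h1` the surviving
$+$ of the right column are bounded by the surviving $-$ above the box, against which they have to
cancel. -/
theorem PairCond.raise_left_bar (H : PairCond n c d c' d') (h : Counts n c d o ō)
    (h' : Counts n c' d' o' ō') (hr : r + 1 < n)
    (h0 : ō (r + 2) = 1)
    (h1 : o' (r + 1) - o' (r + 2) + ō' (r + 2) - ō' (r + 1) ≤ o (r + 2) - o (r + 1))
    (h2 : o (r + 1) ≤ o (r + 2))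
    (h3 : ō (r + 1) = 0)
    (he : ∀ z ≤ n, e z = d z + if z = r + 1 then 1 else 0) :
    PairCond n c e c' d' := by
  intro a b hab hbn
  have s1 := h.step (r := r) (by omega)
  have s2 := h.step (r := r + 1) (by omega)
  have s3 := h'.step (r := r) (by omega)
  have s4 := h'.step (r := r + 1) (by omega)
  rw [show r + 1 + 1 = r + 2 from rfl] at s2 s4
  have H0 := H a b hab hbn
  have e1 := he a (by omega)
  have e2 := he b (by omega)
  by_cases ha : a = r + 1 <;> by_cases hb : b = r + 1
  · subst ha hb
    have H1 := H.near hr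
    rw [if_pos rfl] at e1
    omega
  · subst ha
    have H1 := H r b (by omega) (by omega)
    have H2 := H (r + 2) b (by omega) (by omega)
    rw [if_pos rfl] at e1
    rw [if_neg hb] at e2
    omega
  · subst hb
    have H1 := H a r (by omega) (by omega)
    have H2 := H a (r + 2) (by omega) (by omega)
    rw [if_neg ha] at e1
    rw [if_pos rfl] at e2
    omega
  · rw [if_neg ha] at e1
    rw [if_neg hb] at e2
    omega

/-- Harmless, as $c'$ occurs only on the larger side. -/
theorem PairCond.raise_right (H : PairCond n c d c' d') (h : Counts n c d o ō)
    (h' : Counts n c' d' o' ō') (hr : r + 1 < n)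
    (h0 : o' (r + 2) = 0)
    (he : ∀ z ≤ n, e z = c' z + if z = r + 1 then 1 else 0) :
    PairCond n c d e d' := by
  intro a b hab hbn
  have s1 := h.step (r := r) (by omega)
  have s2 := h.step (r := r + 1) (by omega)
  have s3 := h'.step (r := r) (by omega)
  have s4 := h'.step (r := r + 1) (by omega)
  rw [show r + 1 + 1 = r + 2 from rfl] at s2 s4
  have H0 := H a b hab hbn
  have e1 := he a (by omega)
  have e2 := he b (by omega)
  by_cases ha : a = r + 1 <;> by_cases hb : b = r + 1
  · subst ha hb
    have H1 := H.near hr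
    rw [if_pos rfl] at e1
    omega
  · subst ha
    have H1 := H r b (by omega) (by omega)
    have H2 := H (r + 2) b (by omega) (by omega)
    rw [if_pos rfl] at e1
    rw [if_neg hb] at e2
    omega
  · subst hb
    have H1 := H a r (by omega) (by omega)
    have H2 := H a (r + 2) (by omega) (by omega)
    rw [if_neg ha] at e1
    rw [if_pos rfl] at e2
    omega
  · rw [if_neg ha] at e1
    rw [if_neg hb] at e2
    omega

/-- The function $d'$ occurs with index $a$ on the larger side and with index $b$ on the smaller
one; only $b=r+1$ requires an argument. -/
theorem PairCond.raise_right_bar (H : PairCond n c d c' d') (h : Counts n c d o ō)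
    (h' : Counts n c' d' o' ō') (hr : r + 1 < n)
    (h0 : ō' (r + 2) = 1)
    (h1 : ō' (r + 1) = 0)
    (h2 : o' (r + 1) ≤ o' (r + 2))
    (he : ∀ z ≤ n, e z = d' z + if z = r + 1 then 1 else 0) :
    PairCond n c d c' e := by
  intro a b hab hbn
  have s1 := h.step (r := r) (by omega)
  have s2 := h.step (r := r + 1) (by omega)
  have s3 := h'.step (r := r) (by omega)
  have s4 := h'.step (r := r + 1) (by omega)
  rw [show r + 1 + 1 = r + 2 from rfl] at s2 s4
  have H0 := H a b hab hbn
  have e1 := he a (by omega)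
  have e2 := he b (by omega)
  by_cases ha : a = r + 1 <;> by_cases hb : b = r + 1
  · subst ha hb
    have H1 := H.near hr
    rw [if_pos rfl] at e1
    omega
  · subst ha
    have H1 := H r b (by omega) (by omega)
    have H2 := H (r + 2) b (by omega) (by omega)
    rw [if_pos rfl] at e1
    rw [if_neg hb] at e2
    omega
  · subst hb
    have H1 := H a r (by omega) (by omega)
    have H2 := H a (r + 2) (by omega) (by omega)
    rw [if_neg ha] at e1
    rw [if_pos rfl] at e2
    omega
  · rw [if_neg ha] at e1
    rw [if_neg hb] at e2
    omega

/-- The function $c$ occurs with index $a$ on the smaller side and with index $b$ on the larger one,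
so a decrease matters only for $b=r+1$. -/
theorem PairCond.lower_left (H : PairCond n c d c' d') (h : Counts n c d o ō)
    (h' : Counts n c' d' o' ō') (hr : r + 1 < n)
    (h0 : o (r + 2) = 1)
    (h1 : o (r + 1) = 0)
    (h2 : ō (r + 1) ≤ ō (r + 2))
    (he : ∀ z ≤ n, c z = e z + if z = r + 1 then 1 else 0) :
    PairCond n e d c' d' := by
  intro a b hab hbn
  have s1 := h.step (r := r) (by omega)
  have s2 := h.step (r := r + 1) (by omega)
  have s3 := h'.step (r := r) (by omega)
  have s4 := h'.step (r := r + 1) (by omega)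
  rw [show r + 1 + 1 = r + 2 from rfl] at s2 s4
  have H0 := H a b hab hbn
  have e1 := he a (by omega)
  have e2 := he b (by omega)
  by_cases ha : a = r + 1 <;> by_cases hb : b = r + 1
  · subst ha hb
    have H1 := H.near hr
    rw [if_pos rfl] at e1
    omega
  · subst ha
    have H1 := H r b (by omega) (by omega)
    have H2 := H (r + 2) b (by omega) (by omega)
    rw [if_pos rfl] at e1
    rw [if_neg hb] at e2
    omega
  · subst hb
    have H1 := H a r (by omega) (by omega)
    have H2 := H a (r + 2) (by omega) (by omega)
    rw [if_neg ha] at e1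
    rw [if_pos rfl] at e2
    omega
  · rw [if_neg ha] at e1
    rw [if_neg hb] at e2
    omega

/-- Harmless, as $d$ occurs only on the smaller side. -/
theorem PairCond.lower_left_bar (H : PairCond n c d c' d') (h : Counts n c d o ō)
    (h' : Counts n c' d' o' ō') (hr : r + 1 < n)
    (h0 : ō (r + 1) = 1)
    (h1 : ō (r + 2) = 0)
    (he : ∀ z ≤ n, d z = e z + if z = r + 1 then 1 else 0) :
    PairCond n c e c' d' := by
  intro a b hab hbn
  have s1 := h.step (r := r) (by omega)
  have s2 := h.step (r := r + 1) (by omega)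
  have s3 := h'.step (r := r) (by omega)
  have s4 := h'.step (r := r + 1) (by omega)
  rw [show r + 1 + 1 = r + 2 from rfl] at s2 s4
  have H0 := H a b hab hbn
  have e1 := he a (by omega)
  have e2 := he b (by omega)
  by_cases ha : a = r + 1 <;> by_cases hb : b = r + 1
  · subst ha hb
    have H1 := H.near hr
    rw [if_pos rfl] at e1
    omega
  · subst ha
    have H1 := H r b (by omega) (by omega)
    have H2 := H (r + 2) b (by omega) (by omega)
    rw [if_pos rfl] at e1
    rw [if_neg hb] at e2
    omega
  · subst hb
    have H1 := H a r (by omega) (by omega)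
    have H2 := H a (r + 2) (by omega) (by omega)
    rw [if_neg ha] at e1
    rw [if_pos rfl] at e2
    omega
  · rw [if_neg ha] at e1
    rw [if_neg hb] at e2
    omega

/-- The hypothesis `h3` is the signature rule on the left column: its surviving $-$ must cancel
against the surviving $+$ below the box, and the right-hand side counts these. -/
theorem PairCond.lower_right (H : PairCond n c d c' d') (h : Counts n c d o ō)
    (h' : Counts n c' d' o' ō') (hr : r + 1 < n)
    (h0 : o' (r + 2) = 1)
    (h1 : o' (r + 1) = 0)
    (h2 : ō' (r + 1) ≤ ō' (r + 2))
    (h3 : (o (r + 2) - o (r + 1)) + (ō (r + 1) - (o (r + 1) - o (r + 2) + ō (r + 2))) ≤ ō' (r + 2) - ō' (r + 1))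
    (he : ∀ z ≤ n, c' z = e z + if z = r + 1 then 1 else 0) :
    PairCond n c d e d' := by
  intro a b hab hbn
  have s1 := h.step (r := r) (by omega)
  have s2 := h.step (r := r + 1) (by omega)
  have s3 := h'.step (r := r) (by omega)
  have s4 := h'.step (r := r + 1) (by omega)
  rw [show r + 1 + 1 = r + 2 from rfl] at s2 s4
  have H0 := H a b hab hbn
  have e1 := he a (by omega)
  have e2 := he b (by omega)
  by_cases ha : a = r + 1 <;> by_cases hb : b = r + 1
  · subst ha hb
    have H1 := H.near hr
    rw [if_pos rfl] at e1
    omega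
  · subst ha
    have H1 := H r b (by omega) (by omega)
    have H2 := H (r + 2) b (by omega) (by omega)
    rw [if_pos rfl] at e1
    rw [if_neg hb] at e2
    omega
  · subst hb
    have H1 := H a r (by omega) (by omega)
    have H2 := H a (r + 2) (by omega) (by omega)
    rw [if_neg ha] at e1
    rw [if_pos rfl] at e2
    omega
  · rw [if_neg ha] at e1
    rw [if_neg hb] at e2
    omega

theorem PairCond.lower_right_bar (H : PairCond n c d c' d') (h : Counts n c d o ō)
    (h' : Counts n c' d' o' ō') (hr : r + 1 < n)
    (h0 : ō' (r + 1) = 1)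
    (h1 : ō' (r + 2) = 0)
    (h2 : (o (r + 2) - o (r + 1)) + (ō (r + 1) - (o (r + 1) - o (r + 2) + ō (r + 2))) = 0)
    (he : ∀ z ≤ n, d' z = e z + if z = r + 1 then 1 else 0) :
    PairCond n c d c' e := by
  intro a b hab hbn
  have s1 := h.step (r := r) (by omega)
  have s2 := h.step (r := r + 1) (by omega)
  have s3 := h'.step (r := r) (by omega)
  have s4 := h'.step (r := r + 1) (by omega)
  rw [show r + 1 + 1 = r + 2 from rfl] at s2 s4
  have H0 := H a b hab hbn
  have e1 := he a (by omega)
  have e2 := he b (by omega)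
  by_cases ha : a = r + 1 <;> by_cases hb : b = r + 1
  · subst ha hb
    have H1 := H.near hr
    rw [if_pos rfl] at e1
    omega
  · subst ha
    have H1 := H r b (by omega) (by omega)
    have H2 := H (r + 2) b (by omega) (by omega)
    rw [if_pos rfl] at e1
    rw [if_neg hb] at e2
    omega
  · subst hb
    have H1 := H a r (by omega) (by omega)
    have H2 := H a (r + 2) (by omega) (by omega)
    rw [if_neg ha] at e1
    rw [if_pos rfl] at e2
    omega
  · rw [if_neg ha] at e1
    rw [if_neg hb] at e2
    omega

/-- Replacing $n$ by $\bar n$ raises $c$ and $d$ together at $n$, in accordance with $c(n)=d(n)$.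
The index $n$ is the last one, so the comparison is with $n-1$ only, and $a=n$ forces $b=n$. -/
theorem PairCond.raise_left_mid {g : ℕ → ℕ} (H : PairCond n c d c' d')
    (h : Counts n c d o ō) (h' : Counts n c' d' o' ō') (hn : 1 ≤ n)
    (h0 : o n = 1)
    (h1 : o' n ≤ ō' n)
    (h2 : ō n = 0)
    (he : ∀ z ≤ n, e z = c z + if z = n then 1 else 0) (hg : ∀ z ≤ n, g z = d z + if z = n then 1 else 0) :
    PairCond n e g c' d' := by
  intro a b hab hbn
  obtain ⟨r, rfl⟩ : ∃ r, n = r + 1 := ⟨n - 1, by omega⟩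
  have s1 := h.step (r := r) (by omega)
  have s3 := h'.step (r := r) (by omega)
  have m1 := h.mid
  have m2 := h'.mid
  have H0 := H a b hab hbn
  have e1 := he a (by omega)
  have e2 := he b (by omega)
  have g1 := hg a (by omega)
  have g2 := hg b (by omega)
  by_cases ha : a = r + 1 <;> by_cases hb : b = r + 1
  · subst ha hb
    have H1 := H r r (by omega) (by omega)
    have H3 := H r (r + 1) (by omega) (by omega)
    rw [if_pos rfl] at e1 g1
    omega
  · omega
  · subst hb
    have H1 := H a r (by omega) (by omega)
    rw [if_neg ha] at e1 g1
    rw [if_pos rfl] at e2 g2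
    omega
  · rw [if_neg ha] at e1 g1
    rw [if_neg hb] at e2 g2
    omega

theorem PairCond.raise_right_mid {g : ℕ → ℕ} (H : PairCond n c d c' d')
    (h : Counts n c d o ō) (h' : Counts n c' d' o' ō') (hn : 1 ≤ n)
    (h0 : o' n = 1)
    (h1 : ō' n = 0)
    (h2 : ō n ≤ o n)
    (he : ∀ z ≤ n, e z = c' z + if z = n then 1 else 0) (hg : ∀ z ≤ n, g z = d' z + if z = n then 1 else 0) :
    PairCond n c d e g := by
  intro a b hab hbn
  obtain ⟨r, rfl⟩ : ∃ r, n = r + 1 := ⟨n - 1, by omega⟩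
  have s1 := h.step (r := r) (by omega)
  have s3 := h'.step (r := r) (by omega)
  have m1 := h.mid
  have m2 := h'.mid
  have H0 := H a b hab hbn
  have e1 := he a (by omega)
  have e2 := he b (by omega)
  have g1 := hg a (by omega)
  have g2 := hg b (by omega)
  by_cases ha : a = r + 1 <;> by_cases hb : b = r + 1
  · subst ha hb
    have H1 := H r r (by omega) (by omega)
    have H3 := H r (r + 1) (by omega) (by omega)
    rw [if_pos rfl] at e1 g1
    omega
  · omega
  · subst hb
    have H1 := H a r (by omega) (by omega)
    rw [if_neg ha] at e1 g1
    rw [if_pos rfl] at e2 g2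
    omega
  · rw [if_neg ha] at e1 g1
    rw [if_neg hb] at e2 g2
    omega

theorem PairCond.lower_left_mid {g : ℕ → ℕ} (H : PairCond n c d c' d')
    (h : Counts n c d o ō) (h' : Counts n c' d' o' ō') (hn : 1 ≤ n)
    (h0 : ō n = 1)
    (h1 : o' n ≤ ō' n)
    (h2 : o n = 0)
    (he : ∀ z ≤ n, c z = e z + if z = n then 1 else 0) (hg : ∀ z ≤ n, d z = g z + if z = n then 1 else 0) :
    PairCond n e g c' d' := by
  intro a b hab hbn
  obtain ⟨r, rfl⟩ : ∃ r, n = r + 1 := ⟨n - 1, by omega⟩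
  have s1 := h.step (r := r) (by omega)
  have s3 := h'.step (r := r) (by omega)
  have m1 := h.mid
  have m2 := h'.mid
  have H0 := H a b hab hbn
  have e1 := he a (by omega)
  have e2 := he b (by omega)
  have g1 := hg a (by omega)
  have g2 := hg b (by omega)
  by_cases ha : a = r + 1 <;> by_cases hb : b = r + 1
  · subst ha hb
    have H1 := H r r (by omega) (by omega)
    have H3 := H r (r + 1) (by omega) (by omega)
    rw [if_pos rfl] at e1 g1
    omega
  · omega
  · subst hb
    have H1 := H a r (by omega) (by omega)
    rw [if_neg ha] at e1 g1
    rw [if_pos rfl] at e2 g2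
    omega
  · rw [if_neg ha] at e1 g1
    rw [if_neg hb] at e2 g2
    omega

theorem PairCond.lower_right_mid {g : ℕ → ℕ} (H : PairCond n c d c' d')
    (h : Counts n c d o ō) (h' : Counts n c' d' o' ō') (hn : 1 ≤ n)
    (h0 : ō' n = 1)
    (h1 : o' n = 0)
    (h2 : ō n ≤ o n)
    (he : ∀ z ≤ n, c' z = e z + if z = n then 1 else 0) (hg : ∀ z ≤ n, d' z = g z + if z = n then 1 else 0) :
    PairCond n c d e g := by
  intro a b hab hbn
  obtain ⟨r, rfl⟩ : ∃ r, n = r + 1 := ⟨n - 1, by omega⟩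
  have s1 := h.step (r := r) (by omega)
  have s3 := h'.step (r := r) (by omega)
  have m1 := h.mid
  have m2 := h'.mid
  have H0 := H a b hab hbn
  have e1 := he a (by omega)
  have e2 := he b (by omega)
  have g1 := hg a (by omega)
  have g2 := hg b (by omega)
  by_cases ha : a = r + 1 <;> by_cases hb : b = r + 1
  · subst ha hb
    have H1 := H r r (by omega) (by omega)
    have H3 := H r (r + 1) (by omega) (by omega)
    rw [if_pos rfl] at e1 g1
    omega
  · omega
  · subst hb
    have H1 := H a r (by omega) (by omega)
    rw [if_neg ha] at e1 g1
    rw [if_pos rfl] at e2 g2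
    omega
  · rw [if_neg ha] at e1 g1
    rw [if_neg hb] at e2 g2
    omega

/-- The length $c(0)$ of the column is not affected because $r+1\ne0$, and elsewhere $c$ stands on
the larger side. -/
theorem SingleCond.raise (H : SingleCond n c d) (h : Counts n c d o ō) (hr : r + 1 < n)
    
    (he : ∀ z ≤ n, e z = c z + if z = r + 1 then 1 else 0) :
    SingleCond n e d := by
  intro b hbn
  have s1 := h.step (r := r) (by omega)
  have s2 := h.step (r := r + 1) (by omega)
  rw [show r + 1 + 1 = r + 2 from rfl] at s2
  have H0 := H b hbn
  have e1 := he 0 (by omega)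
  rw [if_neg (by omega)] at e1
  have e2 := he b (by omega)
  by_cases hb : b = r + 1
  · subst hb
    have H1 := H r (by omega)
    have H2 := H (r + 2) (by omega)
    rw [if_pos rfl] at e2
    omega
  · rw [if_neg hb] at e2
    omega

theorem SingleCond.raise_bar (H : SingleCond n c d) (h : Counts n c d o ō) (hr : r + 1 < n)
    (h0 : ō (r + 2) = 1)
    (h1 : o (r + 1) ≤ o (r + 2))
    (h2 : ō (r + 1) = 0)
    (he : ∀ z ≤ n, e z = d z + if z = r + 1 then 1 else 0) :
    SingleCond n c e := by
  intro b hbn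
  have s1 := h.step (r := r) (by omega)
  have s2 := h.step (r := r + 1) (by omega)
  rw [show r + 1 + 1 = r + 2 from rfl] at s2
  have H0 := H b hbn
  have e1 := he 0 (by omega)
  rw [if_neg (by omega)] at e1
  have e2 := he b (by omega)
  by_cases hb : b = r + 1
  · subst hb
    have H1 := H r (by omega)
    have H2 := H (r + 2) (by omega)
    rw [if_pos rfl] at e2
    omega
  · rw [if_neg hb] at e2
    omega

theorem SingleCond.lower (H : SingleCond n c d) (h : Counts n c d o ō) (hr : r + 1 < n)
    (h0 : o (r + 2) = 1)
    (h1 : o (r + 1) = 0)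
    (h2 : ō (r + 1) ≤ ō (r + 2))
    (he : ∀ z ≤ n, c z = e z + if z = r + 1 then 1 else 0) :
    SingleCond n e d := by
  intro b hbn
  have s1 := h.step (r := r) (by omega)
  have s2 := h.step (r := r + 1) (by omega)
  rw [show r + 1 + 1 = r + 2 from rfl] at s2
  have H0 := H b hbn
  have e1 := he 0 (by omega)
  rw [if_neg (by omega)] at e1
  have e2 := he b (by omega)
  by_cases hb : b = r + 1
  · subst hb
    have H1 := H r (by omega)
    have H2 := H (r + 2) (by omega)
    rw [if_pos rfl] at e2
    omega
  · rw [if_neg hb] at e2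
    omega

theorem SingleCond.lower_bar (H : SingleCond n c d) (h : Counts n c d o ō) (hr : r + 1 < n)
    
    (he : ∀ z ≤ n, d z = e z + if z = r + 1 then 1 else 0) :
    SingleCond n c e := by
  intro b hbn
  have s1 := h.step (r := r) (by omega)
  have s2 := h.step (r := r + 1) (by omega)
  rw [show r + 1 + 1 = r + 2 from rfl] at s2
  have H0 := H b hbn
  have e1 := he 0 (by omega)
  rw [if_neg (by omega)] at e1
  have e2 := he b (by omega)
  by_cases hb : b = r + 1
  · subst hb
    have H1 := H r (by omega)
    have H2 := H (r + 2) (by omega)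
    rw [if_pos rfl] at e2
    omega
  · rw [if_neg hb] at e2
    omega

end TypeC

/-! ## The boxes before and after a given box -/

theorem range_prefix (g : ℕ → List (ℕ × ℕ)) {j t : ℕ} (h : j ≤ t) :
    ∃ u, (List.range t).reverse.flatMap g = u ++ (List.range j).reverse.flatMap g := by
  induction t, h using Nat.le_induction with
  | base => exact ⟨[], rfl⟩
  | succ t ht ih =>
    obtain ⟨u, hu⟩ := ih
    exact ⟨g t ++ u, by simp [List.range_succ, hu]⟩

theorem range_reverse_split {a N : ℕ} (h : a < N) : (List.range N).reverse =
    ((List.range (N - (a + 1))).reverse.map fun j => a + 1 + j) ++ a :: (List.range a).reverse := by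
  obtain ⟨d, rfl⟩ := Nat.exists_eq_add_of_lt h
  rw [show a + d + 1 = (a + 1) + d by ring, List.range_add, List.range_succ]
  simp [List.map_reverse]

theorem append_cons_inj {α : Type} {x : α} {l₁ l₂ r₁ r₂ : List α} (hl : x ∉ l₁) (hr : x ∉ r₁)
    (h : l₁ ++ x :: l₂ = r₁ ++ x :: r₂) : l₁ = r₁ ∧ l₂ = r₂ := by
  induction l₁ generalizing r₁ with
  | nil =>
    cases r₁ with
    | nil => simpa using h
    | cons b r =>
      simp only [List.nil_append, List.cons_append, List.cons.injEq] at h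
      exact absurd (by simp [h.1]) hr
  | cons b l ih =>
    cases r₁ with
    | nil =>
      simp only [List.nil_append, List.cons_append, List.cons.injEq] at h
      exact absurd (by simp [h.1]) hl
    | cons b' r =>
      simp only [List.cons_append, List.cons.injEq] at h
      have := ih (fun h => hl (by simp [h])) (fun h => hr (by simp [h])) h.2
      exact ⟨by rw [h.1, this.1], this.2⟩

/-- The boxes of a column from top to bottom, those above a box and those below it. -/
def colBoxes (s : List ℕ) (k : ℕ) : List (ℕ × ℕ) := (List.range (len s k)).reverse.map fun a => (k, a)

def upBoxes (s : List ℕ) (k a : ℕ) : List (ℕ × ℕ) :=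
  (List.range (len s k - (a + 1))).reverse.map fun j => (k, a + 1 + j)

def downBoxes (k a : ℕ) : List (ℕ × ℕ) := (List.range a).reverse.map fun j => (k, j)

/-- A box occurs only once in the reading order, so any splitting at it agrees with the explicit
one. Only the ends next to the box are recorded: before it, the column to the right followed by the
boxes above; after it, the boxes below followed by the column to the left. -/
theorem boxes_eq_of_mem {s : List ℕ} {k a : ℕ} {l₁ l₂ : List (ℕ × ℕ)}
    (h : boxes s = l₁ ++ (k, a) :: l₂) (h1 : (k, a) ∉ l₁) :
    (∃ u, l₁ = u ++ upBoxes s k a) ∧ (∃ v, l₂ = downBoxes k a ++ v) ∧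
    (k + 1 < s.length → ∃ u, l₁ = u ++ (colBoxes s (k + 1) ++ upBoxes s k a)) ∧
    (∀ j, k = j + 1 → ∃ v, l₂ = (downBoxes k a ++ colBoxes s j) ++ v) := by
  have hm : (k, a) ∈ boxes s := by rw [h]; simp
  obtain ⟨hk, ha⟩ := mem_boxes.1 hm
  have hcol : colBoxes s k = upBoxes s k a ++ (k, a) :: downBoxes k a := by
    unfold colBoxes
    rw [range_reverse_split ha]
    simp [upBoxes, downBoxes, Function.comp_def]
  have hb : ∀ j, (List.range (j + 1)).reverse.flatMap (colBoxes s) =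
      colBoxes s j ++ (List.range j).reverse.flatMap (colBoxes s) := by
    intro j; simp [List.range_succ]
  have hup : (k, a) ∉ upBoxes s k a := by simp [upBoxes]; omega
  have hother : ∀ j, j ≠ k → (k, a) ∉ colBoxes s j := by
    intro j hj; simp [colBoxes, hj]
  have hu : ∀ {j} (_ : k < j) (hj : j ≤ s.length) (u), boxes s = u ++
      (List.range j).reverse.flatMap (colBoxes s) → (k, a) ∉ u := by
    intro j hkj hj u e hmem
    have nd := nodup_boxes s
    rw [e, List.nodup_append] at nd
    refine nd.2.2 _ hmem (k, a) ?_ rfl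
    simp [colBoxes, hkj, ha]
  refine ⟨?_, ?_, ?_, ?_⟩
  · obtain ⟨u, e⟩ := range_prefix (colBoxes s) (show k + 1 ≤ s.length from hk)
    have e' : boxes s = u ++ (List.range (k + 1)).reverse.flatMap (colBoxes s) := e
    have hnu := hu (by omega) hk u e'
    rw [hb, hcol, h] at e'
    have e2 : l₁ ++ (k, a) :: l₂ = (u ++ upBoxes s k a) ++ (k, a) ::
        (downBoxes k a ++ (List.range k).reverse.flatMap (colBoxes s)) := by simpa using e'
    exact ⟨u, (append_cons_inj h1 (by simp [hnu, hup]) e2).1⟩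
  · obtain ⟨u, e⟩ := range_prefix (colBoxes s) (show k + 1 ≤ s.length from hk)
    have e' : boxes s = u ++ (List.range (k + 1)).reverse.flatMap (colBoxes s) := e
    have hnu := hu (by omega) hk u e'
    rw [hb, hcol, h] at e'
    have e2 : l₁ ++ (k, a) :: l₂ = (u ++ upBoxes s k a) ++ (k, a) ::
        (downBoxes k a ++ (List.range k).reverse.flatMap (colBoxes s)) := by simpa using e'
    exact ⟨_, (append_cons_inj h1 (by simp [hnu, hup]) e2).2⟩
  · intro hk'
    obtain ⟨u, e⟩ := range_prefix (colBoxes s) (show k + 2 ≤ s.length from hk')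
    have e' : boxes s = u ++ (List.range (k + 2)).reverse.flatMap (colBoxes s) := e
    have hnu := hu (by omega) hk' u e'
    rw [hb, hb, hcol, h] at e'
    have e2 : l₁ ++ (k, a) :: l₂ = (u ++ (colBoxes s (k + 1) ++ upBoxes s k a)) ++ (k, a) ::
        (downBoxes k a ++ (List.range k).reverse.flatMap (colBoxes s)) := by simpa using e'
    exact ⟨u, (append_cons_inj h1 (by simp [hnu, hup, hother]) e2).1⟩
  · rintro j rfl
    obtain ⟨u, e⟩ := range_prefix (colBoxes s) (show j + 1 + 1 ≤ s.length from hk)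
    have e' : boxes s = u ++ (List.range (j + 1 + 1)).reverse.flatMap (colBoxes s) := e
    have hnu := hu (by omega) hk u e'
    rw [hb, hcol, hb, h] at e'
    have e2 : l₁ ++ (j + 1, a) :: l₂ = (u ++ upBoxes s (j + 1) a) ++ (j + 1, a) ::
        (downBoxes (j + 1) a ++ (colBoxes s j ++ (List.range j).reverse.flatMap (colBoxes s))) := by
      simpa using e'
    refine ⟨(List.range j).reverse.flatMap (colBoxes s), ?_⟩
    rw [(append_cons_inj h1 (by simp [hnu, hup]) e2).2, List.append_assoc]

/-- The letters of a column from top to bottom, those above a box and those below it. -/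
def letters (C : ℕ → ℕ) (N : ℕ) : List ℕ := (List.range N).reverse.map C

def upLetters (C : ℕ → ℕ) (N a : ℕ) : List ℕ :=
  (List.range (N - (a + 1))).reverse.map fun j => C (a + 1 + j)

theorem StrictColumn.pairwise_letters {C : ℕ → ℕ} {N : ℕ} (h : StrictColumn C N) {M : ℕ}
    (hM : M ≤ N) : (letters C M).Pairwise (· < ·) := by
  unfold letters
  rw [List.pairwise_map, List.pairwise_reverse]
  refine List.pairwise_lt_range.imp_of_mem ?_
  intro a b _ hb hab
  exact h.lt hab ((List.mem_range.1 hb).trans_le hM)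

theorem StrictColumn.pairwise_upLetters {C : ℕ → ℕ} {N : ℕ} (h : StrictColumn C N) (a : ℕ) :
    (upLetters C N a).Pairwise (· < ·) := by
  unfold upLetters
  rw [List.pairwise_map, List.pairwise_reverse]
  refine List.pairwise_lt_range.imp_of_mem ?_
  intro b c _ hc hbc
  have := List.mem_range.1 hc
  exact h.lt (by omega) (by omega)

theorem mem_letters {C : ℕ → ℕ} {N y : ℕ} : y ∈ letters C N ↔ ∃ a < N, C a = y := by
  simp [letters]

theorem mem_upLetters {C : ℕ → ℕ} {N a y : ℕ} :
    y ∈ upLetters C N a ↔ ∃ b < N, a < b ∧ C b = y := by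
  simp only [upLetters, List.mem_map, List.mem_reverse, List.mem_range]
  constructor
  · rintro ⟨b, hb, e⟩; exact ⟨a + 1 + b, by omega, by omega, e⟩
  · rintro ⟨b, hb, hab, e⟩
    exact ⟨b - (a + 1), by omega, by rw [← e]; congr 1; omega⟩

theorem mult_letters (C : ℕ → ℕ) (N y : ℕ) : mult (letters C N) y = occ C N y := by
  simp [mult, occ, mem_letters]

theorem StrictColumn.mult_downLetters {C : ℕ → ℕ} {N : ℕ} (h : StrictColumn C N) {a : ℕ}
    (ha : a < N) (y : ℕ) : mult (letters C a) y = if C a < y then occ C N y else 0 := by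
  have : (∃ b < a, C b = y) ↔ C a < y ∧ ∃ b < N, C b = y := by
    constructor
    · rintro ⟨b, hb, rfl⟩; exact ⟨h.lt hb ha, b, by omega, rfl⟩
    · rintro ⟨h1, b, hb, rfl⟩
      refine ⟨b, ?_, rfl⟩
      by_contra hab
      rcases Nat.lt_or_ge a b with h2 | h2
      · have := h.lt h2 hb; omega
      · have : a = b := by omega
        subst this; omega
  simp only [mult, mem_letters, this, occ]
  split_ifs <;> simp_all

theorem StrictColumn.mult_upLetters {C : ℕ → ℕ} {N : ℕ} (h : StrictColumn C N) {a : ℕ}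
    (ha : a < N) (y : ℕ) : mult (upLetters C N a) y = if y < C a then occ C N y else 0 := by
  have : (∃ b < N, a < b ∧ C b = y) ↔ y < C a ∧ ∃ b < N, C b = y := by
    constructor
    · rintro ⟨b, hb, hab, rfl⟩; exact ⟨h.lt hab hb, b, hb, rfl⟩
    · rintro ⟨h1, b, hb, rfl⟩
      refine ⟨b, hb, ?_, rfl⟩
      by_contra hab
      rcases Nat.lt_or_ge b a with h2 | h2
      · have := h.lt h2 ha; omega
      · have : a = b := by omega
        subst this; omega
  simp only [mult, mem_upLetters, this, occ]
  split_ifs <;> simp_all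

/-! ### The signature rule in the neighbourhood of the box acted upon -/

section

variable {n : ℕ} (ve vf : Fin n → ℕ → Option ℕ) (i : Fin n)

/-- The numbers of surviving signs of a word of letters. -/
def phiL (L : List ℕ) : ℕ := (survivors Sgn.plus (letterWord ve vf i L)).length

def epsL (L : List ℕ) : ℕ := (survivors Sgn.minus (letterWord ve vf i L)).length

theorem phiL_append (L L' : List ℕ) :
    phiL ve vf i (L ++ L') = (phiL ve vf i L - epsL ve vf i L') + phiL ve vf i L' := by
  unfold phiL epsL
  rw [letterWord_append, (length_survivors_append _ _).2]

theorem epsL_append (L L' : List ℕ) :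
    epsL ve vf i (L ++ L') = epsL ve vf i L + (epsL ve vf i L' - phiL ve vf i L) := by
  unfold phiL epsL
  rw [letterWord_append, (length_survivors_append _ _).1]

/-- What is known about the columns of a tableau `T` if an operator acts on the box `(k, a)`. -/
structure ActsAt (s : List ℕ) (T : Tableau) (k a : ℕ) : Prop where
  hk : k < s.length
  ha : a < len s k
  up : phiL ve vf i (upLetters (T k) (len s k) a) = 0
  down : epsL ve vf i (letters (T k) a) = 0
  right : k + 1 < s.length →
    (phiL ve vf i (letters (T (k + 1)) (len s (k + 1))) -
      epsL ve vf i (upLetters (T k) (len s k) a)) = 0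
  left : ∀ j, k = j + 1 → epsL ve vf i (letters (T j) (len s j)) ≤
    phiL ve vf i (letters (T k) a)

variable {ve vf i}

/-- A suffix of a word without surviving $+$ has none either, and dually for prefixes and $-$. Hence
the global condition restricts to the neighbouring column together with the part of the column next
to it in the reading order. -/
theorem actsAt_of_split {s : List ℕ} {T : Tableau} {k a : ℕ} {l₁ l₂ : List (ℕ × ℕ)}
    (h : boxes s = l₁ ++ (k, a) :: l₂) (h1 : (k, a) ∉ l₁)
    (hp : survivors Sgn.plus (boxWord ve vf i T l₁) = [])
    (hm : survivors Sgn.minus (boxWord ve vf i T l₂) = []) : ActsAt ve vf i s T k a := by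
  have hmem : (k, a) ∈ boxes s := by rw [h]; simp
  obtain ⟨hk, ha⟩ := mem_boxes.1 hmem
  obtain ⟨⟨u, hu⟩, ⟨v, hv⟩, hr, hl⟩ := boxes_eq_of_mem h h1
  have hP : ∀ l l', l₁ = l ++ l' → phiL ve vf i (l'.map fun x => T x.1 x.2) = 0 := by
    rintro l l' rfl
    unfold phiL
    rw [← length_survivors_boxWord]
    rw [boxWord_append] at hp
    rw [survivors_plus_suffix hp]; rfl
  have hM : ∀ l l', l₂ = l ++ l' → epsL ve vf i (l.map fun x => T x.1 x.2) = 0 := by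
    rintro l l' rfl
    unfold epsL
    rw [← length_survivors_boxWord]
    rw [boxWord_append] at hm
    rw [survivors_minus_prefix hm]; rfl
  have e1 : ∀ k, (colBoxes s k).map (fun x => T x.1 x.2) = letters (T k) (len s k) := by
    intro k; simp [colBoxes, letters, Function.comp_def]
  have e2 : (upBoxes s k a).map (fun x => T x.1 x.2) = upLetters (T k) (len s k) a := by
    simp [upBoxes, upLetters, Function.comp_def]
  have e3 : (downBoxes k a).map (fun x => T x.1 x.2) = letters (T k) a := by
    simp [downBoxes, letters, Function.comp_def]
  have hup := hP _ _ hu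
  have hdown := hM _ _ hv
  rw [e2] at hup
  rw [e3] at hdown
  refine ⟨hk, ha, hup, hdown, fun hk' => ?_, fun j hj => ?_⟩
  · obtain ⟨u, hu⟩ := hr hk'
    have := hP _ _ hu
    rw [List.map_append, e1, e2, phiL_append] at this
    omega
  · obtain ⟨u, hu⟩ := hl j hj
    have := hM _ _ hu
    rw [List.map_append, e1, e3, epsL_append] at this
    omega

end

section

variable {n m : ℕ} {A : Fin n → Fin n → ℤ} {col : ℕ → ℕ} {ve vf : Fin n → ℕ → Option ℕ}
  {vwt : ℕ → Fin n → ℤ} (h : IsLetterChain n m A col ve vf vwt) {s : List ℕ} {T : Tableau}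
include h

theorem IsLetterChain.f_actsAt {i : Fin n} {T' : Tableau}
    (hf : (tableauCrystal n ve vf vwt s).f i T = some T') :
    ∃ k a, ActsAt ve vf i s T k a ∧ 1 ≤ T k a ∧ T k a + 1 ≤ m ∧ col (T k a) = i + 1 ∧
      T' = T.upd (k, a) (T k a + 1) := by
  rw [h.f_eq_some_iff] at hf
  obtain ⟨l₁, ⟨k, a⟩, l₂, y, e, h1, -, hy, rfl, h3, h4⟩ := hf
  rw [h.vf_iff] at hy
  obtain ⟨hy1, rfl, hy2, hy3⟩ := hy
  exact ⟨k, a, actsAt_of_split e h1 h3 h4, hy1, hy2, hy3, rfl⟩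

theorem IsLetterChain.e_actsAt {i : Fin n} {T' : Tableau}
    (hf : (tableauCrystal n ve vf vwt s).e i T = some T') :
    ∃ k a y, ActsAt ve vf i s T k a ∧ 1 ≤ y ∧ T k a = y + 1 ∧ y + 1 ≤ m ∧ col y = i + 1 ∧
      T' = T.upd (k, a) y := by
  rw [h.e_eq_some_iff] at hf
  obtain ⟨l₁, ⟨k, a⟩, l₂, y, e, h1, -, hy, rfl, h3, h4⟩ := hf
  rw [h.ve_iff] at hy
  obtain ⟨hy1, hy, hy2, hy3⟩ := hy
  dsimp only at hy hy2
  exact ⟨k, a, y, actsAt_of_split e h1 h3 h4, hy1, hy, by omega, hy3, rfl⟩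

end

theorem StrictColumn.cnt_bar {C : ℕ → ℕ} {N : ℕ} (h : StrictColumn C N) {z : ℕ} (hz : 1 ≤ z) :
    cnt C N (z - 1) = cnt C N z + occ C N z := by
  have := h.cnt_eq (z - 1)
  rwa [Nat.sub_add_cancel hz] at this

/-! ### The column conditions of type $C_n$ as inequalities between counting functions -/

namespace TypeC

/-- The counting functions of a column. -/
def cc (C : ℕ → ℕ) (N a : ℕ) : ℕ := cnt C N a

def dd (n : ℕ) (C : ℕ → ℕ) (N a : ℕ) : ℕ := cnt C N (2 * n - a)

def ob (n : ℕ) (C : ℕ → ℕ) (N a : ℕ) : ℕ := occ C N (2 * n + 1 - a)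

theorem counts {n : ℕ} {C : ℕ → ℕ} {N : ℕ} (h : StrictColumn C N) :
    Counts n (cc C N) (dd n C N) (occ C N) (ob n C N) where
  left a _ := h.cnt_eq a
  right a ha := by
    have := h.cnt_bar (z := 2 * n - a) (by omega)
    unfold dd ob
    rw [show 2 * n - (a + 1) = 2 * n - a - 1 by omega, this]
    congr 2
    omega
  mid := by unfold cc dd; congr 1; omega
  o_le a := occ_le_one _ _ _
  ō_le a := occ_le_one _ _ _

theorem Counts.c_anti {n : ℕ} {c d o ō : ℕ → ℕ} (h : Counts n c d o ō) {a b : ℕ} (hab : a ≤ b)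
    (hb : b ≤ n) : c b ≤ c a ∧ c a ≤ c b + (b - a) ∧ d a ≤ d b ∧ d b ≤ d a + (b - a) := by
  induction b, hab using Nat.le_induction with
  | base => omega
  | succ b hab ih =>
    have := ih (by omega)
    have := h.step (r := b) (by omega)
    omega

/-- The rows of the letters `a` and `ā`. -/
theorem exists_row {C : ℕ → ℕ} {N a : ℕ} (h : StrictColumn C N) (ho : occ C N a = 1) :
    ∃ p < N, C p = a ∧ p = cc C N a := by
  obtain ⟨p, hp, e⟩ := occ_eq_one_iff.1 ho
  exact ⟨p, hp, e, by rw [← h.cnt_at hp, e]; rfl⟩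

theorem exists_row_bar {n : ℕ} {C : ℕ → ℕ} {N a : ℕ} (h : StrictColumn C N) (ha : a < n)
    (ho : ob n C N (a + 1) = 1) : ∃ q < N, C q = bar n (a + 1) ∧ q = dd n C N a := by
  obtain ⟨p, hp, e⟩ := occ_eq_one_iff.1 ho
  refine ⟨p, hp, e, ?_⟩
  rw [← h.cnt_at hp, e]
  unfold dd
  congr 1
  omega

theorem row_eq {C : ℕ → ℕ} {N a p : ℕ} (h : StrictColumn C N) (hp : p < N)
    (e : C p = a) : occ C N a = 1 ∧ p = cc C N a :=
  ⟨occ_eq_one_iff.2 ⟨p, hp, e⟩, by rw [← h.cnt_at hp, e]; rfl⟩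

theorem row_bar_eq {n : ℕ} {C : ℕ → ℕ} {N a q : ℕ} (h : StrictColumn C N) (hq : q < N)
    (h1 : 1 ≤ a) (e : C q = bar n a) : ob n C N a = 1 ∧ q = dd n C N (a - 1) := by
  refine ⟨occ_eq_one_iff.2 ⟨q, hq, e⟩, ?_⟩
  rw [← h.cnt_at hq, e]
  unfold dd bar
  congr 1
  omega

/-- If $b$ and $\bar b$ lie in rows $p>q$, then $p=c(b)$ and $q=d(b)-1$, so (1CC) is precisely the
inequality at $b$. If one of the two letters is missing, the inequality at $b$ follows from that at
$b-1$, since $d$ grows and $c$ drops by at most one in total; at $0$ it is an equality. -/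
theorem oneColumn_iff {n : ℕ} {C : ℕ → ℕ} {N : ℕ} (h : StrictColumn C N)
    (h1 : ∀ a < N, 1 ≤ C a) (h2 : ∀ a < N, C a ≤ 2 * n) :
    OneColumn n N C ↔ SingleCond n (cc C N) (dd n C N) := by
  have hc := counts (n := n) h
  have hc0 : cc C N 0 = N := cnt_zero h1
  have hd0 : dd n C N 0 = 0 := cnt_eq_zero h2
  constructor
  · intro H b
    induction b with
    | zero => intro _; omega
    | succ b ih =>
      intro hb
      have hih := ih (by omega)
      have st := hc.step (r := b) (by omega)
      by_cases hboth : occ C N (b + 1) = 1 ∧ ob n C N (b + 1) = 1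
      · obtain ⟨p, hp, ep, hp'⟩ := exists_row h hboth.1
        obtain ⟨q, hq, eq, hq'⟩ := exists_row_bar h (by omega) hboth.2
        have hqp : q < p := by
          rcases Nat.lt_trichotomy q p with h' | h' | h'
          · exact h'
          · subst h'; rw [ep] at eq; unfold bar at eq; omega
          · have := h.lt h' hq; rw [ep, eq] at this; unfold bar at this; omega
        have := H p q (b + 1) hqp hp (by omega) hb ep eq
        omega
      · omega
  · intro H p q a hqp hp ha1 han ep eq
    have h3 := row_eq h hp ep
    have h4 := row_bar_eq (n := n) h (hqp.trans hp) ha1 eq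
    have h5 := H a han
    have st := hc.step (r := a - 1) (by omega)
    rw [Nat.sub_add_cancel ha1] at st
    omega

/-- The diagonal $a=b$ is the row condition. If $a$ lies in row $p$ of the left column and $\bar a$
in row $q$ of the right one, then $p=c(a)=c(a-1)-1$ and $q=d'(a-1)$, so the inequality at $(a-1,n)$
is (2CC-1), because $c(n)=d(n)$, and those at $(a-1,b)$ give (2CC-2). The other inequalities follow
by moving one index at a time: an increase of $b$ or a decrease of $a$ by one can cost something
only if both letters concerned are present. (2CC-1) is not needed for the direction from tableaux to
inequalities. -/
theorem two_columns_iff {n : ℕ} {C D : ℕ → ℕ} {N N' : ℕ} (hC : StrictColumn C N)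
    (hD : StrictColumn D N') (hN : N ≤ N') (h2 : ∀ a < N, C a ≤ 2 * n) :
    ((∀ a < N, C a ≤ D a) ∧ TwoColumnFirst n N C D ∧ TwoColumnSecond n N C D) ↔
      PairCond n (cc C N) (dd n C N) (cc D N') (dd n D N') := by
  have hc := counts (n := n) hC
  have hd := counts (n := n) hD
  have hd0 : dd n C N 0 = 0 := cnt_eq_zero h2
  rw [rows_iff_cnt hC hD hN]
  constructor
  · rintro ⟨hrows, -, H⟩
    have rc : ∀ a, cc C N a ≤ cc D N' a := fun a => hrows a
    have rd : ∀ a, dd n C N a ≤ dd n D N' a := fun a => hrows _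
    -- the case in which both letters are present
    have key : ∀ a, a < n → occ C N (a + 1) = 1 → ob n D N' (a + 1) = 1 → ∀ b, a ≤ b → b ≤ n →
        cc C N a + a + dd n C N b ≤ cc C N b + b + dd n D N' a ∧
        cc C N a + a + dd n D N' b ≤ cc D N' b + b + dd n D N' a := by
      intro a ha ho ho' b hab
      obtain ⟨p, hp, ep, hp'⟩ := exists_row hC ho
      obtain ⟨q, hq, eq, hq'⟩ := exists_row_bar hD ha ho'
      have sa := hc.step ha
      induction b, hab using Nat.le_induction with
      | base =>
        intro _
        have := rc a
        have := rd a
        omega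
      | succ b hab ih =>
        intro hb
        have hih := ih (by omega)
        have st := hc.step (r := b) (by omega)
        have st' := hd.step (r := b) (by omega)
        have a1 := hc.c_anti (a := a) (b := b) hab (by omega)
        have a1' := hd.c_anti (a := a) (b := b) hab (by omega)
        have a2 := hc.c_anti (a := a + 1) (b := b + 1) (by omega) (by omega)
        constructor
        · by_cases hboth : occ C N (b + 1) = 1 ∧ ob n C N (b + 1) = 1
          · obtain ⟨r, hr, er, hr'⟩ := exists_row hC hboth.1
            obtain ⟨t, ht, et, ht'⟩ := exists_row_bar hC (by omega) hboth.2
            have htr : t < r := by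
              rcases Nat.lt_trichotomy t r with h' | h' | h'
              · exact h'
              · subst h'; rw [er] at et; unfold bar at et; omega
              · have := hC.lt h' ht; rw [er, et] at this; unfold bar at this; omega
            -- If $\overline{b+1}$ lies below row $q$, then (2CC-2) does not apply, but $d(b+1)\le
            -- d'(a)$, and the claim follows because $c$ drops by at most one per step.
            rcases Nat.lt_or_ge t q with htq | hqt
            · omega
            · have := H p q (a + 1) (by omega) hp (by omega) (by omega) ep eq r t (b + 1) hqt htr
                (by omega) (by omega) (by omega) (Or.inl ⟨er, et⟩)
              omega
          · omega
        · by_cases hboth : occ D N' (b + 1) = 1 ∧ ob n D N' (b + 1) = 1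
          · obtain ⟨r, hr, er, hr'⟩ := exists_row hD hboth.1
            obtain ⟨t, ht, et, ht'⟩ := exists_row_bar hD (by omega) hboth.2
            have htr : t < r := by
              rcases Nat.lt_trichotomy t r with h' | h' | h'
              · exact h'
              · subst h'; rw [er] at et; unfold bar at et; omega
              · have := hD.lt h' ht; rw [er, et] at this; unfold bar at this; omega
            -- Likewise, if $b+1$ lies above row $p$, then $c(a)\le c'(b+1)$, and $d'$ grows by at
            -- most one per step.
            rcases Nat.lt_or_ge p r with hpr | hrp
            · omega
            · have := H p q (a + 1) (by omega) hp (by omega) (by omega) ep eq r t (b + 1)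
                (by omega) htr hrp (by omega) (by omega) (Or.inr ⟨er, et⟩)
              omega
          · omega
    intro a b hab hbn
    -- The index $a$ is lowered, starting from the diagonal. The step from $a+1$ to $a$ is free
    -- unless $a+1$ occurs on the left and its bar on the right.
    induction hk : b - a generalizing a with
    | zero =>
      have : a = b := by omega
      subst this
      have := rc a
      have := rd a
      omega
    | succ k ih =>
      by_cases hboth : occ C N (a + 1) = 1 ∧ ob n D N' (a + 1) = 1
      · exact key a (by omega) hboth.1 hboth.2 b hab hbn
      · have := ih (a + 1) (by omega) (by omega)
        have st := hc.step (r := a) (by omega)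
        have st' := hd.step (r := a) (by omega)
        omega
  · intro H
    have key : ∀ p q a, p < N → q < N' → 1 ≤ a → a ≤ n → C p = a → D q = bar n a → ∀ b, a ≤ b →
        b ≤ n → p + a + dd n C N b ≤ cc C N b + b + q ∧
          p + a + dd n D N' b ≤ cc D N' b + b + q := by
      intro p q a hp hq ha1 han ep eq b hab hbn
      have h3 := row_eq hC hp ep
      have h4 := row_bar_eq (n := n) hD hq ha1 eq
      have st := hc.step (r := a - 1) (by omega)
      have := H (a - 1) b (by omega) hbn
      rw [Nat.sub_add_cancel ha1] at st
      omega
    refine ⟨fun z => ?_, ?_, ?_⟩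
    · rcases Nat.le_or_ge z n with hz | hz
      · have := (H z z le_rfl hz).2
        change cc C N z ≤ cc D N' z
        omega
      -- For $n\le z\le 2n$ the count at $z$ is the value of $d$ at $2n-z$, so the first diagonal
      -- inequality supplies the upper half of the alphabet.
      · rcases Nat.le_or_ge z (2 * n) with hz' | hz'
        · have := (H (2 * n - z) (2 * n - z) le_rfl (by omega)).1
          unfold dd at this
          rw [show 2 * n - (2 * n - z) = z by omega] at this
          omega
        · have := cnt_anti C N hz'
          have : cnt C N (2 * n) = 0 := cnt_eq_zero h2
          omega
    · intro p q a hqp hp ha1 han ep eq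
      have := (key p q a hp (by omega) ha1 han ep eq n han le_rfl).1
      have := hc.mid
      omega
    · intro p q a hqp hp ha1 han ep eq r t b hqt htr hrp hb1 hbn hor
      have hab : a ≤ b := by
        rcases hor with ⟨er, et⟩ | ⟨er, et⟩
        · rcases Nat.lt_or_ge r p with h' | h'
          · have := hC.lt h' hp; omega
          · have : r = p := by omega
            subst this; omega
        · rcases Nat.lt_or_ge q t with h' | h'
          · have := hD.lt h' (by omega); rw [et, eq] at this; unfold bar at this; omega
          · have : t = q := by omega
            subst this; rw [et] at eq; unfold bar at eq; omega
      have hk := key p q a hp (by omega) ha1 han ep eq b hab hbn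
      rcases hor with ⟨er, et⟩ | ⟨er, et⟩
      · have h3 := row_eq hC (by omega) er
        have h4 := row_bar_eq (n := n) hC (by omega) hb1 et
        have st := hc.step (r := b - 1) (by omega)
        rw [Nat.sub_add_cancel hb1] at st
        omega
      · have h3 := row_eq hD (by omega) er
        have h4 := row_bar_eq (n := n) hD (by omega) hb1 et
        have st := hd.step (r := b - 1) (by omega)
        rw [Nat.sub_add_cancel hb1] at st
        omega

end TypeC

/-! ### Changing a single entry -/

theorem len_mono {s : List ℕ} (hs : s.Pairwise (· ≤ ·)) {j k : ℕ} (hjk : j ≤ k)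
    (hk : k < s.length) : len s j ≤ len s k := by
  unfold len
  rw [List.getD_eq_getElem _ _ (by omega), List.getD_eq_getElem _ _ hk]
  rcases Nat.lt_or_ge j k with h | h
  · exact List.pairwise_iff_getElem.1 hs j k (by omega) hk h
  · have : j = k := by omega
    subst this; rfl

theorem IsReverseTableau.strictColumn {m : ℕ} {s : List ℕ} {T : Tableau}
    (h : IsReverseTableau m s T) {k : ℕ} (hk : k < s.length) : StrictColumn (T k) (len s k) :=
  fun a ha => h.columns k a hk ha

theorem Tableau.upd_ne (T : Tableau) {k j : ℕ} (a y : ℕ) (h : j ≠ k) : T.upd (k, a) y j = T j := by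
  funext b
  rw [Tableau.upd_apply, if_neg]
  simp [h]

theorem Tableau.upd_eq (T : Tableau) (k a y b : ℕ) :
    T.upd (k, a) y k b = if b = a then y else T k b := by
  rw [Tableau.upd_apply]; simp

/-- Raising an entry of a strict column keeps it strict if the next letter does not occur. -/
theorem StrictColumn.upd_raise {T : Tableau} {k a N : ℕ} (h : StrictColumn (T k) N) (ha : a < N)
    (ho : occ (T k) N (T k a + 1) = 0) : StrictColumn (T.upd (k, a) (T k a + 1) k) N := by
  intro b hb
  rw [Tableau.upd_eq, Tableau.upd_eq]
  have h1 := h b hb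
  split_ifs with h2 h3 h3
  · omega
  · subst h2
    by_contra hlt
    have : occ (T k) N (T k (b + 1) + 1) = 1 := occ_eq_one_iff.2 ⟨b, by omega, by omega⟩
    omega
  · subst h3; omega
  · exact h1

theorem StrictColumn.upd_lower {T : Tableau} {k a N y : ℕ} (h : StrictColumn (T k) N) (ha : a < N)
    (hy : T k a = y + 1) (ho : occ (T k) N y = 0) : StrictColumn (T.upd (k, a) y k) N := by
  intro b hb
  rw [Tableau.upd_eq, Tableau.upd_eq]
  have h1 := h b hb
  split_ifs with h2 h3 h3
  · omega
  · subst h2; omega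
  · subst h3
    by_contra hlt
    have : occ (T k) N y = 1 := occ_eq_one_iff.2 ⟨b + 1, by omega, by omega⟩
    omega
  · exact h1

theorem cnt_upd_raise {T : Tableau} {k a N : ℕ} (ha : a < N) (z : ℕ) :
    cnt (T.upd (k, a) (T k a + 1) k) N z = cnt (T k) N z + if z = T k a then 1 else 0 :=
  cnt_raise ha (by rw [Tableau.upd_eq, if_pos rfl])
    (fun b hb => by rw [Tableau.upd_eq, if_neg hb]) z

theorem cnt_upd_lower {T : Tableau} {k a N y : ℕ} (ha : a < N) (hy : T k a = y + 1) (z : ℕ) :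
    cnt (T k) N z = cnt (T.upd (k, a) y k) N z + if z = y then 1 else 0 := by
  have e : T.upd (k, a) y k a = y := by rw [Tableau.upd_eq, if_pos rfl]
  have := cnt_raise (C := T.upd (k, a) y k) (D := T k) ha (by rw [e, hy])
    (fun b hb => by rw [Tableau.upd_eq, if_neg hb]) z
  rwa [e] at this

/-! ### Stability of the tableaux of type $C_n$ -/

namespace TypeC

/-- A set of tableaux described by conditions on the counting functions. -/
structure IsGood (n : ℕ) (s : List ℕ) (T : Tableau) : Prop where
  off_shape : ∀ k a, ¬ (k < s.length ∧ a < len s k) → T k a = 0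
  entries : ∀ k a, k < s.length → a < len s k → 1 ≤ T k a ∧ T k a ≤ 2 * n
  columns : ∀ k, k < s.length → StrictColumn (T k) (len s k)
  single : ∀ k, k < s.length → SingleCond n (cc (T k) (len s k)) (dd n (T k) (len s k))
  pair : ∀ k, k + 1 < s.length → PairCond n (cc (T k) (len s k)) (dd n (T k) (len s k))
    (cc (T (k + 1)) (len s (k + 1))) (dd n (T (k + 1)) (len s (k + 1)))

theorem mem_tableaux_iff {n : ℕ} {s : List ℕ} (hs : s.Pairwise (· ≤ ·)) {T : Tableau} :
    T ∈ tableaux n s ↔ IsGood n s T := by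
  constructor
  · rintro ⟨h, h1, h2, h3⟩
    have hcol : ∀ k, k < s.length → StrictColumn (T k) (len s k) := fun k hk => h.strictColumn hk
    refine ⟨h.off_shape, h.entries, hcol, fun k hk => ?_, fun k hk => ?_⟩
    · exact (oneColumn_iff (hcol k hk) (fun a ha => (h.entries k a hk ha).1)
        (fun a ha => (h.entries k a hk ha).2)).1 (h1 k hk)
    · exact (two_columns_iff (hcol k (by omega)) (hcol (k + 1) hk)
        (len_mono hs (Nat.le_succ k) hk) (fun a ha => (h.entries k a (by omega) ha).2)).1
        ⟨fun a ha => h.rows k a hk ha, h2 k hk, h3 k hk⟩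
  · intro h
    have key := fun k (hk : k + 1 < s.length) =>
      (two_columns_iff (h.columns k (by omega)) (h.columns (k + 1) hk)
        (len_mono hs (Nat.le_succ k) hk) (fun a ha => (h.entries k a (by omega) ha).2)).2
        (h.pair k hk)
    refine ⟨⟨h.off_shape, h.entries, fun k a hk ha => (key k hk).1 a ha,
      fun k a hk ha => h.columns k hk a ha⟩, fun k hk => ?_, fun k hk => (key k hk).2.1,
      fun k hk => (key k hk).2.2⟩
    exact (oneColumn_iff (h.columns k hk) (fun a ha => (h.entries k a hk ha).1)
        (fun a ha => (h.entries k a hk ha).2)).2 (h.single k hk)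

theorem col_iff_of_lt {n : ℕ} {i : Fin n} (hi : (i : ℕ) + 1 < n) (y : ℕ)
    (h2 : y < 2 * n) : (if y ≤ n then y else 2 * n - y) = (i : ℕ) + 1 ↔
      y = i + 1 ∨ y = 2 * n - 1 - i := by
  split_ifs <;> omega

theorem col_iff_of_eq {n : ℕ} {i : Fin n} (hi : (i : ℕ) + 1 = n) (y : ℕ)
    (h2 : y < 2 * n) : (if y ≤ n then y else 2 * n - y) = (i : ℕ) + 1 ↔ y = n := by
  split_ifs <;> omega

section

variable {n : ℕ} (hn : 3 ≤ n) {i : Fin n} {C : ℕ → ℕ} {N : ℕ} (h : StrictColumn C N)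
  (hm : ∀ a < N, 1 ≤ C a ∧ C a ≤ 2 * n)
include hn h hm

/-- For $i+1<n$ the colour labels the two arrows $i+1\to i+2$ and $\overline{i+2}\to\overline{i+1}$,
so a column has signs $+-+-$ at most. The truncated subtractions are the cancellations. -/
theorem survivors_letters_of_lt (hi : (i : ℕ) + 1 < n) :
    phiL ve vf i (letters C N) = occ C N (i + 1) - occ C N (i + 2) + ob n C N (i + 2) -
      ob n C N (i + 1) ∧
    epsL ve vf i (letters C N) = occ C N (i + 2) - occ C N (i + 1) +
      (ob n C N (i + 1) - (occ C N (i + 1) - occ C N (i + 2) + ob n C N (i + 2))) := by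
  have := (isLetterChain (N := 0) hn).survivors_four (i := i) (p := i + 1) (q := 2 * n - 1 - i)
    (by omega) (by omega) (by omega) (fun y _ => col_iff_of_lt hi y) (h.pairwise_letters le_rfl) (by
      intro y hy
      obtain ⟨a, ha, rfl⟩ := mem_letters.1 hy
      exact hm a ha)
  simp only [mult_letters] at this
  unfold phiL epsL ob
  rw [show 2 * n + 1 - (i + 2) = 2 * n - 1 - i by omega,
    show 2 * n + 1 - (i + 1) = 2 * n - 1 - i + 1 by omega]
  exact this

theorem survivors_up_of_lt (hi : (i : ℕ) + 1 < n) {a : ℕ} (ha : a < N) :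
    phiL ve vf i (upLetters C N a) =
      (if (i : ℕ) + 1 < C a then occ C N (i + 1) else 0) -
      (if (i : ℕ) + 2 < C a then occ C N (i + 2) else 0) +
      (if 2 * n - 1 - i < C a then ob n C N (i + 2) else 0) -
      (if 2 * n - i < C a then ob n C N (i + 1) else 0) ∧
    epsL ve vf i (upLetters C N a) =
      (if (i : ℕ) + 2 < C a then occ C N (i + 2) else 0) -
      (if (i : ℕ) + 1 < C a then occ C N (i + 1) else 0) +
      ((if 2 * n - i < C a then ob n C N (i + 1) else 0) -
      ((if (i : ℕ) + 1 < C a then occ C N (i + 1) else 0) -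
      (if (i : ℕ) + 2 < C a then occ C N (i + 2) else 0) +
      (if 2 * n - 1 - i < C a then ob n C N (i + 2) else 0))) := by
  have := (isLetterChain (N := 0) hn).survivors_four (i := i) (p := i + 1) (q := 2 * n - 1 - i)
    (by omega) (by omega) (by omega) (fun y _ => col_iff_of_lt hi y) (h.pairwise_upLetters a) (by
      intro y hy
      obtain ⟨b, hb, _, rfl⟩ := mem_upLetters.1 hy
      exact hm b hb)
  rw [show 2 * n - 1 - (i : ℕ) + 1 = 2 * n - i by omega] at this
  simp only [h.mult_upLetters ha] at this
  unfold phiL epsL ob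
  rw [show 2 * n + 1 - (i + 2) = 2 * n - 1 - i by omega,
    show 2 * n + 1 - (i + 1) = 2 * n - i by omega]
  exact this

theorem survivors_down_of_lt (hi : (i : ℕ) + 1 < n) {a : ℕ} (ha : a < N) :
    phiL ve vf i (letters C a) =
      (if C a < i + 1 then occ C N (i + 1) else 0) -
      (if C a < i + 2 then occ C N (i + 2) else 0) +
      (if C a < 2 * n - 1 - i then ob n C N (i + 2) else 0) -
      (if C a < 2 * n - i then ob n C N (i + 1) else 0) ∧
    epsL ve vf i (letters C a) =
      (if C a < i + 2 then occ C N (i + 2) else 0) -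
      (if C a < i + 1 then occ C N (i + 1) else 0) +
      ((if C a < 2 * n - i then ob n C N (i + 1) else 0) -
      ((if C a < i + 1 then occ C N (i + 1) else 0) -
      (if C a < i + 2 then occ C N (i + 2) else 0) +
      (if C a < 2 * n - 1 - i then ob n C N (i + 2) else 0))) := by
  have := (isLetterChain (N := 0) hn).survivors_four (i := i) (p := i + 1) (q := 2 * n - 1 - i)
    (by omega) (by omega) (by omega) (fun y _ => col_iff_of_lt hi y) (h.pairwise_letters ha.le) (by
      intro y hy
      obtain ⟨b, hb, rfl⟩ := mem_letters.1 hy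
      exact hm b (by omega))
  rw [show 2 * n - 1 - (i : ℕ) + 1 = 2 * n - i by omega] at this
  simp only [h.mult_downLetters ha] at this
  unfold phiL epsL ob
  rw [show 2 * n + 1 - (i + 2) = 2 * n - 1 - i by omega,
    show 2 * n + 1 - (i + 1) = 2 * n - i by omega]
  exact this

theorem survivors_of_eq (hi : (i : ℕ) + 1 = n) :
    phiL ve vf i (letters C N) = occ C N n - ob n C N n ∧
    epsL ve vf i (letters C N) = ob n C N n - occ C N n ∧
    ∀ a < N, phiL ve vf i (upLetters C N a) = (if n < C a then occ C N n else 0) -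
        (if n + 1 < C a then ob n C N n else 0) ∧
      epsL ve vf i (upLetters C N a) = (if n + 1 < C a then ob n C N n else 0) -
        (if n < C a then occ C N n else 0) ∧
      phiL ve vf i (letters C a) = (if C a < n then occ C N n else 0) -
        (if C a < n + 1 then ob n C N n else 0) ∧
      epsL ve vf i (letters C a) = (if C a < n + 1 then ob n C N n else 0) -
        (if C a < n then occ C N n else 0) := by
  have key := fun L => (isLetterChain (N := 0) hn).survivors_two (i := i) (p := n)
    (by omega) (by omega) (fun y _ => col_iff_of_eq hi y) (L := L)
  have e : 2 * n + 1 - n = n + 1 := by omega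
  unfold phiL epsL ob
  rw [e]
  have k1 := key (letters C N) (h.pairwise_letters le_rfl) (by
      intro y hy
      obtain ⟨a, ha, rfl⟩ := mem_letters.1 hy
      exact hm a ha)
  simp only [mult_letters] at k1
  refine ⟨k1.1, k1.2, fun a ha => ?_⟩
  have k2 := key (upLetters C N a) (h.pairwise_upLetters a) (by
      intro y hy
      obtain ⟨b, hb, _, rfl⟩ := mem_upLetters.1 hy
      exact hm b hb)
  have k3 := key (letters C a) (h.pairwise_letters ha.le) (by
      intro y hy
      obtain ⟨b, hb, rfl⟩ := mem_letters.1 hy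
      exact hm b (by omega))
  simp only [h.mult_upLetters ha, h.mult_downLetters ha] at k2 k3
  exact ⟨k2.1, k2.2, k3.1, k3.2⟩

end

/-- One step towards stability: it suffices to look at the column that is changed. -/
theorem IsGood.upd {n : ℕ} {s : List ℕ} {T : Tableau} (h : IsGood n s T) {k a y : ℕ}
    (hk : k < s.length) (ha : a < len s k) (hy : 1 ≤ y ∧ y ≤ 2 * n)
    (hcol : StrictColumn (T.upd (k, a) y k) (len s k))
    (hsingle : SingleCond n (cc (T.upd (k, a) y k) (len s k)) (dd n (T.upd (k, a) y k) (len s k)))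
    (hright : k + 1 < s.length → PairCond n (cc (T.upd (k, a) y k) (len s k))
      (dd n (T.upd (k, a) y k) (len s k))
      (cc (T (k + 1)) (len s (k + 1))) (dd n (T (k + 1)) (len s (k + 1))))
    (hleft : ∀ j, k = j + 1 → PairCond n (cc (T j) (len s j)) (dd n (T j) (len s j))
      (cc (T.upd (k, a) y k) (len s k)) (dd n (T.upd (k, a) y k) (len s k))) :
    IsGood n s (T.upd (k, a) y) where
  off_shape j b hjb := by
    rw [Tableau.upd_apply, if_neg, h.off_shape j b hjb]
    rintro ⟨⟩
    exact hjb ⟨hk, ha⟩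
  entries j b hj hb := by
    rw [Tableau.upd_apply]
    split_ifs
    · exact hy
    · exact h.entries j b hj hb
  columns j hj := by
    by_cases hjk : j = k
    · subst hjk; exact hcol
    · rw [Tableau.upd_ne _ _ _ hjk]; exact h.columns j hj
  single j hj := by
    by_cases hjk : j = k
    · subst hjk; exact hsingle
    · rw [Tableau.upd_ne _ _ _ hjk]; exact h.single j hj
  pair j hj := by
    by_cases hjk : j = k
    · subst hjk
      rw [Tableau.upd_ne _ _ _ (show j + 1 ≠ j by omega)]
      exact hright hj
    · rw [Tableau.upd_ne _ _ _ hjk]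
      by_cases hjk' : j + 1 = k
      · subst hjk'; exact hleft j rfl
      · rw [Tableau.upd_ne _ _ _ hjk']; exact h.pair j hj

/-- The rule is evaluated on the rest of the column and on the two neighbouring columns. The
resulting relations between occurrences of the four letters of colour $i+1$ are the hypotheses of
the preservation lemmas. There are three cases: an unbarred letter, a barred letter, and the arrow
$n\to\bar n$. -/
theorem IsGood.f_mem {n : ℕ} (hn : 3 ≤ n) {s : List ℕ} {T T' : Tableau} (h : IsGood n s T)
    {i : Fin n} (hf : (tabCrystal n s).f i T = some T') : IsGood n s T' := by
  obtain ⟨k, a, hact, hy1, hym, hcol, rfl⟩ := (isLetterChain (N := 0) hn).f_actsAt hf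
  obtain ⟨hk, ha, hup, hdown, hright, hleft⟩ := hact
  have hi := i.2
  have hC := h.columns k hk
  have hE : ∀ j, j < s.length → ∀ a < len s j, 1 ≤ T j a ∧ T j a ≤ 2 * n :=
    fun j hj a => h.entries j a hj
  have cC := counts (n := n) hC
  have hocc : occ (T k) (len s k) (T k a) = 1 := occ_eq_one_iff.2 ⟨a, ha, rfl⟩
  have hcnt := fun z => cnt_upd_raise (T := T) (k := k) (N := len s k) ha z
  rcases Nat.lt_or_ge ((i : ℕ) + 1) n with hin | hin
  · have hy := (col_iff_of_lt hin _ (by omega)).1 hcol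
    have eup := survivors_up_of_lt hn hC (hE k hk) hin ha
    have edown := survivors_down_of_lt hn hC (hE k hk) hin ha
    have own := fun j hj => survivors_letters_of_lt hn (h.columns j hj) (hE j hj) hin
    rcases hy with hy | hy
    · have hT : T k a = i + 1 := by omega
      rw [hT] at eup edown hocc
      simp (disch := omega) only [if_pos, if_neg, lt_irrefl, if_false] at eup edown
      have ho : occ (T k) (len s k) (i + 1) = 1 := hocc
      have he : ∀ z ≤ n, cc (T.upd (k, a) (T k a + 1) k) (len s k) z = cc (T k) (len s k) z + if z = i + 1 then 1 else 0 := fun z hz => by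
        unfold cc; rw [hcnt, hy]
      have hg : ∀ z ≤ n, dd n (T.upd (k, a) (T k a + 1) k) (len s k) z = dd n (T k) (len s k) z := fun z hz => by
        have := hcnt (2 * n - z)
        rw [if_neg (by omega), add_zero] at this
        exact this
      -- The letter $i+2$ would stand directly below the box, and its $-$ would cancel the $+$ at
      -- which $\tilde f$ acts.
      have hfree : occ (T k) (len s k) (i + 2) = 0 := by
        have t1 := cC.o_le (i + 1)
        have t2 := cC.o_le (i + 2)
        have t3 := cC.ō_le (i + 1)
        have t4 := cC.ō_le (i + 2)
        omega
      refine h.upd hk ha (by omega) (hC.upd_raise ha (by rw [hy, ← hfree])) ?_ (fun hk' => ?_) (fun j hj => ?_)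
      · exact (SingleCond.raise (h.single k hk) cC hin  he).congr
          (fun z hz => rfl) hg
      · have h1 := hright hk'
        have h2 := own (k + 1) hk'
        exact (PairCond.raise_left (h.pair k hk') cC (counts (h.columns (k + 1) hk')) hin
          (by omega) (by omega) (by omega) he).congr (fun z hz => rfl) hg (fun z hz => rfl) (fun z hz => rfl)
      · subst hj
        have h1 := hleft j rfl
        have h2 := own j (by omega)
        exact (PairCond.raise_right (h.pair j hk) (counts (h.columns j (by omega))) cC hin
          (by omega) he).congr (fun z hz => rfl) (fun z hz => rfl) (fun z hz => rfl) hg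
    · have hT : T k a = 2 * n - 1 - i := by omega
      rw [hT] at eup edown hocc
      simp (disch := omega) only [if_pos, if_neg, lt_irrefl, if_false] at eup edown
      have ho : ob n (T k) (len s k) (i + 2) = 1 := by
        rw [← hocc]; unfold ob; congr 1; omega
      have he : ∀ z ≤ n, dd n (T.upd (k, a) (T k a + 1) k) (len s k) z = dd n (T k) (len s k) z + if z = i + 1 then 1 else 0 := fun z hz => by
        unfold dd; rw [hcnt, hy]; congr 2; rw [eq_iff_iff]; omega
      have hg : ∀ z ≤ n, cc (T.upd (k, a) (T k a + 1) k) (len s k) z = cc (T k) (len s k) z := fun z hz => by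
        have := hcnt z
        rw [if_neg (by omega), add_zero] at this
        exact this
      have hfree : ob n (T k) (len s k) (i + 1) = 0 := by
        have t1 := cC.o_le (i + 1)
        have t2 := cC.o_le (i + 2)
        have t3 := cC.ō_le (i + 1)
        have t4 := cC.ō_le (i + 2)
        omega
      refine h.upd hk ha (by omega) (hC.upd_raise ha (by rw [hy, ← hfree]; unfold ob; congr 1; omega)) ?_ (fun hk' => ?_) (fun j hj => ?_)
      · exact (SingleCond.raise_bar (h.single k hk) cC hin (by omega) (by omega) (by omega) he).congr
          hg (fun z hz => rfl)
      · have h1 := hright hk'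
        have h2 := own (k + 1) hk'
        exact (PairCond.raise_left_bar (h.pair k hk') cC (counts (h.columns (k + 1) hk')) hin
          (by omega) (by omega) (by omega) (by omega) he).congr hg (fun z hz => rfl) (fun z hz => rfl) (fun z hz => rfl)
      · subst hj
        have h1 := hleft j rfl
        have h2 := own j (by omega)
        exact (PairCond.raise_right_bar (h.pair j hk) (counts (h.columns j (by omega))) cC hin
          (by omega) (by omega) (by omega) he).congr (fun z hz => rfl) (fun z hz => rfl) hg (fun z hz => rfl)
  · have hin : (i : ℕ) + 1 = n := by omega
    have hy := (col_iff_of_eq hin _ (by omega)).1 hcol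
    have eown := (survivors_of_eq hn hC (hE k hk) hin).2.2 a ha
    have own := fun j hj => survivors_of_eq hn (h.columns j hj) (hE j hj) hin
    have hT : T k a = n := by omega
    rw [hT] at eown hocc
    simp (disch := omega) only [if_pos, if_neg, lt_irrefl, if_false] at eown
    have ho : occ (T k) (len s k) n = 1 := by rw [← hocc]
    have he : ∀ z ≤ n, cc (T.upd (k, a) (T k a + 1) k) (len s k) z = cc (T k) (len s k) z + if z = n then 1 else 0 := fun z hz => by
      unfold cc; rw [hcnt, hy]
    have hg : ∀ z ≤ n, dd n (T.upd (k, a) (T k a + 1) k) (len s k) z = dd n (T k) (len s k) z + if z = n then 1 else 0 := fun z hz => by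
      unfold dd; rw [hcnt, hy]; congr 2; rw [eq_iff_iff]; omega
    have hfree : ob n (T k) (len s k) n = 0 := by omega
    refine h.upd hk ha (by omega) (hC.upd_raise ha (by rw [hy, ← hfree]; unfold ob; congr 1; omega)) ?_ (fun hk' => ?_) (fun j hj => ?_)
    · intro b hb
      have h1 := h.single k hk b hb
      have h2 := he b hb
      have h3 := hg b hb
      have h4 := he 0 (by omega)
      rw [if_neg (by omega)] at h4
      omega
    · have h1 := hright hk'
      have h2 := own (k + 1) hk'
      exact PairCond.raise_left_mid (h.pair k hk') cC (counts (h.columns (k + 1) hk')) (by omega)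
        ho (by omega) hfree he hg
    · subst hj
      have h1 := hleft j rfl
      have h2 := own j (by omega)
      exact PairCond.raise_right_mid (h.pair j hk) (counts (h.columns j (by omega))) cC (by omega)
        ho hfree (by omega) he hg

theorem IsGood.e_mem {n : ℕ} (hn : 3 ≤ n) {s : List ℕ} {T T' : Tableau} (h : IsGood n s T)
    {i : Fin n} (hf : (tabCrystal n s).e i T = some T') : IsGood n s T' := by
  obtain ⟨k, a, y, hact, hy1, hyT, hym, hcol, rfl⟩ := (isLetterChain (N := 0) hn).e_actsAt hf
  obtain ⟨hk, ha, hup, hdown, hright, hleft⟩ := hact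
  have hi := i.2
  have hC := h.columns k hk
  have hE : ∀ j, j < s.length → ∀ a < len s j, 1 ≤ T j a ∧ T j a ≤ 2 * n :=
    fun j hj a => h.entries j a hj
  have cC := counts (n := n) hC
  have hocc : occ (T k) (len s k) (T k a) = 1 := occ_eq_one_iff.2 ⟨a, ha, rfl⟩
  have hcnt := fun z => cnt_upd_lower (N := len s k) ha hyT z
  rcases Nat.lt_or_ge ((i : ℕ) + 1) n with hin | hin
  · have hy := (col_iff_of_lt hin _ (by omega)).1 hcol
    have eup := survivors_up_of_lt hn hC (hE k hk) hin ha
    have edown := survivors_down_of_lt hn hC (hE k hk) hin ha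
    have own := fun j hj => survivors_letters_of_lt hn (h.columns j hj) (hE j hj) hin
    rcases hy with hy | hy
    · have hT : T k a = i + 2 := by omega
      rw [hT] at eup edown hocc
      simp (disch := omega) only [if_pos, if_neg, lt_irrefl, if_false] at eup edown
      have ho : occ (T k) (len s k) (i + 2) = 1 := by
        rw [← hocc]
      have he : ∀ z ≤ n, cc (T k) (len s k) z = cc (T.upd (k, a) y k) (len s k) z + if z = i + 1 then 1 else 0 := fun z hz => by
        unfold cc; rw [hcnt, hy]
      have hg : ∀ z ≤ n, dd n (T.upd (k, a) y k) (len s k) z = dd n (T k) (len s k) z := fun z hz => by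
        have := hcnt (2 * n - z)
        rw [if_neg (by omega), add_zero] at this
        exact this.symm
      -- The letter $i+1$ would stand directly above the box, and its $+$ would cancel the $-$ at
      -- which $\tilde e$ acts.
      have hfree : occ (T k) (len s k) (i + 1) = 0 := by
        have t1 := cC.o_le (i + 1)
        have t2 := cC.o_le (i + 2)
        have t3 := cC.ō_le (i + 1)
        have t4 := cC.ō_le (i + 2)
        omega
      refine h.upd hk ha (by omega) (hC.upd_lower ha hyT (by rw [hy, ← hfree])) ?_ (fun hk' => ?_) (fun j hj => ?_)
      · exact (SingleCond.lower (h.single k hk) cC hin (by omega) (by omega) (by omega) he).congr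
          (fun z hz => rfl) hg
      · have h1 := hright hk'
        have h2 := own (k + 1) hk'
        exact (PairCond.lower_left (h.pair k hk') cC (counts (h.columns (k + 1) hk')) hin
          (by omega) (by omega) (by omega) he).congr (fun z hz => rfl) hg (fun z hz => rfl) (fun z hz => rfl)
      · subst hj
        have h1 := hleft j rfl
        have h2 := own j (by omega)
        exact (PairCond.lower_right (h.pair j hk) (counts (h.columns j (by omega))) cC hin
          (by omega) (by omega) (by omega) (by omega) he).congr (fun z hz => rfl) (fun z hz => rfl) (fun z hz => rfl) hg
    · have hT : T k a = 2 * n - i := by omega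
      rw [hT] at eup edown hocc
      simp (disch := omega) only [if_pos, if_neg, lt_irrefl, if_false] at eup edown
      have ho : ob n (T k) (len s k) (i + 1) = 1 := by
        rw [← hocc]; unfold ob; congr 1; omega
      have he : ∀ z ≤ n, dd n (T k) (len s k) z = dd n (T.upd (k, a) y k) (len s k) z + if z = i + 1 then 1 else 0 := fun z hz => by
        unfold dd; rw [hcnt, hy]; congr 2; rw [eq_iff_iff]; omega
      have hg : ∀ z ≤ n, cc (T.upd (k, a) y k) (len s k) z = cc (T k) (len s k) z := fun z hz => by
        have := hcnt z
        rw [if_neg (by omega), add_zero] at this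
        exact this.symm
      have hfree : ob n (T k) (len s k) (i + 2) = 0 := by
        have t1 := cC.o_le (i + 1)
        have t2 := cC.o_le (i + 2)
        have t3 := cC.ō_le (i + 1)
        have t4 := cC.ō_le (i + 2)
        omega
      refine h.upd hk ha (by omega) (hC.upd_lower ha hyT (by rw [hy, ← hfree]; unfold ob; congr 1; omega)) ?_ (fun hk' => ?_) (fun j hj => ?_)
      · exact (SingleCond.lower_bar (h.single k hk) cC hin  he).congr
          hg (fun z hz => rfl)
      · have h1 := hright hk'
        have h2 := own (k + 1) hk'
        exact (PairCond.lower_left_bar (h.pair k hk') cC (counts (h.columns (k + 1) hk')) hin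
          (by omega) (by omega) he).congr hg (fun z hz => rfl) (fun z hz => rfl) (fun z hz => rfl)
      · subst hj
        have h1 := hleft j rfl
        have h2 := own j (by omega)
        exact (PairCond.lower_right_bar (h.pair j hk) (counts (h.columns j (by omega))) cC hin
          (by omega) (by omega) (by omega) he).congr (fun z hz => rfl) (fun z hz => rfl) hg (fun z hz => rfl)
  · have hin : (i : ℕ) + 1 = n := by omega
    have hy := (col_iff_of_eq hin _ (by omega)).1 hcol
    have eown := (survivors_of_eq hn hC (hE k hk) hin).2.2 a ha
    have own := fun j hj => survivors_of_eq hn (h.columns j hj) (hE j hj) hin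
    have hT : T k a = n + 1 := by omega
    rw [hT] at eown hocc
    simp (disch := omega) only [if_pos, if_neg, lt_irrefl, if_false] at eown
    have ho : ob n (T k) (len s k) n = 1 := by rw [← hocc]; unfold ob; congr 1; omega
    have he : ∀ z ≤ n, cc (T k) (len s k) z = cc (T.upd (k, a) y k) (len s k) z + if z = n then 1 else 0 := fun z hz => by
      unfold cc; rw [hcnt, hy]
    have hg : ∀ z ≤ n, dd n (T k) (len s k) z = dd n (T.upd (k, a) y k) (len s k) z + if z = n then 1 else 0 := fun z hz => by
      unfold dd; rw [hcnt, hy]; congr 2; rw [eq_iff_iff]; omega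
    have hfree : occ (T k) (len s k) n = 0 := by omega
    refine h.upd hk ha (by omega) (hC.upd_lower ha hyT (by rw [hy, ← hfree])) ?_ (fun hk' => ?_) (fun j hj => ?_)
    · intro b hb
      have h1 := h.single k hk b hb
      have h2 := he b hb
      have h3 := hg b hb
      have h4 := he 0 (by omega)
      rw [if_neg (by omega)] at h4
      omega
    · have h1 := hright hk'
      have h2 := own (k + 1) hk'
      exact PairCond.lower_left_mid (h.pair k hk') cC (counts (h.columns (k + 1) hk')) (by omega)
        ho (by omega) hfree he hg
    · subst hj
      have h1 := hleft j rfl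
      have h2 := own j (by omega)
      exact PairCond.lower_right_mid (h.pair j hk) (counts (h.columns j (by omega))) cC (by omega)
        ho hfree (by omega) he hg

end TypeC

/-! ### Stability of the tableaux of type $A_n$ -/

namespace TypeA

/-- Tableaux with the condition on the rows expressed by the counting functions. -/
structure IsGood (n : ℕ) (s : List ℕ) (T : Tableau) : Prop where
  off_shape : ∀ k a, ¬ (k < s.length ∧ a < len s k) → T k a = 0
  entries : ∀ k a, k < s.length → a < len s k → 1 ≤ T k a ∧ T k a ≤ n + 1
  columns : ∀ k, k < s.length → StrictColumn (T k) (len s k)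
  rows : ∀ k, k + 1 < s.length → ∀ z, cnt (T k) (len s k) z ≤ cnt (T (k + 1)) (len s (k + 1)) z

theorem mem_tableaux_iff {n : ℕ} {s : List ℕ} (hs : s.Pairwise (· ≤ ·)) {T : Tableau} :
    T ∈ tableaux n s ↔ IsGood n s T := by
  constructor
  · intro h
    have h : IsReverseTableau (n + 1) s T := h
    exact ⟨h.off_shape, h.entries, fun k hk => h.strictColumn hk, fun k hk =>
      (rows_iff_cnt (h.strictColumn (by omega)) (h.strictColumn hk)
        (len_mono hs (Nat.le_succ k) hk)).1 fun a ha => h.rows k a hk ha⟩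
  · intro h
    exact ⟨h.off_shape, h.entries, fun k a hk ha =>
      (rows_iff_cnt (h.columns k (by omega)) (h.columns (k + 1) hk)
        (len_mono hs (Nat.le_succ k) hk)).2 (h.rows k hk) a ha, fun k a hk ha => h.columns k hk a ha⟩

/-- It suffices to look at the column that is changed. -/
theorem IsGood.upd {n : ℕ} {s : List ℕ} {T : Tableau} (h : IsGood n s T) {k a y : ℕ}
    (hk : k < s.length) (ha : a < len s k) (hy : 1 ≤ y ∧ y ≤ n + 1)
    (hcol : StrictColumn (T.upd (k, a) y k) (len s k))
    (hright : k + 1 < s.length → ∀ z, cnt (T.upd (k, a) y k) (len s k) z ≤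
      cnt (T (k + 1)) (len s (k + 1)) z)
    (hleft : ∀ j, k = j + 1 → ∀ z, cnt (T j) (len s j) z ≤ cnt (T.upd (k, a) y k) (len s k) z) :
    IsGood n s (T.upd (k, a) y) where
  off_shape j b hjb := by
    rw [Tableau.upd_apply, if_neg, h.off_shape j b hjb]
    rintro ⟨⟩
    exact hjb ⟨hk, ha⟩
  entries j b hj hb := by
    rw [Tableau.upd_apply]
    split_ifs
    · exact hy
    · exact h.entries j b hj hb
  columns j hj := by
    by_cases hjk : j = k
    · subst hjk; exact hcol
    · rw [Tableau.upd_ne _ _ _ hjk]; exact h.columns j hj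
  rows j hj := by
    by_cases hjk : j = k
    · subst hjk
      rw [Tableau.upd_ne _ _ _ (show j + 1 ≠ j by omega)]
      exact hright hj
    · rw [Tableau.upd_ne _ _ _ hjk]
      by_cases hjk' : j + 1 = k
      · subst hjk'; exact hleft j rfl
      · rw [Tableau.upd_ne _ _ _ hjk']; exact h.rows j hj

section

variable {n : ℕ} {i : Fin n} {C : ℕ → ℕ} {N : ℕ} (h : StrictColumn C N)
  (hm : ∀ a < N, 1 ≤ C a ∧ C a ≤ n + 1)
include h hm

theorem survivors_letters :
    phiL ve vf i (letters C N) = occ C N (i + 1) - occ C N (i + 2) ∧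
    epsL ve vf i (letters C N) = occ C N (i + 2) - occ C N (i + 1) ∧
    ∀ a < N, phiL ve vf i (upLetters C N a) = (if (i : ℕ) + 1 < C a then occ C N (i + 1) else 0) -
        (if (i : ℕ) + 2 < C a then occ C N (i + 2) else 0) ∧
      epsL ve vf i (upLetters C N a) = (if (i : ℕ) + 2 < C a then occ C N (i + 2) else 0) -
        (if (i : ℕ) + 1 < C a then occ C N (i + 1) else 0) ∧
      phiL ve vf i (letters C a) = (if C a < i + 1 then occ C N (i + 1) else 0) -
        (if C a < i + 2 then occ C N (i + 2) else 0) ∧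
      epsL ve vf i (letters C a) = (if C a < i + 2 then occ C N (i + 2) else 0) -
        (if C a < i + 1 then occ C N (i + 1) else 0) := by
  have hi := i.2
  have key := fun L => (isLetterChain (n := n) (N := 0)).survivors_two (i := i) (p := i + 1)
    (by omega) (by omega) (fun y _ _ => Iff.rfl) (L := L)
  unfold phiL epsL
  have k1 := key (letters C N) (h.pairwise_letters le_rfl) (by
      intro y hy
      obtain ⟨a, ha, rfl⟩ := mem_letters.1 hy
      exact hm a ha)
  simp only [mult_letters] at k1
  refine ⟨k1.1, k1.2, fun a ha => ?_⟩
  have k2 := key (upLetters C N a) (h.pairwise_upLetters a) (by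
      intro y hy
      obtain ⟨b, hb, _, rfl⟩ := mem_upLetters.1 hy
      exact hm b hb)
  have k3 := key (letters C a) (h.pairwise_letters ha.le) (by
      intro y hy
      obtain ⟨b, hb, rfl⟩ := mem_letters.1 hy
      exact hm b (by omega))
  simp only [h.mult_upLetters ha, h.mult_downLetters ha] at k2 k3
  exact ⟨k2.1, k2.2, k3.1, k3.2⟩

end

theorem IsGood.f_mem {n : ℕ} {s : List ℕ} {T T' : Tableau} (h : IsGood n s T)
    {i : Fin n} (hf : (tabCrystal n s).f i T = some T') : IsGood n s T' := by
  obtain ⟨k, a, hact, hy1, hym, hcol, rfl⟩ := (isLetterChain (n := n) (N := 0)).f_actsAt hf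
  obtain ⟨hk, ha, hup, hdown, hright, hleft⟩ := hact
  have hC := h.columns k hk
  have hE : ∀ j, j < s.length → ∀ a < len s j, 1 ≤ T j a ∧ T j a ≤ n + 1 :=
    fun j hj a => h.entries j a hj
  have hocc : occ (T k) (len s k) (T k a) = 1 := occ_eq_one_iff.2 ⟨a, ha, rfl⟩
  have hcnt := fun z => cnt_upd_raise (T := T) (k := k) (N := len s k) ha z
  have eown := (survivors_letters (i := i) hC (hE k hk)).2.2 a ha
  have own := fun j hj => survivors_letters (i := i) (h.columns j hj) (hE j hj)
  have hcol : T k a = i + 1 := hcol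
  rw [hcol] at eown hocc
  simp (disch := omega) only [if_pos, if_neg, lt_irrefl, if_false] at eown
  have hfree : occ (T k) (len s k) (i + 2) = 0 := by omega
  have s1 := hC.cnt_eq i
  have s2 := hC.cnt_eq (i + 1)
  refine h.upd hk ha (by omega) (hC.upd_raise ha (by rw [hcol, ← hfree])) (fun hk' z => ?_)
    (fun j hj z => ?_)
  · rw [hcnt]
    have h1 := hright hk'
    have h2 := own (k + 1) hk'
    have r := h.rows k hk'
    have r0 := r i
    have r2 := r (i + 2)
    have rz := r z
    have t1 := (h.columns (k + 1) hk').cnt_eq i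
    have t2 := (h.columns (k + 1) hk').cnt_eq (i + 1)
    rw [show (i : ℕ) + 1 + 1 = i + 2 from rfl] at t2 s2
    have t3 := occ_le_one (T (k + 1)) (len s (k + 1)) (i + 1)
    -- Only $z=i+1$ is critical. If $i+1$ does not occur in the right column, the comparison at $i$
    -- has the necessary slack. If it does, the signature rule forces $i+2$ to occur there too, and
    -- the comparison at $i+2$ suffices because $i+2$ is absent on the left.
    split_ifs with hz
    · subst hz
      rw [hcol] at rz ⊢
      omega
    · exact rz
  · subst hj
    rw [hcnt]
    exact (h.rows j hk z).trans (Nat.le_add_right _ _)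

theorem IsGood.e_mem {n : ℕ} {s : List ℕ} {T T' : Tableau} (h : IsGood n s T)
    {i : Fin n} (hf : (tabCrystal n s).e i T = some T') : IsGood n s T' := by
  obtain ⟨k, a, y, hact, hy1, hyT, hym, hcol, rfl⟩ := (isLetterChain (n := n) (N := 0)).e_actsAt hf
  obtain ⟨hk, ha, hup, hdown, hright, hleft⟩ := hact
  have hC := h.columns k hk
  have hE : ∀ j, j < s.length → ∀ a < len s j, 1 ≤ T j a ∧ T j a ≤ n + 1 :=
    fun j hj a => h.entries j a hj
  have hocc : occ (T k) (len s k) (T k a) = 1 := occ_eq_one_iff.2 ⟨a, ha, rfl⟩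
  have hcnt := fun z => cnt_upd_lower (N := len s k) ha hyT z
  have eown := (survivors_letters (i := i) hC (hE k hk)).2.2 a ha
  have own := fun j hj => survivors_letters (i := i) (h.columns j hj) (hE j hj)
  obtain rfl : y = i + 1 := hcol
  rw [hyT] at eown hocc
  simp (disch := omega) only [if_pos, if_neg, lt_irrefl, if_false] at eown
  have hfree : occ (T k) (len s k) (i + 1) = 0 := by omega
  have hocc : occ (T k) (len s k) (i + 2) = 1 := hocc
  have s1 := hC.cnt_eq i
  have s2 := hC.cnt_eq (i + 1)
  refine h.upd hk ha (by omega) (hC.upd_lower ha hyT hfree) (fun hk' z => ?_) (fun j hj z => ?_)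
  · have := hcnt z
    exact le_trans (by omega) (h.rows k hk' z)
  · subst hj
    have hz' := hcnt z
    have h1 := hleft j rfl
    have h2 := own j (by omega)
    have r := h.rows j hk
    have r0 := r i
    have r2 := r (i + 2)
    have rz := r z
    have t1 := (h.columns j (by omega)).cnt_eq i
    have t2 := (h.columns j (by omega)).cnt_eq (i + 1)
    rw [show (i : ℕ) + 1 + 1 = i + 2 from rfl] at t2 s2
    have t3 := occ_le_one (T j) (len s j) (i + 1)
    split_ifs at hz' with hz
    · subst hz
      omega
    · omega

end TypeA

/-! ## The highest weight tableau -/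

/-- The tableau with the columns `1, 2, …, i_k`. -/
def topTableau (s : List ℕ) : Tableau := fun k a =>
  if k < s.length ∧ a < len s k then len s k - a else 0

theorem topTableau_of_lt {s : List ℕ} {k a : ℕ} (hk : k < s.length) (ha : a < len s k) :
    topTableau s k a = len s k - a := if_pos ⟨hk, ha⟩

/-- The columns to the right of column `k`, from right to left. -/
def laterColumns (s : List ℕ) (k : ℕ) : List ℕ :=
  (List.range (s.length - (k + 1))).reverse.map fun j => k + 1 + j

theorem mem_laterColumns {s : List ℕ} {k j : ℕ} :
    j ∈ laterColumns s k ↔ k < j ∧ j < s.length := by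
  simp only [laterColumns, List.mem_map, List.mem_reverse, List.mem_range]
  constructor
  · rintro ⟨i, hi, rfl⟩; omega
  · rintro ⟨h1, h2⟩; exact ⟨j - (k + 1), by omega, by omega⟩

theorem boxes_eq_later {s : List ℕ} {k a : ℕ} (hk : k < s.length) (ha : a < len s k) :
    ∃ l, boxes s = ((laterColumns s k).flatMap (colBoxes s) ++ (upBoxes s k a ++ [(k, a)])) ++ l := by
  refine ⟨downBoxes k a ++ (List.range k).reverse.flatMap (colBoxes s), ?_⟩
  change (List.range s.length).reverse.flatMap (colBoxes s) = _
  have hcol : colBoxes s k = upBoxes s k a ++ (k, a) :: downBoxes k a := by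
    unfold colBoxes
    rw [range_reverse_split ha]
    simp [upBoxes, downBoxes, Function.comp_def]
  rw [range_reverse_split hk, List.flatMap_append, List.flatMap_cons, hcol]
  simp [laterColumns]

theorem sum_map_range_reverse (f : ℕ → ℤ) (N : ℕ) :
    ((List.range N).reverse.map f).sum = ∑ x ∈ Finset.range N, f x := by
  rw [List.map_reverse, List.sum_reverse]
  induction N with
  | zero => simp
  | succ N ih => simp [List.range_succ, Finset.sum_range_succ, ih]

section

variable {n m : ℕ} {A : Fin n → Fin n → ℤ} {col : ℕ → ℕ} {ve vf : Fin n → ℕ → Option ℕ}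
  {vwt : ℕ → Fin n → ℤ} (h : IsLetterChain n m A col ve vf vwt) (hnm : n < m)
  (hcol : ∀ x ≤ n, col x = x)
include h hnm hcol

/-- The weight of a column with the letters `1, …, M`. -/
theorem IsLetterChain.sum_vwt (j : Fin n) {M : ℕ} (hM : M ≤ n) :
    ∑ x ∈ Finset.range M, vwt (x + 1) j = if M = j + 1 then 1 else 0 := by
  induction M with
  | zero => simp
  | succ M ih =>
    rw [Finset.sum_range_succ, ih (by omega), h.vwt_eq _ _ (by omega) (by omega), hcol _ hM,
      Nat.add_sub_cancel, hcol M (by omega)]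
    split_ifs <;> omega

theorem IsLetterChain.sum_vwt_rev (j : Fin n) {M N : ℕ} (hM : M ≤ n) (hN : N ≤ M) :
    ∑ x ∈ Finset.range N, vwt (N - x) j = if N = j + 1 then 1 else 0 := by
  rw [← h.sum_vwt hnm hcol j (hN.trans hM), ← Finset.sum_range_reflect]
  refine Finset.sum_congr rfl fun x hx => ?_
  have := Finset.mem_range.1 hx
  congr 2; omega

theorem IsLetterChain.colBoxes_sum {s : List ℕ} {T : Tableau} {k : ℕ}
    (hs : len s k ≤ n) (hT : ∀ a < len s k, T k a = len s k - a) (j : Fin n) :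
    ((colBoxes s k).map fun x => vwt (T x.1 x.2) j).sum = if len s k = j + 1 then 1 else 0 := by
  rw [colBoxes, List.map_map, sum_map_range_reverse, ← h.sum_vwt_rev hnm hcol j le_rfl hs]
  · refine Finset.sum_congr rfl fun x hx => ?_
    simp [hT x (Finset.mem_range.1 hx)]

/-- Where a tableau annihilated by all `e_i` first differs from the highest weight tableau. -/
theorem IsLetterChain.first_difference {s : List ℕ} (hs : ∀ k < s.length, len s k ≤ n)
    {T : Tableau} (hT : ∀ x ∈ boxes s, 1 ≤ T x.1 x.2 ∧ T x.1 x.2 ≤ m)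
    (heps : ∀ i, (tableauCrystal n ve vf vwt s).eps i T = 0) {k a : ℕ}
    (hk : k < s.length) (ha : a < len s k)
    (hlater : ∀ k', k < k' → k' < s.length → ∀ a < len s k', T k' a = len s k' - a)
    (hup : ∀ b, a < b → b < len s k → T k b = len s k - b) (h2 : 2 ≤ T k a) :
    (∃ k', k < k' ∧ k' < s.length ∧ len s k' = col (T k a - 1)) ∨
      len s k - a - 1 = col (T k a - 1) := by
  have hTm : 1 ≤ T k a ∧ T k a ≤ m := hT _ (mem_boxes.2 ⟨hk, ha⟩)
  have hcm := h.col_mem (T k a - 1) (by omega) (by omega)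
  obtain ⟨j, hj⟩ : ∃ j : Fin n, col (T k a - 1) = j + 1 :=
    ⟨⟨col (T k a - 1) - 1, by omega⟩, by simp; omega⟩
  by_contra hcon
  push Not at hcon
  obtain ⟨l, hl⟩ := boxes_eq_later hk ha
  set l₁ := (laterColumns s k).flatMap (colBoxes s) ++ (upBoxes s k a ++ [(k, a)]) with hl₁
  -- No $-$ survives in the whole word, hence none in an initial segment. Up to the box in question,
  -- a complete column $1,\dots,M$ has weight $\omega_M$, and so has an upper part $1,\dots,M$; the
  -- entry itself contributes $-1$. Some $\omega_M$ must make up for it.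
  have hnet : 0 ≤ net (boxWord ve vf j T l₁) := by
    have e0 : (survivors Sgn.minus (boxWord ve vf j T (boxes s))).length = 0 := heps j
    rw [hl, boxWord_append, (length_survivors_append _ _).1] at e0
    rw [← length_survivors_sub]
    omega
  rw [h.net_boxWord j (fun x hx => hT x (by rw [hl]; exact List.mem_append_left _ hx)), hl₁,
    List.map_append, List.map_append, List.sum_append, List.sum_append] at hnet
  have e1 : (((laterColumns s k).flatMap (colBoxes s)).map fun x => vwt (T x.1 x.2) j).sum = 0 := by
    have : ∀ L : List ℕ, (∀ k' ∈ L, k < k' ∧ k' < s.length) →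
        ((L.flatMap (colBoxes s)).map fun x => vwt (T x.1 x.2) j).sum = 0 := by
      intro L
      induction L with
      | nil => simp
      | cons k' L ih =>
        intro hL
        have hk' := hL k' (by simp)
        rw [List.flatMap_cons, List.map_append, List.sum_append,
          ih fun i hi => hL i (by simp [hi]),
          h.colBoxes_sum hnm hcol (hs k' hk'.2) (hlater k' hk'.1 hk'.2), if_neg]
        · rfl
        · have := hcon.1 k' hk'.1 hk'.2
          omega
    exact this _ fun k' hk' => mem_laterColumns.1 hk'
  have e2 : ((upBoxes s k a).map fun x => vwt (T x.1 x.2) j).sum = 0 := by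
    rw [upBoxes, List.map_map, sum_map_range_reverse]
    rw [show (0 : ℤ) = if len s k - (a + 1) = (j : ℕ) + 1 then 1 else 0 by
      rw [if_neg]; have := hcon.2; omega]
    rw [← h.sum_vwt_rev hnm hcol j (hs k hk) (show len s k - (a + 1) ≤ len s k by omega)]
    refine Finset.sum_congr rfl fun x hx => ?_
    have := Finset.mem_range.1 hx
    simp only [Function.comp_apply]
    rw [hup _ (by omega) (by omega)]
    congr 1; omega
  have e3 : vwt (T k a) j = -1 := by
    rw [h.vwt_eq _ _ hTm.1 hTm.2]
    have h3 : ¬ (T k a < m ∧ col (T k a) = j + 1) := by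
      rintro ⟨h3, h4⟩
      have := h.col_ne (T k a - 1) (by omega) (by omega)
      rw [Nat.sub_add_cancel hTm.1] at this
      omega
    rw [if_neg h3, if_pos ⟨h2, hj⟩]
    rfl
  simp only [e1, e2, List.map_cons, List.map_nil, List.sum_cons, List.sum_nil, e3] at hnet
  omega

theorem IsLetterChain.wt_topTableau {s : List ℕ} (hs : ∀ k < s.length, len s k ≤ n) (j : Fin n) :
    (tableauCrystal n ve vf vwt s).wt (topTableau s) j = s.count ((j : ℕ) + 1) := by
  change ((boxes s).map fun x => vwt (topTableau s x.1 x.2) j).sum = _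
  have key : ∀ t ≤ s.length, ((((List.range t).reverse.flatMap (colBoxes s))).map
      fun x => vwt (topTableau s x.1 x.2) j).sum = (s.take t).count ((j : ℕ) + 1) := by
    intro t
    induction t with
    | zero => simp
    | succ t ih =>
      intro ht
      rw [List.range_succ, List.reverse_append, List.flatMap_append, List.map_append,
        List.sum_append, ih (by omega), List.take_add_one, List.count_append,
        List.getElem?_eq_getElem (by omega)]
      simp only [List.reverse_cons, List.reverse_nil, List.nil_append, List.flatMap_cons,
        List.flatMap_nil, List.append_nil, Option.toList_some]
      rw [h.colBoxes_sum hnm hcol (hs t (by omega)) fun a ha => topTableau_of_lt (by omega) ha]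
      have e : len s t = s[t] := by unfold len; rw [List.getD_eq_getElem _ _ (by omega)]
      rw [e, List.count_singleton]
      push_cast
      simp only [beq_iff_eq]
      ring
  have := key s.length le_rfl
  rwa [List.take_length] at this

omit hcol hnm in
/-- A stable set of tableaux with a unique element annihilated by all `e_i` is generated by it. -/
theorem IsLetterChain.isGeneratedBy {s : List ℕ} {S : Set Tableau}
    (hcr : IsCrystal A (tableauCrystal n ve vf vwt s) S) {u : Tableau} (hu : u ∈ S)
    (huniq : ∀ T ∈ S, (∀ i, (tableauCrystal n ve vf vwt s).eps i T = 0) → T = u)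
    {w : Fin n → ℕ} (hw : ∀ j, (tableauCrystal n ve vf vwt s).wt u j = w j) :
    IsGeneratedBy (tableauCrystal n ve vf vwt s) S u w := by
  refine ⟨hw, fun T => ⟨fun hT => ?_, fun hT => ?_⟩⟩
  -- Each $\tilde e_i$ lowers one entry by one, so the sum of the entries bounds the number of steps
  -- up to an element killed by all $\tilde e_i$.
  · induction hN : ((boxes s).map fun x => T x.1 x.2).sum using Nat.strong_induction_on
      generalizing T with
    | _ N ih =>
      by_cases h0 : ∀ i, (tableauCrystal n ve vf vwt s).eps i T = 0
      · rw [huniq T hT h0]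
      · push Not at h0
        obtain ⟨i, hi⟩ := h0
        have hne := (hcr.e_eq_none T hT i).not.2 hi
        obtain ⟨T', hT'⟩ := Option.ne_none_iff_exists'.1 hne
        have hmem := hcr.e_mem T hT i T' hT'
        refine Relation.ReflTransGen.tail (ih _ ?_ T' hmem rfl)
          ⟨i, (hcr.f_iff_e T' hmem T hT i).2 hT'⟩
        rw [h.e_eq_some_iff] at hT'
        obtain ⟨l₁, x, l₂, y, e, h1, h2, hy, rfl, -, -⟩ := hT'
        rw [h.ve_iff] at hy
        have c1 : ∀ l : List (ℕ × ℕ), x ∉ l → (l.map fun z => T.upd x y z.1 z.2) =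
            l.map fun z => T z.1 z.2 := fun l hl => List.map_congr_left fun z hz => by
          rw [Tableau.upd_apply, if_neg]
          rintro rfl; exact hl hz
        rw [← hN, e]
        rw [List.map_append, List.map_cons, List.sum_append, List.sum_cons, List.map_append,
          List.map_cons, List.sum_append, List.sum_cons, c1 l₁ h1, c1 l₂ h2, Tableau.upd_apply,
          if_pos rfl]
        omega
  · induction hT with
    | refl => exact hu
    | tail _ h ih => obtain ⟨i, hi⟩ := h; exact hcr.f_mem _ ih i _ hi

end

/-- Induction over the boxes of a tableau in the order of `boxes`. -/
theorem eq_topTableau {s : List ℕ} {T : Tableau}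
    (hoff : ∀ k a, ¬ (k < s.length ∧ a < len s k) → T k a = 0)
    (step : ∀ k a, k < s.length → a < len s k →
      (∀ k', k < k' → k' < s.length → ∀ a < len s k', T k' a = len s k' - a) →
      (∀ b, a < b → b < len s k → T k b = len s k - b) → T k a = len s k - a) :
    T = topTableau s := by
  have key : ∀ d k, k < s.length → s.length - k = d → ∀ a < len s k, T k a = len s k - a := by
    intro d
    induction d using Nat.strong_induction_on with
    | _ d ih =>
      intro k hk hd
      have key2 : ∀ c a, a < len s k → len s k - a = c → T k a = len s k - a := by
        intro c
        induction c using Nat.strong_induction_on with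
        | _ c ih2 =>
          intro a ha hc
          exact step k a hk ha (fun k' h1 h2 => ih _ (by omega) k' h2 rfl)
            fun b h1 h2 => ih2 _ (by omega) b h2 rfl
      exact fun a ha => key2 _ a ha rfl
  funext k a
  by_cases hka : k < s.length ∧ a < len s k
  · rw [topTableau_of_lt hka.1 hka.2]; exact key _ k hka.1 rfl a hka.2
  · rw [hoff k a hka, topTableau, if_neg hka]

theorem topTableau_isReverseTableau {m : ℕ} {s : List ℕ} (hs : s.Pairwise (· ≤ ·))
    (hm : ∀ k < s.length, len s k ≤ m) : IsReverseTableau m s (topTableau s) where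
  off_shape k a h := if_neg h
  entries k a hk ha := by
    have := hm k hk
    rw [topTableau_of_lt hk ha]; omega
  rows k a hk ha := by
    have := len_mono hs (Nat.le_succ k) hk
    rw [Nat.succ_eq_add_one] at this
    rw [topTableau_of_lt (by omega) ha, topTableau_of_lt hk (by omega)]; omega
  columns k a hk ha := by
    rw [topTableau_of_lt hk ha, topTableau_of_lt hk (by omega)]; omega

/-! ### The tableaux of both types as highest weight crystals -/

namespace TypeA

theorem tableaux_isCrystal {n N : ℕ} {s : List ℕ} (hs : s.Pairwise (· ≤ ·)) :
    IsCrystal ((patternA n N).classicalCartan n) (tabCrystal n s) (tableaux n s) :=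
  (isLetterChain (n := n) (N := N)).isCrystal
    (fun T hT x hx => by
      obtain ⟨k, a⟩ := x
      obtain ⟨hk, ha⟩ := mem_boxes.1 hx
      exact ((mem_tableaux_iff hs).1 hT).entries k a hk ha)
    (fun T hT i T' h => (mem_tableaux_iff hs).2 (((mem_tableaux_iff hs).1 hT).e_mem h))
    (fun T hT i T' h => (mem_tableaux_iff hs).2 (((mem_tableaux_iff hs).1 hT).f_mem h))

/-- At the first wrong box the entry exceeds its minimal value, and minus one it would be the length
of a later column. The row condition bounds it by an entry of the next column, which is already
known and too small. -/
theorem tableaux_isGeneratedBy {n : ℕ} {s : List ℕ} (hs : s.Pairwise (· ≤ ·))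
    (hn : ∀ k < s.length, len s k ≤ n) :
    IsGeneratedBy (tabCrystal n s) (tableaux n s) (topTableau s)
      (fun j => s.count ((j : ℕ) + 1)) := by
  have chain := isLetterChain (n := n) (N := 0)
  refine chain.isGeneratedBy (tableaux_isCrystal (N := 0) hs)
    (topTableau_isReverseTableau hs fun k hk => (hn k hk).trans (Nat.le_succ n)) ?_
    (fun j => chain.wt_topTableau (by omega) (fun _ _ => rfl) hn j)
  intro T hT heps
  have hT : IsReverseTableau (n + 1) s T := hT
  refine eq_topTableau hT.off_shape fun k a hk ha hlater hup => ?_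
  have hlow := (hT.strictColumn hk).lower (fun a ha => (hT.entries k a hk ha).1) ha
  by_contra hne
  rcases chain.first_difference (by omega) (fun _ _ => rfl) hn
    (fun x hx => hT.entries _ _ (mem_boxes.1 hx).1 (mem_boxes.1 hx).2) heps hk ha hlater hup
    (by omega) with ⟨k', h1, h2, h3⟩ | h3
  · have r := hT.rows k a (by omega) ha
    have l1 := len_mono hs (show k ≤ k + 1 by omega) (by omega)
    have l2 := len_mono hs (show k + 1 ≤ k' by omega) h2
    rw [hlater (k + 1) (by omega) (by omega) a (by omega)] at r
    omega
  · omega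

end TypeA

namespace TypeC

theorem tableaux_isCrystal {n N : ℕ} (hn : 3 ≤ n) {s : List ℕ} (hs : s.Pairwise (· ≤ ·)) :
    IsCrystal ((patternC n N).classicalCartan n) (tabCrystal n s) (tableaux n s) :=
  (isLetterChain (n := n) (N := N) hn).isCrystal
    (fun T hT x hx => by
      obtain ⟨k, a⟩ := x
      obtain ⟨hk, ha⟩ := mem_boxes.1 hx
      exact ((mem_tableaux_iff hs).1 hT).entries k a hk ha)
    (fun T hT i T' h => (mem_tableaux_iff hs).2 (((mem_tableaux_iff hs).1 hT).e_mem hn h))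
    (fun T hT i T' h => (mem_tableaux_iff hs).2 (((mem_tableaux_iff hs).1 hT).f_mem hn h))

theorem topTableau_mem {n : ℕ} {s : List ℕ} (hs : s.Pairwise (· ≤ ·))
    (hn : ∀ k < s.length, len s k ≤ n) : topTableau s ∈ tableaux n s := by
  have hle : ∀ k a, k < s.length → topTableau s k a ≤ n := fun k a hk => by
    have := hn k hk
    unfold topTableau
    split_ifs <;> omega
  refine ⟨topTableau_isReverseTableau hs fun k hk => (hn k hk).trans (by omega), ?_, ?_, ?_⟩
  · intro k hk p q a _ _ _ _ _ h
    have := hle k q hk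
    unfold bar at h; omega
  · intro k hk p q a _ _ _ _ _ h
    have := hle (k + 1) q hk
    unfold bar at h; omega
  · intro k hk p q a _ _ _ _ _ h
    have := hle (k + 1) q hk
    unfold bar at h; omega

/-- Besides the possibility treated for $A_n$, the wrong entry might be the bar of the letter
immediately above it; this is what (1CC) excludes. -/
theorem tableaux_isGeneratedBy {n : ℕ} (h3 : 3 ≤ n) {s : List ℕ} (hs : s.Pairwise (· ≤ ·))
    (hn : ∀ k < s.length, len s k ≤ n) :
    IsGeneratedBy (tabCrystal n s) (tableaux n s) (topTableau s)
      (fun j => s.count ((j : ℕ) + 1)) := by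
  have chain := isLetterChain (n := n) (N := 0) h3
  have hcol : ∀ x ≤ n, (if x ≤ n then x else 2 * n - x) = x := fun x hx => if_pos hx
  refine chain.isGeneratedBy (tableaux_isCrystal (N := 0) h3 hs) (topTableau_mem hs hn) ?_
    (fun j => chain.wt_topTableau (by omega) hcol hn j)
  rintro T ⟨hT, h1cc, -, -⟩ heps
  refine eq_topTableau hT.off_shape fun k a hk ha hlater hup => ?_
  have hlow := (hT.strictColumn hk).lower (fun a ha => (hT.entries k a hk ha).1) ha
  by_contra hne
  have hent := hT.entries k a hk ha
  have hr : k + 1 < s.length → T k a ≤ len s (k + 1) - a := fun hk' => by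
    have r := hT.rows k a hk' ha
    have l1 := len_mono hs (show k ≤ k + 1 by omega) (by omega)
    rwa [hlater (k + 1) (by omega) (by omega) a (by omega)] at r
  rcases chain.first_difference (by omega) hcol hn
    (fun x hx => hT.entries _ _ (mem_boxes.1 hx).1 (mem_boxes.1 hx).2) heps hk ha hlater hup
    (by omega) with ⟨k', h1, h2, h3⟩ | h3
  · have r := hr (by omega)
    have l2 := len_mono hs (show k + 1 ≤ k' by omega) h2
    have := hn k' h2
    split_ifs at h3 <;> omega
  -- The arrow into the entry has the colour of the last correct letter above. An unbarred entry
  -- would be the minimal one, so the entry is the bar of that letter. If there is no letter above,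
  -- the colour would be $0$.
  · have hbar : T k a = 2 * n + 1 - (len s k - a - 1) ∧ n < T k a := by
      split_ifs at h3 <;> omega
    by_cases ha1 : a + 1 < len s k
    · have h4 := hup (a + 1) (by omega) ha1
      have := hn k hk
      have := h1cc k hk (a + 1) a (len s k - a - 1) (by omega) ha1 (by omega) (by omega)
        (by omega) (by unfold bar; omega)
      omega
    · have := chain.col_mem (T k a - 1) (by omega) (by omega)
      omega

end TypeC

/-! ## The sequence of a dominant integral weight -/

theorem omegas_pairwise {n : ℕ} (w : Fin n → ℕ) : (omegas w).Pairwise (· ≤ ·) := by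
  unfold omegas
  rw [List.pairwise_flatMap]
  refine ⟨fun j _ => ?_, ?_⟩
  · rw [List.pairwise_replicate]; right; exact le_rfl
  · refine (List.pairwise_lt_finRange n).imp fun {i j} hij x hx y hy => ?_
    rw [List.eq_of_mem_replicate hx, List.eq_of_mem_replicate hy]
    have : (i : ℕ) < j := hij
    omega

theorem mem_omegas {n : ℕ} {w : Fin n → ℕ} {x : ℕ} (hx : x ∈ omegas w) : 1 ≤ x ∧ x ≤ n := by
  unfold omegas at hx
  rw [List.mem_flatMap] at hx
  obtain ⟨j, _, h⟩ := hx
  rw [List.eq_of_mem_replicate h]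
  have := j.2
  omega

theorem len_omegas {n : ℕ} {w : Fin n → ℕ} {k : ℕ} (hk : k < (omegas w).length) :
    1 ≤ len (omegas w) k ∧ len (omegas w) k ≤ n := by
  unfold len
  rw [List.getD_eq_getElem _ _ hk]
  exact mem_omegas (List.getElem_mem hk)

theorem count_omegas {n : ℕ} (w : Fin n → ℕ) (j : Fin n) :
    (omegas w).count ((j : ℕ) + 1) = w j := by
  unfold omegas
  rw [List.count_flatMap]
  have : (List.count ((j : ℕ) + 1) ∘ fun i : Fin n => List.replicate (w i) ((i : ℕ) + 1)) =
      fun i => if i = j then w j else 0 := by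
    funext i
    simp only [Function.comp_apply, List.count_replicate, beq_iff_eq]
    by_cases hij : i = j
    · simp [hij]
    · rw [if_neg, if_neg hij]
      intro h; exact hij (Fin.ext (by omega))
  rw [this, ← Fin.sum_univ_def]
  simp

/-! ## Columns of walls and boxes of tableaux -/

theorem start_succ {s : List ℕ} {k : ℕ} (hk : k < s.length) :
    start s (k + 1) = start s k + len s k := by
  unfold start len
  rw [List.sum_take_succ _ _ hk, List.getD_eq_getElem _ _ hk]

theorem start_length (s : List ℕ) : start s s.length = s.sum := by
  unfold start; rw [List.take_length]

theorem start_mono {s : List ℕ} {j k : ℕ} (hjk : j ≤ k) (hk : k ≤ s.length) :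
    start s j ≤ start s k := by
  induction k, hjk using Nat.le_induction with
  | base => exact le_rfl
  | succ k _ ih => rw [start_succ (by omega)]; exact (ih (by omega)).trans (Nat.le_add_right _ _)

theorem start_add_lt {s : List ℕ} {k a : ℕ} (hk : k < s.length) (ha : a < len s k) :
    start s k + a < s.sum := by
  rw [← start_length]
  have := start_mono (s := s) (show k + 1 ≤ s.length from hk) le_rfl
  rw [start_succ hk] at this
  omega

theorem start_inj {s : List ℕ} {k a k' a' : ℕ} (hk : k < s.length) (ha : a < len s k)
    (hk' : k' < s.length) (ha' : a' < len s k') (h : start s k + a = start s k' + a') :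
    k = k' ∧ a = a' := by
  rcases Nat.lt_trichotomy k k' with hlt | rfl | hlt
  · have := start_mono (s := s) (show k + 1 ≤ k' from hlt) hk'.le
    rw [start_succ hk] at this
    omega
  · exact ⟨rfl, by omega⟩
  · have := start_mono (s := s) (show k' + 1 ≤ k from hlt) hk.le
    rw [start_succ hk'] at this
    omega

theorem range_start (s : List ℕ) {t : ℕ} (ht : t ≤ s.length) : (List.range (start s t)).reverse =
    ((List.range t).reverse.flatMap (colBoxes s)).map fun x => start s x.1 + x.2 := by
  induction t with
  | zero => simp [start]
  | succ t ih =>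
    rw [start_succ (by omega), List.range_add, List.reverse_append, ih (by omega), List.range_succ]
    simp [colBoxes, List.map_reverse, Function.comp_def]

/-- Columns of a wall are numbered from the right but read from the left, and the parts are arranged
in the opposite order to the columns of the tableau; both objects are therefore traversed in the
same order. -/
theorem range_sum_reverse (s : List ℕ) : (List.range s.sum).reverse =
    (boxes s).map fun x => start s x.1 + x.2 := by
  rw [← start_length, range_start s le_rfl]; rfl

theorem exists_box {s : List ℕ} {c : ℕ} (hc : c < s.sum) :
    ∃ k a, k < s.length ∧ a < len s k ∧ c = start s k + a := by
  have : c ∈ (List.range s.sum).reverse := by simpa using hc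
  rw [range_sum_reverse, List.mem_map] at this
  obtain ⟨⟨k, a⟩, hx, rfl⟩ := this
  exact ⟨k, a, (mem_boxes.1 hx).1, (mem_boxes.1 hx).2, rfl⟩

/-! ## Deleting adjacent cancelling signs -/

/-- Here `q a` is the $-$ and `p a` the $+$ of row `a`. The pairs to be deleted consist of the $+$
of row $a+1$ and the $-$ of row $a$, so they straddle consecutive indices; the induction carries
along the unmatched $+$ of the row above. -/
theorem sameSurvivors_delete {α : Type} (p q : ℕ → List (Sgn × α)) (del : ℕ → Prop)
    [DecidablePred del] (h : ∀ a, del a → SameSurvivors (p (a + 1) ++ q a) []) (N : ℕ) :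
    SameSurvivors ((if 0 < N ∧ del (N - 1) then p N else []) ++
        (List.range N).reverse.flatMap fun a => q a ++ p a)
      ((List.range N).reverse.flatMap fun a =>
        (if del a then [] else q a) ++ (if 0 < a ∧ del (a - 1) then [] else p a)) := by
  induction N with
  | zero => intro s; rfl
  | succ N ih =>
    rw [List.range_succ, List.reverse_append, List.flatMap_append, List.flatMap_append]
    simp only [List.reverse_cons, List.reverse_nil, List.nil_append, List.flatMap_cons,
      List.flatMap_nil, List.append_nil, Nat.add_sub_cancel, Nat.succ_pos, true_and]
    set X := (List.range N).reverse.flatMap fun a => q a ++ p a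
    set Y := (List.range N).reverse.flatMap fun a =>
      (if del a then [] else q a) ++ (if 0 < a ∧ del (a - 1) then [] else p a)
    have h1 : SameSurvivors (p N ++ X) ((if 0 < N ∧ del (N - 1) then [] else p N) ++ Y) := by
      split_ifs at ih ⊢ with h0
      · exact ih
      · exact SameSurvivors.append (fun _ => rfl) ih
    have h2 : SameSurvivors ((if del N then p (N + 1) else []) ++ q N)
        (if del N then [] else q N) := by
      split_ifs with h0
      · exact h N h0
      · intro s; rfl
    have := h2.append h1
    simpa [List.append_assoc] using this

/-! ## The sign word of a wall -/

theorem flatMap_congr' {α β : Type} {l : List α} {f g : α → List β} (h : ∀ a ∈ l, f a = g a) :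
    l.flatMap f = l.flatMap g := by
  induction l with
  | nil => rfl
  | cons a l ih =>
    rw [List.flatMap_cons, List.flatMap_cons, h a (by simp), ih fun b hb => h b (by simp [hb])]

theorem SameSurvivors.symm {α : Type} {u v : List (Sgn × α)} (h : SameSurvivors u v) :
    SameSurvivors v u := fun t => (h t).symm

theorem filter_eq_of_iff {α : Type} [DecidableEq α] {L : List α} (hL : L.Nodup) {p : α → Bool}
    {b : α} {Q : Prop} [Decidable Q] (hb : Q → b ∈ L) (h : ∀ x ∈ L, p x = true ↔ x = b ∧ Q) :
    L.filter p = if Q then [b] else [] := by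
  split_ifs with hQ
  · have : L.filter p = L.filter (fun x => x == b) := by
      refine List.filter_congr fun x hx => ?_
      rw [Bool.eq_iff_iff, h x hx]; simp [hQ]
    rw [this, List.filter_beq, List.count_eq_one_of_mem hL (hb hQ)]
    rfl
  · rw [List.filter_eq_nil_iff]
    intro x hx hp
    exact hQ ((h x hx).1 hp).2

namespace WallPattern

theorem mem_places {Y : Finset Block} {k : ℕ} {b : Block} :
    b ∈ places Y k ↔ b.1 = k ∧ b.2.1 < bound Y := by
  obtain ⟨c, r, σ⟩ := b
  simp only [places, List.mem_flatMap, List.mem_range, List.mem_cons, List.not_mem_nil, or_false,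
    Prod.mk.injEq]
  constructor
  · rintro ⟨r', h, ⟨rfl, rfl, rfl⟩ | ⟨rfl, rfl, rfl⟩⟩ <;> exact ⟨rfl, h⟩
  · rintro ⟨rfl, h⟩
    exact ⟨r, h, by cases σ <;> simp⟩

theorem nodup_places (Y : Finset Block) (k : ℕ) : (places Y k).Nodup := by
  unfold places
  rw [List.nodup_flatMap]
  refine ⟨fun r _ => by simp, List.nodup_range.imp ?_⟩
  intro r r' hr b hb hb'
  simp only [List.mem_cons, List.not_mem_nil, or_false] at hb hb'
  rcases hb with rfl | rfl <;> rcases hb' with h | h <;> simp at h <;> exact hr h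

theorem lt_bound_of_mem {Y : Finset Block} {b : Block} (h : b ∈ Y) :
    b.1 + 1 < bound Y ∧ b.2.1 + 1 < bound Y := by
  have := Finset.le_sup (f := fun b : Block => max b.1 b.2.1) h
  unfold bound
  simp only [sup_le_iff] at this
  omega

end WallPattern

/-- All entries of `X` in boxes of the shape lie in `1, …, m`. -/
def Entries (m : ℕ) (s : List ℕ) (X : Tableau) : Prop :=
  ∀ k a, k < s.length → a < len s k → 1 ≤ X k a ∧ X k a ≤ m

/-- All columns of `X` are strict. -/
def Strict (s : List ℕ) (X : Tableau) : Prop := ∀ k < s.length, StrictColumn (X k) (len s k)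

theorem strict_lower_iff {s : List ℕ} {X : Tableau} (hX : Strict s X) {k a : ℕ} (hk : k < s.length)
    (ha : a < len s k) (h2 : 2 ≤ X k a) : Strict s (X.upd (k, a) (X k a - 1)) ↔
      ¬ (a + 1 < len s k ∧ X k (a + 1) + 1 = X k a) := by
  constructor
  · rintro h ⟨h3, h4⟩
    have := h k hk a h3
    rw [Tableau.upd_eq, Tableau.upd_eq, if_pos rfl, if_neg (by omega)] at this
    omega
  · intro h j hj
    by_cases hjk : j = k
    · subst hjk
      intro b hb
      rw [Tableau.upd_eq, Tableau.upd_eq]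
      have h1 := hX j hj b hb
      split_ifs with h2 h3 h3
      · omega
      · subst h2; omega
      · subst h3
        by_contra hlt
        exact h ⟨hb, by omega⟩
      · exact h1
    · rw [Tableau.upd_ne _ _ _ hjk]; exact hX j hj

theorem strict_raise_iff {s : List ℕ} {X : Tableau} (hX : Strict s X) {k a : ℕ} (hk : k < s.length)
    (ha : a < len s k) : Strict s (X.upd (k, a) (X k a + 1)) ↔
      ¬ (0 < a ∧ X k a + 1 = X k (a - 1)) := by
  constructor
  · rintro h ⟨h3, h4⟩
    have := h k hk (a - 1) (by omega)
    rw [Nat.sub_add_cancel h3, Tableau.upd_eq, Tableau.upd_eq, if_pos rfl, if_neg (by omega)] at this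
    omega
  · intro h j hj
    by_cases hjk : j = k
    · subst hjk
      intro b hb
      rw [Tableau.upd_eq, Tableau.upd_eq]
      have h1 := hX j hj b hb
      split_ifs with h2 h3 h3
      · omega
      · subst h2
        by_contra hlt
        exact h ⟨by omega, by rw [Nat.add_sub_cancel]; omega⟩
      · subst h3; omega
      · exact h1
    · rw [Tableau.upd_ne _ _ _ hjk]; exact hX j hj

theorem Entries.upd {m : ℕ} {s : List ℕ} {X : Tableau} (h : Entries m s X) {x : ℕ × ℕ} {y : ℕ}
    (h1 : 1 ≤ y) (h2 : y ≤ m) : Entries m s (X.upd x y) := by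
  intro k a hk ha
  rw [Tableau.upd_apply]
  split_ifs
  · exact ⟨h1, h2⟩
  · exact h k a hk ha

/-- `St Y X` says that every column of the wall `Y` represents the corresponding entry of `X`. The
wall is built, over a fixed wall, by blocks that are placed at `place k a u`, `1 ≤ u < X k a`. -/
structure WallModel (n m : ℕ) (s : List ℕ) (P : WallPattern) (col : ℕ → ℕ)
    (place : ℕ → ℕ → ℕ → Block) (St : Finset Block → Tableau → Prop) : Prop where
  slot_exists : ∀ r, ∃ σ ∈ P.slots r, ∀ c, P.ground (c, r, σ) = false
  ground_eq : ∀ c c' r σ, P.ground (c, r, σ) = P.ground (c', r, σ)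
  place_fst : ∀ k a u, (place k a u).1 = start s k + a
  color_removable : ∀ Y X, St Y X → Entries m s X → ∀ k a, k < s.length → a < len s k →
    2 ≤ X k a → place k a (X k a - 1) ∈ Y → P.color (place k a (X k a - 1)) = col (X k a - 1)
  color_admissible : ∀ Y X, St Y X → Entries m s X → ∀ k a, k < s.length → a < len s k →
    X k a < m → P.color (place k a (X k a)) = col (X k a)
  proper_iff : ∀ Y X, St Y X → Entries m s X → (P.IsProper Y ↔ Strict s X)
  removable_top : ∀ Y X c b, St Y X → Entries m s X → 1 ≤ c → P.IsRemovable c Y b →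
    ∃ k a, k < s.length ∧ a < len s k ∧ 2 ≤ X k a ∧ b = place k a (X k a - 1)
  admissible_top : ∀ Y X c b, St Y X → Entries m s X → 1 ≤ c → P.IsAdmissible c Y b →
    ∃ k a, k < s.length ∧ a < len s k ∧ X k a < m ∧ b = place k a (X k a)
  mem_place : ∀ Y X, St Y X → Entries m s X → Strict s X → ∀ k a, k < s.length → a < len s k →
    2 ≤ X k a → ¬ (a + 1 < len s k ∧ X k (a + 1) + 1 = X k a) → place k a (X k a - 1) ∈ Y
  not_mem_place : ∀ Y X, St Y X → Entries m s X → ∀ k a, k < s.length → a < len s k →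
    X k a < m → place k a (X k a) ∉ Y
  st_erase : ∀ Y X, St Y X → Entries m s X → ∀ k a, k < s.length → a < len s k → 2 ≤ X k a →
    place k a (X k a - 1) ∈ Y → St (Y.erase (place k a (X k a - 1))) (X.upd (k, a) (X k a - 1))
  st_insert : ∀ Y X, St Y X → Entries m s X → ∀ k a, k < s.length → a < len s k → X k a < m →
    place k a (X k a) ∉ Y → St (insert (place k a (X k a)) Y) (X.upd (k, a) (X k a + 1))

/-- The block that is removed or added when the entry in a box is changed. -/
def topBlock (place : ℕ → ℕ → ℕ → Block) (X : Tableau) (t : Sgn) (x : ℕ × ℕ) : Block :=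
  if t = Sgn.minus then place x.1 x.2 (X x.1 x.2 - 1) else place x.1 x.2 (X x.1 x.2)

namespace WallModel

variable {n m : ℕ} {s : List ℕ} {P : WallPattern} {col : ℕ → ℕ}
  {place : ℕ → ℕ → ℕ → Block} {St : Finset Block → Tableau → Prop}
  (M : WallModel n m s P col place St)
include M

/-- A slot that can be filled has an added block to its right or below it, unless it is in column
$0$ or row $0$; so it exceeds the existing blocks by at most one in either direction. -/
theorem lt_bound_of_admissible {c : ℕ} {Y : Finset Block} {b : Block}
    (h : P.IsAdmissible c Y b) : b.1 < WallPattern.bound Y ∧ b.2.1 < WallPattern.bound Y := by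
  obtain ⟨h1, -, h2, -⟩ := h
  obtain ⟨h3, h4, h5, h6⟩ := h2 b (Finset.mem_insert_self _ _)
  have h0 : 2 ≤ WallPattern.bound Y := by unfold WallPattern.bound; omega
  constructor
  · rcases Nat.eq_zero_or_pos b.1 with hb | hb
    · omega
    · rcases h6 (by omega) with h7 | h7
      · rw [M.ground_eq (b.1 - 1) b.1] at h7
        rw [show (b.1, b.2.1, b.2.2) = b from rfl] at h7
        rw [h3] at h7; exact absurd h7 (by simp)
      · rcases Finset.mem_insert.1 h7 with h8 | h8
        · have := congrArg Prod.fst h8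
          simp only at this; omega
        · have := (WallPattern.lt_bound_of_mem h8).1
          simp only at this; omega
  · rcases Nat.eq_zero_or_pos b.2.1 with hb | hb
    · omega
    · obtain ⟨σ, hσ, hg⟩ := M.slot_exists (b.2.1 - 1)
      rcases h5 (by omega) σ hσ with h7 | h7
      · rw [hg] at h7; exact absurd h7 (by simp)
      · rcases Finset.mem_insert.1 h7 with h8 | h8
        · have := congrArg (fun b : Block => b.2.1) h8
          simp only at this; omega
        · have := (WallPattern.lt_bound_of_mem h8).2
          simp only at this; omega

/-- Removing the top block of a column lowers the corresponding letter, and the wall stays proper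
exactly if the column of letters stays strict, that is, if the next smaller letter is not directly
above. -/
theorem removable_iff {Y : Finset Block} {X : Tableau} (h : St Y X) (hE : Entries m s X)
    (hX : Strict s X) {c : ℕ} (hc : 1 ≤ c) {b : Block} : P.IsRemovable c Y b ↔
    ∃ k a, k < s.length ∧ a < len s k ∧ b = place k a (X k a - 1) ∧ 2 ≤ X k a ∧
      col (X k a - 1) = c ∧ ¬ (a + 1 < len s k ∧ X k (a + 1) + 1 = X k a) := by
  constructor
  · intro hr
    obtain ⟨k, a, hk, ha, h2, rfl⟩ := M.removable_top Y X c b h hE hc hr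
    obtain ⟨hm, hcol, hp⟩ := hr
    have hXm := hE k a hk ha
    rw [M.color_removable Y X h hE k a hk ha h2 hm] at hcol
    have := (M.proper_iff _ _ (M.st_erase Y X h hE k a hk ha h2 hm)
      (hE.upd (by omega) (by omega))).1 hp
    exact ⟨k, a, hk, ha, rfl, h2, hcol, (strict_lower_iff hX hk ha h2).1 this⟩
  · rintro ⟨k, a, hk, ha, rfl, h2, hcol, hdel⟩
    have hXm := hE k a hk ha
    have hm := M.mem_place Y X h hE hX k a hk ha h2 hdel
    refine ⟨hm, by rw [M.color_removable Y X h hE k a hk ha h2 hm, hcol], ?_⟩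
    exact (M.proper_iff _ _ (M.st_erase Y X h hE k a hk ha h2 hm)
      (hE.upd (by omega) (by omega))).2 ((strict_lower_iff hX hk ha h2).2 hdel)

theorem admissible_iff {Y : Finset Block} {X : Tableau} (h : St Y X) (hE : Entries m s X)
    (hX : Strict s X) {c : ℕ} (hc : 1 ≤ c) {b : Block} : P.IsAdmissible c Y b ↔
    ∃ k a, k < s.length ∧ a < len s k ∧ b = place k a (X k a) ∧ X k a < m ∧
      col (X k a) = c ∧ ¬ (0 < a ∧ X k a + 1 = X k (a - 1)) := by
  constructor
  · intro hr
    obtain ⟨k, a, hk, ha, h2, rfl⟩ := M.admissible_top Y X c b h hE hc hr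
    obtain ⟨hm, hcol, hp⟩ := hr
    have hXm := hE k a hk ha
    rw [M.color_admissible Y X h hE k a hk ha h2] at hcol
    have := (M.proper_iff _ _ (M.st_insert Y X h hE k a hk ha h2 hm)
      (hE.upd (by omega) (by omega))).1 hp
    exact ⟨k, a, hk, ha, rfl, h2, hcol, (strict_raise_iff hX hk ha).1 this⟩
  · rintro ⟨k, a, hk, ha, rfl, h2, hcol, hdel⟩
    have hXm := hE k a hk ha
    have hm := M.not_mem_place Y X h hE k a hk ha h2
    refine ⟨hm, by rw [M.color_admissible Y X h hE k a hk ha h2, hcol], ?_⟩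
    exact (M.proper_iff _ _ (M.st_insert Y X h hE k a hk ha h2 hm)
      (hE.upd (by omega) (by omega))).2 ((strict_raise_iff hX hk ha).2 hdel)

/-- The signs of the column of a box that are not cancelled within the part. -/
theorem columnSigns_eq {Y : Finset Block} {X : Tableau} (h : St Y X) (hE : Entries m s X)
    (hX : Strict s X) {c : ℕ} (hc : 1 ≤ c) {k a : ℕ} (hk : k < s.length) (ha : a < len s k) :
    P.columnSigns c Y (start s k + a) =
      (if 2 ≤ X k a ∧ col (X k a - 1) = c ∧ ¬ (a + 1 < len s k ∧ X k (a + 1) + 1 = X k a)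
        then [(Sgn.minus, place k a (X k a - 1))] else []) ++
      (if X k a < m ∧ col (X k a) = c ∧ ¬ (0 < a ∧ X k a + 1 = X k (a - 1))
        then [(Sgn.plus, place k a (X k a))] else []) := by
  unfold WallPattern.columnSigns
  rw [filter_eq_of_iff (b := place k a (X k a - 1))
      (Q := 2 ≤ X k a ∧ col (X k a - 1) = c ∧ ¬ (a + 1 < len s k ∧ X k (a + 1) + 1 = X k a))
      (WallPattern.nodup_places Y _),
    filter_eq_of_iff (b := place k a (X k a))
      (Q := X k a < m ∧ col (X k a) = c ∧ ¬ (0 < a ∧ X k a + 1 = X k (a - 1)))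
      (WallPattern.nodup_places Y _)]
  · congr 1 <;> split_ifs <;> rfl
  · intro hQ
    rw [WallPattern.mem_places]
    exact ⟨M.place_fst k a _, (M.lt_bound_of_admissible
      ((M.admissible_iff h hE hX hc).2 ⟨k, a, hk, ha, rfl, hQ⟩)).2⟩
  · intro b hb
    rw [decide_eq_true_iff, M.admissible_iff h hE hX hc]
    constructor
    · rintro ⟨k', a', hk', ha', rfl, hQ⟩
      have := (WallPattern.mem_places.1 hb).1
      rw [M.place_fst] at this
      obtain ⟨rfl, rfl⟩ := start_inj hk' ha' hk ha this
      exact ⟨rfl, hQ⟩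
    · rintro ⟨rfl, hQ⟩
      exact ⟨k, a, hk, ha, rfl, hQ⟩
  · intro hQ
    rw [WallPattern.mem_places]
    have := (WallPattern.lt_bound_of_mem ((M.removable_iff h hE hX hc).2 ⟨k, a, hk, ha, rfl, hQ⟩).1).2
    exact ⟨M.place_fst k a _, by omega⟩
  · intro b hb
    rw [decide_eq_true_iff, M.removable_iff h hE hX hc]
    constructor
    · rintro ⟨k', a', hk', ha', rfl, hQ⟩
      have := (WallPattern.mem_places.1 hb).1
      rw [M.place_fst] at this
      obtain ⟨rfl, rfl⟩ := start_inj hk' ha' hk ha this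
      exact ⟨rfl, hQ⟩
    · rintro ⟨rfl, hQ⟩
      exact ⟨k, a, hk, ha, rfl, hQ⟩

theorem columnSigns_eq_nil {Y : Finset Block} {X : Tableau} (h : St Y X) (hE : Entries m s X)
    (hX : Strict s X) {c : ℕ} (hc : 1 ≤ c) {l : ℕ}
    (hl : s.sum ≤ l ∨ WallPattern.bound Y ≤ l) : P.columnSigns c Y l = [] := by
  unfold WallPattern.columnSigns
  rw [List.append_eq_nil_iff, List.map_eq_nil_iff, List.map_eq_nil_iff, List.filter_eq_nil_iff,
    List.filter_eq_nil_iff]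
  refine ⟨fun b hb hr => ?_, fun b hb hr => ?_⟩
  · rw [decide_eq_true_iff] at hr
    have h1 := (WallPattern.lt_bound_of_mem hr.1).1
    have h2 := (WallPattern.mem_places.1 hb).1
    obtain ⟨k, a, hk, ha, rfl, -⟩ := (M.removable_iff h hE hX hc).1 hr
    have h3 := start_add_lt hk ha
    rw [M.place_fst] at h1 h2
    omega
  · rw [decide_eq_true_iff] at hr
    have h1 := (M.lt_bound_of_admissible hr).1
    have h2 := (WallPattern.mem_places.1 hb).1
    obtain ⟨k, a, hk, ha, rfl, -⟩ := (M.admissible_iff h hE hX hc).1 hr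
    have h3 := start_add_lt hk ha
    rw [M.place_fst] at h1 h2
    omega

theorem word_eq {Y : Finset Block} {X : Tableau} (h : St Y X) (hE : Entries m s X)
    (hX : Strict s X) {c : ℕ} (hc : 1 ≤ c) :
    P.word c Y = (boxes s).flatMap fun x => P.columnSigns c Y (start s x.1 + x.2) := by
  have key : ∀ K K', K ≤ K' → (∀ l, K ≤ l → P.columnSigns c Y l = []) →
      (List.range K').reverse.flatMap (P.columnSigns c Y) =
        (List.range K).reverse.flatMap (P.columnSigns c Y) := by
    intro K K' hKK hnil
    induction K', hKK using Nat.le_induction with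
    | base => rfl
    | succ K' hK ih => simp [List.range_succ, ih, hnil K' hK]
  have h1 := key _ _ (le_max_left (WallPattern.bound Y) s.sum) fun l hl =>
    M.columnSigns_eq_nil h hE hX hc (Or.inr hl)
  have h2 := key _ _ (le_max_right (WallPattern.bound Y) s.sum) fun l hl =>
    M.columnSigns_eq_nil h hE hX hc (Or.inl hl)
  unfold WallPattern.word
  rw [← h1, h2, range_sum_reverse, List.flatMap_map]

section

variable {A : Fin n → Fin n → ℤ} {ve vf : Fin n → ℕ → Option ℕ} {vwt : ℕ → Fin n → ℤ}
  (chain : IsLetterChain n m A col ve vf vwt)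
include chain

/-- The sign word of a wall and that of the tableau have the same surviving signs. -/
theorem survivors_word {Y : Finset Block} {X : Tableau} (h : St Y X) (hE : Entries m s X)
    (hX : Strict s X) (i : Fin n) (t : Sgn) : survivors t (P.word (i + 1) Y) =
      (survivors t (boxWord ve vf i X (boxes s))).map (topBlock place X t) := by
  rw [← survivors_map t (topBlock place X),
    M.word_eq h hE hX (Nat.succ_pos _)]
  have hve : ∀ k a, k < s.length → a < len s k → ((ve i (X k a)).isSome ↔
      2 ≤ X k a ∧ col (X k a - 1) = i + 1) := by
    intro k a hk ha
    have := hE k a hk ha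
    rw [Option.isSome_iff_exists]
    constructor
    · rintro ⟨y, hy⟩
      rw [chain.ve_iff] at hy
      obtain ⟨h1, h2, h3, h4⟩ := hy
      rw [h2, Nat.add_sub_cancel]
      exact ⟨by omega, h4⟩
    · rintro ⟨h1, h2⟩
      exact ⟨X k a - 1, (chain.ve_iff _ _ _).2 ⟨by omega, by omega, this.2, h2⟩⟩
  have hvf : ∀ k a, k < s.length → a < len s k → ((vf i (X k a)).isSome ↔
      X k a < m ∧ col (X k a) = i + 1) := by
    intro k a hk ha
    have := hE k a hk ha
    rw [Option.isSome_iff_exists]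
    constructor
    · rintro ⟨y, hy⟩
      rw [chain.vf_iff] at hy
      exact ⟨by omega, hy.2.2.2⟩
    · rintro ⟨h1, h2⟩
      exact ⟨X k a + 1, (chain.vf_iff _ _ _).2 ⟨this.1, rfl, by omega, h2⟩⟩
  refine SameSurvivors.symm ?_ t
  rw [boxWord, List.map_flatMap]
  unfold boxes
  rw [List.flatMap_assoc, List.flatMap_assoc]
  refine SameSurvivors.flatMap fun k hk => ?_
  have hk : k < s.length := by simpa using hk
  rw [List.flatMap_map, List.flatMap_map]
  have key := sameSurvivors_delete
    (fun a => if (vf i (X k a)).isSome then [(Sgn.plus, place k a (X k a))] else [])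
    (fun a => if (ve i (X k a)).isSome then [(Sgn.minus, place k a (X k a - 1))] else [])
    (fun a => a + 1 < len s k ∧ X k (a + 1) + 1 = X k a)
    (fun a hdel => by
      -- If rows $a+1$ and $a$ contain $y$ and $y+1$, then the arrow $y\to y+1$ gives both or
      -- neither of the signs. The wall shows neither, because performing one of the changes would
      -- produce two equal letters.
      have hiff : (vf i (X k (a + 1))).isSome ↔ (ve i (X k a)).isSome := by
        rw [hve k a hk (by omega), hvf k (a + 1) hk hdel.1]
        have h1 := hE k a hk (by omega)
        have h2 := hE k (a + 1) hk hdel.1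
        rw [show X k a - 1 = X k (a + 1) by omega]
        constructor
        · exact fun h => ⟨by omega, h.2⟩
        · exact fun h => ⟨by omega, h.2⟩
      by_cases h0 : (ve i (X k a)).isSome
      · simp only [if_pos h0, if_pos (hiff.2 h0)]
        exact sameSurvivors_cancel _ _ []
      · simp only [if_neg h0, if_neg (hiff.not.2 h0)]
        intro t; rfl) (len s k)
  rw [if_neg (by omega), List.nil_append] at key
  convert key using 1
  · refine flatMap_congr' fun a ha => ?_
    simp only [letterSigns, List.map_append]
    congr 1 <;> split_ifs <;> simp [topBlock]
  · refine flatMap_congr' fun a ha => ?_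
    have ha : a < len s k := by simpa using ha
    rw [M.columnSigns_eq h hE hX (Nat.succ_pos _) hk ha]
    congr 1
    · by_cases h1 : a + 1 < len s k ∧ X k (a + 1) + 1 = X k a
      · rw [if_neg (by tauto), if_pos h1]
      · rw [if_neg h1]
        refine if_congr ?_ rfl rfl
        rw [hve k a hk ha]; tauto
    · have e : (0 < a ∧ X k a + 1 = X k (a - 1)) ↔
          (0 < a ∧ a - 1 + 1 < len s k ∧ X k (a - 1 + 1) + 1 = X k (a - 1)) := by
        constructor
        · rintro ⟨h1, h2⟩; rw [Nat.sub_add_cancel h1]; exact ⟨h1, ha, h2⟩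
        · rintro ⟨h1, h2, h3⟩; rw [Nat.sub_add_cancel h1] at h3; exact ⟨h1, h3⟩
      by_cases h1 : 0 < a ∧ X k a + 1 = X k (a - 1)
      · rw [if_neg (by tauto), if_pos (e.1 h1)]
      · rw [if_neg (e.not.1 h1)]
        refine if_congr ?_ rfl rfl
        rw [hvf k a hk ha]; tauto

end

end WallModel

/-! ## From tableaux to walls -/

/-- The map `W` is a bijection from the tableaux to the walls with inverse `toT`, and it intertwines
the operators because corresponding survivors label corresponding changes. All crystal axioms and
generation are then transported from the tableaux. -/
theorem WallModel.crystal_walls {n m : ℕ} {s : List ℕ} {P : WallPattern} {col : ℕ → ℕ}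
    {place : ℕ → ℕ → ℕ → Block} {St : Finset Block → Tableau → Prop}
    (M : WallModel n m s P col place St) {ve vf : Fin n → ℕ → Option ℕ} {vwt : ℕ → Fin n → ℤ}
    (chain : IsLetterChain n m (P.classicalCartan n) col ve vf vwt) {tabs : Set Tableau}
    {walls : Set (Finset Block)} {u : Tableau} {w : Fin n → ℕ}
    (htab : IsCrystal (P.classicalCartan n) (tableauCrystal n ve vf vwt s) tabs)
    (hgen : IsGeneratedBy (tableauCrystal n ve vf vwt s) tabs u w)
    (W : Tableau → Finset Block) (toT : Finset Block → Tableau)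
    (hE : ∀ T ∈ tabs, Entries m s T) (hS : ∀ T ∈ tabs, Strict s T)
    (hW : ∀ T ∈ tabs, ∀ Y, St Y T ↔ Y = W T)
    (hmem : ∀ T ∈ tabs, W T ∈ walls) (hsurj : ∀ Y ∈ walls, ∃ T ∈ tabs, Y = W T)
    (hleft : ∀ T ∈ tabs, toT (W T) = T)
    (hwt : ∀ T ∈ tabs, P.weight n (W T) = (tableauCrystal n ve vf vwt s).wt T) :
    IsCrystal (P.classicalCartan n) (P.crystal n) walls ∧
      IsGeneratedBy (P.crystal n) walls (W u) w ∧
      IsCrystal (P.classicalCartan n) (tableauCrystal n ve vf vwt s) tabs ∧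
      IsCrystalIso (P.crystal n) walls (tableauCrystal n ve vf vwt s) tabs toT := by
  have hWT := fun T hT => (hW T hT _).2 rfl
  have hsurv := fun T hT i t => M.survivors_word chain (hWT T hT) (hE T hT) (hS T hT) i t
  have heps : ∀ T ∈ tabs, ∀ i, (P.crystal n).eps i (W T) =
      (tableauCrystal n ve vf vwt s).eps i T := fun T hT i => by
    change (survivors Sgn.minus (P.word (i + 1) (W T))).length = _
    rw [hsurv T hT, List.length_map]; rfl
  have hphi : ∀ T ∈ tabs, ∀ i, (P.crystal n).phi i (W T) =
      (tableauCrystal n ve vf vwt s).phi i T := fun T hT i => by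
    change (survivors Sgn.plus (P.word (i + 1) (W T))).length = _
    rw [hsurv T hT, List.length_map]; rfl
  have he : ∀ T ∈ tabs, ∀ i, (P.crystal n).e i (W T) =
      ((tableauCrystal n ve vf vwt s).e i T).map W := fun T hT i => by
    change Option.map (fun b => (W T).erase b) (survivors Sgn.minus (P.word (i + 1) (W T))).getLast?
      = Option.map W (Option.map (fun x => T.upd x ((ve i (T x.1 x.2)).getD 0))
        (survivors Sgn.minus (boxWord ve vf i T (boxes s))).getLast?)
    rw [hsurv T hT, List.getLast?_map]
    have hst : (tableauCrystal n ve vf vwt s).e i T =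
      Option.map (fun x => T.upd x ((ve i (T x.1 x.2)).getD 0))
        (survivors Sgn.minus (boxWord ve vf i T (boxes s))).getLast? := rfl
    cases hx : (survivors Sgn.minus (boxWord ve vf i T (boxes s))).getLast? with
    | none => rfl
    | some x =>
      obtain ⟨k, a⟩ := x
      rw [hx, Option.map_some] at hst
      obtain ⟨hbox, hv, -⟩ := mem_boxWord ve vf (mem_of_mem_survivors (List.mem_of_getLast? hx))
      obtain ⟨hk, ha⟩ := mem_boxes.1 hbox
      obtain ⟨y, hy⟩ := Option.isSome_iff_exists.1 (hv rfl)
      rw [hy, Option.getD_some] at hst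
      have hmem' := htab.e_mem T hT i _ hst
      rw [chain.ve_iff] at hy
      have hy1 : y = T k a - 1 := by have := hy.2.1; simp only at this; omega
      have h2 : 2 ≤ T k a := by have := hy.2.1; simp only at this; omega
      subst hy1
      -- Stability of the tableaux makes the lowered column strict, so the block is indeed present,
      -- and its removal yields the unique wall of the new tableau.
      have hdel := (strict_lower_iff (hS T hT) hk ha h2).1 (hS _ hmem')
      have hpl := M.mem_place _ T (hWT T hT) (hE T hT) (hS T hT) k a hk ha h2 hdel
      have := (hW _ hmem' _).1 (M.st_erase _ T (hWT T hT) (hE T hT) k a hk ha h2 hpl)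
      simp only [Option.map_some, topBlock, if_true]
      rw [(chain.ve_iff i (T k a) (T k a - 1)).2 hy]
      exact congrArg some this
  have hf : ∀ T ∈ tabs, ∀ i, (P.crystal n).f i (W T) =
      ((tableauCrystal n ve vf vwt s).f i T).map W := fun T hT i => by
    change Option.map (fun b => insert b (W T)) (survivors Sgn.plus (P.word (i + 1) (W T))).head?
      = Option.map W (Option.map (fun x => T.upd x ((vf i (T x.1 x.2)).getD 0))
        (survivors Sgn.plus (boxWord ve vf i T (boxes s))).head?)
    rw [hsurv T hT, List.head?_map]
    have hst : (tableauCrystal n ve vf vwt s).f i T =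
      Option.map (fun x => T.upd x ((vf i (T x.1 x.2)).getD 0))
        (survivors Sgn.plus (boxWord ve vf i T (boxes s))).head? := rfl
    cases hx : (survivors Sgn.plus (boxWord ve vf i T (boxes s))).head? with
    | none => rfl
    | some x =>
      obtain ⟨k, a⟩ := x
      rw [hx, Option.map_some] at hst
      obtain ⟨hbox, -, hv⟩ := mem_boxWord ve vf (mem_of_mem_survivors (List.mem_of_head? hx))
      obtain ⟨hk, ha⟩ := mem_boxes.1 hbox
      obtain ⟨y, hy⟩ := Option.isSome_iff_exists.1 (hv rfl)
      rw [hy, Option.getD_some] at hst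
      have hmem' := htab.f_mem T hT i _ hst
      rw [chain.vf_iff] at hy
      have hy1 : y = T k a + 1 := hy.2.1
      have h2 : T k a < m := by have := hy.2.2.1; omega
      subst hy1
      have hpl := M.not_mem_place _ T (hWT T hT) (hE T hT) k a hk ha h2
      have := (hW _ hmem' _).1 (M.st_insert _ T (hWT T hT) (hE T hT) k a hk ha h2 hpl)
      simp only [Option.map_some, topBlock]
      rw [(chain.vf_iff i (T k a) (T k a + 1)).2 hy]
      exact congrArg some this
  have hinj : ∀ T ∈ tabs, ∀ T' ∈ tabs, W T = W T' → T = T' := fun T hT T' hT' h => by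
    rw [← hleft T hT, h, hleft T' hT']
  have hsome : ∀ {o : Option Tableau} {T' : Tableau}, (∀ T, o = some T → T ∈ tabs) → T' ∈ tabs →
      (o.map W = some (W T') ↔ o = some T') := by
    intro o T' ho hT'
    cases o with
    | none => simp
    | some T =>
      simp only [Option.map_some, Option.some.injEq]
      exact ⟨fun h => hinj T (ho T rfl) T' hT' h, fun h => by rw [h]⟩
  have hwalls : ∀ {Y}, Y ∈ walls ↔ ∃ T ∈ tabs, W T = Y := by
    intro Y
    constructor
    · intro hY; obtain ⟨T, hT, rfl⟩ := hsurj Y hY; exact ⟨T, hT, rfl⟩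
    · rintro ⟨T, hT, rfl⟩; exact hmem T hT
  refine ⟨?_, ?_, htab, ?_⟩
  · constructor
    · intro Y hY i Y' h
      obtain ⟨T, hT, rfl⟩ := hwalls.1 hY
      rw [he T hT, Option.map_eq_some_iff] at h
      obtain ⟨T', hT', rfl⟩ := h
      exact hmem _ (htab.e_mem T hT i T' hT')
    · intro Y hY i Y' h
      obtain ⟨T, hT, rfl⟩ := hwalls.1 hY
      rw [hf T hT, Option.map_eq_some_iff] at h
      obtain ⟨T', hT', rfl⟩ := h
      exact hmem _ (htab.f_mem T hT i T' hT')
    · intro Y hY i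
      obtain ⟨T, hT, rfl⟩ := hwalls.1 hY
      rw [he T hT, heps T hT, Option.map_eq_none_iff]; exact htab.e_eq_none T hT i
    · intro Y hY i
      obtain ⟨T, hT, rfl⟩ := hwalls.1 hY
      rw [hf T hT, hphi T hT, Option.map_eq_none_iff]; exact htab.f_eq_none T hT i
    · intro Y hY i
      obtain ⟨T, hT, rfl⟩ := hwalls.1 hY
      rw [heps T hT, hphi T hT, htab.phi_sub_eps T hT i]
      exact (congrFun (hwt T hT) i).symm
    · intro Y hY Y' hY' i
      obtain ⟨T, hT, rfl⟩ := hwalls.1 hY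
      obtain ⟨T', hT', rfl⟩ := hwalls.1 hY'
      rw [he T' hT', hf T hT, hsome (htab.f_mem T hT i) hT', hsome (htab.e_mem T' hT' i) hT]
      exact htab.f_iff_e T hT T' hT' i
    · intro Y hY i Y' h j
      obtain ⟨T, hT, rfl⟩ := hwalls.1 hY
      rw [hf T hT, Option.map_eq_some_iff] at h
      obtain ⟨T', hT', rfl⟩ := h
      change P.weight n (W T') j = P.weight n (W T) j - _
      rw [hwt T hT, hwt T' (htab.f_mem T hT i T' hT')]
      exact htab.wt_f T hT i T' hT' j
    · intro Y hY i Y' h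
      obtain ⟨T, hT, rfl⟩ := hwalls.1 hY
      rw [hf T hT, Option.map_eq_some_iff] at h
      obtain ⟨T', hT', rfl⟩ := h
      rw [heps T hT, heps T' (htab.f_mem T hT i T' hT')]
      exact htab.eps_f T hT i T' hT'
    · intro Y hY i Y' h
      obtain ⟨T, hT, rfl⟩ := hwalls.1 hY
      rw [hf T hT, Option.map_eq_some_iff] at h
      obtain ⟨T', hT', rfl⟩ := h
      rw [hphi T hT, hphi T' (htab.f_mem T hT i T' hT')]
      exact htab.phi_f T hT i T' hT'
  · have hu : u ∈ tabs := (hgen.2 u).2 Relation.ReflTransGen.refl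
    refine ⟨fun j => ?_, fun Y => ⟨fun hY => ?_, fun hY => ?_⟩⟩
    · change P.weight n (W u) j = _
      rw [hwt u hu]; exact hgen.1 j
    · obtain ⟨T, hT, rfl⟩ := hwalls.1 hY
      have hT' := (hgen.2 T).1 hT
      clear hY hT
      induction hT' with
      | refl => exact Relation.ReflTransGen.refl
      | @tail T₁ T₂ h1 h2 ih =>
        have hm1 := (hgen.2 T₁).2 h1
        obtain ⟨i, hi⟩ := h2
        exact ih.tail ⟨i, by rw [hf T₁ hm1, hi]; rfl⟩
    · induction hY with
      | refl => exact hmem u hu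
      | tail _ h ih =>
        obtain ⟨T, hT, rfl⟩ := hwalls.1 ih
        obtain ⟨i, hi⟩ := h
        rw [hf T hT, Option.map_eq_some_iff] at hi
        obtain ⟨T', hT', rfl⟩ := hi
        exact hmem _ (htab.f_mem T hT i T' hT')
  · have hmap : ∀ o : Option Tableau, (∀ T, o = some T → T ∈ tabs) → o = (o.map W).map toT := by
      intro o ho
      cases o with
      | none => rfl
      | some T => simp [hleft T (ho T rfl)]
    constructor
    · refine ⟨fun Y hY => ?_, fun Y hY Y' hY' h => ?_, fun T hT => ?_⟩
      · obtain ⟨T, hT, rfl⟩ := hwalls.1 hY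
        rw [hleft T hT]; exact hT
      · obtain ⟨T, hT, rfl⟩ := hwalls.1 hY
        obtain ⟨T', hT', rfl⟩ := hwalls.1 hY'
        rw [hleft T hT, hleft T' hT'] at h
        rw [h]
      · exact ⟨W T, hmem T hT, hleft T hT⟩
    · intro Y hY
      obtain ⟨T, hT, rfl⟩ := hwalls.1 hY
      rw [hleft T hT]; exact (hwt T hT).symm
    · intro Y hY i
      obtain ⟨T, hT, rfl⟩ := hwalls.1 hY
      rw [hleft T hT, heps T hT]
    · intro Y hY i
      obtain ⟨T, hT, rfl⟩ := hwalls.1 hY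
      rw [hleft T hT, hphi T hT]
    · intro Y hY i
      obtain ⟨T, hT, rfl⟩ := hwalls.1 hY
      rw [hleft T hT, he T hT]; exact hmap _ (htab.e_mem T hT i)
    · intro Y hY i
      obtain ⟨T, hT, rfl⟩ := hwalls.1 hY
      rw [hleft T hT, hf T hT]; exact hmap _ (htab.f_mem T hT i)

/-- The column to the right of a column that is not the right-most one. -/
theorem right_column {s : List ℕ} (hs : ∀ k < s.length, 1 ≤ len s k) {k a : ℕ} (hk : k < s.length)
    (h0 : start s k + a ≠ 0) : (0 < a ∧ start s k + a - 1 = start s k + (a - 1)) ∨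
      (a = 0 ∧ ∃ j, k = j + 1 ∧ start s k + a - 1 = start s j + (len s j - 1)) := by
  rcases Nat.eq_zero_or_pos a with ha | ha
  · right
    refine ⟨ha, ?_⟩
    cases k with
    | zero => simp [start, ha] at h0
    | succ j =>
      have := hs j (by omega)
      refine ⟨j, rfl, ?_⟩
      rw [start_succ (by omega)]
      omega
  · left; exact ⟨ha, by omega⟩

/-! ### Walls of type $A_n^{(1)}$ as a model of columns of letters -/

namespace TypeA

theorem base_succ (n : ℕ) {s : List ℕ} {k : ℕ} (hk : k + 1 < s.length) :
    base n s k = base n s (k + 1) + (n + 1 - len s (k + 1)) := by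
  unfold base len
  rw [List.drop_eq_getElem_cons hk, List.getD_eq_getElem _ _ hk, List.map_cons, List.sum_cons,
    Nat.add_comm]

/-- This fixes the base heights modulo $n+1$: the lifts make the colours of every part look as if it
were the left-most one. -/
theorem sum_add_base {n : ℕ} {s : List ℕ} (hs : ∀ k < s.length, len s k ≤ n) {k : ℕ}
    (hk : k < s.length) :
    s.sum + base n s k = start s k + len s k + (s.length - (k + 1)) * (n + 1) := by
  obtain ⟨d, hd⟩ : ∃ d, s.length = k + 1 + d := ⟨s.length - (k + 1), by omega⟩
  induction d generalizing k with
  | zero =>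
    have h1 := start_length s
    rw [hd, Nat.add_zero, start_succ hk] at h1
    have h2 : base n s k = 0 := by
      unfold base; rw [List.drop_of_length_le (by omega)]; rfl
    rw [hd, h2, ← h1]; simp
  | succ d ih =>
    have h1 := ih (k := k + 1) (by omega) (by omega)
    have h2 := base_succ n (s := s) (k := k) (by omega)
    have h3 := hs (k + 1) (by omega)
    rw [start_succ hk] at h1
    rw [show s.length - (k + 1) = d + 1 by omega, Nat.succ_mul]
    rw [show s.length - (k + 1 + 1) = d by omega] at h1
    omega

/-- The column of a box has height `base + X - (len - a)`. -/
def St (n : ℕ) (s : List ℕ) (Y : Finset Block) (X : Tableau) : Prop :=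
  (∀ k a, k < s.length → a < len s k → len s k - a ≤ base n s k + X k a) ∧
  (∀ k a, k < s.length → a < len s k → ∀ r σ, (start s k + a, r, σ) ∈ Y ↔
    σ = false ∧ r + (len s k - a) < base n s k + X k a) ∧
  ∀ b ∈ Y, b.1 < s.sum

section

variable {n : ℕ} {s : List ℕ} (hs : ∀ k < s.length, 1 ≤ len s k ∧ len s k ≤ n)
include hs

/-- The row of the block that changes the letter $u$ into $u+1$ has colour $u$ modulo $n+1$, so
colours of blocks are colours of arrows. -/
theorem color_eq {k a r u : ℕ} (hk : k < s.length) (ha : a < len s k)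
    (hr : r + (len s k - a) = base n s k + u) :
    s.sum + r + n * (start s k + a) = u + (n + 1) * ((s.length - (k + 1)) + start s k + a) := by
  have h1 := sum_add_base (fun k hk => (hs k hk).2) hk
  obtain ⟨d, hd⟩ : ∃ d, len s k = a + d := ⟨len s k - a, by omega⟩
  rw [hd, Nat.add_sub_cancel_left] at hr
  rw [hd] at h1
  zify at *
  linear_combination h1 + hr

/-- Heights of adjacent columns of a part differ by the difference of the letters minus one, so the
absence of free space on the right is strictness. Between two parts it is automatic, the base rising
by $n+1-i_{k+1}$. -/
theorem isProper_iff {Y : Finset Block} {X : Tableau} (h : St n s Y X)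
    (hE : Entries (n + 1) s X) : (patternA n s.sum).IsProper Y ↔ Strict s X := by
  obtain ⟨h0, h1, h2⟩ := h
  constructor
  · rintro ⟨hY, -⟩ k hk a ha
    by_contra hlt
    have e0 := h0 k a hk (by omega)
    have hmem : (start s k + (a + 1), base n s k + X k a - (len s k - a), false) ∈ Y :=
      (h1 k (a + 1) hk ha _ _).2 ⟨rfl, by omega⟩
    rcases (hY _ hmem).2.2.2 (by simp) with h3 | h3
    · simp [patternA] at h3
    · have := ((h1 k a hk (by omega) _ _).1 h3).2
      dsimp only at this
      omega
  · intro hX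
    refine ⟨fun b hb => ?_, by simp [patternA]⟩
    obtain ⟨c, r, σ⟩ := b
    obtain ⟨k, a, hk, ha, rfl⟩ := exists_box (h2 _ hb)
    obtain ⟨rfl, hr⟩ := (h1 k a hk ha r σ).1 hb
    refine ⟨rfl, by simp [patternA], fun hr0 σ hσ => Or.inr ?_, fun hc => Or.inr ?_⟩
    · have hσ : σ = false := by simpa [patternA] using hσ
      exact (h1 k a hk ha _ _).2 ⟨hσ, by dsimp only at hr0 ⊢; omega⟩
    · rcases right_column (fun k hk => (hs k hk).1) hk hc with ⟨ha0, e⟩ | ⟨ha0, j, rfl, e⟩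
      · simp only [e]
        have := hX k hk (a - 1) (by omega)
        rw [Nat.sub_add_cancel ha0] at this
        exact (h1 k (a - 1) hk (by omega) _ _).2 ⟨rfl, by omega⟩
      · simp only [e]
        have l1 := hs j (by omega)
        have l2 := hs (j + 1) hk
        have := base_succ n (s := s) (k := j) hk
        have e1 := hE j (len s j - 1) (by omega) (by omega)
        have e2 := hE (j + 1) a hk ha
        exact (h1 j (len s j - 1) (by omega) (by omega) _ _).2 ⟨rfl, by omega⟩

theorem wallModel : WallModel n (n + 1) s (patternA n s.sum) (fun x => x) (place n s)
    (St n s) where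
  slot_exists r := ⟨false, by simp [patternA], fun _ => rfl⟩
  ground_eq _ _ _ _ := rfl
  place_fst _ _ _ := rfl
  color_removable Y X h hE k a hk ha h2 hmem := by
    have e1 := ((h.2.1 k a hk ha _ _).1 hmem).2
    have e2 := hE k a hk ha
    have := color_eq hs hk ha (r := base n s k + (X k a - 1) - (len s k - a)) (u := X k a - 1)
      (by omega)
    change (s.sum + (base n s k + (X k a - 1) - (len s k - a)) + n * (start s k + a)) % (n + 1) = _
    rw [this, Nat.add_mul_mod_self_left, Nat.mod_eq_of_lt (by omega)]
  color_admissible Y X h hE k a hk ha h2 := by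
    have e1 := h.1 k a hk ha
    have := color_eq hs hk ha (r := base n s k + X k a - (len s k - a)) (u := X k a)
      (by omega)
    change (s.sum + (base n s k + X k a - (len s k - a)) + n * (start s k + a)) % (n + 1) = _
    rw [this, Nat.add_mul_mod_self_left, Nat.mod_eq_of_lt (by omega)]
  proper_iff Y X h hE := isProper_iff hs h hE
  removable_top Y X c b h hE hc hr := by
    obtain ⟨hb, hcol, hp⟩ := hr
    obtain ⟨l, r, σ⟩ := b
    obtain ⟨k, a, hk, ha, rfl⟩ := exists_box (h.2.2 _ hb)
    obtain ⟨rfl, hr⟩ := (h.2.1 k a hk ha r σ).1 hb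
    have htop : r + (len s k - a) + 1 = base n s k + X k a := by
      by_contra hne
      have hmem : (start s k + a, r + 1, false) ∈ Y.erase (start s k + a, r, false) :=
        Finset.mem_erase.2 ⟨by simp, (h.2.1 k a hk ha _ _).2 ⟨rfl, by omega⟩⟩
      rcases (hp.1 _ hmem).2.2.1 (by simp) false (by simp [patternA]) with h3 | h3
      · simp [patternA] at h3
      · simp at h3
    have e1 := hE k a hk ha
    have := color_eq hs hk ha (r := r) (u := X k a - 1) (by omega)
    have hcol : (s.sum + r + n * (start s k + a)) % (n + 1) = c := hcol
    rw [this, Nat.add_mul_mod_self_left, Nat.mod_eq_of_lt (by omega)] at hcol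
    exact ⟨k, a, hk, ha, by omega, by unfold place; congr 2; omega⟩
  admissible_top Y X c b h hE hc hr := by
    obtain ⟨hb, hcol, hp⟩ := hr
    obtain ⟨l, r, σ⟩ := b
    have hpb := hp.1 _ (Finset.mem_insert_self _ _)
    obtain rfl : σ = false := by simpa [patternA] using hpb.2.1
    rcases Nat.lt_or_ge l s.sum with hl | hl
    · obtain ⟨k, a, hk, ha, rfl⟩ := exists_box hl
      have e0 := h.1 k a hk ha
      have htop : r + (len s k - a) = base n s k + X k a := by
        have h3 := (h.2.1 k a hk ha r false).not.1 hb
        simp only [true_and, not_lt] at h3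
        by_contra hne
        rcases hpb.2.2.1 (by dsimp only; omega) false (by simp [patternA]) with h4 | h4
        · simp [patternA] at h4
        · rcases Finset.mem_insert.1 h4 with h5 | h5
          · simp at h5; omega
          · have := ((h.2.1 k a hk ha _ _).1 h5).2
            dsimp only at this
            omega
      have e1 := hE k a hk ha
      have := color_eq hs hk ha (r := r) (u := X k a) (by omega)
      have hcol : (s.sum + r + n * (start s k + a)) % (n + 1) = c := hcol
      rw [this, Nat.add_mul_mod_self_left] at hcol
      refine ⟨k, a, hk, ha, ?_, by unfold place; congr 2; omega⟩
      by_contra hlt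
      rw [show X k a = n + 1 by omega, Nat.mod_self] at hcol
      omega
    -- Left of the shape only the bottom place of the first free column could be filled. Its colour
    -- is $N+nN\equiv0$ modulo $n+1$, and colour $0$ is excluded by `hc`.
    · have hr0 : r = 0 := by
        by_contra hr0
        rcases hpb.2.2.1 hr0 false (by simp [patternA]) with h4 | h4
        · simp [patternA] at h4
        · rcases Finset.mem_insert.1 h4 with h5 | h5
          · simp at h5; omega
          · have := h.2.2 _ h5
            simp only at this; omega
      have hl0 : l = s.sum := by
        by_contra hl0
        rcases hpb.2.2.2 (by simp only; omega) with h4 | h4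
        · simp [patternA] at h4
        · rcases Finset.mem_insert.1 h4 with h5 | h5
          · simp at h5; omega
          · have := h.2.2 _ h5
            simp only at this; omega
      have hcol : (s.sum + r + n * l) % (n + 1) = c := hcol
      rw [hr0, hl0, show s.sum + 0 + n * s.sum = s.sum * (n + 1) by ring, Nat.mul_mod_left] at hcol
      omega
  mem_place Y X h hE hX k a hk ha h2 hdel := by
    have h3 := (hX k hk).lower (fun a ha => (hE k a hk ha).1) ha
    refine (h.2.1 k a hk ha _ _).2 ⟨rfl, ?_⟩
    by_cases ha1 : a + 1 < len s k
    · have h4 := (hX k hk).lower (fun a ha => (hE k a hk ha).1) ha1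
      have := hX k hk a ha1
      omega
    · omega
  not_mem_place Y X h hE k a hk ha h2 hmem := by
    have := ((h.2.1 k a hk ha _ _).1 hmem).2
    have := h.1 k a hk ha
    omega
  st_erase Y X h hE k a hk ha h2 hmem := by
    have htop := ((h.2.1 k a hk ha _ _).1 hmem).2
    refine ⟨fun j b hj hb => ?_, fun j b hj hb r σ => ?_, fun b hb =>
      h.2.2 b (Finset.mem_of_mem_erase hb)⟩
    · have := h.1 j b hj hb
      rw [Tableau.upd_apply]
      split_ifs with e
      · obtain ⟨rfl, rfl⟩ := Prod.mk.inj e; omega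
      · exact this
    · rw [Finset.mem_erase, h.2.1 j b hj hb, Tableau.upd_apply]
      split_ifs with e
      · obtain ⟨rfl, rfl⟩ := Prod.mk.inj e
        simp only [place, ne_eq, Prod.mk.injEq, true_and]
        constructor
        · rintro ⟨h3, rfl, h4⟩
          refine ⟨rfl, ?_⟩
          simp only [and_true] at h3
          omega
        · rintro ⟨rfl, h3⟩
          exact ⟨by simp only [and_true]; omega, rfl, by omega⟩
      · refine and_iff_right ?_
        intro h3
        have h3 : start s j + b = start s k + a := congrArg Prod.fst h3
        obtain ⟨rfl, rfl⟩ := start_inj hj hb hk ha h3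
        exact e rfl
  st_insert Y X h hE k a hk ha h2 hmem := by
    have e0 := h.1 k a hk ha
    refine ⟨fun j b hj hb => ?_, fun j b hj hb r σ => ?_, fun b hb => ?_⟩
    · have := h.1 j b hj hb
      rw [Tableau.upd_apply]
      split_ifs with e
      · obtain ⟨rfl, rfl⟩ := Prod.mk.inj e; omega
      · exact this
    · rw [Finset.mem_insert, h.2.1 j b hj hb, Tableau.upd_apply]
      split_ifs with e
      · obtain ⟨rfl, rfl⟩ := Prod.mk.inj e
        simp only [place, Prod.mk.injEq, true_and]
        constructor
        · rintro (⟨rfl, rfl⟩ | ⟨rfl, h3⟩)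
          · exact ⟨rfl, by omega⟩
          · exact ⟨rfl, by omega⟩
        · rintro ⟨rfl, h3⟩
          simp only [and_true, true_and]
          omega
      · refine or_iff_right ?_
        intro h3
        have h3 : start s j + b = start s k + a := congrArg Prod.fst h3
        obtain ⟨rfl, rfl⟩ := start_inj hj hb hk ha h3
        exact e rfl
    · rcases Finset.mem_insert.1 hb with rfl | hb
      · exact start_add_lt hk ha
      · exact h.2.2 b hb

end

end TypeA

/-- The weight of a wall, computed column by column. -/
theorem weight_eq_of_columns {n : ℕ} {P : WallPattern} {s : List ℕ} {Y : Finset Block}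
    (hY : ∀ b ∈ Y, b.1 < s.sum) {T : Tableau} {ve vf : Fin n → ℕ → Option ℕ}
    {vwt : ℕ → Fin n → ℤ} {j : Fin n} (G : ℕ → ℤ)
    (hcol : ∀ k a, k < s.length → a < len s k → ∑ b ∈ Y with b.1 = start s k + a,
      P.cartan (j + 1) (P.color b) = G (start s k + a) - vwt (T k a) j)
    (hG : ∑ c ∈ Finset.range s.sum, G c = if P.top = j + 1 then 1 else 0) :
    P.weight n Y j = (tableauCrystal n ve vf vwt s).wt T j := by
  have e1 : ∑ b ∈ Y, P.cartan (j + 1) (P.color b) = ∑ c ∈ Finset.range s.sum,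
      ∑ b ∈ Y with b.1 = c, P.cartan (j + 1) (P.color b) :=
    (Finset.sum_fiberwise_of_maps_to (fun b hb => Finset.mem_range.2 (hY b hb)) _).symm
  have e2 : ∀ g : ℕ → ℤ, ∑ c ∈ Finset.range s.sum, g c =
      ((boxes s).map fun x => g (start s x.1 + x.2)).sum := fun g => by
    rw [← sum_map_range_reverse, range_sum_reverse, List.map_map]; rfl
  change (if P.top = j + 1 then 1 else 0) - ∑ b ∈ Y, P.cartan (j + 1) (P.color b) =
    ((boxes s).map fun x => vwt (T x.1 x.2) j).sum
  rw [← hG, e1, e2, e2]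
  have e3 : ∀ l : List (ℕ × ℕ), (∀ x ∈ l, x.1 < s.length ∧ x.2 < len s x.1) →
      (l.map fun x => G (start s x.1 + x.2)).sum - (l.map fun x => ∑ b ∈ Y with
        b.1 = start s x.1 + x.2, P.cartan (j + 1) (P.color b)).sum =
      (l.map fun x => vwt (T x.1 x.2) j).sum := by
    intro l
    induction l with
    | nil => simp
    | cons x l ih =>
      intro hl
      have h1 := hl x (by simp)
      have h2 := ih fun y hy => hl y (by simp [hy])
      simp only [List.map_cons, List.sum_cons, hcol _ _ h1.1 h1.2, ← h2]
      ring
  exact e3 _ fun x hx => mem_boxes.1 hx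

theorem card_eq_of_fibers {D : Finset Block} {f : Block → ℕ} {d : ℕ → ℕ} {m : ℕ}
    (h : ∀ c, (D.filter fun b => f b = c).card = d c) (hd : ∀ c, m ≤ c → d c = 0) :
    D.card = ∑ c ∈ Finset.range m, d c := by
  rw [Finset.card_eq_sum_card_fiberwise (f := f) (t := Finset.range m)]
  · exact Finset.sum_congr rfl fun c _ => h c
  · intro b hb
    by_contra hm
    have h1 := h (f b)
    rw [hd _ (by simpa using hm), Finset.card_eq_zero, Finset.filter_eq_empty_iff] at h1
    exact h1 hb rfl

/-! ### The walls of $Y(\lambda)$ in type $A_n$: weights, reducedness, comparison with tableaux -/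

namespace TypeA

/-- The cyclic form of the Cartan matrix, as a second difference of indicators; it is also correct
for $n=1$, where both neighbours of a colour coincide. -/
theorem cartanA_eq {n q j : ℕ} (hq : q ≤ n) (hj : j < n) : cartanA n (j + 1) q =
    2 * (if q = j + 1 then 1 else 0) - (if (if q = n then 0 else q + 1) = j + 1 then 1 else 0) -
      (if (if q = 0 then n else q - 1) = j + 1 then 1 else 0) := by
  unfold cartanA
  grind

/-- The wall whose columns represent the entries of a tableau. -/
def ofTableau (n : ℕ) (s : List ℕ) (T : Tableau) : Finset Block :=
  (Finset.range s.length).biUnion fun k => (Finset.range (len s k)).biUnion fun a =>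
    stack n s k a (T k a)

theorem mem_ofTableau {n : ℕ} {s : List ℕ} {T : Tableau} {b : Block} : b ∈ ofTableau n s T ↔
    ∃ k a, k < s.length ∧ a < len s k ∧ b.1 = start s k + a ∧ b.2.2 = false ∧
      b.2.1 < base n s k + T k a - (len s k - a) := by
  obtain ⟨c, r, σ⟩ := b
  simp only [ofTableau, stack, Finset.mem_biUnion, Finset.mem_range, Finset.mem_image,
    Prod.mk.injEq]
  constructor
  · rintro ⟨k, hk, a, ha, r, hr, rfl, rfl, rfl⟩
    exact ⟨k, a, hk, ha, rfl, rfl, hr⟩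
  · rintro ⟨k, a, hk, ha, rfl, rfl, hr⟩
    exact ⟨k, hk, a, ha, r, hr, rfl, rfl, rfl⟩

theorem highest_eq (n : ℕ) (s : List ℕ) : highest n s = ofTableau n s (topTableau s) := by
  refine Finset.biUnion_congr rfl fun k hk => Finset.biUnion_congr rfl fun a ha => ?_
  rw [topTableau_of_lt (Finset.mem_range.1 hk) (Finset.mem_range.1 ha)]

theorem st_iff {n : ℕ} {s : List ℕ} {T : Tableau}
    (hT : ∀ k a, k < s.length → a < len s k → len s k - a ≤ T k a) {Y : Finset Block} :
    St n s Y T ↔ Y = ofTableau n s T := by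
  constructor
  · rintro ⟨-, h1, h2⟩
    ext ⟨c, r, σ⟩
    rw [mem_ofTableau]
    constructor
    · intro hb
      obtain ⟨k, a, hk, ha, rfl⟩ := exists_box (h2 _ hb)
      have := (h1 k a hk ha r σ).1 hb
      exact ⟨k, a, hk, ha, rfl, this.1, by dsimp only; omega⟩
    · rintro ⟨k, a, hk, ha, rfl, h3, h4⟩
      exact (h1 k a hk ha r σ).2 ⟨h3, by dsimp only at h4; omega⟩
  · rintro rfl
    refine ⟨fun k a hk ha => (hT k a hk ha).trans (Nat.le_add_left _ _),
      fun k a hk ha r σ => ?_, fun b hb => ?_⟩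
    · rw [mem_ofTableau]
      constructor
      · rintro ⟨k', a', hk', ha', h1, h2, h3⟩
        obtain ⟨rfl, rfl⟩ := start_inj hk ha hk' ha' h1
        exact ⟨h2, by dsimp only at h3; omega⟩
      · rintro ⟨h2, h3⟩
        exact ⟨k, a, hk, ha, rfl, h2, by dsimp only; omega⟩
    · obtain ⟨k, a, hk, ha, h1, -⟩ := mem_ofTableau.1 hb
      rw [h1]; exact start_add_lt hk ha

/-- The columns of a Young wall are given by their heights. -/
theorem exists_height {n N : ℕ} {Y : Finset Block} (hY : (patternA n N).IsYoungWall Y) (c : ℕ) :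
    ∃ h, ∀ r σ, (c, r, σ) ∈ Y ↔ σ = false ∧ r < h := by
  have hex : ∃ r, (c, r, false) ∉ Y := ⟨WallPattern.bound Y, fun h => by
    have := (WallPattern.lt_bound_of_mem h).2; dsimp only at this; omega⟩
  classical
  refine ⟨Nat.find hex, fun r σ => ⟨fun h => ?_, ?_⟩⟩
  · have hσ : σ = false := by simpa [patternA] using (hY _ h).2.1
    subst hσ
    refine ⟨rfl, ?_⟩
    by_contra hr
    have key : ∀ d, (c, Nat.find hex + d, false) ∉ Y := by
      intro d
      induction d with
      | zero => exact Nat.find_spec hex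
      | succ d ih =>
        intro h'
        rcases (hY _ h').2.2.1 (by dsimp only; omega) false (by simp [patternA]) with h2 | h2
        · simp [patternA] at h2
        · exact ih (by simpa [← Nat.add_assoc] using h2)
    exact key (r - Nat.find hex) (by rwa [Nat.add_sub_cancel' (by omega)])
  · rintro ⟨rfl, hr⟩
    exact not_not.1 (Nat.find_min hex hr)

section

variable {n : ℕ} {s : List ℕ} (hs : ∀ k < s.length, 1 ≤ len s k ∧ len s k ≤ n)
include hs

omit hs in
theorem filter_column {Y : Finset Block} {X : Tableau} (h : St n s Y X) {k a : ℕ}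
    (hk : k < s.length) (ha : a < len s k) : (Y.filter fun b => b.1 = start s k + a) =
      (Finset.range (base n s k + X k a - (len s k - a))).image
        fun r => (start s k + a, r, false) := by
  ext ⟨c, r, σ⟩
  simp only [Finset.mem_filter, Finset.mem_image, Finset.mem_range, Prod.mk.injEq]
  constructor
  · rintro ⟨hb, rfl⟩
    have := (h.2.1 k a hk ha r σ).1 hb
    exact ⟨r, by omega, rfl, rfl, this.1.symm⟩
  · rintro ⟨r, hr, rfl, rfl, rfl⟩
    exact ⟨(h.2.1 k a hk ha _ _).2 ⟨rfl, by omega⟩, rfl⟩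

theorem toTableau_eq {Y : Finset Block} {X : Tableau} (h : St n s Y X)
    (hE : Entries (n + 1) s X) (hoff : ∀ k a, ¬ (k < s.length ∧ a < len s k) → X k a = 0) :
    toTableau n s Y = X := by
  funext k a
  unfold toTableau
  split_ifs with hka
  · obtain ⟨hk, ha⟩ := hka
    have e0 := h.1 k a hk ha
    have e1 := hE k a hk ha
    unfold entry
    rw [filter_column h hk ha, Finset.card_image_of_injective _ fun r r' e => by simpa using e,
      Finset.card_range]
    have := color_eq hs hk ha (r := base n s k + X k a - (len s k - a)) (u := X k a) (by omega)
    -- In `entry` the height is increased by $n$ in place of being decreased by $1$; this is the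
    -- same modulo $n+1$ and makes sense for an empty column.
    rw [show s.sum + (base n s k + X k a - (len s k - a) + n) + n * (start s k + a) =
      (X k a - 1) + (n + 1) * ((s.length - (k + 1)) + start s k + a + 1) by
        rw [Nat.mul_add (n + 1) _ 1]; omega]
    rw [Nat.add_mul_mod_self_left, Nat.mod_eq_of_lt (by omega)]
    omega
  · exact (hoff k a hka).symm

/-- A $\delta$-column has $n+1$ blocks. Blocks that can be removed must lie above the column to the
left, and a column exceeds its left neighbour by at most $n$; between two parts this uses the row
condition. -/
theorem isReduced {Y : Finset Block} {X : Tableau} (h : St n s Y X)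
    (hX : X ∈ tableaux n s) : (patternA n s.sum).IsReduced Y := by
  have hX : IsReverseTableau (n + 1) s X := hX
  intro D hD c hc hdelta hp
  have hcard := card_eq_of_fibers (m := n + 1) hdelta (fun c hc => by simp [patternA]; omega)
  have hsum : ∑ c ∈ Finset.range (n + 1), (patternA n s.sum).delta c = n + 1 := by
    rw [Finset.sum_congr rfl fun c hc => by
      change (if c ≤ n then 1 else 0) = 1
      rw [if_pos (by have := Finset.mem_range.1 hc; omega)]]
    simp
  rw [hsum] at hcard
  obtain ⟨b, hb⟩ : D.Nonempty := by rw [← Finset.card_pos]; omega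
  obtain ⟨k, a, hk, ha, hca⟩ := exists_box (h.2.2 b (hD hb))
  rw [hc b hb] at hca
  obtain ⟨lo, hlo, hhi⟩ : ∃ lo, (∀ r < lo, (c + 1, r, false) ∈ Y) ∧
      base n s k + X k a - (len s k - a) ≤ lo + n := by
    have e1 := hX.entries k a hk ha
    by_cases ha1 : a + 1 < len s k
    · refine ⟨base n s k + X k (a + 1) - (len s k - (a + 1)), fun r hr => ?_, ?_⟩
      · rw [hca, Nat.add_assoc]
        exact (h.2.1 k (a + 1) hk ha1 r false).2 ⟨rfl, by omega⟩
      · have e2 := hX.entries k (a + 1) hk ha1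
        omega
    · by_cases hk1 : k + 1 < s.length
      · have l1 := hs k hk
        have l2 := hs (k + 1) hk1
        have e3 := (hX.strictColumn hk1).lower (fun a ha => (hX.entries (k + 1) a hk1 ha).1)
          (a := 0) (by omega)
        refine ⟨base n s (k + 1) + X (k + 1) 0 - len s (k + 1), fun r hr => ?_, ?_⟩
        · rw [hca, show start s k + a + 1 = start s (k + 1) + 0 by rw [start_succ hk]; omega]
          exact (h.2.1 (k + 1) 0 hk1 (by omega) r false).2 ⟨rfl, by omega⟩
        · have e4 := hX.rows k a hk1 ha
          have e5 : X (k + 1) a ≤ X (k + 1) 0 := by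
            by_cases ha2 : a < len s (k + 1)
            · rcases Nat.eq_zero_or_pos a with rfl | ha0
              · exact le_rfl
              · exact ((hX.strictColumn hk1).lt ha0 ha2).le
            · rw [hX.off_shape (k + 1) a fun h => ha2 h.2]; exact Nat.zero_le _
          have := base_succ n hk1
          omega
      · have hb0 : base n s k = 0 := by
          unfold base; rw [List.drop_of_length_le (by omega)]; rfl
        exact ⟨0, by simp, by omega⟩
  have hsub : D ⊆ (Finset.Ico lo (base n s k + X k a - (len s k - a))).image
      fun r => (c, r, false) := by
    rintro ⟨l, r, σ⟩ hb
    obtain rfl : l = c := hc _ hb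
    obtain ⟨rfl, hr⟩ := (h.2.1 k a hk ha r σ).1 (by rw [← hca]; exact hD hb)
    refine Finset.mem_image.2 ⟨r, Finset.mem_Ico.2 ⟨?_, by omega⟩, rfl⟩
    by_contra hlt
    have hmem : (l + 1, r, false) ∈ Y \ D := Finset.mem_sdiff.2 ⟨hlo r (by omega), fun h => by
      have := hc _ h; simp at this⟩
    rcases (hp.1 _ hmem).2.2.2 (by simp) with h3 | h3
    · simp [patternA] at h3
    · exact (Finset.mem_sdiff.1 h3).2 hb
  have := (Finset.card_le_card hsub).trans Finset.card_image_le
  rw [Nat.card_Ico] at this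
  omega

omit hs in
theorem mem_part {Y : Finset Block} {X : Tableau} (h : St n s Y X) {k a u : ℕ}
    (hk : k < s.length) (ha : a < len s k) (hu : len s k ≤ a + u) (hu' : a + u ≤ n) :
    (a, u) ∈ part n s Y k ↔ u < X k a := by
  have := h.2.1 k a hk ha (base n s k + u - (len s k - a)) false
  unfold part
  rw [Finset.mem_filter, Finset.mem_product, Finset.mem_range, Finset.mem_range]
  change (a < _ ∧ u < _) ∧ len s k ≤ a + u ∧ a + u ≤ n ∧
    (start s k + a, base n s k + u - (len s k - a), false) ∈ Y ↔ _
  rw [this]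
  constructor
  · rintro ⟨-, -, -, -, h⟩; omega
  · intro h; exact ⟨⟨ha, by omega⟩, hu, hu', rfl, by omega⟩

theorem mem_walls_of_st {Y : Finset Block} {X : Tableau} (h : St n s Y X)
    (hX : X ∈ tableaux n s) (hmono : s.Pairwise (· ≤ ·)) : Y ∈ walls n s := by
  have hT : IsReverseTableau (n + 1) s X := hX
  have hlow : ∀ k a, k < s.length → a < len s k → len s k - a ≤ X k a := fun k a hk ha =>
    (hT.strictColumn hk).lower (fun a ha => (hT.entries k a hk ha).1) ha
  have hup : ∀ k a, k < s.length → a < len s k → X k a + a ≤ n + 1 := fun k a hk ha =>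
    (hT.strictColumn hk).upper (fun a ha => (hT.entries k a hk ha).2) ha
  refine ⟨(isProper_iff hs h hT.entries).2 fun k hk => hT.strictColumn hk, isReduced hs h hX,
    fun b hb => ?_, fun b hb => ?_, fun k hk x hx hu hpart => ?_⟩
  · rw [highest_eq, mem_ofTableau] at hb
    obtain ⟨k, a, hk, ha, h1, h2, h3⟩ := hb
    obtain ⟨c, r, σ⟩ := b
    dsimp only at h1 h2 h3
    subst h1
    rw [topTableau_of_lt hk ha] at h3
    have := hlow k a hk ha
    exact (h.2.1 k a hk ha r σ).2 ⟨h2, by omega⟩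
  · obtain ⟨c, r, σ⟩ := b
    obtain ⟨k, a, hk, ha, rfl⟩ := exists_box (h.2.2 _ hb)
    obtain ⟨rfl, h1⟩ := (h.2.1 k a hk ha r σ).1 hb
    have := hup k a hk ha
    simp only [lowest, stack, Finset.mem_biUnion, Finset.mem_range, Finset.mem_image]
    exact ⟨k, hk, a, ha, r, by omega, rfl⟩
  · obtain ⟨a, u⟩ := x
    dsimp only at hx hu
    have hle := len_mono hmono (Nat.le_succ k) hk
    rw [Nat.succ_eq_add_one] at hle
    have hu' : a + u ≤ n := by
      simp only [part, Finset.mem_filter] at hpart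
      exact hpart.2.2.1
    have h1 := (mem_part h (by omega) hx (by omega) hu').1 hpart
    exact (mem_part h hk (by omega) hu hu').2 (h1.trans_le (hT.rows k a hk hx))

/-- The columns of a Young wall are given by heights. The walls $H_\lambda$ and $L_\lambda$ confine
the letters to $1,\dots,n+1$, properness gives strict columns, and (Y2) gives the row condition. -/
theorem exists_st_of_mem_walls {Y : Finset Block} (hY : Y ∈ walls n s)
    (hmono : s.Pairwise (· ≤ ·)) : ∃ X ∈ tableaux n s, St n s Y X := by
  obtain ⟨hp, -, hH, hL, hpart⟩ := hY
  choose h hh using exists_height hp.1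
  have h1 : ∀ k a, k < s.length → a < len s k → base n s k ≤ h (start s k + a) := by
    intro k a hk ha
    by_contra hlt
    have : (start s k + a, h (start s k + a), false) ∈ highest n s := by
      simp only [highest, stack, Finset.mem_biUnion, Finset.mem_range, Finset.mem_image]
      exact ⟨k, hk, a, ha, _, by omega, rfl⟩
    have := ((hh _ _ _).1 (hH this)).2
    omega
  have h2 : ∀ k a, k < s.length → a < len s k →
      h (start s k + a) + len s k ≤ base n s k + n + 1 := by
    intro k a hk ha
    by_contra hlt
    have l1 := hs k hk
    have : (start s k + a, base n s k + n + 1 - len s k, false) ∈ Y :=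
      (hh _ _ _).2 ⟨rfl, by omega⟩
    have := hL this
    simp only [lowest, stack, Finset.mem_biUnion, Finset.mem_range, Finset.mem_image,
      Prod.mk.injEq] at this
    obtain ⟨k', hk', a', ha', r, hr, e1, e2, -⟩ := this
    obtain ⟨rfl, rfl⟩ := start_inj hk' ha' hk ha e1
    omega
  have h3 : ∀ b ∈ Y, b.1 < s.sum := by
    intro b hb
    have := hL hb
    simp only [lowest, stack, Finset.mem_biUnion, Finset.mem_range, Finset.mem_image] at this
    obtain ⟨k, hk, a, ha, r, hr, rfl⟩ := this
    exact start_add_lt hk ha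
  set X : Tableau := fun k a => if k < s.length ∧ a < len s k then
    h (start s k + a) + (len s k - a) - base n s k else 0 with hXdef
  have hX : ∀ k a, k < s.length → a < len s k →
      X k a = h (start s k + a) + (len s k - a) - base n s k := fun k a hk ha => if_pos ⟨hk, ha⟩
  have hst : St n s Y X := by
    refine ⟨fun k a hk ha => ?_, fun k a hk ha r σ => ?_, h3⟩
    · rw [hX k a hk ha]; omega
    · have := h1 k a hk ha
      rw [hh, hX k a hk ha]
      exact and_congr_right fun _ => by omega
  have hE : Entries (n + 1) s X := by
    intro k a hk ha
    have := h1 k a hk ha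
    have := h2 k a hk ha
    rw [hX k a hk ha]; omega
  have hS := (isProper_iff hs hst hE).1 hp
  refine ⟨X, ⟨fun k a h => if_neg h, hE, fun k a hk ha => ?_, fun k a hk ha => hS k hk a ha⟩, hst⟩
  by_contra hlt
  have hle := len_mono hmono (Nat.le_succ k) hk
  rw [Nat.succ_eq_add_one] at hle
  have e1 : X (k + 1) a + a ≤ n + 1 :=
    (hS (k + 1) hk).upper (fun a ha => (hE (k + 1) a hk ha).2) (by omega)
  have e3 : X k a + a ≤ n + 1 :=
    (hS k (by omega)).upper (fun a ha => (hE k a (by omega) ha).2) ha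
  have e2 : len s (k + 1) - a ≤ X (k + 1) a :=
    (hS (k + 1) hk).lower (fun a ha => (hE (k + 1) a hk ha).1) (by omega)
  -- If a row decreased, the block of colour `X (k + 1) a` in column `a` would lie in the part of
  -- $\omega_{i_k}$ but not in the next part, contrary to (Y2). Strictness places it in the region
  -- to be compared.
  have := (mem_part hst hk (u := X (k + 1) a) (by omega) (by omega) (by omega)).1
    (hpart k hk (a, X (k + 1) a) ha (by dsimp only; omega)
      ((mem_part hst (by omega) ha (by omega) (by omega)).2 (by omega)))
  omega

/-- Up a column the Cartan entries form a telescoping second difference of the indicator `g` of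
colour $j+1$. The top contributes the weight of the letter; the contributions of the bottoms
telescope over the columns to that of $\Lambda$. -/
theorem weight_eq {Y : Finset Block} {X : Tableau} (h : St n s Y X)
    (hE : Entries (n + 1) s X) : (patternA n s.sum).weight n Y = (tabCrystal n s).wt X := by
  funext j
  have hj := j.2
  set g : ℕ → ℤ := fun v => if v % (n + 1) = j + 1 then 1 else 0 with hg
  refine weight_eq_of_columns h.2.2 (fun c => g (s.sum + n * c) - g (s.sum + n * (c + 1)))
    (fun k a hk ha => ?_) ?_
  · have e0 := h.1 k a hk ha
    have e1 := hE k a hk ha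
    rw [filter_column h hk ha, Finset.sum_image fun r _ r' _ e => by simpa using e]
    set c := start s k + a with hc
    set H := base n s k + X k a - (len s k - a) with hH
    have tele : ∀ r, (patternA n s.sum).cartan (j + 1) ((patternA n s.sum).color (c, r, false)) =
        (g (s.sum + r + n * c) - g (s.sum + r + n * (c + 1))) -
          (g (s.sum + (r + 1) + n * c) - g (s.sum + (r + 1) + n * (c + 1))) := by
      intro r
      change cartanA n (j + 1) ((s.sum + r + n * c) % (n + 1)) = _
      have m1 : s.sum + (r + 1) + n * (c + 1) = (s.sum + r + n * c) + (n + 1) := by ring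
      have m2 : s.sum + (r + 1) + n * c = (s.sum + r + n * c) + 1 := by ring
      have m3 : s.sum + r + n * (c + 1) = (s.sum + r + n * c) + n := by ring
      simp only [hg]
      rw [m1, m2, m3, Nat.add_mod_right]
      generalize hv : s.sum + r + n * c = v
      have hq : v % (n + 1) < n + 1 := Nat.mod_lt _ (by omega)
      have q1 : (v + 1) % (n + 1) = if v % (n + 1) = n then 0 else v % (n + 1) + 1 := by
        rw [Nat.add_mod]
        split_ifs with hv'
        · rw [hv']
          rcases Nat.lt_or_ge 1 (n + 1) with h1 | h1
          · rw [Nat.mod_eq_of_lt h1, Nat.mod_self]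
          · omega
        · rw [Nat.mod_eq_of_lt (show 1 < n + 1 by omega), Nat.mod_eq_of_lt (by omega)]
      have q2 : (v + n) % (n + 1) = if v % (n + 1) = 0 then n else v % (n + 1) - 1 := by
        rw [Nat.add_mod, Nat.mod_eq_of_lt (show n < n + 1 by omega)]
        split_ifs with hv'
        · rw [hv', Nat.zero_add, Nat.mod_eq_of_lt (by omega)]
        · rw [show v % (n + 1) + n = (v % (n + 1) - 1) + (n + 1) by omega, Nat.add_mod_right,
            Nat.mod_eq_of_lt (by omega)]
      rw [q1, q2, cartanA_eq (Nat.lt_succ_iff.1 hq) hj]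
      ring
    have hcol := color_eq hs hk ha (r := H) (u := X k a) (by omega)
    rw [← hc] at hcol
    rw [Finset.sum_congr rfl fun r _ => tele r, Finset.sum_range_sub', Nat.add_zero]
    have f1 : g (s.sum + H + n * c) = if X k a = j + 1 then 1 else 0 := by
      simp only [hg]
      rw [hcol, Nat.add_mul_mod_self_left]
      rcases Nat.lt_or_ge (X k a) (n + 1) with h1 | h1
      · rw [Nat.mod_eq_of_lt h1]
      · rw [show X k a = n + 1 by omega, Nat.mod_self, if_neg (by omega), if_neg (by omega)]
    have f2 : g (s.sum + H + n * (c + 1)) = if X k a = j + 2 then 1 else 0 := by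
      simp only [hg]
      rw [show s.sum + H + n * (c + 1) = (X k a - 1) +
        (n + 1) * (s.length - (k + 1) + start s k + a + 1) by
          rw [Nat.mul_add n, Nat.mul_add (n + 1) _ 1]; omega]
      rw [Nat.add_mul_mod_self_left, Nat.mod_eq_of_lt (by omega)]
      refine if_congr ?_ rfl rfl
      omega
    rw [f1, f2]
    rfl
  · rw [Finset.sum_range_sub' (fun c => g (s.sum + n * c))]
    simp only [hg]
    rw [show s.sum + n * s.sum = s.sum * (n + 1) by ring, Nat.mul_mod_left, Nat.mul_zero,
      Nat.add_zero, if_neg (show ¬ (0 = (j : ℕ) + 1) by omega), sub_zero]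
    rfl

theorem main (hmono : s.Pairwise (· ≤ ·)) {w : Fin n → ℕ}
    (hw : ∀ j : Fin n, s.count ((j : ℕ) + 1) = w j) :
    IsCrystal ((patternA n s.sum).classicalCartan n) ((patternA n s.sum).crystal n) (walls n s) ∧
      IsGeneratedBy ((patternA n s.sum).crystal n) (walls n s) (highest n s) w ∧
      IsCrystal ((patternA n s.sum).classicalCartan n) (tabCrystal n s) (tableaux n s) ∧
      IsCrystalIso ((patternA n s.sum).crystal n) (walls n s) (tabCrystal n s) (tableaux n s)
        (toTableau n s) := by
  have hrev : ∀ T ∈ tableaux n s, IsReverseTableau (n + 1) s T := fun T hT => hT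
  have hlow : ∀ T ∈ tableaux n s, ∀ k a, k < s.length → a < len s k → len s k - a ≤ T k a :=
    fun T hT k a hk ha => ((hrev T hT).strictColumn hk).lower
      (fun a ha => ((hrev T hT).entries k a hk ha).1) ha
  have hst : ∀ T ∈ tableaux n s, ∀ Y, St n s Y T ↔ Y = ofTableau n s T :=
    fun T hT Y => st_iff (hlow T hT)
  rw [highest_eq]
  refine (wallModel hs).crystal_walls isLetterChain (tableaux_isCrystal hmono) ?_ (ofTableau n s)
    (toTableau n s) (fun T hT => (hrev T hT).entries)
    (fun T hT k hk => (hrev T hT).strictColumn hk) hst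
    (fun T hT => mem_walls_of_st hs ((hst T hT _).2 rfl) hT hmono) ?_ ?_ ?_
  · obtain rfl : w = fun j : Fin n => s.count ((j : ℕ) + 1) := (funext hw).symm
    exact tableaux_isGeneratedBy hmono fun k hk => (hs k hk).2
  · intro Y hY
    obtain ⟨X, hX, h⟩ := exists_st_of_mem_walls hs hY hmono
    exact ⟨X, hX, (hst X hX Y).1 h⟩
  · intro T hT
    exact toTableau_eq hs ((hst T hT _).2 rfl) (hrev T hT).entries (hrev T hT).off_shape
  · intro T hT
    exact weight_eq hs ((hst T hT _).2 rfl) (hrev T hT).entries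

end

end TypeA

namespace TypeC

/-! ## Columns of walls of type `C_n` -/

section Pattern

variable {n N : ℕ}

theorem mem_slots {r : ℕ} {σ : Bool} :
    σ ∈ (patternC n N).slots r ↔ σ = false ∨ r % (2 * n - 2) = 0 := by
  change σ ∈ (if r % (2 * n - 2) = 0 then ({false, true} : Finset Bool) else {false}) ↔ _
  split_ifs with h <;> cases σ <;> simp [h]

theorem ground_iff {b : Block} : (patternC n N).ground b = true ↔ b.2.1 = 0 ∧ b.2.2 = false := by
  simp [patternC]

theorem ground_eq_false_iff {b : Block} :
    (patternC n N).ground b = false ↔ ¬ (b.2.1 = 0 ∧ b.2.2 = false) := by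
  rw [← ground_iff (n := n) (N := N), Bool.not_eq_true]

theorem color_half {c r : ℕ} {σ : Bool} (h : r % (2 * n - 2) = 0) :
    (patternC n N).color (c, r, σ) = (N + c + 1 + (if σ then 1 else 0)) % 2 := by
  change (if r % (2 * n - 2) = 0 then (N + c + 1 + (if σ then 1 else 0)) % 2 else _) = _
  rw [if_pos h]

theorem color_half_lt {c r : ℕ} {σ : Bool} (h : r % (2 * n - 2) = 0) :
    (patternC n N).color (c, r, σ) ≤ 1 := by
  rw [color_half h]; omega

theorem color_half_succ {c r : ℕ} {σ : Bool} (h : r % (2 * n - 2) = 0) :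
    (patternC n N).color (c + 1, r, σ) + (patternC n N).color (c, r, σ) = 1 := by
  rw [color_half h, color_half h]; omega

theorem exists_color (c : ℕ) {r i : ℕ} (h : r % (2 * n - 2) = 0) (hi : i ≤ 1) :
    ∃ σ ∈ (patternC n N).slots r, (patternC n N).color (c, r, σ) = i := by
  have h1 := color_half (n := n) (N := N) (c := c) (σ := false) h
  have h2 := color_half (n := n) (N := N) (c := c) (σ := true) h
  simp only [Bool.false_eq_true, if_false, if_true] at h1 h2
  rcases Nat.mod_two_eq_zero_or_one (N + c + 1) with h3 | h3
  · by_cases hi0 : i = 0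
    · exact ⟨false, mem_slots.2 (Or.inr h), by omega⟩
    · exact ⟨true, mem_slots.2 (Or.inr h), by omega⟩
  · by_cases hi0 : i = 0
    · exact ⟨true, mem_slots.2 (Or.inr h), by omega⟩
    · exact ⟨false, mem_slots.2 (Or.inr h), by omega⟩

/-- The slot of the `1`-block of a row of half-unit thickness. -/
theorem decide_color {c r : ℕ} {σ : Bool} (h : r % (2 * n - 2) = 0) :
    decide ((patternC n N).color (c, r, true) = 1) = σ ↔ (patternC n N).color (c, r, σ) = 1 := by
  have h1 := color_half (n := n) (N := N) (c := c) (σ := false) h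
  have h2 := color_half (n := n) (N := N) (c := c) (σ := true) h
  simp only [Bool.false_eq_true, if_false, if_true] at h1 h2
  cases σ
  · rw [decide_eq_false_iff_not]; omega
  · rw [decide_eq_true_iff]

theorem add_mod_period {B j : ℕ} (hB : B % (2 * n - 2) = 0) (hj : j < 2 * n - 2) :
    (B + j) % (2 * n - 2) = j := by
  rw [Nat.add_mod, hB, Nat.zero_add, Nat.mod_mod, Nat.mod_eq_of_lt hj]

theorem color_unit {B c j : ℕ} {σ : Bool} (hB : B % (2 * n - 2) = 0) (h0 : 0 < j)
    (hj : j < 2 * n - 2) : (patternC n N).color (c, B + j, σ) =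
      if j < n then j + 1 else 2 * n - 1 - j := by
  change (if (B + j) % (2 * n - 2) = 0 then (N + c + 1 + (if σ then 1 else 0)) % 2
    else if (B + j) % (2 * n - 2) < n then (B + j) % (2 * n - 2) + 1
    else 2 * n - 1 - (B + j) % (2 * n - 2)) = _
  rw [add_mod_period hB hj, if_neg (by omega)]

theorem slot_unit {B r : ℕ} {σ : Bool} (hB : B % (2 * n - 2) = 0) (h0 : B < r)
    (hj : r < B + (2 * n - 2)) (hσ : σ ∈ (patternC n N).slots r) : σ = false := by
  rcases mem_slots.1 hσ with h | h
  · exact h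
  · have := add_mod_period hB (j := r - B) (by omega)
    rw [Nat.add_sub_cancel' h0.le] at this
    omega

end Pattern

/-- The blocks of a column that represents the letter `x` and whose part is lifted by `B` rows. -/
def InColumn (n N B x : ℕ) (b : Block) : Prop :=
  b.2.1 < B ∨ (b.2.1 = B ∧ ((patternC n N).color b = 0 ∨ 2 ≤ x)) ∨
    (B < b.2.1 ∧ b.2.1 < B + (2 * n - 2) ∧ b.2.1 + 1 < B + x) ∨
    (b.2.1 = B + (2 * n - 2) ∧ (patternC n N).color b = 1 ∧ x = 2 * n)

section Column

variable {n N B : ℕ} (hn : 3 ≤ n)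
include hn

theorem InColumn.below {x c r : ℕ} {σ : Bool} (h : InColumn n N B x (c, r, σ))
    (hr : r ≠ 0) (σ' : Bool) : InColumn n N B x (c, r - 1, σ') := by
  unfold InColumn at *
  dsimp only at *
  omega

/-- Only the rows of half-unit thickness are delicate, since the colour of a slot changes from
column to column. As $x\ge2$, the lower one is full in the right column; as $x'<2n$, the upper one
is empty in the left column. -/
theorem InColumn.right {x x' c c' r : ℕ} {σ : Bool} (h : InColumn n N B x' (c', r, σ))
    (hx' : 1 ≤ x') (hx : x' < x) (hx2 : x ≤ 2 * n) : InColumn n N B x (c, r, σ) := by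
  unfold InColumn at *
  dsimp only at *
  omega

/-- A column of the part on the left does not rise above the row where the right part begins. In
that row it can contain only a $1$-block, and the same slot of the right neighbour has colour $0$
and is filled whatever its letter is. -/
theorem InColumn.right_part {x x' c r : ℕ} {σ : Bool} (hB : B % (2 * n - 2) = 0)
    (h : InColumn n N B x' (c + 1, r, σ)) :
    InColumn n N (B + (2 * n - 2)) x (c, r, σ) := by
  unfold InColumn at *
  dsimp only at *
  rcases Nat.lt_or_ge r (B + (2 * n - 2)) with h1 | h1
  · exact Or.inl h1
  · have hr : r = B + (2 * n - 2) := by omega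
    have hr0 : r % (2 * n - 2) = 0 := by rw [hr, Nat.add_mod_right, hB]
    have := color_half_succ (n := n) (N := N) (c := c) (σ := σ) hr0
    omega

/-- The top row of a column is completely filled. -/
theorem full_iff {x c r : ℕ} (hB : B % (2 * n - 2) = 0) (hx : 1 ≤ x) (hx2 : x ≤ 2 * n) :
    ((∀ σ ∈ (patternC n N).slots r, InColumn n N B x (c, r, σ)) ∧
      ∀ σ ∈ (patternC n N).slots (r + 1), ¬ InColumn n N B x (c, r + 1, σ)) ↔
    2 ≤ x ∧ x ≤ 2 * n - 1 ∧ r + 2 = B + x := by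
  have hB2 : (B + (2 * n - 2)) % (2 * n - 2) = 0 := by rw [Nat.add_mod_right, hB]
  obtain ⟨σ₀, s0, c0⟩ := exists_color (n := n) (N := N) c hB (show 0 ≤ 1 by omega)
  obtain ⟨σ₁, s1, c1⟩ := exists_color (n := n) (N := N) c hB (show 1 ≤ 1 by omega)
  obtain ⟨τ₀, t0, d0⟩ := exists_color (n := n) (N := N) c hB2 (show 0 ≤ 1 by omega)
  obtain ⟨τ₁, t1, d1⟩ := exists_color (n := n) (N := N) c hB2 (show 1 ≤ 1 by omega)
  constructor
  · rintro ⟨h1, h2⟩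
    have hf := h2 false (mem_slots.2 (Or.inl rfl))
    have hg := h1 false (mem_slots.2 (Or.inl rfl))
    by_cases e1 : r + 1 = B
    · rw [e1] at h2
      exact absurd (Or.inr (Or.inl ⟨rfl, Or.inl c0⟩)) (h2 σ₀ s0)
    · by_cases e2 : r = B
      · have h3 := h1 σ₁ (e2 ▸ s1)
        subst e2
        unfold InColumn at *
        dsimp only at *
        omega
      · by_cases e3 : r + 1 = B + (2 * n - 2)
        · have h3 := h2 τ₁ (e3 ▸ t1)
          unfold InColumn at *
          dsimp only at *
          rw [e3] at h3
          omega
        · by_cases e4 : r = B + (2 * n - 2)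
          · have h3 := h1 τ₀ (e4 ▸ t0)
            unfold InColumn at *
            dsimp only at *
            rw [e4] at h3
            omega
          · unfold InColumn at *
            dsimp only at *
            omega
  · rintro ⟨h1, h2, h3⟩
    constructor <;> intro σ _ <;> unfold InColumn <;> dsimp only <;> omega

/-- What can be seen from a column about a block on which no block rests. -/
theorem top_of_inColumn {x c r : ℕ} {σ : Bool} (hB : B % (2 * n - 2) = 0) (hx : 1 ≤ x)
    (hx2 : x ≤ 2 * n) (h : InColumn n N B x (c, r, σ))
    (hσ : σ ∈ (patternC n N).slots r) (hc : 1 ≤ (patternC n N).color (c, r, σ))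
    (htop : ∀ σ ∈ (patternC n N).slots (r + 1), ¬ InColumn n N B x (c, r + 1, σ)) :
    2 ≤ x ∧ r + 2 = B + x ∧
      (if x - 1 = 1 ∨ x - 1 = 2 * n - 1 then (patternC n N).color (c, r, σ) = 1 else σ = false) := by
  have hB2 : (B + (2 * n - 2)) % (2 * n - 2) = 0 := by rw [Nat.add_mod_right, hB]
  obtain ⟨σ₀, s0, c0⟩ := exists_color (n := n) (N := N) c hB (show 0 ≤ 1 by omega)
  obtain ⟨τ₁, t1, d1⟩ := exists_color (n := n) (N := N) c hB2 (show 1 ≤ 1 by omega)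
  have hf := htop false (mem_slots.2 (Or.inl rfl))
  have hl := fun h => color_half_lt (n := n) (N := N) (c := c) (r := r) (σ := σ) h
  have hu := fun h1 h2 => slot_unit (N := N) hB (r := r) (σ := σ) h1 h2 hσ
  by_cases e1 : r + 1 = B
  · rw [e1] at htop
    exact absurd (Or.inr (Or.inl ⟨rfl, Or.inl c0⟩)) (htop σ₀ s0)
  · by_cases e2 : r = B
    · have hl := hl (by rw [e2, hB])
      have : x = 2 := by
        unfold InColumn at *; dsimp only at *; omega
      rw [if_pos (by omega)]
      omega
    · by_cases e3 : r + 1 = B + (2 * n - 2)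
      · have h3 := htop τ₁ (e3 ▸ t1)
        have hu := hu (by omega) (by omega)
        have : x = 2 * n - 1 := by
          unfold InColumn at *
          dsimp only at *
          rw [e3] at h3
          omega
        rw [if_neg (by omega)]
        exact ⟨by omega, by omega, hu⟩
      · by_cases e4 : r = B + (2 * n - 2)
        · have hl := hl (by rw [e4, hB2])
          have : x = 2 * n := by
            unfold InColumn at *; dsimp only at *; omega
          rw [if_pos (by omega)]
          omega
        · have : r + 2 = B + x ∧ B < r ∧ r < B + (2 * n - 2) := by
            unfold InColumn at *; dsimp only at *; omega
          rw [if_neg (by omega)]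
          exact ⟨by omega, by omega, hu (by omega) (by omega)⟩

/-- What can be seen from a column about a free slot below which there is no free slot. -/
theorem free_of_not_inColumn {x c r : ℕ} {σ : Bool} (hB : B % (2 * n - 2) = 0) (hx : 1 ≤ x)
    (hx2 : x ≤ 2 * n) (h : ¬ InColumn n N B x (c, r, σ))
    (hσ : σ ∈ (patternC n N).slots r) (hc : 1 ≤ (patternC n N).color (c, r, σ))
    (hbelow : r ≠ 0 → ∀ σ ∈ (patternC n N).slots (r - 1), InColumn n N B x (c, r - 1, σ)) :
    x < 2 * n ∧ r + 1 = B + x ∧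
      (if x = 1 ∨ x = 2 * n - 1 then (patternC n N).color (c, r, σ) = 1 else σ = false) := by
  have hB2 : (B + (2 * n - 2)) % (2 * n - 2) = 0 := by rw [Nat.add_mod_right, hB]
  obtain ⟨σ₁, s1, c1⟩ := exists_color (n := n) (N := N) c hB (show 1 ≤ 1 by omega)
  obtain ⟨τ₀, t0, d0⟩ := exists_color (n := n) (N := N) c hB2 (show 0 ≤ 1 by omega)
  have hl := fun h => color_half_lt (n := n) (N := N) (c := c) (r := r) (σ := σ) h
  have hu := fun h1 h2 => slot_unit (N := N) hB (r := r) (σ := σ) h1 h2 hσ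
  by_cases e1 : r = B
  · have hl := hl (by rw [e1, hB])
    have : x = 1 := by
      unfold InColumn at *; dsimp only at *; omega
    rw [if_pos (by omega)]
    omega
  · have hr : B < r := by unfold InColumn at h; dsimp only at h; omega
    have hf := hbelow (by omega) false (mem_slots.2 (Or.inl rfl))
    by_cases e2 : r = B + 1
    · have h3 := hbelow (by omega) σ₁ (by rw [e2]; exact s1)
      have hu := hu (by omega) (by omega)
      have : x = 2 := by
        subst e2
        unfold InColumn at *
        dsimp only at *
        rw [Nat.add_sub_cancel] at h3
        omega
      rw [if_neg (by omega)]
      exact ⟨by omega, by omega, hu⟩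
    · by_cases e3 : r = B + (2 * n - 2)
      · have hl := hl (by rw [e3, hB2])
        have : x = 2 * n - 1 := by
          unfold InColumn at *; dsimp only at *; omega
        rw [if_pos (by omega)]
        omega
      · by_cases e4 : r = B + (2 * n - 2) + 1
        · have h3 := hbelow (by omega) τ₀ (by rw [e4]; exact t0)
          subst e4
          unfold InColumn at *
          dsimp only at *
          rw [Nat.add_sub_cancel] at h3
          omega
        · have : r + 1 = B + x ∧ B < r ∧ r < B + (2 * n - 2) := by
            unfold InColumn at *; dsimp only at *; omega
          rw [if_neg (by omega)]
          exact ⟨by omega, by omega, hu (by omega) (by omega)⟩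

end Column

end TypeC

/-! ### Walls of type $A_{2n-1}^{(2)}$ as a model of columns of letters -/

namespace TypeC

section Place

variable {n : ℕ} {s : List ℕ}

theorem base_mod (n : ℕ) (s : List ℕ) (k : ℕ) : base n s k % (2 * n - 2) = 0 :=
  Nat.mul_mod_left _ _

theorem base_succ (n : ℕ) {s : List ℕ} {k : ℕ} (hk : k + 1 < s.length) :
    base n s k = base n s (k + 1) + (2 * n - 2) := by
  unfold base
  rw [show s.length - 1 - k = (s.length - 1 - (k + 1)) + 1 by omega, Nat.succ_mul]

theorem base_eq_zero {n : ℕ} (hn : 3 ≤ n) {s : List ℕ} {k : ℕ} (hk : k < s.length) :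
    base n s k = 0 ↔ k + 1 = s.length := by
  unfold base
  rw [Nat.mul_eq_zero]
  omega

/-- The letters $2,\dots,2n-1$ fill one period of $2n-2$ heights, so the height of a full column
determines both its part and its letter. -/
theorem base_eq_iff {n : ℕ} (hn : 3 ≤ n) {s : List ℕ} {k k' x x' : ℕ} (hk : k < s.length)
    (hk' : k' < s.length) (hx : 2 ≤ x) (hx2 : x ≤ 2 * n - 1) (hx' : 2 ≤ x')
    (hx2' : x' ≤ 2 * n - 1) (h : base n s k + x = base n s k' + x') : k = k' ∧ x = x' := by
  have key : ∀ k x, 2 ≤ x → x ≤ 2 * n - 1 →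
      (base n s k + x - 2) / (2 * n - 2) = s.length - 1 - k := by
    intro k x h2 h3
    unfold base
    rw [show (s.length - 1 - k) * (2 * n - 2) + x - 2 =
      (x - 2) + (s.length - 1 - k) * (2 * n - 2) by omega,
      Nat.add_mul_div_right _ _ (by omega), Nat.div_eq_of_lt (by omega), Nat.zero_add]
  have h1 := key k x hx hx2
  have h2 := key k' x' hx' hx2'
  rw [h] at h1
  have : k = k' := by omega
  subst this
  exact ⟨rfl, by omega⟩

theorem place_iff (hn : 3 ≤ n) {k a u : ℕ} (hu : 1 ≤ u) {b : Block} :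
    b = place n s k a u ↔ b.1 = start s k + a ∧ b.2.1 + 1 = base n s k + u ∧
      (if u = 1 ∨ u = 2 * n - 1 then (patternC n s.sum).color b = 1 else b.2.2 = false) := by
  obtain ⟨c, r, σ⟩ := b
  unfold place
  simp only [Prod.mk.injEq]
  constructor
  · rintro ⟨rfl, rfl, h⟩
    refine ⟨rfl, by omega, ?_⟩
    split_ifs at h ⊢ with h1
    · refine (decide_color ?_).1 h.symm
      rcases h1 with rfl | rfl
      · exact base_mod n s k
      · rw [show base n s k + (2 * n - 1) - 1 = base n s k + (2 * n - 2) by omega,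
          Nat.add_mod_right, base_mod]
    · exact h
  · rintro ⟨rfl, h2, h⟩
    obtain rfl : r = base n s k + u - 1 := by omega
    refine ⟨rfl, rfl, ?_⟩
    split_ifs at h ⊢ with h1
    · refine ((decide_color ?_).2 h).symm
      rcases h1 with rfl | rfl
      · exact base_mod n s k
      · rw [show base n s k + (2 * n - 1) - 1 = base n s k + (2 * n - 2) by omega,
          Nat.add_mod_right, base_mod]
    · exact h

theorem color_place (hn : 3 ≤ n) {k a u : ℕ} (hu : 1 ≤ u) (hu2 : u < 2 * n) :
    (patternC n s.sum).color (place n s k a u) = if u ≤ n then u else 2 * n - u := by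
  have h := (place_iff (s := s) (k := k) (a := a) hn hu).1 rfl
  by_cases h1 : u = 1 ∨ u = 2 * n - 1
  · rw [if_pos h1] at h
    rw [h.2.2]
    split_ifs <;> omega
  · have : place n s k a u = (start s k + a, base n s k + (u - 1), false) := by
      unfold place; rw [if_neg h1]; congr 2; omega
    rw [this, color_unit (base_mod n s k) (by omega) (by omega)]
    split_ifs <;> omega

theorem place_mem_slots (hn : 3 ≤ n) {k a u : ℕ} (hu : 1 ≤ u) :
    (place n s k a u).2.2 ∈ (patternC n s.sum).slots (place n s k a u).2.1 := by
  rw [mem_slots]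
  by_cases h1 : u = 1 ∨ u = 2 * n - 1
  · right
    change (base n s k + u - 1) % (2 * n - 2) = 0
    rcases h1 with rfl | rfl
    · exact base_mod n s k
    · rw [show base n s k + (2 * n - 1) - 1 = base n s k + (2 * n - 2) by omega,
        Nat.add_mod_right, base_mod]
  · left
    unfold place; rw [if_neg h1]

theorem not_inColumn_place (hn : 3 ≤ n) {k a x : ℕ} (hx : 1 ≤ x) (hx2 : x < 2 * n) :
    ¬ InColumn n s.sum (base n s k) x (place n s k a x) := by
  have h := (place_iff (s := s) (k := k) (a := a) hn hx).1 rfl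
  unfold InColumn
  split_ifs at h <;> omega

/-- Passing to the next letter adds a single block. It is the $1$-block of a row of half-unit
thickness for the first and the last arrow, and a unit cube otherwise. -/
theorem inColumn_succ_iff (hn : 3 ≤ n) {N B x : ℕ} (hB : B % (2 * n - 2) = 0) (hx : 1 ≤ x)
    (hx2 : x < 2 * n) {b : Block} (hσ : b.2.2 ∈ (patternC n N).slots b.2.1) :
    InColumn n N B (x + 1) b ↔ InColumn n N B x b ∨ (b.2.1 + 1 = B + x ∧
      (if x = 1 ∨ x = 2 * n - 1 then (patternC n N).color b = 1 else b.2.2 = false)) := by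
  obtain ⟨c, r, σ⟩ := b
  have hl := fun h => color_half_lt (n := n) (N := N) (c := c) (r := r) (σ := σ) h
  have hu := fun h1 h2 => slot_unit (N := N) hB (r := r) (σ := σ) h1 h2 hσ
  by_cases e1 : r = B
  · have hl := hl (by rw [e1, hB])
    unfold InColumn
    dsimp only at *
    by_cases h1 : x = 1 ∨ x = 2 * n - 1
    · rw [if_pos h1]; omega
    · rw [if_neg h1]; omega
  · by_cases e2 : r = B + (2 * n - 2)
    · have hl := hl (by rw [e2, Nat.add_mod_right, hB])
      unfold InColumn
      dsimp only at *
      by_cases h1 : x = 1 ∨ x = 2 * n - 1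
      · rw [if_pos h1]; omega
      · rw [if_neg h1]; omega
    · unfold InColumn
      dsimp only at *
      by_cases h1 : x = 1 ∨ x = 2 * n - 1
      · rw [if_pos h1]; omega
      · rw [if_neg h1]
        constructor
        · intro h
          by_cases h2 : r + 1 = B + x
          · exact Or.inr ⟨h2, hu (by omega) (by omega)⟩
          · omega
        · omega

theorem inColumn_succ (hn : 3 ≤ n) {k a x : ℕ} (hx : 1 ≤ x) (hx2 : x < 2 * n) {b : Block}
    (hb : b.1 = start s k + a) (hσ : b.2.2 ∈ (patternC n s.sum).slots b.2.1) :
    InColumn n s.sum (base n s k) (x + 1) b ↔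
      InColumn n s.sum (base n s k) x b ∨ b = place n s k a x := by
  rw [place_iff hn hx, inColumn_succ_iff hn (base_mod n s k) hx hx2 hσ]
  exact or_congr_right (and_iff_right hb).symm

end Place

/-- The columns of the wall `Y` represent the entries of `X`. -/
def St (n : ℕ) (s : List ℕ) (Y : Finset Block) (X : Tableau) : Prop :=
  (∀ k a, k < s.length → a < len s k → ∀ b : Block, b.1 = start s k + a →
    ((patternC n s.sum).Filled Y b ↔ b.2.2 ∈ (patternC n s.sum).slots b.2.1 ∧
      InColumn n s.sum (base n s k) (X k a) b)) ∧
  (∀ b ∈ Y, b.1 < s.sum) ∧ ∀ b ∈ Y, (patternC n s.sum).ground b = false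

section Walls

variable {n : ℕ} (hn : 3 ≤ n) {s : List ℕ} (hs : ∀ k < s.length, 1 ≤ len s k)
include hn hs

omit hn hs in
theorem exists_mem_of_full {Y : Finset Block} {c r : ℕ}
    (h : (patternC n s.sum).IsFullColumn Y c r) : ∃ σ, (c, r, σ) ∈ Y := by
  by_cases hr : r = 0
  · subst hr
    refine ⟨true, (h.1 true (mem_slots.2 (Or.inr (Nat.zero_mod _)))).resolve_left ?_⟩
    rw [ground_iff]; simp
  · refine ⟨false, (h.1 false (mem_slots.2 (Or.inl rfl))).resolve_left ?_⟩
    rw [ground_iff]; simp [hr]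

omit hs in
theorem St.full_iff {Y : Finset Block} {X : Tableau} (h : St n s Y X)
    (hE : Entries (2 * n) s X) {k a r : ℕ} (hk : k < s.length) (ha : a < len s k) :
    (patternC n s.sum).IsFullColumn Y (start s k + a) r ↔
      2 ≤ X k a ∧ X k a ≤ 2 * n - 1 ∧ r + 2 = base n s k + X k a := by
  have hXm := hE k a hk ha
  rw [← TypeC.full_iff (N := s.sum) (c := start s k + a) hn (base_mod n s k) hXm.1 hXm.2]
  refine and_congr (forall₂_congr fun σ hσ => ?_) (forall₂_congr fun σ hσ => not_congr ?_)
  · rw [h.1 k a hk ha _ rfl]; exact and_iff_right hσ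
  · rw [h.1 k a hk ha _ rfl]; exact and_iff_right hσ

/-- Full columns of equal height belong to one part and represent the same letter, so strictness
excludes them; the absence of free space on the right was checked for columns inside a part and for
neighbouring parts separately. -/
theorem isProper_of_strict {Y : Finset Block} {X : Tableau} (h : St n s Y X)
    (hE : Entries (2 * n) s X) (hX : Strict s X) : (patternC n s.sum).IsProper Y := by
  refine ⟨fun b hb => ?_, fun _ b hb b' hb' hf hf' hr => ?_⟩
  · obtain ⟨c, r, σ⟩ := b
    obtain ⟨k, a, hk, ha, rfl⟩ := exists_box (h.2.1 _ hb)
    obtain ⟨hslot, hin⟩ := (h.1 k a hk ha _ rfl).1 (Or.inr hb)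
    refine ⟨h.2.2 _ hb, hslot, fun hr0 τ hτ => ?_, fun hc => ?_⟩
    · exact (h.1 k a hk ha _ rfl).2 ⟨hτ, hin.below hn hr0 τ⟩
    · dsimp only at hc ⊢
      rcases right_column hs hk hc with ⟨ha0, e⟩ | ⟨rfl, j, rfl, e⟩
      · rw [e]
        refine (h.1 k (a - 1) hk (by omega) _ rfl).2 ⟨hslot, ?_⟩
        have h1 := hX k hk (a - 1) (by omega)
        rw [Nat.sub_add_cancel ha0] at h1
        exact hin.right hn (hE k a hk ha).1 h1 (hE k (a - 1) hk (by omega)).2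
      · rw [e]
        have := hs j (by omega)
        refine (h.1 j (len s j - 1) (by omega) (by omega) _ rfl).2 ⟨hslot, ?_⟩
        rw [base_succ n hk]
        refine InColumn.right_part hn (base_mod n s (j + 1)) (x' := X (j + 1) 0) ?_
        rw [← e, Nat.sub_add_cancel (by omega)]
        exact hin
  · obtain ⟨k, a, hk, ha, e⟩ := exists_box (h.2.1 _ hb)
    obtain ⟨k', a', hk', ha', e'⟩ := exists_box (h.2.1 _ hb')
    rw [e, h.full_iff hn hE hk ha] at hf
    rw [e', h.full_iff hn hE hk' ha'] at hf'
    obtain ⟨rfl, hx⟩ := base_eq_iff hn hk hk' hf.1 hf.2.1 hf'.1 hf'.2.1 (by omega)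
    have := (hX k hk).inj ha ha' hx
    omega

omit hs in
-- The building rule makes the left column no higher, which leaves equal letters to be excluded.
-- Equal letters among $2,\dots,2n-1$ give full columns of the same height; for $1$ and $\bar1$ the
-- alternation of the colours in the half-rows gives the contradiction.
theorem strict_of_isProper {Y : Finset Block} {X : Tableau} (h : St n s Y X)
    (hE : Entries (2 * n) s X) (hY : (patternC n s.sum).IsProper Y) : Strict s X := by
  intro k hk a ha
  by_contra hlt
  have e1 := hE k a hk (by omega)
  have e2 := hE k (a + 1) hk ha
  have hB := base_mod n s k
  have hB2 : (base n s k + (2 * n - 2)) % (2 * n - 2) = 0 := by rw [Nat.add_mod_right, hB]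
  have hright : ∀ r, ∀ σ ∈ (patternC n s.sum).slots r,
      InColumn n s.sum (base n s k) (X k (a + 1)) (start s k + a + 1, r, σ) →
      InColumn n s.sum (base n s k) (X k a) (start s k + a, r, σ) := by
    intro r σ hσ hin
    refine ((h.1 k a hk (by omega) _ rfl).1 ?_).2
    rcases (h.1 k (a + 1) hk ha (start s k + a + 1, r, σ) rfl).2 ⟨hσ, hin⟩ with hg | hm
    · exact Or.inl (by rw [ground_iff] at hg ⊢; exact hg)
    · exact (hY.1 _ hm).2.2.2 (Nat.succ_ne_zero _)
  -- The $1$-block on top of a column of letter $\bar1$ would need the slot to its right to be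
  -- filled. That slot has colour $0$ and lies in the last row of the same part, where only
  -- $1$-blocks occur.
  have c1 : X k (a + 1) < 2 * n := by
    by_contra h2
    obtain ⟨σ, hσ, hc⟩ := exists_color (n := n) (N := s.sum) (start s k + a + 1) hB2
      (show 1 ≤ 1 by omega)
    have h3 := hright _ σ hσ (by unfold InColumn; dsimp only; omega)
    have h4 := color_half_succ (n := n) (N := s.sum) (c := start s k + a) (σ := σ) hB2
    unfold InColumn at h3
    dsimp only at h3
    omega
  have c2 : 2 ≤ X k a := by
    by_contra h2
    obtain ⟨σ, hσ, hc⟩ := exists_color (n := n) (N := s.sum) (start s k + a + 1) hB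
      (show 0 ≤ 1 by omega)
    have h3 := hright _ σ hσ (by unfold InColumn; dsimp only; omega)
    have h4 := color_half_succ (n := n) (N := s.sum) (c := start s k + a) (σ := σ) hB
    unfold InColumn at h3
    dsimp only at h3
    omega
  rcases Nat.eq_or_lt_of_le (not_lt.1 hlt) with heq | hlt'
  · have f1 := (h.full_iff hn hE hk (show a < len s k by omega)
      (r := base n s k + X k a - 2)).2 ⟨by omega, by omega, by omega⟩
    have f2 := (h.full_iff hn hE hk ha
      (r := base n s k + X k a - 2)).2 ⟨by omega, by omega, by omega⟩
    obtain ⟨σ, m1⟩ := exists_mem_of_full f1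
    obtain ⟨τ, m2⟩ := exists_mem_of_full f2
    have := hY.2 rfl _ m1 _ m2 f1 f2 rfl
    dsimp only at this
    omega
  · have h3 := hright (base n s k + X k (a + 1) - 2) false (mem_slots.2 (Or.inl rfl))
      (by unfold InColumn; dsimp only; omega)
    unfold InColumn at h3
    dsimp only at h3
    omega

theorem wallModel : WallModel n (2 * n) s (patternC n s.sum)
    (fun x => if x ≤ n then x else 2 * n - x) (place n s) (St n s) where
  slot_exists r := by
    by_cases hr : r = 0
    · subst hr
      exact ⟨true, mem_slots.2 (Or.inr (Nat.zero_mod _)), fun c => by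
        rw [ground_eq_false_iff]; simp⟩
    · exact ⟨false, mem_slots.2 (Or.inl rfl), fun c => by
        rw [ground_eq_false_iff]; simp [hr]⟩
  ground_eq _ _ _ _ := rfl
  place_fst _ _ _ := rfl
  color_removable Y X h hE k a hk ha h2 hmem := by
    have := hE k a hk ha
    exact color_place hn (by omega) (by omega)
  color_admissible Y X h hE k a hk ha h2 := color_place hn (hE k a hk ha).1 h2
  proper_iff Y X h hE := ⟨strict_of_isProper hn h hE, isProper_of_strict hn hs h hE⟩
  removable_top Y X c b h hE hc hr := by
    obtain ⟨hb, hcol, hp⟩ := hr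
    obtain ⟨l, r, σ⟩ := b
    obtain ⟨k, a, hk, ha, rfl⟩ := exists_box (h.2.1 _ hb)
    obtain ⟨hslot, hin⟩ := (h.1 k a hk ha _ rfl).1 (Or.inr hb)
    have hXm := hE k a hk ha
    have htop : ∀ τ ∈ (patternC n s.sum).slots (r + 1),
        ¬ InColumn n s.sum (base n s k) (X k a) (start s k + a, r + 1, τ) := by
      intro τ hτ hτin
      have hm : (start s k + a, r + 1, τ) ∈ Y := by
        refine ((h.1 k a hk ha _ rfl).2 ⟨hτ, hτin⟩).resolve_left ?_
        rw [ground_iff]; simp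
      rcases (hp.1 _ (Finset.mem_erase.2 ⟨by simp, hm⟩)).2.2.1 (Nat.succ_ne_zero _) σ hslot
        with hg | hg
      · rw [show (start s k + a, r + 1 - 1, σ) = (start s k + a, r, σ) from rfl, h.2.2 _ hb] at hg
        exact absurd hg (by simp)
      · exact (Finset.mem_erase.1 hg).1 rfl
    obtain ⟨h2, h3, h4⟩ := top_of_inColumn hn (base_mod n s k) hXm.1 hXm.2 hin hslot
      (by omega) htop
    exact ⟨k, a, hk, ha, h2, (place_iff hn (by omega)).2 ⟨rfl, by dsimp only; omega, h4⟩⟩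
  admissible_top Y X c b h hE hc hr := by
    obtain ⟨hb, hcol, hp⟩ := hr
    obtain ⟨l, r, σ⟩ := b
    obtain ⟨hg, hslot, hbelow, hright⟩ := hp.1 _ (Finset.mem_insert_self _ _)
    dsimp only at hslot hbelow hright
    have hbelow' : r ≠ 0 → ∀ τ ∈ (patternC n s.sum).slots (r - 1),
        (patternC n s.sum).Filled Y (l, r - 1, τ) := by
      intro hr0 τ hτ
      rcases hbelow hr0 τ hτ with h1 | h1
      · exact Or.inl h1
      · refine Or.inr (Finset.mem_of_mem_insert_of_ne h1 ?_)
        simp only [ne_eq, Prod.mk.injEq]; omega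
    rcases Nat.lt_or_ge l s.sum with hl | hl
    · obtain ⟨k, a, hk, ha, rfl⟩ := exists_box hl
      have hXm := hE k a hk ha
      have hin : ¬ InColumn n s.sum (base n s k) (X k a) (start s k + a, r, σ) := by
        intro hin
        rcases (h.1 k a hk ha _ rfl).2 ⟨hslot, hin⟩ with h1 | h1
        · rw [hg] at h1; exact absurd h1 (by simp)
        · exact hb h1
      obtain ⟨h2, h3, h4⟩ := free_of_not_inColumn hn (base_mod n s k) hXm.1 hXm.2 hin hslot
        (by omega) (fun hr0 τ hτ => ((h.1 k a hk ha _ rfl).1 (hbelow' hr0 τ hτ)).2)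
      exact ⟨k, a, hk, ha, h2, (place_iff hn hXm.1).2 ⟨rfl, h3, h4⟩⟩
    · have hr0 : r = 0 := by
        by_contra hr0
        have key : ∃ τ, (l, r - 1, τ) ∈ Y := by
          by_cases hr1 : r - 1 = 0
          · refine ⟨true, (hbelow' hr0 true (mem_slots.2
              (Or.inr (by rw [hr1, Nat.zero_mod])))).resolve_left ?_⟩
            rw [ground_iff]; simp
          · refine ⟨false, (hbelow' hr0 false (mem_slots.2 (Or.inl rfl))).resolve_left ?_⟩
            rw [ground_iff]; simp [hr1]
        obtain ⟨τ, hτ⟩ := key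
        have := h.2.1 _ hτ
        dsimp only at this; omega
      subst hr0
      have hσ : σ = true := by
        rw [ground_eq_false_iff] at hg
        simpa using hg
      subst hσ
      have hl0 : l = s.sum := by
        by_contra hl0
        rcases hright (by omega) with h1 | h1
        · rw [ground_iff] at h1; simp at h1
        · have h2 := Finset.mem_of_mem_insert_of_ne h1
            (by simp only [ne_eq, Prod.mk.injEq]; omega)
          have := h.2.1 _ h2
          dsimp only at this; omega
      -- The only slot available left of the shape is the front slot at the bottom of column $N$;
      -- its colour is even, hence $0$.
      rw [color_half (Nat.zero_mod _), hl0, if_pos rfl] at hcol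
      omega
  mem_place Y X h hE hX k a hk ha h2 hdel := by
    have hXm := hE k a hk ha
    have hpl := (place_iff (s := s) (k := k) (a := a) hn (show 1 ≤ X k a - 1 by omega)).1 rfl
    have hin := (inColumn_succ hn (x := X k a - 1) (b := place n s k a (X k a - 1)) (by omega)
      (by omega) rfl (place_mem_slots hn (by omega))).2 (Or.inr rfl)
    rw [Nat.sub_add_cancel hXm.1] at hin
    refine ((h.1 k a hk ha _ rfl).2 ⟨place_mem_slots hn (by omega), hin⟩).resolve_left ?_
    rw [ground_iff]
    rintro ⟨h3, h4⟩
    -- The block of the arrow $1\to2$ could belong to the ground-state wall only at base $0$. As the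
    -- letter $1$ is not directly above, the column is then the left-most one of the wall, and its
    -- back block at the bottom has colour $0$.
    have hx2 : X k a = 2 := by omega
    have hb0 : base n s k = 0 := by omega
    have hk1 := (base_eq_zero hn hk).1 hb0
    have ha1 : a + 1 = len s k := by
      by_contra hne
      have l1 := (hX k hk) a (by omega)
      have l2 := (hE k (a + 1) hk (by omega)).1
      exact hdel ⟨by omega, by omega⟩
    have hsum : s.sum = start s k + a + 1 := by
      rw [← start_length, ← hk1, start_succ hk]; omega
    rw [if_pos (by omega)] at hpl
    have hc := hpl.2.2
    rw [show place n s k a (X k a - 1) = (start s k + a, 0, false) from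
      Prod.ext rfl (Prod.ext h3 h4), color_half (Nat.zero_mod _)] at hc
    simp only [Bool.false_eq_true, if_false] at hc
    omega
  not_mem_place Y X h hE k a hk ha h2 hmem := by
    exact not_inColumn_place hn (hE k a hk ha).1 h2 ((h.1 k a hk ha _ rfl).1 (Or.inr hmem)).2
  st_erase Y X h hE k a hk ha h2 hmem := by
    have hXm := hE k a hk ha
    have hgr := h.2.2 _ hmem
    refine ⟨fun j c hj hc b hb => ?_, fun b hb => h.2.1 b (Finset.mem_of_mem_erase hb),
      fun b hb => h.2.2 b (Finset.mem_of_mem_erase hb)⟩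
    have hF : (patternC n s.sum).Filled (Y.erase (place n s k a (X k a - 1))) b ↔
        (patternC n s.sum).Filled Y b ∧ b ≠ place n s k a (X k a - 1) := by
      unfold WallPattern.Filled
      rw [Finset.mem_erase]
      by_cases hbp : b = place n s k a (X k a - 1)
      · rw [hbp, hgr]; simp
      · simp [hbp]
    rw [hF, h.1 j c hj hc b hb, Tableau.upd_apply]
    split_ifs with e
    · obtain ⟨rfl, rfl⟩ := Prod.mk.inj e
      rw [and_assoc]
      refine and_congr_right fun hσ => ?_
      have h1 := inColumn_succ hn (x := X j c - 1) (by omega) (by omega) hb hσ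
      rw [Nat.sub_add_cancel hXm.1] at h1
      rw [h1]
      constructor
      · rintro ⟨h3 | h3, h4⟩
        · exact h3
        · exact absurd h3 h4
      · intro h3
        refine ⟨Or.inl h3, ?_⟩
        rintro rfl
        exact not_inColumn_place hn (by omega) (by omega) h3
    · refine and_iff_left ?_
      rintro rfl
      obtain ⟨rfl, rfl⟩ := start_inj hk ha hj hc hb
      exact e rfl
  st_insert Y X h hE k a hk ha h2 hmem := by
    have hXm := hE k a hk ha
    have hgr : (patternC n s.sum).ground (place n s k a (X k a)) = false := by
      rw [← Bool.not_eq_true]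
      intro hg
      exact not_inColumn_place hn hXm.1 h2 ((h.1 k a hk ha _ rfl).1 (Or.inl hg)).2
    refine ⟨fun j c hj hc b hb => ?_, fun b hb => ?_, fun b hb => ?_⟩
    · have hF : (patternC n s.sum).Filled (insert (place n s k a (X k a)) Y) b ↔
          (patternC n s.sum).Filled Y b ∨ b = place n s k a (X k a) := by
        unfold WallPattern.Filled
        rw [Finset.mem_insert]; tauto
      rw [hF, h.1 j c hj hc b hb, Tableau.upd_apply]
      split_ifs with e
      · obtain ⟨rfl, rfl⟩ := Prod.mk.inj e
        constructor
        · rintro (⟨h3, h4⟩ | rfl)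
          · exact ⟨h3, (inColumn_succ hn hXm.1 h2 hb h3).2 (Or.inl h4)⟩
          · have := place_mem_slots (s := s) (k := j) (a := c) hn hXm.1
            exact ⟨this, (inColumn_succ hn hXm.1 h2 hb this).2 (Or.inr rfl)⟩
        · rintro ⟨h3, h4⟩
          rcases (inColumn_succ hn hXm.1 h2 hb h3).1 h4 with h5 | h5
          · exact Or.inl ⟨h3, h5⟩
          · exact Or.inr h5
      · refine or_iff_left ?_
        rintro rfl
        obtain ⟨rfl, rfl⟩ := start_inj hk ha hj hc hb
        exact e rfl
    · rcases Finset.mem_insert.1 hb with rfl | hb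
      · exact start_add_lt hk ha
      · exact h.2.1 b hb
    · rcases Finset.mem_insert.1 hb with rfl | hb
      · exact hgr
      · exact h.2.2 b hb

end Walls

end TypeC

/-! ### The wall of a tableau of type $C_n$ -/

namespace TypeC

theorem mem_stack {n : ℕ} (hn : 3 ≤ n) {s : List ℕ} {k a x : ℕ} (hx : 1 ≤ x) (hx2 : x ≤ 2 * n)
    {b : Block} : b ∈ stack n s k a x ↔ b.1 = start s k + a ∧
      b.2.2 ∈ (patternC n s.sum).slots b.2.1 ∧ (patternC n s.sum).ground b = false ∧
      InColumn n s.sum (base n s k) x b := by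
  obtain ⟨c, r, σ⟩ := b
  unfold stack
  rw [Finset.mem_filter]
  have e1 : ((c, r, σ) : Block) ∈ (Finset.range (base n s k + 2 * n) ×ˢ
      (Finset.univ : Finset Bool)).image (fun y => ((start s k + a, y.1, y.2) : Block)) ↔
      c = start s k + a ∧ r < base n s k + 2 * n := by
    simp only [Finset.mem_image, Finset.mem_product, Finset.mem_range, Finset.mem_univ, and_true,
      Prod.mk.injEq, Prod.exists]
    constructor
    · rintro ⟨r, σ, h, rfl, rfl, rfl⟩; exact ⟨rfl, h⟩
    · rintro ⟨rfl, h⟩; exact ⟨r, σ, h, rfl, rfl, rfl⟩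
  rw [e1, and_assoc]
  refine and_congr_right fun _ => ?_
  have e2 : (if x = 1 then
      r < base n s k ∨ (r = base n s k ∧ (patternC n s.sum).color (c, r, σ) = 0)
    else if x = bar n 1 then
      r < base n s k + (2 * n - 2) ∨
        (r = base n s k + (2 * n - 2) ∧ (patternC n s.sum).color (c, r, σ) = 1)
    else r < base n s k + x - 1) ↔ InColumn n s.sum (base n s k) x (c, r, σ) := by
    unfold InColumn bar
    dsimp only
    by_cases h1 : x = 1
    · rw [if_pos h1]; omega
    · rw [if_neg h1]
      by_cases h2 : x = 2 * n + 1 - 1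
      · rw [if_pos h2]; omega
      · rw [if_neg h2]; omega
  dsimp only
  rw [e2]
  constructor
  · rintro ⟨-, h⟩; exact h
  · intro h
    refine ⟨?_, h⟩
    have := h.2.2
    unfold InColumn at this
    dsimp only at this
    omega

/-- The wall whose columns represent the entries of a tableau. -/
def ofTableau (n : ℕ) (s : List ℕ) (T : Tableau) : Finset Block :=
  (Finset.range s.length).biUnion fun k => (Finset.range (len s k)).biUnion fun a =>
    stack n s k a (T k a)

theorem mem_ofTableau {n : ℕ} (hn : 3 ≤ n) {s : List ℕ} {T : Tableau} (hT : Entries (2 * n) s T)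
    {b : Block} : b ∈ ofTableau n s T ↔ ∃ k a, k < s.length ∧ a < len s k ∧ b.1 = start s k + a ∧
      b.2.2 ∈ (patternC n s.sum).slots b.2.1 ∧ (patternC n s.sum).ground b = false ∧
      InColumn n s.sum (base n s k) (T k a) b := by
  simp only [ofTableau, Finset.mem_biUnion, Finset.mem_range]
  constructor
  · rintro ⟨k, hk, a, ha, h⟩
    exact ⟨k, a, hk, ha, (mem_stack hn (hT k a hk ha).1 (hT k a hk ha).2).1 h⟩
  · rintro ⟨k, a, hk, ha, h⟩
    exact ⟨k, hk, a, ha, (mem_stack hn (hT k a hk ha).1 (hT k a hk ha).2).2 h⟩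

theorem highest_eq (n : ℕ) (s : List ℕ) : highest n s = ofTableau n s (topTableau s) := by
  refine Finset.biUnion_congr rfl fun k hk => Finset.biUnion_congr rfl fun a ha => ?_
  rw [topTableau_of_lt (Finset.mem_range.1 hk) (Finset.mem_range.1 ha)]

/-- The blocks of the ground-state wall belong to the columns of every tableau. -/
theorem inColumn_of_ground {n : ℕ} (hn : 3 ≤ n) {s : List ℕ} {k a x : ℕ} (hk : k < s.length)
    (ha : a < len s k) (hx : len s k - a ≤ x) {b : Block} (hb : b.1 = start s k + a)
    (hg : (patternC n s.sum).ground b = true) : b.2.2 ∈ (patternC n s.sum).slots b.2.1 ∧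
      InColumn n s.sum (base n s k) x b := by
  obtain ⟨c, r, σ⟩ := b
  rw [ground_iff] at hg
  obtain ⟨h1, h2⟩ := hg
  dsimp only at hb h1 h2
  subst hb h1 h2
  refine ⟨mem_slots.2 (Or.inl rfl), ?_⟩
  unfold InColumn
  dsimp only
  by_cases hb0 : base n s k = 0
  · by_cases hx2 : 2 ≤ x
    · exact Or.inr (Or.inl ⟨hb0.symm, Or.inr hx2⟩)
    -- The letter $1$ at base $0$ occurs only in the left-most column, by the hypothesis $i_k-a\le
    -- x$. The parity in the definition of the ground-state wall makes its ground block a $0$-block.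
    · have hk1 := (base_eq_zero hn hk).1 hb0
      have hsum : s.sum = start s k + a + 1 := by
        rw [← start_length, ← hk1, start_succ hk]; omega
      refine Or.inr (Or.inl ⟨hb0.symm, Or.inl ?_⟩)
      rw [color_half (Nat.zero_mod _)]
      simp only [Bool.false_eq_true, if_false]
      omega
  · omega

theorem st_iff {n : ℕ} (hn : 3 ≤ n) {s : List ℕ} {T : Tableau} (hE : Entries (2 * n) s T)
    (hT : ∀ k a, k < s.length → a < len s k → len s k - a ≤ T k a) {Y : Finset Block} :
    St n s Y T ↔ Y = ofTableau n s T := by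
  constructor
  · rintro ⟨h1, h2, h3⟩
    ext b
    rw [mem_ofTableau hn hE]
    constructor
    · intro hb
      obtain ⟨k, a, hk, ha, hc⟩ := exists_box (h2 _ hb)
      have := (h1 k a hk ha b hc).1 (Or.inr hb)
      exact ⟨k, a, hk, ha, hc, this.1, h3 b hb, this.2⟩
    · rintro ⟨k, a, hk, ha, hc, h4, h5, h6⟩
      refine ((h1 k a hk ha b hc).2 ⟨h4, h6⟩).resolve_left ?_
      rw [h5]; simp
  · rintro rfl
    refine ⟨fun k a hk ha b hb => ?_, fun b hb => ?_, fun b hb => ?_⟩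
    · unfold WallPattern.Filled
      rw [mem_ofTableau hn hE]
      constructor
      · rintro (h | ⟨k', a', hk', ha', h1, h2, -, h3⟩)
        · exact inColumn_of_ground hn hk ha (hT k a hk ha) hb h
        · obtain ⟨rfl, rfl⟩ := start_inj hk ha hk' ha' (hb.symm.trans h1)
          exact ⟨h2, h3⟩
      · rintro ⟨h2, h3⟩
        by_cases hg : (patternC n s.sum).ground b = true
        · exact Or.inl hg
        · exact Or.inr ⟨k, a, hk, ha, hb, h2, by simpa using hg, h3⟩
    · obtain ⟨k, a, hk, ha, h1, -⟩ := (mem_ofTableau hn hE).1 hb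
      rw [h1]; exact start_add_lt hk ha
    · obtain ⟨k, a, hk, ha, -, -, h1, -⟩ := (mem_ofTableau hn hE).1 hb
      exact h1

end TypeC

/-! ### Reducedness in type $C_n$ -/

namespace TypeC

theorem mod_of_color_le_one {n N : ℕ} (hn : 3 ≤ n) {b : Block}
    (h : (patternC n N).color b ≤ 1) : b.2.1 % (2 * n - 2) = 0 := by
  by_contra h0
  have := Nat.mod_lt b.2.1 (show 2 * n - 2 > 0 by omega)
  change (if b.2.1 % (2 * n - 2) = 0 then (N + b.1 + 1 + (if b.2.2 then 1 else 0)) % 2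
    else if b.2.1 % (2 * n - 2) < n then b.2.1 % (2 * n - 2) + 1
    else 2 * n - 1 - b.2.1 % (2 * n - 2)) ≤ 1 at h
  rw [if_neg h0] at h
  split_ifs at h <;> omega

theorem eq_of_mod {p B r : ℕ} (hB : B % p = 0) (hr : r % p = 0) (h1 : B ≤ r) (h2 : r < B + p) :
    r = B := by
  have h3 : (r - B) % p = 0 := by
    obtain ⟨c, rfl⟩ := Nat.dvd_of_mod_eq_zero hB
    obtain ⟨d, rfl⟩ := Nat.dvd_of_mod_eq_zero hr
    rw [← Nat.mul_sub, Nat.mul_mod_right]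
  rw [Nat.mod_eq_of_lt (by omega)] at h3
  omega

theorem sum_delta {n N : ℕ} (hn : 3 ≤ n) :
    ∑ c ∈ Finset.range (n + 1), (patternC n N).delta c = 2 * n - 1 := by
  obtain ⟨m, rfl⟩ : ∃ m, n = m + 2 := ⟨n - 2, by omega⟩
  change ∑ c ∈ Finset.range (m + 2 + 1),
    (if c ≤ 1 ∨ c = m + 2 then 1 else if c < m + 2 then 2 else 0) = _
  rw [Finset.sum_range_succ, if_pos (by omega), Finset.sum_range_succ', Finset.sum_range_succ',
    if_pos (by omega), if_pos (by omega), Finset.sum_congr rfl fun c hc => by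
      have := Finset.mem_range.1 hc
      rw [if_neg (by omega), if_pos (by omega)]]
  simp only [Finset.sum_const, Finset.card_range, smul_eq_mul]
  omega

theorem inColumn_half {n N B x : ℕ} {b : Block} (hB : B % (2 * n - 2) = 0)
    (hb : b.2.1 % (2 * n - 2) = 0) : InColumn n N B x b ↔ b.2.1 < B ∨
      (b.2.1 = B ∧ ((patternC n N).color b = 0 ∨ 2 ≤ x)) ∨
      (b.2.1 = B + (2 * n - 2) ∧ (patternC n N).color b = 1 ∧ x = 2 * n) := by
  have := eq_of_mod hB hb
  unfold InColumn
  constructor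
  · rintro (h | h | h | h)
    · exact Or.inl h
    · exact Or.inr (Or.inl h)
    · have := this h.1.le h.2.1
      omega
    · exact Or.inr (Or.inr h)
  · rintro (h | h | h)
    · exact Or.inl h
    · exact Or.inr (Or.inl h)
    · exact Or.inr (Or.inr (Or.inr h))

/-- A column of a part whose right neighbour in the part does not protect a `0`-block and a
`1`-block. -/
theorem extreme_of_free {n N B x y c r₀ r₁ : ℕ} {σ₀ σ₁ : Bool} (hB : B % (2 * n - 2) = 0)
    (hy : 1 ≤ y) (h₀ : r₀ % (2 * n - 2) = 0) (h₁ : r₁ % (2 * n - 2) = 0)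
    (c₀ : (patternC n N).color (c, r₀, σ₀) = 0) (c₁ : (patternC n N).color (c, r₁, σ₁) = 1)
    (i₀ : InColumn n N B x (c, r₀, σ₀)) (i₁ : InColumn n N B x (c, r₁, σ₁))
    (f₀ : ¬ InColumn n N B y (c + 1, r₀, σ₀)) (f₁ : ¬ InColumn n N B y (c + 1, r₁, σ₁)) :
    x = 2 * n ∧ y = 1 := by
  have s₀ := color_half_succ (n := n) (N := N) (c := c) (σ := σ₀) h₀
  have s₁ := color_half_succ (n := n) (N := N) (c := c) (σ := σ₁) h₁
  rw [inColumn_half hB h₀] at i₀ f₀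
  rw [inColumn_half hB h₁] at i₁ f₁
  dsimp only at *
  have : y = 1 := by omega
  have : x = 2 * n := by omega
  exact ⟨this, by omega⟩

/-- The same for the left-most column of a part, its right neighbour lying in the next part. -/
theorem inner_of_free {n N B x y c r₀ r₁ : ℕ} {σ₀ σ₁ : Bool} (hn : 3 ≤ n)
    (hB : B % (2 * n - 2) = 0) (h₀ : r₀ % (2 * n - 2) = 0) (h₁ : r₁ % (2 * n - 2) = 0)
    (c₀ : (patternC n N).color (c, r₀, σ₀) = 0) (c₁ : (patternC n N).color (c, r₁, σ₁) = 1)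
    (i₁ : InColumn n N (B + (2 * n - 2)) x (c, r₁, σ₁))
    (i₀ : InColumn n N (B + (2 * n - 2)) x (c, r₀, σ₀))
    (f₀ : ¬ InColumn n N B y (c + 1, r₀, σ₀)) (f₁ : ¬ InColumn n N B y (c + 1, r₁, σ₁)) :
    2 ≤ x ∧ y ≠ 2 * n := by
  have hB' : (B + (2 * n - 2)) % (2 * n - 2) = 0 := by rw [Nat.add_mod_right, hB]
  have s₀ := color_half_succ (n := n) (N := N) (c := c) (σ := σ₀) h₀
  have s₁ := color_half_succ (n := n) (N := N) (c := c) (σ := σ₁) h₁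
  have g₀ := eq_of_mod hB h₀
  have g₁ := eq_of_mod hB h₁
  rw [inColumn_half hB h₀] at f₀
  rw [inColumn_half hB h₁] at f₁
  rw [inColumn_half hB' h₀] at i₀
  rw [inColumn_half hB' h₁] at i₁
  dsimp only at *
  have h2 : 2 ≤ x := by
    by_contra h2
    have : r₁ < B + (2 * n - 2) := by omega
    have := g₁ (by omega) this
    omega
  refine ⟨h2, fun hy => ?_⟩
  have : r₀ ≤ B + (2 * n - 2) := by omega
  rcases this.lt_or_eq with h3 | h3
  · have := g₀ (by omega) h3
    omega
  · omega

/-- The blocks of the left-most column of a part that its left neighbour does not hold in place: one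
back block for each row of an interval, and one more front block in the half-row at the base of the
part. There are $2n-1+x-y$ of them. -/
theorem mem_window {n N B x y c r : ℕ} {σ : Bool} (hn : 3 ≤ n) (hB : B % (2 * n - 2) = 0)
    (hx : 2 ≤ x) (hxy : x ≤ y) (hy : y < 2 * n) (hσ : σ ∈ (patternC n N).slots r)
    (h : InColumn n N (B + (2 * n - 2)) x (c, r, σ)) (hf : ¬ InColumn n N B y (c + 1, r, σ)) :
    (c, r, σ) ∈ ((Finset.Ico (B + y - 1) (B + (2 * n - 2) + x - 1)).image
      fun r => ((c, r, false) : Block)) ∪ {(c, B + (2 * n - 2), true)} := by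
  have hB' : (B + (2 * n - 2)) % (2 * n - 2) = 0 := by rw [Nat.add_mod_right, hB]
  rw [Finset.mem_union, Finset.mem_singleton, Finset.mem_image]
  have hr : B + y - 1 ≤ r := by unfold InColumn at hf; dsimp only at hf; omega
  have hr' : r < B + (2 * n - 2) + x - 1 := by unfold InColumn at h; dsimp only at h; omega
  by_cases hr2 : r = B + (2 * n - 2)
  · cases σ
    · exact Or.inl ⟨_, Finset.mem_Ico.2 ⟨hr, hr'⟩, rfl⟩
    · exact Or.inr (by rw [hr2])
  · have hs : σ = false := by
      by_cases hr3 : r < B + (2 * n - 2)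
      · exact slot_unit hB (by omega) (by omega) hσ
      · exact slot_unit hB' (by omega) (by omega) hσ
    subst hs
    exact Or.inl ⟨_, Finset.mem_Ico.2 ⟨hr, hr'⟩, rfl⟩

/-- After the removal of a `δ`-column from the left-most column of a part, it has the same height as
the next column. -/
theorem not_isProper_sdiff_window {n : ℕ} (hn : 3 ≤ n) {s : List ℕ} {Y D : Finset Block}
    {X : Tableau} (h : St n s Y X) (hE : Entries (2 * n) s X) {k a c : ℕ} (hk : k + 1 < s.length)
    (ha : a < len s k) (h0 : 0 < len s (k + 1)) (hc : c = start s k + a)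
    (hc' : c + 1 = start s (k + 1) + 0) (hx : X k a = X (k + 1) 0) (h2 : 2 ≤ X k a)
    (h3 : X k a < 2 * n)
    (hD : D = ((Finset.Ico (base n s (k + 1) + X k a - 1) (base n s k + X k a - 1)).image
      fun r => ((c, r, false) : Block)) ∪ {(c, base n s k, true)}) :
    ¬ (patternC n s.sum).IsProper (Y \ D) := by
  intro hp
  have hB := base_succ n hk
  have hrow : ∀ b ∈ D, b.1 = c ∧ base n s (k + 1) + X k a - 1 ≤ b.2.1 := by
    intro b hb
    rw [hD, Finset.mem_union, Finset.mem_singleton, Finset.mem_image] at hb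
    rcases hb with ⟨r, hr, rfl⟩ | rfl
    · exact ⟨rfl, (Finset.mem_Ico.1 hr).1⟩
    · exact ⟨rfl, by dsimp only; omega⟩
  have hkeep : ∀ b, (b.1 = c → b.2.1 + 1 < base n s (k + 1) + X k a) →
      ((patternC n s.sum).Filled (Y \ D) b ↔ (patternC n s.sum).Filled Y b) := by
    intro b hb
    unfold WallPattern.Filled
    rw [Finset.mem_sdiff, and_iff_left]
    intro hbD
    have h5 := hrow b hbD
    have := hb h5.1
    omega
  have f1 : (patternC n s.sum).IsFullColumn (Y \ D) (c + 1) (base n s (k + 1) + X k a - 2) := by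
    have := (h.full_iff hn hE hk h0 (r := base n s (k + 1) + X k a - 2)).2
      ⟨by omega, by omega, by omega⟩
    rw [← hc'] at this
    refine ⟨fun σ hσ => (hkeep _ ?_).2 (this.1 σ hσ), fun σ hσ hf => this.2 σ hσ ((hkeep _ ?_).1 hf)⟩
    · intro h; simp at h
    · intro h; simp at h
  have f2 : (patternC n s.sum).IsFullColumn (Y \ D) c (base n s (k + 1) + X k a - 2) := by
    refine ⟨fun σ hσ => ?_, fun σ hσ hf => ?_⟩
    · rw [hkeep _ (fun _ => by dsimp only; omega), h.1 k a (by omega) ha _ hc]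
      exact ⟨hσ, by unfold InColumn; dsimp only; omega⟩
    · rcases hf with hg | hm
      · rw [ground_iff] at hg
        dsimp only at hg
        omega
      · obtain ⟨m1, m2⟩ := Finset.mem_sdiff.1 hm
        refine m2 ?_
        rw [hD, Finset.mem_union, Finset.mem_singleton, Finset.mem_image]
        have hbase := base_mod n s (k + 1)
        by_cases hr : base n s (k + 1) + X k a - 2 + 1 = base n s k
        · cases σ
          · exact Or.inl ⟨_, Finset.mem_Ico.2 ⟨by omega, by omega⟩, rfl⟩
          · exact Or.inr (by rw [hr])
        · obtain rfl := slot_unit hbase (by omega) (by omega) hσ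
          exact Or.inl ⟨_, Finset.mem_Ico.2 ⟨by omega, by omega⟩, rfl⟩
  obtain ⟨σ, m1⟩ := exists_mem_of_full f1
  obtain ⟨τ, m2⟩ := exists_mem_of_full f2
  have := hp.2 rfl _ m1 _ m2 f1 f2 rfl
  simp at this

/-- A $\delta$-column contains a $0$-block, a $1$-block and $2n-1$ blocks in all, none of them
needed by the column to the left. Inside a part this is possible only for $\bar1$ with $1$ directly
above, contrary to (1CC). At the boundary of two parts the row condition leaves exactly one
candidate set of blocks, whose removal makes two full columns equally high. In the left-most column
the only $0$-block belongs to the ground-state wall. -/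
theorem isReduced {n : ℕ} (hn : 3 ≤ n) {s : List ℕ} (hs : ∀ k < s.length, 1 ≤ len s k)
    (hmono : s.Pairwise (· ≤ ·)) {Y : Finset Block} {X : Tableau} (h : St n s Y X)
    (hX : X ∈ tableaux n s) : (patternC n s.sum).IsReduced Y := by
  obtain ⟨hT, hone, -, -⟩ := hX
  intro D hD c hc hdelta hp
  have hcard := card_eq_of_fibers (m := n + 1) hdelta fun c hc => by
    change (if c ≤ 1 ∨ c = n then 1 else if c < n then 2 else 0) = 0
    rw [if_neg (by omega), if_neg (by omega)]
  rw [sum_delta hn] at hcard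
  have hex : ∀ i ≤ 1, ∃ r σ, (c, r, σ) ∈ D ∧ (patternC n s.sum).color (c, r, σ) = i := by
    intro i hi
    have h1 := hdelta i
    rw [show (patternC n s.sum).delta i = 1 from if_pos (Or.inl hi)] at h1
    obtain ⟨⟨l, r, σ⟩, hb⟩ := Finset.card_pos.1 (by rw [h1]; exact Nat.one_pos)
    rw [Finset.mem_filter] at hb
    obtain rfl : l = c := hc _ hb.1
    exact ⟨r, σ, hb⟩
  obtain ⟨r0, σ0, hb0, hc0⟩ := hex 0 (by omega)
  obtain ⟨r1, σ1, hb1, hc1⟩ := hex 1 (by omega)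
  have hm0 := mod_of_color_le_one hn (b := (c, r0, σ0)) hc0.le.step
  have hm1 := mod_of_color_le_one hn (b := (c, r1, σ1)) hc1.le
  dsimp only at hm0 hm1
  obtain ⟨k, a, hk, ha, hca⟩ := exists_box (h.2.1 _ (hD hb0))
  dsimp only at hca
  have hin : ∀ r σ, (c, r, σ) ∈ D → σ ∈ (patternC n s.sum).slots r ∧
      InColumn n s.sum (base n s k) (X k a) (c, r, σ) := fun r σ hb =>
    (h.1 k a hk ha _ hca).1 (Or.inr (hD hb))
  have hfree : ∀ r σ, (c, r, σ) ∈ D → ∀ j a', j < s.length → a' < len s j →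
      c + 1 = start s j + a' → ¬ InColumn n s.sum (base n s j) (X j a') (c + 1, r, σ) := by
    intro r σ hb j a' hj ha' hc' hin'
    have hg := h.2.2 _ (hD hb)
    have hm : (c + 1, r, σ) ∈ Y := by
      refine ((h.1 j a' hj ha' _ hc').2 ⟨(hin r σ hb).1, hin'⟩).resolve_left ?_
      rw [show (patternC n s.sum).ground (c + 1, r, σ) = (patternC n s.sum).ground (c, r, σ) from
        rfl, hg]
      simp
    have hm' : (c + 1, r, σ) ∈ Y \ D := Finset.mem_sdiff.2 ⟨hm, fun h => by
      have := hc _ h; simp at this⟩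
    rcases (hp.1 _ hm').2.2.2 (Nat.succ_ne_zero c) with h3 | h3
    · rw [show ((c + 1, r, σ).1 - 1, (c + 1, r, σ).2.1, (c + 1, r, σ).2.2) = (c, r, σ) from rfl,
        hg] at h3
      exact absurd h3 (by simp)
    · exact (Finset.mem_sdiff.1 h3).2 hb
  have hB := base_mod n s k
  have e0 := (hin _ _ hb0).2
  have e1 := (hin _ _ hb1).2
  have eX := hT.entries k a hk ha
  by_cases ha1 : a + 1 < len s k
  · have f0 := hfree _ _ hb0 k (a + 1) hk ha1 (by omega)
    have f1 := hfree _ _ hb1 k (a + 1) hk ha1 (by omega)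
    have eY := hT.entries k (a + 1) hk ha1
    have := extreme_of_free hB eY.1 hm0 hm1 hc0 hc1 e0 e1 f0 f1
    have := hone k hk (a + 1) a 1 (by omega) ha1 le_rfl (by omega) this.2
      (by rw [this.1]; unfold bar; omega)
    push_cast at this
    omega
  · by_cases hk1 : k + 1 < s.length
    · have l2 := hs (k + 1) hk1
      have hc' : c + 1 = start s (k + 1) + 0 := by rw [hca, start_succ hk]; omega
      have f := fun r σ hb => hfree r σ hb (k + 1) 0 hk1 l2 hc'
      have f0 := f _ _ hb0
      have f1 := f _ _ hb1
      have hB' := base_mod n s (k + 1)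
      have hBB := base_succ n hk1
      have eY := hT.entries (k + 1) 0 hk1 l2
      have hxy : X k a ≤ X (k + 1) 0 := by
        refine (hT.rows k a hk1 ha).trans ?_
        have := len_mono hmono (Nat.le_succ k) hk1
        rw [Nat.succ_eq_add_one] at this
        rcases Nat.eq_zero_or_pos a with rfl | ha0
        · exact le_rfl
        · exact ((hT.strictColumn hk1).lt ha0 (by omega)).le
      have hx2 : 2 ≤ X k a ∧ X (k + 1) 0 ≠ 2 * n :=
        inner_of_free hn hB' hm0 hm1 hc0 hc1 (hBB ▸ e1) (hBB ▸ e0) f0 f1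
      set W := ((Finset.Ico (base n s (k + 1) + X (k + 1) 0 - 1) (base n s k + X k a - 1)).image
        fun r => ((c, r, false) : Block)) ∪ {(c, base n s k, true)} with hW
      have hsub : D ⊆ W := by
        rintro ⟨l, r, σ⟩ hb
        obtain rfl : l = c := hc _ hb
        obtain ⟨i1, i2⟩ := hin r σ hb
        rw [hBB] at i2
        rw [hW, hBB]
        exact mem_window hn hB' hx2.1 hxy (by omega) i1 i2 (f r σ hb)
      have hWcard : W.card ≤ (base n s k + X k a - 1) - (base n s (k + 1) + X (k + 1) 0 - 1) + 1 := by
        have h1 := Finset.card_union_le ((Finset.Ico (base n s (k + 1) + X (k + 1) 0 - 1)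
          (base n s k + X k a - 1)).image fun r => ((c, r, false) : Block)) {(c, base n s k, true)}
        have h2 := Finset.card_image_le (s := Finset.Ico (base n s (k + 1) + X (k + 1) 0 - 1)
          (base n s k + X k a - 1)) (f := fun r => ((c, r, false) : Block))
        rw [Finset.card_singleton] at h1
        rw [Nat.card_Ico] at h2
        exact h1.trans (Nat.add_le_add_right (h2.trans (by omega)) 1)
      have := Finset.card_le_card hsub
      -- There are at most $2n-1+x-y$ candidates, of which $2n-1$ are needed; with $x\le y$ this
      -- forces $x=y$ and the removal of all of them.
      have hxy' : X k a = X (k + 1) 0 := by omega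
      have hDW := Finset.eq_of_subset_of_card_le hsub (by omega)
      rw [← hxy'] at hW
      exact not_isProper_sdiff_window hn h hT.entries hk1 ha l2 hca hc' hxy' hx2.1 (by omega)
        (hDW.trans hW) hp
    · have hbz := (base_eq_zero hn hk).2 (by omega)
      have hsum : s.sum = c + 1 := by
        rw [← start_length, show s.length = k + 1 by omega, start_succ hk]; omega
      have hr0 : r0 = 0 := by
        rw [inColumn_half hB hm0] at e0
        dsimp only at e0
        omega
      subst hr0
      have := h.2.2 _ (hD hb0)
      rw [ground_eq_false_iff] at this
      have hσ : σ0 = true := by simpa using this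
      subst hσ
      rw [color_half hm0, if_pos rfl, hsum] at hc0
      omega

end TypeC

/-! ### Reading the letters off the tops of the columns -/

namespace TypeC

section Reading

variable {n : ℕ} (hn : 3 ≤ n) {s : List ℕ} {Y : Finset Block} {X : Tableau} (h : St n s Y X)
  {k a : ℕ} (hk : k < s.length) (ha : a < len s k) (hx : 1 ≤ X k a) (hx2 : X k a ≤ 2 * n)
include hn h hk ha hx hx2

/-- The top row of a column. -/
theorem sup_column : ((Y.filter fun b => b.1 = start s k + a).sup fun b => b.2.1) =
    base n s k + (X k a - 2) := by
  refine le_antisymm (Finset.sup_le fun b hb => ?_) ?_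
  · obtain ⟨hb, hc⟩ := Finset.mem_filter.1 hb
    have := ((h.1 k a hk ha b hc).1 (Or.inr hb)).2
    unfold InColumn at this
    omega
  -- If the top row is row $0$ there may be no added block at all, and the empty supremum is $0$.
  -- The truncated difference accounts for the letters $1$ and $2$ having the same top row.
  · rcases Nat.eq_zero_or_pos (base n s k + (X k a - 2)) with h0 | h0
    · rw [h0]; exact Nat.zero_le _
    · have hB := base_mod n s k
      have key : ∃ σ ∈ (patternC n s.sum).slots (base n s k + (X k a - 2)),
          InColumn n s.sum (base n s k) (X k a)
            (start s k + a, base n s k + (X k a - 2), σ) := by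
        by_cases h1 : X k a = 1
        · obtain ⟨σ, hσ, hc⟩ := exists_color (n := n) (N := s.sum) (start s k + a)
            (r := base n s k + (X k a - 2)) (by rw [h1]; exact hB) (show 0 ≤ 1 by omega)
          exact ⟨σ, hσ, Or.inr (Or.inl ⟨by dsimp only; omega, Or.inl hc⟩)⟩
        · by_cases h2 : X k a = 2 * n
          · obtain ⟨σ, hσ, hc⟩ := exists_color (n := n) (N := s.sum) (start s k + a)
              (r := base n s k + (X k a - 2)) (by rw [h2, Nat.add_mod_right, hB]) le_rfl
            exact ⟨σ, hσ, Or.inr (Or.inr (Or.inr ⟨by dsimp only; omega, hc, h2⟩))⟩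
          · exact ⟨false, mem_slots.2 (Or.inl rfl), by unfold InColumn; dsimp only; omega⟩
      obtain ⟨σ, hσ, hin⟩ := key
      have hm := ((h.1 k a hk ha (_, _, σ) rfl).2 ⟨hσ, hin⟩).resolve_left (by
        rw [ground_iff]; dsimp only; omega)
      have hm' : ((start s k + a, base n s k + (X k a - 2), σ) : Block) ∈
        Y.filter fun b => b.1 = start s k + a := Finset.mem_filter.2 ⟨hm, rfl⟩
      exact Finset.le_sup (f := fun b : Block => b.2.1) hm'

/-- In a half-row the colours of the filled top slots separate $1$, $\bar1$ and $2$; in the other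
rows the position in the period determines the letter. -/
theorem entry_eq : entry n s.sum Y (start s k + a) = X k a := by
  have hB := base_mod n s k
  unfold entry
  dsimp only
  rw [sup_column hn h hk ha hx hx2]
  set r := base n s k + (X k a - 2) with hr
  set colors := (Finset.univ.filter fun σ => (patternC n s.sum).Filled Y
    (start s k + a, r, σ)).image fun σ => (patternC n s.sum).color (start s k + a, r, σ) with hcol
  have hmem : ∀ i, i ∈ colors ↔ ∃ σ, (σ ∈ (patternC n s.sum).slots r ∧
      InColumn n s.sum (base n s k) (X k a) (start s k + a, r, σ)) ∧
      (patternC n s.sum).color (start s k + a, r, σ) = i := by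
    intro i
    rw [hcol, Finset.mem_image]
    refine exists_congr fun σ => and_congr_left fun _ => ?_
    rw [Finset.mem_filter, h.1 k a hk ha _ rfl]
    exact and_iff_right (Finset.mem_univ _)
  by_cases hm : r % (2 * n - 2) = 0
  · rw [if_pos hm]
    have hin := fun σ => inColumn_half (N := s.sum) (x := X k a)
      (b := (start s k + a, r, σ)) hB hm
    obtain ⟨σ₀, s₀, c₀⟩ := exists_color (n := n) (N := s.sum) (start s k + a) hm
      (show 0 ≤ 1 by omega)
    obtain ⟨σ₁, s₁, c₁⟩ := exists_color (n := n) (N := s.sum) (start s k + a) hm le_rfl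
    dsimp only at hin
    by_cases h1 : X k a = 1
    · have : colors = {0} := by
        refine Finset.eq_singleton_iff_unique_mem.2 ⟨(hmem 0).2 ⟨σ₀, ⟨s₀, (hin σ₀).2 (by omega)⟩, c₀⟩,
          fun i hi => ?_⟩
        obtain ⟨σ, ⟨-, h2⟩, rfl⟩ := (hmem i).1 hi
        rw [hin] at h2
        omega
      rw [if_pos this, h1]
    · by_cases h2 : X k a = 2 * n
      · have : colors = {1} := by
          refine Finset.eq_singleton_iff_unique_mem.2
            ⟨(hmem 1).2 ⟨σ₁, ⟨s₁, (hin σ₁).2 (by omega)⟩, c₁⟩, fun i hi => ?_⟩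
          obtain ⟨σ, ⟨-, h3⟩, rfl⟩ := (hmem i).1 hi
          rw [hin] at h3
          omega
        rw [if_neg (by rw [this]; simp), if_pos this, h2]
        unfold bar; omega
      · have h3 : r = base n s k := eq_of_mod hB hm (by omega) (by omega)
        have m0 : 0 ∈ colors := (hmem 0).2 ⟨σ₀, ⟨s₀, (hin σ₀).2 (by omega)⟩, c₀⟩
        have m1 : 1 ∈ colors := (hmem 1).2 ⟨σ₁, ⟨s₁, (hin σ₁).2 (by omega)⟩, c₁⟩
        rw [if_neg (fun e => by rw [e] at m1; simp at m1),
          if_neg (fun e => by rw [e] at m0; simp at m0)]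
        omega
  · rw [if_neg hm]
    have h3 : 3 ≤ X k a := by
      by_contra h3
      refine hm ?_
      rw [show r = base n s k by omega, hB]
    have h4 : X k a < 2 * n := by
      by_contra h4
      refine hm ?_
      rw [show r = base n s k + (2 * n - 2) by omega, Nat.add_mod_right, hB]
    have hmod : r % (2 * n - 2) = X k a - 2 := add_mod_period hB (by omega)
    rw [hmod, hr, color_unit hB (by omega) (by omega)]
    unfold bar
    split_ifs <;> omega

end Reading

theorem toTableau_eq {n : ℕ} (hn : 3 ≤ n) {s : List ℕ} {Y : Finset Block} {X : Tableau}
    (h : St n s Y X) (hE : Entries (2 * n) s X)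
    (hoff : ∀ k a, ¬ (k < s.length ∧ a < len s k) → X k a = 0) : toTableau n s Y = X := by
  funext k a
  unfold toTableau
  split_ifs with hka
  · exact entry_eq hn h hka.1 hka.2 (hE k a hka.1 hka.2).1 (hE k a hka.1 hka.2).2
  · exact (hoff k a hka).symm

end TypeC

/-! ### Weights of walls of type $C_n$ -/

namespace TypeC

/-- The blocks of a column that represents the letter `x`, including those of the ground-state
wall. -/
def column (n N B x c : ℕ) : Finset Block :=
  ((Finset.range (B + 2 * n) ×ˢ (Finset.univ : Finset Bool)).image
    fun y => ((c, y.1, y.2) : Block)).filter fun b =>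
      b.2.2 ∈ (patternC n N).slots b.2.1 ∧
        (b.2.1 < B ∨ (b.2.1 = B ∧ ((patternC n N).color b = 0 ∨ 2 ≤ x)) ∨
        (B < b.2.1 ∧ b.2.1 < B + (2 * n - 2) ∧ b.2.1 + 1 < B + x) ∨
        (b.2.1 = B + (2 * n - 2) ∧ (patternC n N).color b = 1 ∧ x = 2 * n))

theorem mem_column {n : ℕ} (hn : 3 ≤ n) {N B x c : ℕ} {b : Block} : b ∈ column n N B x c ↔
    b.1 = c ∧ b.2.2 ∈ (patternC n N).slots b.2.1 ∧ InColumn n N B x b := by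
  obtain ⟨l, r, σ⟩ := b
  unfold column
  rw [Finset.mem_filter]
  simp only [Finset.mem_image, Finset.mem_product, Finset.mem_range, Finset.mem_univ, and_true,
    Prod.mk.injEq, Prod.exists]
  constructor
  · rintro ⟨⟨r, σ, h, rfl, rfl, rfl⟩, h'⟩; exact ⟨rfl, h'⟩
  · rintro ⟨rfl, h1, h2⟩
    refine ⟨⟨r, σ, ?_, rfl, rfl, rfl⟩, h1, h2⟩
    unfold InColumn at h2
    dsimp only at h2
    omega

theorem sum_column_insert {n : ℕ} (hn : 3 ≤ n) {N B B' x x' c r : ℕ} {σ : Bool}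
    (hσ : σ ∈ (patternC n N).slots r) (h : ¬ InColumn n N B x (c, r, σ))
    (h' : ∀ r' σ', σ' ∈ (patternC n N).slots r' → (InColumn n N B' x' (c, r', σ') ↔
      InColumn n N B x (c, r', σ') ∨ (r' = r ∧ σ' = σ))) (f : Block → ℤ) :
    ∑ b ∈ column n N B' x' c, f b = ∑ b ∈ column n N B x c, f b + f (c, r, σ) := by
  have : column n N B' x' c = insert (c, r, σ) (column n N B x c) := by
    ext ⟨l, r', σ'⟩
    rw [Finset.mem_insert, mem_column hn, mem_column hn]
    simp only [Prod.mk.injEq]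
    constructor
    · rintro ⟨rfl, h1, h2⟩
      rcases (h' _ _ h1).1 h2 with h3 | h3
      · exact Or.inr ⟨rfl, h1, h3⟩
      · exact Or.inl ⟨rfl, h3⟩
    · rintro (⟨rfl, rfl, rfl⟩ | ⟨rfl, h1, h2⟩)
      · exact ⟨rfl, hσ, (h' _ _ hσ).2 (Or.inr ⟨rfl, rfl⟩)⟩
      · exact ⟨rfl, h1, (h' _ _ h1).2 (Or.inl h2)⟩
  rw [this, Finset.sum_insert fun hm => h ((mem_column hn).1 hm).2.2, add_comm]

theorem eq_of_color_half {n N c r : ℕ} {σ τ : Bool} (h : r % (2 * n - 2) = 0)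
    (hc : (patternC n N).color (c, r, σ) = (patternC n N).color (c, r, τ)) : σ = τ := by
  rw [color_half h, color_half h] at hc
  cases σ <;> cases τ <;> simp at hc ⊢ <;> omega

/-- An arrow of colour $i$ subtracts $\alpha_i$ from the weight of the letter, so the Cartan entries
of the added blocks telescope. -/
theorem cartanC_color {n : ℕ} (hn : 3 ≤ n) {x : ℕ} (hx : 1 ≤ x) (hx2 : x < 2 * n) (j : Fin n) :
    cartanC n (j + 1) (if x ≤ n then x else 2 * n - x) = vwt x j - vwt (x + 1) j := by
  have := j.2
  rcases Nat.lt_or_ge n x with h | h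
  · rw [if_neg (by omega)]
    unfold cartanC vwt coord bar
    grind (splits := 30)
  · rw [if_pos h]
    unfold cartanC vwt coord bar
    grind (splits := 30)

/-- The nodes $0$ and $1$ have the same neighbours in $A_{2n-1}^{(2)}$, so their columns of the
Cartan matrix differ only in row $1$. -/
theorem cartanC_zero {n : ℕ} (hn : 3 ≤ n) (j : Fin n) : cartanC n (j + 1) 0 =
    cartanC n (j + 1) 1 - 2 * (if (j : ℕ) = 0 then 1 else 0) := by
  unfold cartanC
  grind

theorem sum_column_succ {n : ℕ} (hn : 3 ≤ n) {N B c x : ℕ} (hB : B % (2 * n - 2) = 0) (hx : 1 ≤ x)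
    (hx2 : x < 2 * n) (g : ℕ → ℤ) :
    ∑ b ∈ column n N B (x + 1) c, g ((patternC n N).color b) =
      ∑ b ∈ column n N B x c, g ((patternC n N).color b) + g (if x ≤ n then x else 2 * n - x) := by
  have hsucc := fun b => inColumn_succ_iff (b := b) (N := N) hn hB hx hx2
  by_cases h1 : x = 1 ∨ x = 2 * n - 1
  · have hr : (B + x - 1) % (2 * n - 2) = 0 := by
      rcases h1 with rfl | rfl
      · exact hB
      · rw [show B + (2 * n - 1) - 1 = B + (2 * n - 2) by omega, Nat.add_mod_right, hB]
    obtain ⟨σ, hσ, hc⟩ := exists_color (n := n) (N := N) c hr le_rfl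
    rw [sum_column_insert hn hσ (B := B) (x := x) ?_ (fun r' σ' hσ' => ?_), hc]
    · congr 2; split_ifs <;> omega
    · rw [inColumn_half hB hr]; dsimp only; omega
    · rw [hsucc _ hσ', if_pos h1]
      refine or_congr_right ?_
      dsimp only
      constructor
      · rintro ⟨h2, h3⟩
        obtain rfl : r' = B + x - 1 := by omega
        exact ⟨rfl, eq_of_color_half hr (h3.trans hc.symm)⟩
      · rintro ⟨rfl, rfl⟩
        exact ⟨by omega, hc⟩
  · rw [sum_column_insert hn (mem_slots.2 (Or.inl rfl)) (B := B) (x := x) (r := B + (x - 1)) ?_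
      (fun r' σ' hσ' => ?_), color_unit hB (by omega) (by omega)]
    · congr 2; split_ifs <;> omega
    · unfold InColumn; dsimp only; omega
    · rw [hsucc _ hσ', if_neg h1]
      exact or_congr_right (and_congr_left fun _ => by dsimp only; omega)

theorem sum_column {n : ℕ} (hn : 3 ≤ n) {N B c x : ℕ} (hB : B % (2 * n - 2) = 0) (hx : 1 ≤ x)
    (hx2 : x ≤ 2 * n) (j : Fin n) :
    ∑ b ∈ column n N B x c, cartanC n (j + 1) ((patternC n N).color b) =
      ∑ b ∈ column n N B 1 c, cartanC n (j + 1) ((patternC n N).color b) + vwt 1 j - vwt x j := by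
  induction x, hx using Nat.le_induction with
  | base => ring
  | succ x hx ih =>
    rw [sum_column_succ hn hB hx (by omega) (cartanC n (j + 1)), ih (by omega),
      cartanC_color hn hx (by omega)]
    ring

/-- Raising the base by one period inserts a $\delta$-column, on which the coroots $h_1,\dots,h_n$
vanish. In the induction step that column appears as the passage from $1$ to $\bar2$ followed by the
$0$-block of the next half-row. -/
theorem sum_column_one {n : ℕ} (hn : 3 ≤ n) {N c : ℕ} (q : ℕ) (j : Fin n) :
    ∑ b ∈ column n N (q * (2 * n - 2)) 1 c, cartanC n (j + 1) ((patternC n N).color b) =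
      cartanC n (j + 1) 0 := by
  induction q with
  | zero =>
    rw [Nat.zero_mul]
    obtain ⟨σ, hσ, hc⟩ := exists_color (n := n) (N := N) c (Nat.zero_mod _) (show 0 ≤ 1 by omega)
    have : column n N 0 1 c = {(c, 0, σ)} := by
      ext ⟨l, r, τ⟩
      rw [mem_column hn, Finset.mem_singleton]
      simp only [Prod.mk.injEq]
      constructor
      · rintro ⟨rfl, h1, h2⟩
        unfold InColumn at h2
        dsimp only at h2
        obtain rfl : r = 0 := by omega
        have h3 : (patternC n N).color (l, 0, τ) = 0 := by omega
        exact ⟨rfl, rfl, eq_of_color_half (Nat.zero_mod _) (h3.trans hc.symm)⟩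
      · rintro ⟨rfl, rfl, rfl⟩
        exact ⟨rfl, hσ, Or.inr (Or.inl ⟨rfl, Or.inl hc⟩)⟩
    rw [this, Finset.sum_singleton, hc]
  | succ q ih =>
    have hB : (q * (2 * n - 2)) % (2 * n - 2) = 0 := Nat.mul_mod_left _ _
    have hB' : (q * (2 * n - 2) + (2 * n - 2)) % (2 * n - 2) = 0 := by
      rw [Nat.add_mod_right, hB]
    obtain ⟨σ, hσ, hc⟩ := exists_color (n := n) (N := N) c hB' (show 0 ≤ 1 by omega)
    rw [Nat.succ_mul, sum_column_insert hn hσ (B := q * (2 * n - 2)) (x := 2 * n - 1) ?_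
      (fun r' σ' hσ' => ?_), sum_column hn hB (by omega) (by omega), ih, hc]
    · have e1 := cartanC_color hn (x := 1) (by omega) (by omega) j
      have e2 := cartanC_color hn (x := 2 * n - 1) (by omega) (by omega) j
      have e3 := cartanC_zero hn j
      have e4 : (vwt (2 * n) j : ℤ) = -(if (j : ℕ) = 0 then 1 else 0) := by
        have := j.2
        unfold vwt coord bar
        grind
      have e5 : (vwt 1 j : ℤ) = if (j : ℕ) = 0 then 1 else 0 := by
        have := j.2
        unfold vwt coord bar
        grind
      rw [if_neg (by omega), show 2 * n - (2 * n - 1) = 1 by omega,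
        show 2 * n - 1 + 1 = 2 * n by omega] at e2
      linarith
    · rw [inColumn_half hB hB']; dsimp only; omega
    · have : ∀ h : r' = q * (2 * n - 2) + (2 * n - 2),
          ((patternC n N).color (c, r', σ') = 0 ↔ σ' = σ) := by
        rintro rfl
        constructor
        · intro h
          exact eq_of_color_half hB' (h.trans hc.symm)
        · rintro rfl; exact hc
      unfold InColumn
      dsimp only
      by_cases h : r' = q * (2 * n - 2) + (2 * n - 2)
      · have := this h
        rw [← this]
        omega
      · omega

theorem weight_eq {n : ℕ} (hn : 3 ≤ n) {s : List ℕ} {Y : Finset Block} {X : Tableau}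
    (h : St n s Y X) (hE : Entries (2 * n) s X) :
    (patternC n s.sum).weight n Y = (tabCrystal n s).wt X := by
  funext j
  -- The correction is $\omega_1$ if the ground block of the column has colour $0$, and $-\omega_1$
  -- if it has colour $1$. These alternate, and their sum over $N$ columns is $\Lambda$ restricted
  -- to the finite coroots.
  refine weight_eq_of_columns h.2.1 (fun c => if (j : ℕ) = 0 then
    (if (s.sum + c) % 2 = 1 then 1 else -1) else 0) (fun k a hk ha => ?_) ?_
  · set c := start s k + a with hc
    have e1 : column n s.sum (base n s k) (X k a) c =
        insert (c, 0, false) (Y.filter fun b => b.1 = c) := by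
      ext b
      rw [mem_column hn, Finset.mem_insert, Finset.mem_filter]
      constructor
      · rintro ⟨hb, h1⟩
        rcases (h.1 k a hk ha b hb).2 h1 with hg | hm
        · rw [ground_iff] at hg
          exact Or.inl (Prod.ext hb (Prod.ext hg.1 hg.2))
        · exact Or.inr ⟨hm, hb⟩
      · rintro (rfl | ⟨hm, hb⟩)
        · exact ⟨rfl, (h.1 k a hk ha _ rfl).1 (Or.inl (by rw [ground_iff]; simp))⟩
        · exact ⟨hb, (h.1 k a hk ha b hb).1 (Or.inr hm)⟩
    have e2 := sum_column hn (N := s.sum) (c := c) (base_mod n s k) (hE k a hk ha).1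
      (hE k a hk ha).2 j
    rw [e1, Finset.sum_insert (fun hm => by
      have := h.2.2 _ (Finset.mem_filter.1 hm).1
      rw [ground_eq_false_iff] at this
      simp at this), show ∑ b ∈ column n s.sum (base n s k) 1 c,
        cartanC n (j + 1) ((patternC n s.sum).color b) = cartanC n (j + 1) 0 from
          sum_column_one hn (s.length - 1 - k) j] at e2
    change ∑ b ∈ Y with b.1 = c, cartanC n (j + 1) ((patternC n s.sum).color b) = _
    have e3 := cartanC_zero hn j
    have e5 : (vwt 1 j : ℤ) = if (j : ℕ) = 0 then 1 else 0 := by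
      have := j.2
      unfold vwt coord bar
      grind
    have e6 := color_half (n := n) (N := s.sum) (c := c) (σ := false) (Nat.zero_mod _)
    simp only [Bool.false_eq_true, if_false, Nat.add_zero] at e6
    rcases Nat.mod_two_eq_zero_or_one (s.sum + c) with h2 | h2
    · rw [show (s.sum + c + 1) % 2 = 1 by omega] at e6
      rw [e6] at e2
      simp only [h2, zero_ne_one, if_false]
      split_ifs at * <;> linarith
    · rw [show (s.sum + c + 1) % 2 = 0 by omega] at e6
      rw [e6] at e2
      simp only [h2, if_true]
      split_ifs at * <;> linarith
  · change _ = if s.sum % 2 = j + 1 then 1 else 0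
    have key : ∀ m, ∑ c ∈ Finset.range m, (if (m + c) % 2 = 1 then (1 : ℤ) else -1) =
        if m % 2 = 1 then 1 else 0 := by
      intro m
      induction m with
      | zero => rfl
      | succ m ih =>
        rw [Finset.sum_range_succ, if_pos (by omega), Finset.sum_congr rfl fun c _ => by
          rw [show (if (m + 1 + c) % 2 = 1 then (1 : ℤ) else -1) =
            -(if (m + c) % 2 = 1 then (1 : ℤ) else -1) by split_ifs <;> omega],
          Finset.sum_neg_distrib, ih]
        split_ifs <;> omega
    by_cases hj : (j : ℕ) = 0
    · simp only [hj, if_true]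
      rw [key]
    · simp only [hj, if_false, Finset.sum_const_zero]
      rw [if_neg (by omega)]

end TypeC

/-! ### The conditions (Y1)–(Y4) in terms of counting functions -/

namespace TypeC

theorem InColumn.mono {n N B x x' : ℕ} {b : Block} (h : InColumn n N B x b) (hx : x ≤ x')
    (hx' : x' ≤ 2 * n) : InColumn n N B x' b := by
  unfold InColumn at *
  omega

theorem inColumn_place {n : ℕ} (hn : 3 ≤ n) {s : List ℕ} {k a u x : ℕ} (hu : 1 ≤ u)
    (hu2 : u < 2 * n) (hx : x ≤ 2 * n) :
    InColumn n s.sum (base n s k) x (place n s k a u) ↔ u < x := by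
  constructor
  · intro h
    by_contra hlt
    exact not_inColumn_place hn hu hu2 (h.mono (not_lt.1 hlt) hu2.le)
  · intro h
    exact ((inColumn_succ hn hu hu2 rfl (place_mem_slots hn hu)).2 (Or.inr rfl)).mono h hx

/-- The reflection of a set whose row `v` is an interval. -/
theorem mem_reflectShift {n q v lo hi : ℕ} {Z : Finset (ℕ × ℕ)} {x : ℕ × ℕ} (hv : v + x.2 = 2 * n)
    (h : ∀ a, (a, v) ∈ Z ↔ lo ≤ a ∧ a < hi) :
    x ∈ reflectShift n q Z ↔ q ≤ x.1 ∧ x.1 < q + (hi - lo) := by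
  have : (Z.filter fun y => y.2 + x.2 = 2 * n) = (Finset.Ico lo hi).image fun a => (a, v) := by
    ext ⟨a, u⟩
    simp only [Finset.mem_filter, Finset.mem_image, Finset.mem_Ico, Prod.mk.injEq]
    constructor
    · rintro ⟨h1, h2⟩
      obtain rfl : u = v := by omega
      exact ⟨a, (h a).1 h1, rfl, rfl⟩
    · rintro ⟨a, h1, rfl, rfl⟩
      exact ⟨(h a).2 h1, hv⟩
  change (q ≤ x.1 ∧ x.1 < q + (Z.filter fun y => y.2 + x.2 = 2 * n).card) ↔ _
  rw [this, Finset.card_image_of_injective _ fun a b e => by simpa using e, Nat.card_Ico]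

section Conditions

variable {n : ℕ} (hn : 3 ≤ n) {s : List ℕ} {Y : Finset Block} {X : Tableau} (h : St n s Y X)
  (hE : Entries (2 * n) s X) (hX : Strict s X)
include hn h hE hX

/-- Row $u$ of a part is an interval of columns starting at the right, whose length is the number of
letters greater than $u$. Hence it has length $c(u)$ below the $n$-row and $d(2n-u)$ above it. -/
theorem mem_part {k : ℕ} (hk : k < s.length) {a u : ℕ} :
    (a, u) ∈ part n s Y k ↔ 1 ≤ u ∧ a < cnt (X k) (len s k) u := by
  unfold part
  rw [Finset.mem_filter, Finset.mem_product, Finset.mem_range, Finset.mem_Ico]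
  dsimp only
  constructor
  · rintro ⟨⟨ha, hu, hu2⟩, hf⟩
    have h1 := ((h.1 k a hk ha _ rfl).1 hf).2
    rw [inColumn_place hn hu hu2 (hE k a hk ha).2] at h1
    exact ⟨hu, ((hX k hk).lt_cnt_iff ha u).2 h1⟩
  · rintro ⟨hu, hac⟩
    have ha : a < len s k := hac.trans_le (cnt_le _ _ _)
    have h1 := ((hX k hk).lt_cnt_iff ha u).1 hac
    have h2 := (hE k a hk ha).2
    exact ⟨⟨ha, hu, by omega⟩, (h.1 k a hk ha _ rfl).2
      ⟨place_mem_slots hn hu, (inColumn_place hn hu (by omega) h2).2 h1⟩⟩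

/-- Over $H_\lambda$, row $v$ consists of the columns $N-v\le a<c(v)$, so its reflection has
$c(v)+v-N$ blocks if $v\le N$ and must contain the $d(v)$ blocks of row $2n-v$. For $v\ge N$ nothing
is required, since $d(v)\le d(n)=c(n)\le c(v)$ in any case. -/
theorem y1_iff (hlen : ∀ k < s.length, len s k ≤ n) : Y1 n s Y ↔
    ∀ k, k < s.length → SingleCond n (cc (X k) (len s k)) (dd n (X k) (len s k)) := by
  refine forall₂_congr fun k hk => ?_
  have hN := hlen k hk
  have hc := counts (n := n) (hX k hk)
  have c0 : cc (X k) (len s k) 0 = len s k := cnt_zero fun a ha => (hE k a hk ha).1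
  have d0 : dd n (X k) (len s k) 0 = 0 := cnt_eq_zero fun a ha => (hE k a hk ha).2
  have hm := hc.mid
  have hrow : ∀ v, 1 ≤ v → v < n → ∀ a, (a, v) ∈ (part n s Y k).filter
      (fun y => len s k ≤ y.1 + y.2 ∧ y.2 < n) ↔
      len s k - v ≤ a ∧ a < cc (X k) (len s k) v := by
    intro v hv hvn a
    rw [Finset.mem_filter, mem_part hn h hE hX hk]
    unfold cc
    dsimp only
    omega
  constructor
  · intro H v hv
    have a1 := hc.c_anti (Nat.zero_le v) hv
    have a2 := hc.c_anti hv le_rfl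
    by_cases hv0 : v = 0
    · subst hv0; omega
    by_cases hvn : v = n
    · subst hvn; omega
    by_contra hlt
    have hpos : 0 < dd n (X k) (len s k) v := by omega
    have h1 := H (dd n (X k) (len s k) v - 1, 2 * n - v)
      ((mem_part hn h hE hX hk).2 ⟨by omega, by unfold dd at *; omega⟩)
      (by unfold Above; dsimp only; omega) (by dsimp only; omega)
    rw [mem_reflectShift (v := v) (by dsimp only; omega) (hrow v (by omega) (by omega))] at h1
    dsimp only at h1
    omega
  · rintro H ⟨a, u⟩ hx - hu
    dsimp only at hu
    obtain ⟨-, hau⟩ := (mem_part hn h hE hX hk).1 hx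
    have hu2 : u < 2 * n := by
      unfold part at hx
      exact (Finset.mem_Ico.1 (Finset.mem_product.1 (Finset.mem_filter.1 hx).1).2).2
    rw [mem_reflectShift (v := 2 * n - u) (by dsimp only; omega)
      (hrow (2 * n - u) (by omega) (by omega))]
    have h1 := H (2 * n - u) (by omega)
    have a2 := hc.c_anti (a := 2 * n - u) (b := n) (by omega) le_rfl
    have h2 : dd n (X k) (len s k) (2 * n - u) = cnt (X k) (len s k) u := by
      unfold dd; congr 1; omega
    rw [h2] at h1 a2
    dsimp only
    omega

/-- If row $u$ of the next part were shorter, its first missing block would violate the inclusion.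
This block lies over both highest weight walls, because a strict column has $c(u)+u\ge c(0)$. -/
theorem y2_iff (hmono : s.Pairwise (· ≤ ·)) : Y2 n s Y ↔
    ∀ k, k + 1 < s.length → ∀ a < len s k, X k a ≤ X (k + 1) a := by
  refine forall₂_congr fun k hk => ?_
  have hle := len_mono hmono (Nat.le_succ k) hk
  have hk' : k < s.length := by omega
  rw [rows_iff_cnt (hX k hk') (hX (k + 1) hk) hle]
  constructor
  · intro H u
    have hc := counts (n := u) (hX (k + 1) hk)
    have a1 := hc.c_anti (Nat.zero_le u) le_rfl
    have c0 : cc (X (k + 1)) (len s (k + 1)) 0 = len s (k + 1) :=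
      cnt_zero fun a ha => (hE (k + 1) a hk ha).1
    unfold cc at a1 c0
    rcases Nat.eq_zero_or_pos u with rfl | hu
    · rw [c0, cnt_zero fun a ha => (hE k a hk' ha).1]
      exact hle
    · by_contra hlt
      rw [Nat.succ_eq_add_one] at hle
      have := ((mem_part hn h hE hX hk).1 (H (cnt (X (k + 1)) (len s (k + 1)) u, u)
        ((mem_part hn h hE hX hk').2 ⟨hu, by omega⟩) (by unfold Above; dsimp only; omega)
        (by unfold Above; dsimp only; omega))).2
      omega
  · rintro H ⟨a, u⟩ hx - -
    obtain ⟨h1, h2⟩ := (mem_part hn h hE hX hk').1 hx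
    exact (mem_part hn h hE hX hk).2 ⟨h1, h2.trans_le (H u)⟩

/-- Row $v$ of the triangle $L^-$ consists of the columns $n-v\le a<c(v)$, and its reflection must
fit into the first $d'(v)$ columns. As $c(n)=d(n)$, this is `PairCond` with $b=n$. -/
theorem y3_iff : Y3 n s Y ↔ ∀ k, k + 1 < s.length → ∀ v, 1 ≤ v → v < n →
    cc (X k) (len s k) v + v ≤ n + dd n (X (k + 1)) (len s (k + 1)) v := by
  refine forall₂_congr fun k hk => ?_
  have hk' : k < s.length := by omega
  have hrow : ∀ v, 1 ≤ v → v < n → ∀ a, (a, v) ∈ (part n s Y k).filter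
      (fun y => n ≤ y.1 + y.2 ∧ y.2 < n) ↔ n - v ≤ a ∧ a < cc (X k) (len s k) v := by
    intro v hv hvn a
    rw [Finset.mem_filter, mem_part hn h hE hX hk']
    unfold cc
    dsimp only
    omega
  constructor
  · intro H v hv hvn
    by_contra hlt
    have h1 : ((dd n (X (k + 1)) (len s (k + 1)) v, 2 * n - v) : ℕ × ℕ) ∈ reflectShift n 0
        ((part n s Y k).filter fun y => n ≤ y.1 + y.2 ∧ y.2 < n) := by
      rw [mem_reflectShift (v := v) (by dsimp only; omega) (hrow v hv hvn)]
      dsimp only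
      omega
    have h2 := ((mem_part hn h hE hX hk).1 (H h1).1).2
    exact lt_irrefl _ h2
  · rintro H ⟨a, u⟩ hx
    obtain ⟨v, hv, hvn, hvu⟩ : ∃ v, 1 ≤ v ∧ v < n ∧ v + u = 2 * n := by
      have h1 : a < 0 + (((part n s Y k).filter fun y => n ≤ y.1 + y.2 ∧ y.2 < n).filter
        fun y => y.2 + u = 2 * n).card := hx.2
      rw [Nat.zero_add] at h1
      obtain ⟨⟨b, v⟩, hb⟩ := Finset.card_pos.1 (Nat.zero_lt_of_lt h1)
      rw [Finset.mem_filter, Finset.mem_filter, mem_part hn h hE hX hk'] at hb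
      exact ⟨v, hb.1.1.1, hb.1.2.2, hb.2⟩
    rw [mem_reflectShift (v := v) hvu (hrow v hv hvn)] at hx
    dsimp only at hx
    have h1 := H v hv hvn
    have h2 : dd n (X (k + 1)) (len s (k + 1)) v = cnt (X (k + 1)) (len s (k + 1)) u := by
      unfold dd; congr 1; omega
    have h3 : cc (X k) (len s k) v ≤ len s k := cnt_le _ _ _
    exact ⟨(mem_part hn h hE hX hk).2 ⟨by omega, by omega⟩, by dsimp only; omega,
      by dsimp only; omega⟩

/-- The inclusion in (Y4) for one of the two parts. -/
theorem upper_subset_iff {g p q a : ℕ} (hg : g < s.length) (ha : 1 ≤ a) :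
    (∀ x ∈ part n s Y g, InUpper n a p q x →
      x ∈ reflectShift n q ((part n s Y g).filter fun y => InLower n a p q y)) ↔
    ∀ v, a ≤ v → v < n → v + q < a + p → ∀ α, q ≤ α → a + α ≤ v + q →
      α < dd n (X g) (len s g) v →
      α + (a + p) < q + v + min (p + 1) (cc (X g) (len s g) v) := by
  have hrow : ∀ v, a ≤ v → v < n → v + q < a + p → ∀ α, (α, v) ∈ (part n s Y g).filter
      (fun y => InLower n a p q y) ↔
      a + p - v ≤ α ∧ α < min (p + 1) (cc (X g) (len s g) v) := by
    intro v hv hvn hvq α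
    -- The triangle stops at column $p$, whence the minimum of $p+1$ and the length of the row.
    rw [Finset.mem_filter, mem_part hn h hE hX hg]
    unfold InLower cc
    dsimp only
    omega
  constructor
  · intro H v hv hvn hvq α hα hα2 hd
    have h1 := H (α, 2 * n - v) ((mem_part hn h hE hX hg).2 ⟨by omega, hd⟩)
      (by unfold InUpper; dsimp only; omega)
    rw [mem_reflectShift (v := v) (by dsimp only; omega) (hrow v hv hvn hvq)] at h1
    dsimp only at h1
    omega
  · rintro H ⟨α, u⟩ hx hup
    have hu2 : u < 2 * n := by
      unfold part at hx
      exact (Finset.mem_Ico.1 (Finset.mem_product.1 (Finset.mem_filter.1 hx).1).2).2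
    have hd := ((mem_part hn h hE hX hg).1 hx).2
    unfold InUpper at hup
    dsimp only at hup
    rw [mem_reflectShift (v := 2 * n - u) (by dsimp only; omega)
      (hrow (2 * n - u) (by omega) (by omega) (by omega))]
    have h2 : dd n (X g) (len s g) (2 * n - u) = cnt (X g) (len s g) u := by
      unfold dd; congr 1; omega
    have := H (2 * n - u) (by omega) (by omega) (by omega) α (by omega) (by omega)
      (by rw [h2]; exact hd)
    dsimp only
    omega

end Conditions

end TypeC

/-! ### Equivalence of the conditions on walls and on tableaux -/

namespace TypeC

section Conditions

variable {n : ℕ} (hn : 3 ≤ n) {s : List ℕ} (hs : ∀ k < s.length, 1 ≤ len s k ∧ len s k ≤ n)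
  (hmono : s.Pairwise (· ≤ ·)) {Y : Finset Block} {X : Tableau} (h : St n s Y X)
include hn hs hmono h

/-- For (Y4), the positions of $a$ and $\bar a$ turn `PairCond` at $(a-1,v)$ into $p+a+d(v)\le
c(v)+v+q$, for either of the two parts. This is the required bound on a block of row $2n-v$; the
bound coming from $p+1$ is the shape of the upper triangle. -/
theorem conditions_of_mem (hT : X ∈ tableaux n s) :
    Y1 n s Y ∧ Y2 n s Y ∧ Y3 n s Y ∧ Y4 n s Y := by
  have hG := (mem_tableaux_iff hmono).1 hT
  have hE : Entries (2 * n) s X := hG.entries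
  have hX : Strict s X := hG.columns
  refine ⟨(y1_iff hn h hE hX fun k hk => (hs k hk).2).2 hG.single,
    (y2_iff hn h hE hX hmono).2 fun k hk a ha => hT.1.rows k a hk ha,
    (y3_iff hn h hE hX).2 fun k hk v hv hvn => ?_, ?_⟩
  · have := (hG.pair k hk v n hvn.le le_rfl).1
    have := (counts (n := n) (hX k (by omega))).mid
    omega
  · intro k hk p q a hqp hp ha han e1 e2 g hg
    have hk' : k < s.length := by omega
    have hle := len_mono hmono (Nat.le_succ k) hk
    rw [Nat.succ_eq_add_one] at hle
    rw [entry_eq hn h hk' hp (hE k p hk' hp).1 (hE k p hk' hp).2] at e1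
    rw [entry_eq hn h hk (show q < len s (k + 1) by omega) (hE _ q hk (by omega)).1
      (hE _ q hk (by omega)).2] at e2
    have hg' : g < s.length := by omega
    rw [upper_subset_iff hn h hE hX hg' ha]
    intro v hv hvn hvq α hα hα2 hd
    have h3 := row_eq (hX k hk') hp e1
    have h4 := row_bar_eq (n := n) (hX (k + 1) hk) (show q < len s (k + 1) by omega) ha e2
    have st := (counts (n := n) (hX k hk')).step (r := a - 1) (by omega)
    rw [Nat.sub_add_cancel ha] at st
    have hp' := hG.pair k hk (a - 1) v (by omega) hvn.le
    rcases hg with rfl | rfl <;> omega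

/-- (Y3) at $a-1$ gives (2CC-1), the case $a=1$ being clear from $i_k\le n$. (2CC-2) is (Y4) in row
$b$, applied to the block that belongs to $\bar b$. -/
theorem mem_of_conditions (hE : Entries (2 * n) s X) (hX : Strict s X)
    (hoff : ∀ k a, ¬ (k < s.length ∧ a < len s k) → X k a = 0)
    (hY1 : Y1 n s Y) (hY2 : Y2 n s Y) (hY3 : Y3 n s Y) (hY4 : Y4 n s Y) : X ∈ tableaux n s := by
  rw [y1_iff hn h hE hX fun k hk => (hs k hk).2] at hY1
  rw [y2_iff hn h hE hX hmono] at hY2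
  rw [y3_iff hn h hE hX] at hY3
  have first : ∀ k, k + 1 < s.length → TwoColumnFirst n (len s k) (X k) (X (k + 1)) := by
    intro k hk p q a hqp hp ha han e1 e2
    have hk' : k < s.length := by omega
    have hN := (hs k hk').2
    have hle := len_mono hmono (Nat.le_succ k) hk
    rw [Nat.succ_eq_add_one] at hle
    have h3 := row_eq (hX k hk') hp e1
    have h4 := row_bar_eq (n := n) (hX (k + 1) hk) (show q < len s (k + 1) by omega) ha e2
    have st := (counts (n := n) (hX k hk')).step (r := a - 1) (by omega)
    rw [Nat.sub_add_cancel ha] at st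
    rcases Nat.eq_or_lt_of_le ha with rfl | ha1
    · omega
    · have := hY3 k hk (a - 1) (by omega) (by omega)
      omega
  refine ⟨⟨hoff, hE, fun k a hk ha => hY2 k hk a ha, fun k a hk ha => hX k hk a ha⟩,
    fun k hk => (oneColumn_iff (hX k hk) (fun a ha => (hE k a hk ha).1)
      (fun a ha => (hE k a hk ha).2)).2 (hY1 k hk), first, fun k hk => ?_⟩
  intro p q a hqp hp ha han e1 e2 r t b hqt htr hrp hb hbn hor
  have hk' : k < s.length := by omega
  have hle := len_mono hmono (Nat.le_succ k) hk
  rw [Nat.succ_eq_add_one] at hle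
  have hf := first k hk p q a hqp hp ha han e1 e2
  obtain ⟨g, hg, e3, e4⟩ : ∃ g, (g = k ∨ g = k + 1) ∧ X g r = b ∧ X g t = bar n b := by
    rcases hor with ⟨e3, e4⟩ | ⟨e3, e4⟩
    · exact ⟨k, Or.inl rfl, e3, e4⟩
    · exact ⟨k + 1, Or.inr rfl, e3, e4⟩
  have hg' : g < s.length := by omega
  have hrN : r < len s g := by rcases hg with rfl | rfl <;> omega
  have hab : a ≤ b := by
    rcases hg with rfl | rfl
    · rcases hrp.eq_or_lt with rfl | hlt
      · omega
      · have := (hX g hk').lt hlt hp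
        omega
    · rcases hqt.eq_or_lt with rfl | hlt
      · unfold bar at *; omega
      · have := (hX (k + 1) hk).lt hlt (htr.trans hrN)
        unfold bar at *
        omega
  have h3 := row_eq (hX g hg') hrN e3
  have h4 := row_bar_eq (n := n) (hX g hg') (htr.trans hrN) hb e4
  have st := (counts (n := n) (hX g hg')).step (r := b - 1) (by omega)
  rw [Nat.sub_add_cancel hb] at st
  have hm := (counts (n := n) (hX g hg')).mid
  rcases hbn.eq_or_lt with rfl | hbn
  · omega
  -- Otherwise $p-q\le b-a$, and (2CC-2) holds because $t<r$; for $b=n$ the same follows from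
  -- (2CC-1).
  · by_cases hbq : b + q < a + p
    · have key := (upper_subset_iff hn h hE hX hg' ha).1 (hY4 k hk p q a hqp hp ha han
        (by rw [entry_eq hn h hk' hp (hE k p hk' hp).1 (hE k p hk' hp).2, e1])
        (by rw [entry_eq hn h hk (show q < len s (k + 1) by omega) (hE _ q hk (by omega)).1
          (hE _ q hk (by omega)).2, e2]) g hg) b hab hbn hbq
      by_cases ht : a + t ≤ b + q
      · have := key t hqt ht (by omega)
        omega
      -- Here $\bar b$ lies beyond the upper triangle. The last column of the triangle in this row
      -- is used instead; it yields $r>p$, a contradiction.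
      · have := key (b + q - a) (by omega) (by omega) (by omega)
        omega
    · omega

end Conditions

end TypeC

/-! ### The walls of $Y(\lambda)$ in type $C_n$ -/

namespace TypeC

section Walls

variable {n : ℕ} (hn : 3 ≤ n) {s : List ℕ} (hs : ∀ k < s.length, 1 ≤ len s k ∧ len s k ≤ n)
include hn hs

theorem mem_highest {b : Block} : b ∈ highest n s ↔
    ∃ k a, k < s.length ∧ a < len s k ∧ b.1 = start s k + a ∧
      b.2.2 ∈ (patternC n s.sum).slots b.2.1 ∧ (patternC n s.sum).ground b = false ∧
      InColumn n s.sum (base n s k) (len s k - a) b := by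
  simp only [highest, Finset.mem_biUnion, Finset.mem_range]
  constructor
  · rintro ⟨k, hk, a, ha, h⟩
    have := (hs k hk).2
    exact ⟨k, a, hk, ha, (mem_stack hn (by omega) (by omega)).1 h⟩
  · rintro ⟨k, a, hk, ha, h⟩
    have := (hs k hk).2
    exact ⟨k, hk, a, ha, (mem_stack hn (by omega) (by omega)).2 h⟩

theorem mem_lowest {b : Block} : b ∈ lowest n s ↔
    ∃ k a, k < s.length ∧ a < len s k ∧ b.1 = start s k + a ∧
      b.2.2 ∈ (patternC n s.sum).slots b.2.1 ∧ (patternC n s.sum).ground b = false ∧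
      InColumn n s.sum (base n s k) (2 * n - a) b := by
  simp only [lowest, Finset.mem_biUnion, Finset.mem_range]
  have hbar : ∀ a, bar n (a + 1) = 2 * n - a := fun a => by unfold bar; omega
  constructor
  · rintro ⟨k, hk, a, ha, h⟩
    have := (hs k hk).2
    rw [hbar] at h
    exact ⟨k, a, hk, ha, (mem_stack hn (by omega) (by omega)).1 h⟩
  · rintro ⟨k, a, hk, ha, h⟩
    have := (hs k hk).2
    refine ⟨k, hk, a, ha, ?_⟩
    rw [hbar]
    exact (mem_stack hn (by omega) (by omega)).2 h

theorem mem_walls_of_st {Y : Finset Block} {X : Tableau} (h : St n s Y X)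
    (hX : X ∈ tableaux n s) (hmono : s.Pairwise (· ≤ ·)) : Y ∈ walls n s := by
  have hT := hX.1
  refine ⟨isProper_of_strict hn (fun k hk => (hs k hk).1) h hT.entries
    fun k hk => hT.strictColumn hk, isReduced hn (fun k hk => (hs k hk).1) hmono h hX,
    fun b hb => ?_, fun b hb => ?_, conditions_of_mem hn hs hmono h hX⟩
  · obtain ⟨k, a, hk, ha, hc, h1, h2, h3⟩ := (mem_highest hn hs).1 hb
    refine ((h.1 k a hk ha b hc).2 ⟨h1, h3.mono ?_ (hT.entries k a hk ha).2⟩).resolve_left ?_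
    · exact (hT.strictColumn hk).lower (fun a ha => (hT.entries k a hk ha).1) ha
    · rw [h2]; simp
  · obtain ⟨k, a, hk, ha, hc⟩ := exists_box (h.2.1 _ hb)
    obtain ⟨h1, h2⟩ := (h.1 k a hk ha b hc).1 (Or.inr hb)
    have := (hT.strictColumn hk).upper (fun a ha => (hT.entries k a hk ha).2) ha
    exact (mem_lowest hn hs).2 ⟨k, a, hk, ha, hc, h1, h.2.2 b hb, h2.mono (by omega) (by omega)⟩

/-- The columns of a wall between the highest and the lowest one represent letters. -/
theorem exists_letter {Y : Finset Block} (hY : (patternC n s.sum).IsYoungWall Y)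
    (hH : highest n s ⊆ Y) (hL : Y ⊆ lowest n s) {k a : ℕ} (hk : k < s.length)
    (ha : a < len s k) : ∃ x, 1 ≤ x ∧ x ≤ 2 * n ∧ ∀ b : Block, b.1 = start s k + a →
      ((patternC n s.sum).Filled Y b ↔ b.2.2 ∈ (patternC n s.sum).slots b.2.1 ∧
        InColumn n s.sum (base n s k) x b) := by
  have hlen := (hs k hk).2
  -- The letter sought is the smallest one, from the letter of $H_\lambda$ on, whose next block is
  -- missing; if no block is missing it is the letter $2n-a$ of $L_\lambda$.
  have hex : ∃ x, len s k - a ≤ x ∧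
      (x = 2 * n - a ∨ ¬ (patternC n s.sum).Filled Y (place n s k a x)) :=
    ⟨2 * n - a, by omega, Or.inl rfl⟩
  classical
  obtain ⟨h1, h2⟩ := Nat.find_spec hex
  have hmin := fun u => Nat.find_min (m := u) hex
  have hle : Nat.find hex ≤ 2 * n - a := Nat.find_le ⟨by omega, Or.inl rfl⟩
  generalize Nat.find hex = x at *
  have hlow : ∀ b : Block, b.1 = start s k + a → (patternC n s.sum).Filled Y b →
      b.2.2 ∈ (patternC n s.sum).slots b.2.1 ∧
        InColumn n s.sum (base n s k) (2 * n - a) b := by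
    rintro b hb (hg | hm)
    · exact inColumn_of_ground hn hk ha (by omega) hb hg
    · obtain ⟨k', a', hk', ha', hc, h3, -, h4⟩ := (mem_lowest hn hs).1 (hL hm)
      obtain ⟨rfl, rfl⟩ := start_inj hk ha hk' ha' (hb.symm.trans hc)
      exact ⟨h3, h4⟩
  -- Each block rests on a filled row, which contains the place of the preceding block; once a place
  -- is empty, all later ones are.
  have hnot : x ≠ 2 * n - a → ∀ y, x ≤ y → ¬ (patternC n s.sum).Filled Y (place n s k a y) := by
    intro hx y hy
    induction y, hy using Nat.le_induction with
    | base => exact h2.resolve_left hx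
    | succ y hy ih =>
      have hpl := (place_iff (s := s) (k := k) (a := a) hn (show 1 ≤ y by omega)).1 rfl
      have hpl' := (place_iff (s := s) (k := k) (a := a) hn (show 1 ≤ y + 1 by omega)).1 rfl
      rintro (hg | hm)
      · rw [ground_iff] at hg
        omega
      · refine ih ?_
        have h3 := (hY _ hm).2.2.1 (by omega) (place n s k a y).2.2 (by
          rw [show (place n s k a (y + 1)).2.1 - 1 = (place n s k a y).2.1 by omega]
          exact place_mem_slots hn (by omega))
        rwa [show ((place n s k a (y + 1)).1, (place n s k a (y + 1)).2.1 - 1,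
          (place n s k a y).2.2) = place n s k a y from
            Prod.ext rfl (Prod.ext (by dsimp only; omega) rfl)] at h3
  refine ⟨x, by omega, by omega, fun b hb => ⟨fun hf => ?_, fun hσ => ?_⟩⟩
  · obtain ⟨hσ, hin⟩ := hlow b hb hf
    refine ⟨hσ, ?_⟩
    have key : ∀ y, x ≤ y → y ≤ 2 * n - a → InColumn n s.sum (base n s k) y b →
        InColumn n s.sum (base n s k) x b := by
      intro y hy
      induction y, hy using Nat.le_induction with
      | base => exact fun _ h => h
      | succ y hy ih =>
        intro hy2 h3
        rcases (inColumn_succ hn (by omega) (by omega) hb hσ).1 h3 with h4 | h4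
        · exact ih (by omega) h4
        · exact absurd (h4 ▸ hf) (hnot (by omega) y hy)
    exact key _ hle le_rfl hin
  · obtain ⟨hσ, hin⟩ := hσ
    have key : ∀ y, len s k - a ≤ y → y ≤ x → InColumn n s.sum (base n s k) y b →
        (patternC n s.sum).Filled Y b := by
      intro y hy
      induction y, hy using Nat.le_induction with
      | base =>
        intro _ h3
        by_cases hg : (patternC n s.sum).ground b = true
        · exact Or.inl hg
        · exact Or.inr (hH ((mem_highest hn hs).2 ⟨k, a, hk, ha, hb, hσ, by simpa using hg, h3⟩))
      | succ y hy ih =>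
        intro hy2 h3
        rcases (inColumn_succ hn (by omega) (by omega) hb hσ).1 h3 with h4 | h4
        · exact ih (by omega) h4
        · by_contra hf
          exact hmin y (by omega) ⟨hy, Or.inr (h4 ▸ hf)⟩
    exact key x h1 le_rfl hin

theorem exists_st_of_mem_walls {Y : Finset Block} (hY : Y ∈ walls n s)
    (hmono : s.Pairwise (· ≤ ·)) : ∃ X ∈ tableaux n s, St n s Y X := by
  obtain ⟨hp, -, hH, hL, h1, h2, h3, h4⟩ := hY
  have hex : ∀ k a, ∃ x, (k < s.length ∧ a < len s k → 1 ≤ x ∧ x ≤ 2 * n ∧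
      ∀ b : Block, b.1 = start s k + a → ((patternC n s.sum).Filled Y b ↔
        b.2.2 ∈ (patternC n s.sum).slots b.2.1 ∧ InColumn n s.sum (base n s k) x b)) ∧
      (¬ (k < s.length ∧ a < len s k) → x = 0) := by
    intro k a
    by_cases hka : k < s.length ∧ a < len s k
    · obtain ⟨x, hx⟩ := exists_letter hn hs hp.1 hH hL hka.1 hka.2
      exact ⟨x, fun _ => hx, fun h => absurd hka h⟩
    · exact ⟨0, fun h => absurd h hka, fun _ => rfl⟩
  choose X hX using hex
  have hE : Entries (2 * n) s X := fun k a hk ha =>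
    ⟨((hX k a).1 ⟨hk, ha⟩).1, ((hX k a).1 ⟨hk, ha⟩).2.1⟩
  have hst : St n s Y X := by
    refine ⟨fun k a hk ha => ((hX k a).1 ⟨hk, ha⟩).2.2, fun b hb => ?_, fun b hb => ?_⟩
    · obtain ⟨k, a, hk, ha, hc, -⟩ := (mem_lowest hn hs).1 (hL hb)
      rw [hc]; exact start_add_lt hk ha
    · obtain ⟨k, a, hk, ha, -, -, hg, -⟩ := (mem_lowest hn hs).1 (hL hb)
      exact hg
  exact ⟨X, mem_of_conditions hn hs hmono hst hE (strict_of_isProper hn hst hE hp)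
    (fun k a => (hX k a).2) h1 h2 h3 h4, hst⟩

theorem main (hmono : s.Pairwise (· ≤ ·)) {w : Fin n → ℕ}
    (hw : ∀ j : Fin n, s.count ((j : ℕ) + 1) = w j) :
    IsCrystal ((patternC n s.sum).classicalCartan n) ((patternC n s.sum).crystal n) (walls n s) ∧
      IsGeneratedBy ((patternC n s.sum).crystal n) (walls n s) (highest n s) w ∧
      IsCrystal ((patternC n s.sum).classicalCartan n) (tabCrystal n s) (tableaux n s) ∧
      IsCrystalIso ((patternC n s.sum).crystal n) (walls n s) (tabCrystal n s) (tableaux n s)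
        (toTableau n s) := by
  have hE : ∀ T ∈ tableaux n s, Entries (2 * n) s T := fun T hT => hT.1.entries
  have hlow : ∀ T ∈ tableaux n s, ∀ k a, k < s.length → a < len s k → len s k - a ≤ T k a :=
    fun T hT k a hk ha => (hT.1.strictColumn hk).lower (fun a ha => (hE T hT k a hk ha).1) ha
  have hst : ∀ T ∈ tableaux n s, ∀ Y, St n s Y T ↔ Y = ofTableau n s T :=
    fun T hT Y => st_iff hn (hE T hT) (hlow T hT)
  rw [highest_eq]
  refine (wallModel hn fun k hk => (hs k hk).1).crystal_walls (isLetterChain hn)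
    (tableaux_isCrystal hn hmono) ?_ (ofTableau n s)
    (toTableau n s) hE (fun T hT k hk => hT.1.strictColumn hk) hst
    (fun T hT => mem_walls_of_st hn hs ((hst T hT _).2 rfl) hT hmono) ?_ ?_ ?_
  · obtain rfl : w = fun j : Fin n => s.count ((j : ℕ) + 1) := (funext hw).symm
    exact tableaux_isGeneratedBy hn hmono fun k hk => (hs k hk).2
  · intro Y hY
    obtain ⟨X, hX, h⟩ := exists_st_of_mem_walls hn hs hY hmono
    exact ⟨X, hX, (hst X hX Y).1 h⟩
  · intro T hT
    exact toTableau_eq hn ((hst T hT _).2 rfl) (hE T hT) hT.1.off_shape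
  · intro T hT
    exact weight_eq hn ((hst T hT _).2 rfl) (hE T hT)

end Walls

end TypeC

end WallTableau

theorem mainTheorem3 :
    (∀ n : ℕ, 1 ≤ n → ∀ w : Fin n → ℕ,
      WallTableau.IsCrystal
        ((WallTableau.patternA n (WallTableau.omegas w).sum).classicalCartan n)
        ((WallTableau.patternA n (WallTableau.omegas w).sum).crystal n)
        (WallTableau.TypeA.walls n (WallTableau.omegas w)) ∧
      WallTableau.IsGeneratedBy
        ((WallTableau.patternA n (WallTableau.omegas w).sum).crystal n)
        (WallTableau.TypeA.walls n (WallTableau.omegas w))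
        (WallTableau.TypeA.highest n (WallTableau.omegas w)) w ∧
      WallTableau.IsCrystal
        ((WallTableau.patternA n (WallTableau.omegas w).sum).classicalCartan n)
        (WallTableau.TypeA.tabCrystal n (WallTableau.omegas w))
        (WallTableau.TypeA.tableaux n (WallTableau.omegas w)) ∧
      WallTableau.IsCrystalIso
        ((WallTableau.patternA n (WallTableau.omegas w).sum).crystal n)
        (WallTableau.TypeA.walls n (WallTableau.omegas w))
        (WallTableau.TypeA.tabCrystal n (WallTableau.omegas w))
        (WallTableau.TypeA.tableaux n (WallTableau.omegas w))
        (WallTableau.TypeA.toTableau n (WallTableau.omegas w))) ∧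
    (∀ n : ℕ, 3 ≤ n → ∀ w : Fin n → ℕ,
      WallTableau.IsCrystal
        ((WallTableau.patternC n (WallTableau.omegas w).sum).classicalCartan n)
        ((WallTableau.patternC n (WallTableau.omegas w).sum).crystal n)
        (WallTableau.TypeC.walls n (WallTableau.omegas w)) ∧
      WallTableau.IsGeneratedBy
        ((WallTableau.patternC n (WallTableau.omegas w).sum).crystal n)
        (WallTableau.TypeC.walls n (WallTableau.omegas w))
        (WallTableau.TypeC.highest n (WallTableau.omegas w)) w ∧
      WallTableau.IsCrystal
        ((WallTableau.patternC n (WallTableau.omegas w).sum).classicalCartan n)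
        (WallTableau.TypeC.tabCrystal n (WallTableau.omegas w))
        (WallTableau.TypeC.tableaux n (WallTableau.omegas w)) ∧
      WallTableau.IsCrystalIso
        ((WallTableau.patternC n (WallTableau.omegas w).sum).crystal n)
        (WallTableau.TypeC.walls n (WallTableau.omegas w))
        (WallTableau.TypeC.tabCrystal n (WallTableau.omegas w))
        (WallTableau.TypeC.tableaux n (WallTableau.omegas w))
        (WallTableau.TypeC.toTableau n (WallTableau.omegas w))) := by
  refine ⟨fun n _ w => ?_, fun n hn w => ?_⟩
  · exact WallTableau.TypeA.main (fun k hk => WallTableau.len_omegas hk)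
      (WallTableau.omegas_pairwise w) (WallTableau.count_omegas w)
  · exact WallTableau.TypeC.main hn (fun k hk => WallTableau.len_omegas hk)
      (WallTableau.omegas_pairwise w) (WallTableau.count_omegas w)
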